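/- **Setting.** Let $\mathcal A$ be an abelian category with small coproducts and enough injectives in which small coproducts of injective objects are injective, $\Phi$ an autoequivalence of $\mathcal A$ and $w:\mathrm{Id}\to\Phi$ a natural transformation with $w_{\Phi(A)}=\Phi(w_A)$ for all $A$. Let $(\mathcal B,\Psi,v)$ be a second such triple, where $\mathcal B$ is an abelian category with small coproducts and of finite injective dimension, i.e. $\mathcal B$ has enough injectives and there is an $n$ such that every object of $\mathcal B$ has injective dimension at most $n$. A *factorization* of $w$ consists of objects $E^{-1},E^0$ and morphisms $\phi^{-1}:\Phi^{-1}(E^0)\to E^{-1}$, $\phi^0:E^{-1}\to E^0$ with $\phi^0\circ\phi^{-1}=\Phi^{-1}(w_{E^0})$ and $\Phi(\phi^{-1})\circ\phi^0=w_{E^{-1}}$. With componentwise morphisms these form an abelian category $\mathrm{Fact}(w)$. Put $E^{2j}=\Phi^j(E^0)$, $E^{2j-1}=\Phi^j(E^{-1})$. The shift is $E[1]=(E^0,\Phi(E^{-1}),-\phi^0,-\Phi(\phi^{-1}))$. A homotopy from $f$ to $g$, $f,g:E\to F$, is a pair $h^{-1}:E^{-1}\to\Phi^{-1}(F^0)$,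 $h^0:E^0\to F^{-1}$ with $f^{-1}-g^{-1}=h^0\phi^0_E+\phi^{-1}_Fh^{-1}$ and $f^0-g^0=\phi_F^0h^0+\Phi(h^{-1})\Phi(\phi_E^{-1})$; $\mathrm K(\mathrm{Fact}\,w)$ is the triangulated homotopy category. The totalization of a complex $(K_l,d_l)$ of factorizations is $\bigoplus_lK_l[-l]$ with structure maps twisted by the $d_l$. A factorization is *co-acyclic* if it lies in the smallest thick subcategory of $\mathrm K(\mathrm{Fact}\,w)$ that contains the totalizations of all bounded exact complexes of factorizations and is closed under small coproducts; the co-derived category $\mathrm D^{co}(w)=\mathrm D^{co}(\mathrm{Fact}\,w)$ is the Verdier quotient of $\mathrm K(\mathrm{Fact}\,w)$ by the co-acyclic factorizations. Likewise for $v$. A *factored functor* $\theta:(\mathcal A,\Phi,w)\to(\mathcal B,\Psi,v)$ is an additive functor $\theta:\mathcal A\to\mathrm{Ch}^b(\mathcal B)$ together with a natural isomorphism $\theta\Phi\cong\Psi\theta$ that identifies $\theta(w_A)$ with $v_{\theta(A)}$ for all $A$. It induces $\theta^f:\mathrm{Fact}(w)\to\mathrm{Fact}(v)$, where $\theta^f(E)$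 is the totalization of the complex of factorizations $(\theta(E^{-1}),\theta(E^0),\theta(\phi^{-1}),\theta(\phi^0))$, and a functor on homotopy categories. Let $\theta$ be left exact, and let $\mathbf R\theta:\mathrm D^+(\mathcal A)\to\mathrm D(\mathcal B)$ be the right derived functor of $C\mapsto\mathrm{tot}^{\oplus}\theta(C)$. **Lemma.** Let $\theta$ be a left exact factored functor as above. (1) The functor $\mathrm Q_{inj}$ from the homotopy category of factorizations of $w$ with injective components to $\mathrm D^{co}(w)$ is an equivalence, so that the derived factored functor $\mathbf R\theta^f=\theta^f\circ \mathrm Q_{inj}^{-1}:\mathrm D^{co}(w)\to\mathrm D^{co}(v)$ is defined. (2) Let $E,F\in\mathrm{Fact}(w)$ be factorizations whose components $E^{-1},E^0,F^{-1},F^0$ have finite injective dimension. If the map $$\mathbf R\theta:\mathrm{Hom}_{\mathrm D(\mathcal A)}(E^i,F^j[t])\to\mathrm{Hom}_{\mathrm D(\mathcal B)}(\mathbf R\theta(E^i),\mathbf R\theta(F^j[t]))$$ is bijective for all $i,j,t\in\mathbb Z$, then the map $$\mathbf R\theta^f:\mathrm{Hom}_{\mathrm D^{co}(w)}(E,F[t])\to\mathrm{Hom}_{\mathrm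 D^{co}(v)}(\mathbf R\theta^f(E),\mathbf R\theta^f(F[t]))$$ is bijective for all $t\in\mathbb Z$. -/

import Mathlib

open CategoryTheory Category Limits

universe v u v₁ u₁ v₂ u₂ w₁ w₂

namespace FactCat

/-- An equivalence of abelian categories is additive. -/
instance equivalence_additive {A : Type u} [Category.{v} A] [Abelian A] (Φ : A ≌ A) :
    Φ.functor.Additive :=
  Functor.additive_of_preserves_binary_products _

/-- Small coproducts include the coproducts indexed by types in the lowest universe. -/
instance hasCoproducts_type {A : Type u} [Category.{v} A] [HasCoproducts.{v} A] (J : Type) :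
    HasColimitsOfShape (Discrete J) A :=
  (hasCoproducts_shrink.{0, v} : HasCoproducts.{0} A) J

/-! ### Integral powers of an autoequivalence -/

section Powers

variable {C : Type u} [Category.{v} C]

/-- The `n`-fold composition of an endofunctor. -/
def natPow (F : C ⥤ C) : ℕ → C ⥤ C
  | 0 => 𝟭 C
  | n + 1 => natPow F n ⋙ F

/-- The `n`-fold composition of an autoequivalence, for an integer `n`. -/
def zPow (e : C ≌ C) : ℤ → C ⥤ C
  | Int.ofNat n => natPow e.functor n
  | Int.negSucc n => natPow e.inverse (n + 1)

/-- The natural isomorphism `e^(n+1) ≅ e ∘ e^n`. -/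
def zPowSucc (e : C ≌ C) : ∀ n : ℤ, zPow e (n + 1) ≅ zPow e n ⋙ e.functor
  | Int.ofNat n => Iso.refl (natPow e.functor n ⋙ e.functor)
  | Int.negSucc 0 =>
      (e.counitIso.symm : 𝟭 C ≅ e.inverse ⋙ e.functor)
  | Int.negSucc (n + 1) =>
      (Functor.isoWhiskerLeft (natPow e.inverse (n + 1)) e.counitIso.symm :
        natPow e.inverse (n + 1) ⋙ 𝟭 C ≅ natPow e.inverse (n + 1) ⋙ e.inverse ⋙ e.functor)

/-- The natural isomorphism `e^n ≅ e ∘ e^m` for `n = m + 1`. -/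
def zPowIso (e : C ≌ C) (n m : ℤ) (h : m + 1 = n) : zPow e n ≅ zPow e m ⋙ e.functor :=
  eqToIso (congrArg (zPow e) h.symm) ≪≫ zPowSucc e m

end Powers

/-! ### Factorizations -/

/-- The data `(Φ, w)` on a category `A`: an autoequivalence `Φ` and a natural transformation
`w : Id ⟶ Φ` such that `w_{Φ(X)} = Φ(w_X)`. -/
structure Potential (A : Type u) [Category.{v} A] where
  /-- the autoequivalence -/
  Φ : A ≌ A
  /-- the natural transformation -/
  w : 𝟭 A ⟶ Φ.functor
  w_obj : ∀ X : A, w.app (Φ.functor.obj X) = Φ.functor.map (w.app X)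

/-- A factorization of `(A, Φ, w)`. The components are `X₁ = E^{-1}` and `X₀ = E^0`, the morphism
`a` is `φ^0 : E^{-1} ⟶ E^0`, and `b` is the transpose `Φ(φ^{-1}) : E^0 ⟶ Φ(E^{-1})` of
`φ^{-1} : Φ^{-1}(E^0) ⟶ E^{-1}` (see `Factorization.c` for `φ^{-1}` itself). -/
structure Factorization {A : Type u} [Category.{v} A] (W : Potential A) where
  /-- the component in degree `-1` -/
  X₁ : A
  /-- the component in degree `0` -/
  X₀ : A
  /-- the morphism `φ^0` -/
  a : X₁ ⟶ X₀
  /-- the morphism `Φ(φ^{-1})` -/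
  b : X₀ ⟶ W.Φ.functor.obj X₁
  a_b : a ≫ b = W.w.app X₁
  b_a : b ≫ W.Φ.functor.map a = W.w.app X₀

namespace Factorization

attribute [simp] a_b b_a

variable {A : Type u} [Category.{v} A] {W : Potential A}

@[simp] lemma a_b_assoc (E : Factorization W) {Z : A} (h : W.Φ.functor.obj E.X₁ ⟶ Z) :
    E.a ≫ E.b ≫ h = W.w.app E.X₁ ≫ h := by
  rw [← assoc, a_b]

@[simp] lemma b_a_assoc (E : Factorization W) {Z : A} (h : W.Φ.functor.obj E.X₀ ⟶ Z) :
    E.b ≫ W.Φ.functor.map E.a ≫ h = W.w.app E.X₀ ≫ h := by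
  rw [← assoc, b_a]

lemma w_naturality {X Y : A} (f : X ⟶ Y) :
    f ≫ W.w.app Y = W.w.app X ≫ W.Φ.functor.map f :=
  W.w.naturality f

/-- The morphism `φ^{-1} : Φ^{-1}(E^0) ⟶ E^{-1}`. -/
def c (E : Factorization W) : W.Φ.inverse.obj E.X₀ ⟶ E.X₁ :=
  W.Φ.inverse.map E.b ≫ W.Φ.unitInv.app E.X₁

lemma map_c (E : Factorization W) :
    W.Φ.functor.map E.c = W.Φ.counit.app E.X₀ ≫ E.b := by
  simp [c]

/-- The relation `φ^0 ∘ φ^{-1} = Φ^{-1}(w_{E^0})`. -/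
lemma c_a (E : Factorization W) :
    E.c ≫ E.a = W.Φ.inverse.map (W.w.app E.X₀) ≫ W.Φ.unitInv.app E.X₀ := by
  have h := W.Φ.unitInv.naturality E.a
  simp only [Functor.comp_map, Functor.id_map] at h
  rw [c, assoc, ← h, ← assoc, ← Functor.map_comp, b_a]

/-- Morphisms of factorizations. -/
@[ext]
structure Hom (E F : Factorization W) where
  /-- the component in degree `-1` -/
  f₁ : E.X₁ ⟶ F.X₁
  /-- the component in degree `0` -/
  f₀ : E.X₀ ⟶ F.X₀
  comm_a : f₁ ≫ F.a = E.a ≫ f₀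
  comm_b : f₀ ≫ F.b = E.b ≫ W.Φ.functor.map f₁

/-- The category `Fact(w)` of factorizations. -/
instance : Category (Factorization W) where
  Hom := Hom
  id E := { f₁ := 𝟙 _, f₀ := 𝟙 _, comm_a := by simp, comm_b := by simp }
  comp f g :=
    { f₁ := f.f₁ ≫ g.f₁
      f₀ := f.f₀ ≫ g.f₀
      comm_a := by rw [assoc, g.comm_a, ← assoc, f.comm_a, assoc]
      comm_b := by rw [assoc, g.comm_b, ← assoc, f.comm_b, assoc, Functor.map_comp] }

@[ext]
lemma hom_ext {E F : Factorization W} {f g : E ⟶ F} (h₁ : f.f₁ = g.f₁) (h₀ : f.f₀ = g.f₀) :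
    f = g :=
  Hom.ext h₁ h₀

@[simp] lemma id_f₁ (E : Factorization W) : Hom.f₁ (𝟙 E) = 𝟙 E.X₁ := rfl
@[simp] lemma id_f₀ (E : Factorization W) : Hom.f₀ (𝟙 E) = 𝟙 E.X₀ := rfl
@[simp] lemma comp_f₁ {E F G : Factorization W} (f : E ⟶ F) (g : F ⟶ G) :
    (f ≫ g).f₁ = f.f₁ ≫ g.f₁ := rfl
@[simp] lemma comp_f₀ {E F G : Factorization W} (f : E ⟶ F) (g : F ⟶ G) :
    (f ≫ g).f₀ = f.f₀ ≫ g.f₀ := rfl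

lemma c_comm {E F : Factorization W} (f : E ⟶ F) :
    W.Φ.inverse.map f.f₀ ≫ F.c = E.c ≫ f.f₁ := by
  have h := W.Φ.unitInv.naturality f.f₁
  simp only [Functor.comp_map, Functor.id_map] at h
  rw [c, c, assoc, ← h, ← Functor.map_comp_assoc, f.comm_b, Functor.map_comp, assoc]

/-- Isomorphisms of factorizations are given by isomorphisms of the components. -/
def isoMk {E F : Factorization W} (e₁ : E.X₁ ≅ F.X₁) (e₀ : E.X₀ ≅ F.X₀)
    (ha : e₁.hom ≫ F.a = E.a ≫ e₀.hom)
    (hb : e₀.hom ≫ F.b = E.b ≫ W.Φ.functor.map e₁.hom) : E ≅ F where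
  hom := { f₁ := e₁.hom, f₀ := e₀.hom, comm_a := ha, comm_b := hb }
  inv :=
    { f₁ := e₁.inv
      f₀ := e₀.inv
      comm_a := by rw [Iso.inv_comp_eq, ← assoc, ha, assoc, e₀.hom_inv_id, comp_id]
      comm_b := by
        rw [Iso.inv_comp_eq, ← assoc, hb, assoc, ← Functor.map_comp, e₁.hom_inv_id,
          CategoryTheory.Functor.map_id, comp_id] }

@[simp] lemma isoMk_hom_f₁ {E F : Factorization W} (e₁ : E.X₁ ≅ F.X₁) (e₀ : E.X₀ ≅ F.X₀) (ha hb) :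
    Hom.f₁ (isoMk e₁ e₀ ha hb).hom = e₁.hom := rfl
@[simp] lemma isoMk_hom_f₀ {E F : Factorization W} (e₁ : E.X₁ ≅ F.X₁) (e₀ : E.X₀ ≅ F.X₀) (ha hb) :
    Hom.f₀ (isoMk e₁ e₀ ha hb).hom = e₀.hom := rfl
@[simp] lemma isoMk_inv_f₁ {E F : Factorization W} (e₁ : E.X₁ ≅ F.X₁) (e₀ : E.X₀ ≅ F.X₀) (ha hb) :
    Hom.f₁ (isoMk e₁ e₀ ha hb).inv = e₁.inv := rfl
@[simp] lemma isoMk_inv_f₀ {E F : Factorization W} (e₁ : E.X₁ ≅ F.X₁) (e₀ : E.X₀ ≅ F.X₀) (ha hb) :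
    Hom.f₀ (isoMk e₁ e₀ ha hb).inv = e₀.inv := rfl

/-- The objects `E^i`, for all integers `i`: `E^{2j} = Φ^j(E^0)` and `E^{2j-1} = Φ^j(E^{-1})`. -/
def X (E : Factorization W) (i : ℤ) : A :=
  if Even i then (zPow W.Φ (i / 2)).obj E.X₀ else (zPow W.Φ ((i + 1) / 2)).obj E.X₁

/-! #### The additive structure -/

section Preadditive

variable [Abelian A]

section

variable {E F : Factorization W}

instance : Zero (E ⟶ F) := ⟨{ f₁ := 0, f₀ := 0, comm_a := by simp, comm_b := by simp }⟩

instance : Add (E ⟶ F) := ⟨fun f g =>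
  { f₁ := f.f₁ + g.f₁
    f₀ := f.f₀ + g.f₀
    comm_a := by
      rw [Preadditive.add_comp, Preadditive.comp_add, f.comm_a, g.comm_a]
    comm_b := by
      rw [Preadditive.add_comp, Functor.map_add, Preadditive.comp_add, f.comm_b, g.comm_b] }⟩

instance : Neg (E ⟶ F) := ⟨fun f =>
  { f₁ := -f.f₁
    f₀ := -f.f₀
    comm_a := by rw [Preadditive.neg_comp, Preadditive.comp_neg, f.comm_a]
    comm_b := by rw [Preadditive.neg_comp, Functor.map_neg, Preadditive.comp_neg, f.comm_b] }⟩

@[simp] lemma zero_f₁ : Hom.f₁ (0 : E ⟶ F) = 0 := rfl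
@[simp] lemma zero_f₀ : Hom.f₀ (0 : E ⟶ F) = 0 := rfl
@[simp] lemma add_f₁ (f g : E ⟶ F) : (f + g).f₁ = f.f₁ + g.f₁ := rfl
@[simp] lemma add_f₀ (f g : E ⟶ F) : (f + g).f₀ = f.f₀ + g.f₀ := rfl
@[simp] lemma neg_f₁ (f : E ⟶ F) : (-f).f₁ = -f.f₁ := rfl
@[simp] lemma neg_f₀ (f : E ⟶ F) : (-f).f₀ = -f.f₀ := rfl

instance : AddCommGroup (E ⟶ F) :=
  { AddGroup.ofLeftAxioms (G := (E ⟶ F))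
      (fun f g h => by ext <;> simp [add_assoc])
      (fun f => by ext <;> simp)
      (fun f => by ext <;> simp) with
    add_comm := fun f g => by ext <;> simp [add_comm] }

@[simp] lemma sub_f₁ (f g : E ⟶ F) : (f - g).f₁ = f.f₁ - g.f₁ := by
  rw [sub_eq_add_neg, add_f₁, neg_f₁, sub_eq_add_neg]
@[simp] lemma sub_f₀ (f g : E ⟶ F) : (f - g).f₀ = f.f₀ - g.f₀ := by
  rw [sub_eq_add_neg, add_f₀, neg_f₀, sub_eq_add_neg]

end

instance : Preadditive (Factorization W) where
  add_comp _ _ _ f g h := by ext <;> simp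
  comp_add _ _ _ f g h := by ext <;> simp

variable (W) in
/-- The component functor `E ↦ E^{-1}`. -/
@[simps]
def ev₁ : Factorization W ⥤ A where
  obj E := E.X₁
  map f := f.f₁

variable (W) in
/-- The component functor `E ↦ E^0`. -/
@[simps]
def ev₀ : Factorization W ⥤ A where
  obj E := E.X₀
  map f := f.f₀

instance : (ev₁ W).Additive where
instance : (ev₀ W).Additive where

/-! #### The shift -/

/-- The shift `E[1] = (E^0, Φ(E^{-1}), -φ^0, -Φ(φ^{-1}))`. -/
def shift₁ (E : Factorization W) : Factorization W where
  X₁ := E.X₀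
  X₀ := W.Φ.functor.obj E.X₁
  a := -E.b
  b := -W.Φ.functor.map E.a
  a_b := by simp
  b_a := by simp [← Functor.map_comp, W.w_obj]

/-- The inverse shift `E[-1] = (Φ^{-1}(E^0), E^{-1}, -φ^{-1}, -φ^0)`. -/
def unshift₁ (E : Factorization W) : Factorization W where
  X₁ := W.Φ.inverse.obj E.X₀
  X₀ := E.X₁
  a := -E.c
  b := -(E.a ≫ W.Φ.counitInv.app E.X₀)
  a_b := by
    have h := W.w.naturality (W.Φ.counitInv.app E.X₀)
    simp only [Functor.comp_obj, Functor.id_obj, Functor.id_map] at h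
    have hb := E.b_a
    apply W.Φ.functor.map_injective
    simp only [Preadditive.neg_comp, Preadditive.comp_neg, neg_neg, Functor.map_comp, map_c,
      assoc, ← W.w_obj]
    rw [← assoc E.b, hb, ← h]
    simp
  b_a := by
    simp only [Preadditive.neg_comp, Preadditive.comp_neg, neg_neg, Functor.map_neg, map_c, assoc]
    simp

variable (W) in
/-- The shift functor `[1]`. -/
def T : Factorization W ⥤ Factorization W where
  obj E := E.shift₁
  map {E F} f :=
    { f₁ := f.f₀
      f₀ := W.Φ.functor.map f.f₁
      comm_a := by simp [shift₁, f.comm_b]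
      comm_b := by simp [shift₁, ← Functor.map_comp, f.comm_a] }

@[simp] lemma T_X₁ (E : Factorization W) : ((T W).obj E).X₁ = E.X₀ := rfl
@[simp] lemma T_X₀ (E : Factorization W) : ((T W).obj E).X₀ = W.Φ.functor.obj E.X₁ := rfl
@[simp] lemma T_a (E : Factorization W) : ((T W).obj E).a = -E.b := rfl
@[simp] lemma T_b (E : Factorization W) : ((T W).obj E).b = -W.Φ.functor.map E.a := rfl
@[simp] lemma T_map_f₁ {E F : Factorization W} (f : E ⟶ F) :
    Hom.f₁ ((T W).map f) = f.f₀ := rfl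
@[simp] lemma T_map_f₀ {E F : Factorization W} (f : E ⟶ F) :
    Hom.f₀ ((T W).map f) = W.Φ.functor.map f.f₁ := rfl

variable (W) in
/-- The functor `[-1]`. -/
def S : Factorization W ⥤ Factorization W where
  obj E := E.unshift₁
  map {E F} f :=
    { f₁ := W.Φ.inverse.map f.f₀
      f₀ := f.f₁
      comm_a := by simp [unshift₁, c_comm]
      comm_b := by
        have h := W.Φ.counitInv.naturality f.f₀
        simp only [Functor.comp_map, Functor.id_map] at h
        have h' := f.comm_a
        simp only [unshift₁, Preadditive.neg_comp, Preadditive.comp_neg, assoc, ← h]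
        rw [← assoc, h', assoc] }

@[simp] lemma S_X₁ (E : Factorization W) :
    ((S W).obj E).X₁ = W.Φ.inverse.obj E.X₀ := rfl
@[simp] lemma S_X₀ (E : Factorization W) : ((S W).obj E).X₀ = E.X₁ := rfl
@[simp] lemma S_a (E : Factorization W) : ((S W).obj E).a = -E.c := rfl
@[simp] lemma S_b (E : Factorization W) :
    ((S W).obj E).b = -(E.a ≫ W.Φ.counitInv.app E.X₀) := rfl
@[simp] lemma S_map_f₁ {E F : Factorization W} (f : E ⟶ F) :
    Hom.f₁ ((S W).map f) = W.Φ.inverse.map f.f₀ := rfl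
@[simp] lemma S_map_f₀ {E F : Factorization W} (f : E ⟶ F) :
    Hom.f₀ ((S W).map f) = f.f₁ := rfl

variable (W) in
/-- The shift, as an autoequivalence of the category of factorizations. -/
def shiftEquiv : Factorization W ≌ Factorization W where
  functor := T W
  inverse := S W
  unitIso := NatIso.ofComponents
    (fun E => isoMk (W.Φ.unitIso.app E.X₁) (Iso.refl E.X₀)
      (by
        change W.Φ.unit.app E.X₁ ≫ (-(W.Φ.inverse.map (-W.Φ.functor.map E.a) ≫
          W.Φ.unitInv.app E.X₀)) = E.a ≫ 𝟙 _
        simp)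
      (by
        change 𝟙 _ ≫ (-((-E.b) ≫ W.Φ.counitInv.app (W.Φ.functor.obj E.X₁))) =
          E.b ≫ W.Φ.functor.map (W.Φ.unit.app E.X₁)
        simp [Equivalence.counitInv_app_functor]))
    (fun {E F} f => by
      ext
      · change f.f₁ ≫ W.Φ.unit.app F.X₁ =
          W.Φ.unit.app E.X₁ ≫ W.Φ.inverse.map (W.Φ.functor.map f.f₁)
        simp
      · change f.f₀ ≫ 𝟙 _ = 𝟙 _ ≫ f.f₀
        simp)
  counitIso := NatIso.ofComponents
    (fun E => isoMk (Iso.refl E.X₁) (W.Φ.counitIso.app E.X₀)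
      (by
        change 𝟙 _ ≫ E.a = (-(-(E.a ≫ W.Φ.counitInv.app E.X₀))) ≫ W.Φ.counit.app E.X₀
        simp)
      (by
        change W.Φ.counit.app E.X₀ ≫ E.b = (-W.Φ.functor.map (-E.c)) ≫ W.Φ.functor.map (𝟙 _)
        simp [map_c]))
    (fun {E F} f => by
      ext
      · change f.f₁ ≫ 𝟙 _ = 𝟙 _ ≫ f.f₁
        simp
      · change W.Φ.functor.map (W.Φ.inverse.map f.f₀) ≫ W.Φ.counit.app F.X₀ =
          W.Φ.counit.app E.X₀ ≫ f.f₀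
        simp)
  functor_unitIso_comp E := by
    ext
    · change 𝟙 E.X₀ ≫ 𝟙 E.X₀ = 𝟙 E.X₀
      simp
    · change W.Φ.functor.map (W.Φ.unit.app E.X₁) ≫ W.Φ.counit.app (W.Φ.functor.obj E.X₁) = 𝟙 _
      simp

instance : (T W).Additive where

instance : (S W).Additive where

end Preadditive
/-! ### Homotopies -/

/-- Degree `-1` maps from `E` to `F`: a morphism `p = h^0 : E^0 ⟶ F^{-1}` and the transpose
`q : Φ(E^{-1}) ⟶ F^0` of a morphism `h^{-1} : E^{-1} ⟶ Φ^{-1}(F^0)`. -/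
@[ext]
structure Deg (E F : Factorization W) where
  /-- the morphism `h^0` -/
  p : E.X₀ ⟶ F.X₁
  /-- the morphism `Φ(h^{-1})` -/
  q : W.Φ.functor.obj E.X₁ ⟶ F.X₀

namespace Deg

/-- Precomposition with a morphism of factorizations. -/
@[simps]
def pre {E E' F : Factorization W} (f : E ⟶ E') (h : Deg E' F) : Deg E F where
  p := f.f₀ ≫ h.p
  q := W.Φ.functor.map f.f₁ ≫ h.q

/-- Postcomposition with a morphism of factorizations. -/
@[simps]
def post {E F F' : Factorization W} (h : Deg E F) (f : F ⟶ F') : Deg E F' where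
  p := h.p ≫ f.f₁
  q := h.q ≫ f.f₀

end Deg

section Homotopy

variable [Abelian A]

namespace Deg

/-- `h` is a homotopy from `f` to `g`: one has `f^0 - g^0 = φ_F^0 h^0 + Φ(h^{-1} φ_E^{-1})` and
`f^{-1} - g^{-1} = h^0 φ_E^0 + φ_F^{-1} h^{-1}`; the second relation is written after applying
`Φ`. -/
structure IsHomotopy {E F : Factorization W} (h : Deg E F) (f g : E ⟶ F) : Prop where
  zero : f.f₀ - g.f₀ = h.p ≫ F.a + E.b ≫ h.q
  one : W.Φ.functor.map (f.f₁ - g.f₁) = W.Φ.functor.map (E.a ≫ h.p) + h.q ≫ F.b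

/-- The shift of a degree `-1` map. -/
@[simps]
def shift {E F : Factorization W} (h : Deg E F) : Deg ((T W).obj E) ((T W).obj F) where
  p := -h.q
  q := -W.Φ.functor.map h.p

/-- The inverse shift of a degree `-1` map. -/
@[simps]
def unshift {E F : Factorization W} (h : Deg E F) : Deg ((S W).obj E) ((S W).obj F) where
  p := -(W.Φ.unit.app E.X₁ ≫ W.Φ.inverse.map h.q)
  q := -(W.Φ.counit.app E.X₀ ≫ h.p)

end Deg

/-- An extension of an endofunctor of the category of factorizations to degree `-1` maps. -/
structure DegLift (G : Factorization W ⥤ Factorization W) where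
  /-- the action on degree `-1` maps -/
  map : ∀ {E F : Factorization W}, Deg E F → Deg (G.obj E) (G.obj F)
  map_pre : ∀ {E E' F : Factorization W} (f : E ⟶ E') (h : Deg E' F),
    map (h.pre f) = (map h).pre (G.map f)
  map_post : ∀ {E F F' : Factorization W} (h : Deg E F) (f : F ⟶ F'),
    map (h.post f) = (map h).post (G.map f)
  isHomotopy : ∀ {E F : Factorization W} (h : Deg E F) (f g : E ⟶ F),
    h.IsHomotopy f g → (map h).IsHomotopy (G.map f) (G.map g)

namespace DegLift

/-- The identity functor acts on degree `-1` maps. -/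
@[simps]
def id : DegLift (𝟭 (Factorization W)) where
  map h := h
  map_pre _ _ := rfl
  map_post _ _ := rfl
  isHomotopy _ _ _ hh := hh

/-- Composition. -/
@[simps]
def comp {G G' : Factorization W ⥤ Factorization W} (L : DegLift G) (L' : DegLift G') :
    DegLift (G ⋙ G') where
  map h := L'.map (L.map h)
  map_pre f h := by rw [L.map_pre, L'.map_pre]; rfl
  map_post h f := by rw [L.map_post, L'.map_post]; rfl
  isHomotopy h f g hh := L'.isHomotopy _ _ _ (L.isHomotopy _ _ _ hh)

variable (W) in
/-- The shift acts on degree `-1` maps. -/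
@[simps map]
def shift : DegLift (T W) where
  map h := h.shift
  map_pre f h := by
    ext
    · change -(W.Φ.functor.map f.f₁ ≫ h.q) = W.Φ.functor.map f.f₁ ≫ (-h.q)
      simp
    · change -W.Φ.functor.map (f.f₀ ≫ h.p) = W.Φ.functor.map f.f₀ ≫ (-W.Φ.functor.map h.p)
      simp
  map_post h f := by
    ext
    · change -(h.q ≫ f.f₀) = (-h.q) ≫ f.f₀
      simp
    · change -W.Φ.functor.map (h.p ≫ f.f₁) = (-W.Φ.functor.map h.p) ≫ W.Φ.functor.map f.f₁
      simp
  isHomotopy {E F} h f g hh :=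
    { zero := by
        change W.Φ.functor.map f.f₁ - W.Φ.functor.map g.f₁ =
          (-h.q) ≫ (-F.b) + (-W.Φ.functor.map E.a) ≫ (-W.Φ.functor.map h.p)
        have := hh.one
        rw [Functor.map_sub] at this
        rw [this]
        simp [add_comm]
      one := by
        change W.Φ.functor.map (f.f₀ - g.f₀) = W.Φ.functor.map ((-E.b) ≫ (-h.q)) +
          (-W.Φ.functor.map h.p) ≫ (-W.Φ.functor.map F.a)
        rw [hh.zero]
        simp [add_comm] }

variable (W) in
/-- The inverse shift acts on degree `-1` maps. -/
@[simps map]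
def unshift : DegLift (S W) where
  map h := h.unshift
  map_pre {E E' F} f h := by
    ext
    · change -(W.Φ.unit.app E.X₁ ≫ W.Φ.inverse.map (W.Φ.functor.map f.f₁ ≫ h.q)) =
        f.f₁ ≫ (-(W.Φ.unit.app E'.X₁ ≫ W.Φ.inverse.map h.q))
      simp
    · change -(W.Φ.counit.app E.X₀ ≫ f.f₀ ≫ h.p) =
        W.Φ.functor.map (W.Φ.inverse.map f.f₀) ≫ (-(W.Φ.counit.app E'.X₀ ≫ h.p))
      simp
  map_post {E F F'} h f := by
    ext
    · change -(W.Φ.unit.app E.X₁ ≫ W.Φ.inverse.map (h.q ≫ f.f₀)) =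
        (-(W.Φ.unit.app E.X₁ ≫ W.Φ.inverse.map h.q)) ≫ W.Φ.inverse.map f.f₀
      simp
    · change -(W.Φ.counit.app E.X₀ ≫ h.p ≫ f.f₁) = (-(W.Φ.counit.app E.X₀ ≫ h.p)) ≫ f.f₁
      simp
  isHomotopy {E F} h f g hh :=
    { zero := by
        change f.f₁ - g.f₁ =
          (show E.X₁ ⟶ F.X₁ from (-(W.Φ.unit.app E.X₁ ≫ W.Φ.inverse.map h.q)) ≫ (-F.c)) +
          (-(E.a ≫ W.Φ.counitInv.app E.X₀)) ≫ (-(W.Φ.counit.app E.X₀ ≫ h.p))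
        apply W.Φ.functor.map_injective
        rw [hh.one]
        simp [map_c, add_comm]
      one := by
        change W.Φ.functor.map (W.Φ.inverse.map f.f₀ - W.Φ.inverse.map g.f₀) =
          W.Φ.functor.map ((-E.c) ≫ (-(W.Φ.unit.app E.X₁ ≫ W.Φ.inverse.map h.q))) +
            (show W.Φ.functor.obj (W.Φ.inverse.obj E.X₀) ⟶ W.Φ.functor.obj (W.Φ.inverse.obj F.X₀)
              from (-(W.Φ.counit.app E.X₀ ≫ h.p)) ≫ (-(F.a ≫ W.Φ.counitInv.app F.X₀)))
        rw [← Functor.map_sub, hh.zero]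
        simp [map_c, add_comm] }

/-- The powers of a functor act on degree `-1` maps. -/
def natPow {G : Factorization W ⥤ Factorization W} (L : DegLift G) :
    ∀ n : ℕ, DegLift (FactCat.natPow G n)
  | 0 => DegLift.id
  | n + 1 => (natPow L n).comp L

variable (W) in
/-- The shifts `[n]` act on degree `-1` maps. -/
def zPow : ∀ n : ℤ, DegLift (FactCat.zPow (shiftEquiv W) n)
  | Int.ofNat n => natPow (shift W) n
  | Int.negSucc n => natPow (unshift W) (n + 1)

lemma zPowSucc_naturality (n : ℤ) {E F : Factorization W} (h : Deg E F) :
    ((zPow W (n + 1)).map h).post ((FactCat.zPowSucc (shiftEquiv W) n).hom.app F) =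
      (((zPow W n).map h).shift).pre ((FactCat.zPowSucc (shiftEquiv W) n).hom.app E) := by
  have key : ∀ {E F : Factorization W} (h : Deg E F),
      h.post ((shiftEquiv W).counitInv.app F) =
        (h.unshift.shift).pre ((shiftEquiv W).counitInv.app E) := by
    intro E F h
    ext
    · change h.p ≫ 𝟙 _ = W.Φ.counitInv.app E.X₀ ≫ (-(-(W.Φ.counit.app E.X₀ ≫ h.p)))
      simp
    · change h.q ≫ W.Φ.counitInv.app F.X₀ = W.Φ.functor.map (𝟙 _) ≫
        (-W.Φ.functor.map (-(W.Φ.unit.app E.X₁ ≫ W.Φ.inverse.map h.q)))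
      simp
  match n with
  | Int.ofNat n =>
    change ((natPow (shift W) n).map h).shift.post (𝟙 _) =
      ((natPow (shift W) n).map h).shift.pre (𝟙 _)
    ext
    · simp
    · change _ ≫ 𝟙 _ = W.Φ.functor.map (𝟙 _) ≫ _
      simp
  | Int.negSucc 0 => exact key h
  | Int.negSucc (n + 1) =>
    exact key ((natPow (unshift W) (n + 1)).map h)

lemma zPowIso_naturality (n m : ℤ) (hnm : m + 1 = n) {E F : Factorization W} (h : Deg E F) :
    ((zPow W n).map h).post ((FactCat.zPowIso (shiftEquiv W) n m hnm).hom.app F) =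
      (((zPow W m).map h).shift).pre ((FactCat.zPowIso (shiftEquiv W) n m hnm).hom.app E) := by
  subst hnm
  have e : FactCat.zPowIso (shiftEquiv W) (m + 1) m rfl = FactCat.zPowSucc (shiftEquiv W) m := by
    simp [FactCat.zPowIso]
  rw [e]
  exact zPowSucc_naturality m h

end DegLift

end Homotopy
section Category

variable [Abelian A]

variable (W) in
/-- The homotopy relation on morphisms of factorizations. -/
def homotopic : HomRel (Factorization W) :=
  fun _ _ f g => ∃ h : Deg _ _, h.IsHomotopy f g

variable (W) in
/-- The homotopy category `K(Fact(w))`. -/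
abbrev HoCat := CategoryTheory.Quotient (homotopic W)

variable (W) in
/-- The functor `Fact(w) ⥤ K(Fact(w))`. -/
abbrev toHoCat : Factorization W ⥤ HoCat W := CategoryTheory.Quotient.functor (homotopic W)

/-! ### Cones, coproducts and totalizations -/

/-- The mapping cone of a morphism of factorizations. -/
noncomputable def cone {E F : Factorization W} (g : E ⟶ F) : Factorization W where
  X₁ := E.X₀ ⊞ F.X₁
  X₀ := W.Φ.functor.obj E.X₁ ⊞ F.X₀
  a := biprod.desc ((-E.b) ≫ biprod.inl + g.f₀ ≫ biprod.inr) (F.a ≫ biprod.inr)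
  b := biprod.desc
    ((-W.Φ.functor.map E.a) ≫ W.Φ.functor.map biprod.inl +
      W.Φ.functor.map g.f₁ ≫ W.Φ.functor.map biprod.inr)
    (F.b ≫ W.Φ.functor.map biprod.inr)
  a_b := by
    have h {Z : A} (z : _ ⟶ Z) : g.f₀ ≫ F.b ≫ z = E.b ≫ W.Φ.functor.map g.f₁ ≫ z := by
      rw [← assoc, g.comm_b, assoc]
    ext1
    · rw [w_naturality]
      simp [h]
    · rw [w_naturality]
      simp
  b_a := by
    have h {Z : A} (z : _ ⟶ Z) : W.Φ.functor.map g.f₁ ≫ W.Φ.functor.map F.a ≫ z =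
        W.Φ.functor.map E.a ≫ W.Φ.functor.map g.f₀ ≫ z := by
      rw [← assoc, ← Functor.map_comp, g.comm_a, Functor.map_comp, assoc]
    ext1
    · rw [w_naturality]
      simp only [biprod.inl_desc_assoc, Preadditive.add_comp, assoc, biprod.inl_desc,
        biprod.inr_desc, Preadditive.neg_comp, ← Functor.map_comp]
      simp [h, ← W.w_obj]
    · rw [w_naturality]
      simp only [biprod.inr_desc_assoc, biprod.inr_desc, assoc, ← Functor.map_comp]
      simp

/-- The coproduct of a small family of factorizations, formed componentwise. -/
noncomputable def sigma [HasCoproducts.{v} A] {J : Type v} (F : J → Factorization W) :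
    Factorization W where
  X₁ := ∐ fun j => (F j).X₁
  X₀ := ∐ fun j => (F j).X₀
  a := Sigma.desc fun j => (F j).a ≫ Sigma.ι (fun j => (F j).X₀) j
  b := Sigma.desc fun j => (F j).b ≫ W.Φ.functor.map (Sigma.ι (fun j => (F j).X₁) j)
  a_b := by
    refine Limits.Sigma.hom_ext _ _ fun j => ?_
    rw [w_naturality]
    simp
  b_a := by
    refine Limits.Sigma.hom_ext _ _ fun j => ?_
    rw [w_naturality]
    simp only [colimit.ι_desc_assoc, Cofan.mk_pt, Cofan.mk_ι_app, assoc, colimit.ι_desc,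
      ← Functor.map_comp]
    simp

section Tot

/-- A family of factorizations `X_l` together with morphisms `γ_l : X_l ⟶ X_{l+1}[1]` such that
the composites `γ_{l+1}[1] ∘ γ_l` vanish. -/
structure Twisted (W : Potential A) where
  /-- the factorizations -/
  X : ℤ → Factorization W
  /-- the morphisms of degree one -/
  γ : ∀ l, X l ⟶ (T W).obj (X (l + 1))
  γ_γ : ∀ l, γ l ≫ (T W).map (γ (l + 1)) = 0

namespace Twisted

/-- The component of `γ_l` in degree `-1`. -/
def s (M : Twisted W) (l : ℤ) : (M.X l).X₁ ⟶ (M.X (l + 1)).X₀ := (M.γ l).f₁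

/-- The component of `γ_l` in degree `0`. -/
def t (M : Twisted W) (l : ℤ) : (M.X l).X₀ ⟶ W.Φ.functor.obj (M.X (l + 1)).X₁ := (M.γ l).f₀

lemma s_b (M : Twisted W) (l : ℤ) {Z : A} (z : _ ⟶ Z) :
    M.s l ≫ (M.X (l + 1)).b ≫ z = -((M.X l).a ≫ M.t l ≫ z) := by
  have h : M.s l ≫ (-(M.X (l + 1)).b) = (M.X l).a ≫ M.t l := (M.γ l).comm_a
  rw [← assoc, ← assoc, ← h]
  simp

lemma t_a (M : Twisted W) (l : ℤ) {Z : A} (z : _ ⟶ Z) :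
    M.t l ≫ W.Φ.functor.map (M.X (l + 1)).a ≫ z =
      -((M.X l).b ≫ W.Φ.functor.map (M.s l) ≫ z) := by
  have h : M.t l ≫ (-W.Φ.functor.map (M.X (l + 1)).a) = (M.X l).b ≫ W.Φ.functor.map (M.s l) :=
    (M.γ l).comm_b
  rw [← assoc, ← assoc, ← h]
  simp

lemma s_t (M : Twisted W) (l : ℤ) {Z : A} (z : _ ⟶ Z) : M.s l ≫ M.t (l + 1) ≫ z = 0 := by
  have h : M.s l ≫ M.t (l + 1) = 0 := congrArg Hom.f₁ (M.γ_γ l)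
  rw [← assoc, h, zero_comp]

lemma t_s (M : Twisted W) (l : ℤ) {Z : A} (z : _ ⟶ Z) :
    M.t l ≫ W.Φ.functor.map (M.s (l + 1)) ≫ z = 0 := by
  have h : M.t l ≫ W.Φ.functor.map (M.s (l + 1)) = 0 := congrArg Hom.f₀ (M.γ_γ l)
  rw [← assoc, h, zero_comp]

/-- Morphisms of twisted families. -/
@[ext]
structure Hom (M N : Twisted W) where
  /-- the components -/
  f : ∀ l, M.X l ⟶ N.X l
  comm : ∀ l, f l ≫ N.γ l = M.γ l ≫ (T W).map (f (l + 1))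

/-- The category of twisted families. -/
instance : Category (Twisted W) where
  Hom := Hom
  id M := { f := fun l => 𝟙 _, comm := by simp }
  comp f g :=
    { f := fun l => f.f l ≫ g.f l
      comm := fun l => by rw [assoc, g.comm, ← assoc, f.comm, assoc, Functor.map_comp] }

@[ext]
lemma hom_ext {M N : Twisted W} {f g : M ⟶ N} (h : ∀ l, f.f l = g.f l) : f = g :=
  Hom.ext (funext h)

@[simp] lemma id_f (M : Twisted W) (l : ℤ) : Hom.f (𝟙 M) l = 𝟙 (M.X l) := rfl
@[simp] lemma comp_f {M N P : Twisted W} (f : M ⟶ N) (g : N ⟶ P) (l : ℤ) :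
    (f ≫ g).f l = f.f l ≫ g.f l := rfl

lemma hom_s {M N : Twisted W} (f : M ⟶ N) (l : ℤ) {Z : A} (z : _ ⟶ Z) :
    (f.f l).f₁ ≫ N.s l ≫ z = M.s l ≫ (f.f (l + 1)).f₀ ≫ z := by
  have h : (f.f l).f₁ ≫ N.s l = M.s l ≫ (f.f (l + 1)).f₀ :=
    congrArg Factorization.Hom.f₁ (f.comm l)
  rw [← assoc, h, assoc]

lemma hom_t {M N : Twisted W} (f : M ⟶ N) (l : ℤ) {Z : A} (z : _ ⟶ Z) :
    (f.f l).f₀ ≫ N.t l ≫ z = M.t l ≫ W.Φ.functor.map (f.f (l + 1)).f₁ ≫ z := by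
  have h : (f.f l).f₀ ≫ N.t l = M.t l ≫ W.Φ.functor.map (f.f (l + 1)).f₁ :=
    congrArg Factorization.Hom.f₀ (f.comm l)
  rw [← assoc, h, assoc]

variable [HasCoproducts.{v} A]

/-- The coproduct of the `X_l`, with the structure maps twisted by the morphisms `γ_l`. -/
noncomputable def tot (M : Twisted W) : Factorization W where
  X₁ := ∐ fun l => (M.X l).X₁
  X₀ := ∐ fun l => (M.X l).X₀
  a := Sigma.desc fun l => (M.X l).a ≫ Sigma.ι (fun l => (M.X l).X₀) l +
    M.s l ≫ Sigma.ι (fun l => (M.X l).X₀) (l + 1)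
  b := Sigma.desc fun l => (M.X l).b ≫ W.Φ.functor.map (Sigma.ι (fun l => (M.X l).X₁) l) +
    M.t l ≫ W.Φ.functor.map (Sigma.ι (fun l => (M.X l).X₁) (l + 1))
  a_b := by
    refine Limits.Sigma.hom_ext _ _ fun l => ?_
    rw [w_naturality]
    simp [s_b, s_t]
  b_a := by
    refine Limits.Sigma.hom_ext _ _ fun l => ?_
    rw [w_naturality]
    simp only [colimit.ι_desc_assoc, Cofan.mk_pt, Cofan.mk_ι_app, Preadditive.add_comp, assoc,
      colimit.ι_desc, ← Functor.map_comp]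
    simp [t_a, t_s]

/-- The inclusion of a summand in degree `-1`. -/
noncomputable def i₁ (M : Twisted W) (l : ℤ) : (M.X l).X₁ ⟶ M.tot.X₁ :=
  Sigma.ι (fun l => (M.X l).X₁) l

/-- The inclusion of a summand in degree `0`. -/
noncomputable def i₀ (M : Twisted W) (l : ℤ) : (M.X l).X₀ ⟶ M.tot.X₀ :=
  Sigma.ι (fun l => (M.X l).X₀) l

lemma ext₁ (M : Twisted W) {Z : A} {f g : M.tot.X₁ ⟶ Z} (h : ∀ l, M.i₁ l ≫ f = M.i₁ l ≫ g) :
    f = g :=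
  Limits.Sigma.hom_ext _ _ h

lemma ext₀ (M : Twisted W) {Z : A} {f g : M.tot.X₀ ⟶ Z} (h : ∀ l, M.i₀ l ≫ f = M.i₀ l ≫ g) :
    f = g :=
  Limits.Sigma.hom_ext _ _ h

@[simp] lemma i₁_a (M : Twisted W) (l : ℤ) :
    M.i₁ l ≫ M.tot.a = (M.X l).a ≫ M.i₀ l + M.s l ≫ M.i₀ (l + 1) :=
  Limits.Sigma.ι_desc _ _

@[simp] lemma i₀_b (M : Twisted W) (l : ℤ) :
    M.i₀ l ≫ M.tot.b = (M.X l).b ≫ W.Φ.functor.map (M.i₁ l) +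
      M.t l ≫ W.Φ.functor.map (M.i₁ (l + 1)) :=
  Limits.Sigma.ι_desc _ _

@[simp] lemma i₁_a_assoc (M : Twisted W) (l : ℤ) {Z : A} (z : _ ⟶ Z) :
    M.i₁ l ≫ M.tot.a ≫ z = (M.X l).a ≫ M.i₀ l ≫ z + M.s l ≫ M.i₀ (l + 1) ≫ z := by
  rw [← assoc, i₁_a, Preadditive.add_comp, assoc, assoc]

@[simp] lemma i₀_b_assoc (M : Twisted W) (l : ℤ) {Z : A} (z : _ ⟶ Z) :
    M.i₀ l ≫ M.tot.b ≫ z = (M.X l).b ≫ W.Φ.functor.map (M.i₁ l) ≫ z +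
      M.t l ≫ W.Φ.functor.map (M.i₁ (l + 1)) ≫ z := by
  rw [← assoc, i₀_b, Preadditive.add_comp, assoc, assoc]

/-- The morphism out of the coproduct in degree `-1` with prescribed components. -/
noncomputable def desc₁ (M : Twisted W) {Z : A} (k : ∀ l, (M.X l).X₁ ⟶ Z) : M.tot.X₁ ⟶ Z :=
  Sigma.desc k

/-- The morphism out of the coproduct in degree `0` with prescribed components. -/
noncomputable def desc₀ (M : Twisted W) {Z : A} (k : ∀ l, (M.X l).X₀ ⟶ Z) : M.tot.X₀ ⟶ Z :=
  Sigma.desc k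

@[simp] lemma i₁_desc₁ (M : Twisted W) {Z : A} (k : ∀ l, (M.X l).X₁ ⟶ Z) (l : ℤ) :
    M.i₁ l ≫ M.desc₁ k = k l :=
  Limits.Sigma.ι_desc _ _

@[simp] lemma i₀_desc₀ (M : Twisted W) {Z : A} (k : ∀ l, (M.X l).X₀ ⟶ Z) (l : ℤ) :
    M.i₀ l ≫ M.desc₀ k = k l :=
  Limits.Sigma.ι_desc _ _

@[simp] lemma i₁_desc₁_assoc (M : Twisted W) {Z Z' : A} (k : ∀ l, (M.X l).X₁ ⟶ Z) (l : ℤ)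
    (z : Z ⟶ Z') : M.i₁ l ≫ M.desc₁ k ≫ z = k l ≫ z := by
  rw [← assoc, i₁_desc₁]

@[simp] lemma i₀_desc₀_assoc (M : Twisted W) {Z Z' : A} (k : ∀ l, (M.X l).X₀ ⟶ Z) (l : ℤ)
    (z : Z ⟶ Z') : M.i₀ l ≫ M.desc₀ k ≫ z = k l ≫ z := by
  rw [← assoc, i₀_desc₀]

/-- Functoriality of `Twisted.tot`. -/
noncomputable def totMap {M N : Twisted W} (f : M ⟶ N) : M.tot ⟶ N.tot where
  f₁ := M.desc₁ fun l => (f.f l).f₁ ≫ N.i₁ l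
  f₀ := M.desc₀ fun l => (f.f l).f₀ ≫ N.i₀ l
  comm_a := by
    have h (l : ℤ) {Z : A} (z : _ ⟶ Z) :
        (f.f l).f₁ ≫ (N.X l).a ≫ z = (M.X l).a ≫ (f.f l).f₀ ≫ z := by
      rw [← assoc, (f.f l).comm_a, assoc]
    refine M.ext₁ fun l => ?_
    simp [h, hom_s]
  comm_b := by
    have h (l : ℤ) {Z : A} (z : _ ⟶ Z) : (f.f l).f₀ ≫ (N.X l).b ≫ z =
        (M.X l).b ≫ W.Φ.functor.map (f.f l).f₁ ≫ z := by
      rw [← assoc, (f.f l).comm_b, assoc]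
    have h₁ (l : ℤ) : W.Φ.functor.map (M.i₁ l) ≫
        W.Φ.functor.map (M.desc₁ fun l => (f.f l).f₁ ≫ N.i₁ l) =
        W.Φ.functor.map (f.f l).f₁ ≫ W.Φ.functor.map (N.i₁ l) := by
      rw [← Functor.map_comp, i₁_desc₁, Functor.map_comp]
    refine M.ext₀ fun l => ?_
    simp [h₁, h, hom_t]

@[simp] lemma i₁_totMap {M N : Twisted W} (f : M ⟶ N) (l : ℤ) :
    M.i₁ l ≫ (totMap f).f₁ = (f.f l).f₁ ≫ N.i₁ l :=
  Limits.Sigma.ι_desc _ _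

@[simp] lemma i₀_totMap {M N : Twisted W} (f : M ⟶ N) (l : ℤ) :
    M.i₀ l ≫ (totMap f).f₀ = (f.f l).f₀ ≫ N.i₀ l :=
  Limits.Sigma.ι_desc _ _

variable (W) in
/-- The functor `Twisted.tot`. -/
noncomputable def totFunctor : Twisted W ⥤ Factorization W where
  obj M := M.tot
  map f := totMap f
  map_id M := by
    ext
    · exact M.ext₁ fun l => by simp
    · exact M.ext₀ fun l => by simp
  map_comp {M N P} f g := by
    ext
    · refine M.ext₁ fun l => ?_
      rw [comp_f₁, ← assoc, i₁_totMap, i₁_totMap, assoc, i₁_totMap, comp_f, comp_f₁, assoc]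
    · refine M.ext₀ fun l => ?_
      rw [comp_f₀, ← assoc, i₀_totMap, i₀_totMap, assoc, i₀_totMap, comp_f, comp_f₀, assoc]

/-- A family of homotopies compatible with the morphisms `γ_l` induces a homotopy. -/
lemma tot_homotopic {M N : Twisted W} (f g : M ⟶ N) (h : ∀ l, Deg (M.X l) (N.X l))
    (hh : ∀ l, (h l).IsHomotopy (f.f l) (g.f l))
    (hc : ∀ l, (h l).post (N.γ l) = ((h (l + 1)).shift).pre (M.γ l)) :
    homotopic W (totMap f) (totMap g) := by
  have h₁ (l : ℤ) {Z : A} (z : _ ⟶ Z) : (h l).p ≫ N.s l ≫ z = -(M.t l ≫ (h (l + 1)).q ≫ z) := by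
    have : (h l).p ≫ N.s l = M.t l ≫ (-(h (l + 1)).q) := congrArg Deg.p (hc l)
    rw [← assoc, this]
    simp
  have h₂ (l : ℤ) {Z : A} (z : _ ⟶ Z) : (h l).q ≫ N.t l ≫ z =
      -(W.Φ.functor.map (M.s l) ≫ W.Φ.functor.map (h (l + 1)).p ≫ z) := by
    have : (h l).q ≫ N.t l = W.Φ.functor.map (M.s l) ≫ (-W.Φ.functor.map (h (l + 1)).p) :=
      congrArg Deg.q (hc l)
    rw [← assoc, this]
    simp
  let hc₁ := isColimitCofanMkObjOfIsColimit W.Φ.functor _ _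
    (coproductIsCoproduct fun l => (M.X l).X₁)
  obtain ⟨q, hq⟩ : ∃ q : W.Φ.functor.obj M.tot.X₁ ⟶ N.tot.X₀, ∀ l,
      W.Φ.functor.map (M.i₁ l) ≫ q = (h l).q ≫ N.i₀ l :=
    ⟨Cofan.IsColimit.desc hc₁ fun l => (h l).q ≫ N.i₀ l, fun l => Cofan.IsColimit.fac hc₁ _ l⟩
  obtain ⟨p, hp⟩ : ∃ p : M.tot.X₀ ⟶ N.tot.X₁, ∀ l, M.i₀ l ≫ p = (h l).p ≫ N.i₁ l :=
    ⟨Sigma.desc fun l => (h l).p ≫ N.i₁ l, fun l => Limits.Sigma.ι_desc _ _⟩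
  have hp' (l : ℤ) {Z : A} (z : _ ⟶ Z) : M.i₀ l ≫ p ≫ z = (h l).p ≫ N.i₁ l ≫ z := by
    rw [← assoc, hp, assoc]
  have hq' (l : ℤ) {Z : A} (z : _ ⟶ Z) :
      W.Φ.functor.map (M.i₁ l) ≫ q ≫ z = (h l).q ≫ N.i₀ l ≫ z := by
    rw [← assoc, hq, assoc]
  refine ⟨{ p := p, q := q }, ?_, ?_⟩
  · refine M.ext₀ fun l => ?_
    have h₀ := congrArg (· ≫ N.i₀ l) (hh l).zero
    simp only [Preadditive.sub_comp, Preadditive.add_comp, assoc] at h₀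
    simp [h₀, h₁, hq, hp']
    abel
  · refine Cofan.IsColimit.hom_ext hc₁ _ _ fun l => ?_
    change W.Φ.functor.map (M.i₁ l) ≫ _ = W.Φ.functor.map (M.i₁ l) ≫ _
    have h₀ := congrArg (· ≫ W.Φ.functor.map (N.i₁ l)) (hh l).one
    simp only [Preadditive.sub_comp, Preadditive.add_comp, assoc, Functor.map_sub,
      ← Functor.map_comp] at h₀
    simp only [Preadditive.comp_add, ← Functor.map_comp, hq', Preadditive.comp_sub, i₁_totMap,
      i₁_a_assoc, hp, i₀_b]
    simp only [Functor.map_sub, Functor.map_add, Functor.map_comp, h₂] at h₀ ⊢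
    rw [h₀]
    abel

end Twisted
end Tot
end Category
section Complexes

variable [Abelian A]

instance natPow_additive (n : ℕ) (G : Factorization W ⥤ Factorization W) [G.Additive] :
    (natPow G n).Additive := by
  induction n with
  | zero => exact inferInstanceAs (𝟭 (Factorization W)).Additive
  | succ n ih => exact inferInstanceAs (natPow G n ⋙ G).Additive

instance zPow_additive (n : ℤ) : (zPow (shiftEquiv W) n).Additive :=
  match n with
  | Int.ofNat n => natPow_additive n (T W)
  | Int.negSucc n => natPow_additive (n + 1) (S W)

variable (W) in
/-- The `n`-fold shift `E ↦ E[n]` of factorizations. -/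
abbrev shiftBy (n : ℤ) : Factorization W ⥤ Factorization W := zPow (shiftEquiv W) n

variable (W) in
/-- The isomorphism `E[-l] ≅ E[-(l+1)][1]`. -/
def shiftByIso (l : ℤ) : shiftBy W (-l) ≅ shiftBy W (-(l + 1)) ⋙ T W :=
  zPowIso (shiftEquiv W) (-l) (-(l + 1)) (by ring)

/-- The factorizations `K_l[-l]`, with the morphisms given by the differentials of a complex
`K` of factorizations. -/
def twistedObj (K : CochainComplex (Factorization W) ℤ) : Twisted W where
  X l := (shiftBy W (-l)).obj (K.X l)
  γ l := (shiftBy W (-l)).map (K.d l (l + 1)) ≫ (shiftByIso W l).hom.app (K.X (l + 1))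
  γ_γ l := by
    have h := (shiftByIso W l).hom.naturality (K.d (l + 1) (l + 1 + 1))
    simp only [Functor.comp_map] at h
    rw [Functor.map_comp, assoc, ← reassoc_of% h, ← Functor.map_comp_assoc, K.d_comp_d,
      Functor.map_zero, zero_comp]

variable (W) in
/-- The functor `twistedObj`. -/
def twisted : CochainComplex (Factorization W) ℤ ⥤ Twisted W where
  obj K := twistedObj K
  map {K L} f :=
    { f := fun l => (shiftBy W (-l)).map (f.f l)
      comm := fun l => by
        have h := (shiftByIso W l).hom.naturality (f.f (l + 1))
        simp only [Functor.comp_map] at h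
        dsimp only [twistedObj]
        rw [assoc, ← h, ← Functor.map_comp_assoc, ← Functor.map_comp_assoc, f.comm] }
  map_id K := Twisted.hom_ext fun l => (shiftBy W (-l)).map_id _
  map_comp f g := Twisted.hom_ext fun l => (shiftBy W (-l)).map_comp _ _

variable (W) in
/-- The totalization `⨁ K_l[-l]` of a complex of factorizations. -/
noncomputable def totalization [HasCoproducts.{v} A] :
    CochainComplex (Factorization W) ℤ ⥤ Factorization W :=
  twisted W ⋙ Twisted.totFunctor W

/-- Homotopies `h_l` between the components of morphisms of complexes of factorizations that
commute with the differentials induce a homotopy between the totalizations. -/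
lemma totalization_homotopic [HasCoproducts.{v} A] {K L : CochainComplex (Factorization W) ℤ}
    (f g : K ⟶ L) (h : ∀ l, Deg (K.X l) (L.X l)) (hh : ∀ l, (h l).IsHomotopy (f.f l) (g.f l))
    (hc : ∀ l, (h l).post (L.d l (l + 1)) = (h (l + 1)).pre (K.d l (l + 1))) :
    homotopic W ((totalization W).map f) ((totalization W).map g) := by
  have pre_pre {E E' E'' F : Factorization W} (a : E ⟶ E') (b : E' ⟶ E'') (h : Deg E'' F) :
      (h.pre b).pre a = h.pre (a ≫ b) := by
    ext <;> simp
  have post_post {E F F' F'' : Factorization W} (h : Deg E F) (a : F ⟶ F') (b : F' ⟶ F'') :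
      (h.post a).post b = h.post (a ≫ b) := by
    ext <;> simp
  refine Twisted.tot_homotopic _ _ (fun l => (DegLift.zPow W (-l)).map (h l))
    (fun l => (DegLift.zPow W (-l)).isHomotopy _ _ _ (hh l)) fun l => ?_
  have pre_post {E E' F F' : Factorization W} (a : E ⟶ E') (h : Deg E' F) (b : F ⟶ F') :
      (h.pre a).post b = (h.post b).pre a := by
    ext <;> simp
  have e : ((DegLift.zPow W (-l)).map (h (l + 1))).post ((shiftByIso W l).hom.app _) =
      (((DegLift.zPow W (-(l + 1))).map (h (l + 1))).shift).pre
        ((shiftByIso W l).hom.app _) :=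
    DegLift.zPowIso_naturality (-l) (-(l + 1)) (by ring) (h (l + 1))
  change ((DegLift.zPow W (-l)).map (h l)).post
    ((shiftBy W (-l)).map (L.d l (l + 1)) ≫ (shiftByIso W l).hom.app (L.X (l + 1))) =
    (((DegLift.zPow W (-(l + 1))).map (h (l + 1))).shift).pre
    ((shiftBy W (-l)).map (K.d l (l + 1)) ≫ (shiftByIso W l).hom.app (K.X (l + 1)))
  rw [← post_post, ← DegLift.map_post, hc, DegLift.map_pre, pre_post, e, pre_pre]

end Complexes

/-! ### Co-derived categories -/

section Coderived

variable [Abelian A] [HasCoproducts.{v} A]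

/-- Bounded exact complexes of factorizations; exactness means exactness of the complexes of
components. -/
structure IsBoundedExact (K : CochainComplex (Factorization W) ℤ) : Prop where
  bounded : ∃ a b : ℤ, K.IsStrictlyGE a ∧ K.IsStrictlyLE b
  exact₁ : (((ev₁ W).mapHomologicalComplex (ComplexShape.up ℤ)).obj K).Acyclic
  exact₀ : (((ev₀ W).mapHomologicalComplex (ComplexShape.up ℤ)).obj K).Acyclic

/-- Co-acyclic factorizations: the objects of the smallest thick subcategory of `K(Fact(w))` that
contains the totalizations of all bounded exact complexes of factorizations and is closed under
small coproducts. -/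
inductive IsCoacyclic : Factorization W → Prop
  | tot (K : CochainComplex (Factorization W) ℤ) (hK : IsBoundedExact K) :
      IsCoacyclic ((totalization W).obj K)
  | shift (E : Factorization W) (hE : IsCoacyclic E) : IsCoacyclic ((T W).obj E)
  | unshift (E : Factorization W) (hE : IsCoacyclic E) : IsCoacyclic ((S W).obj E)
  | cone {E F : Factorization W} (g : E ⟶ F) (hE : IsCoacyclic E) (hF : IsCoacyclic F) :
      IsCoacyclic (Factorization.cone g)
  | retract {E F : Factorization W} (i : E ⟶ F) (r : F ⟶ E) (h : homotopic W (i ≫ r) (𝟙 E))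
      (hF : IsCoacyclic F) : IsCoacyclic E
  | sigma {J : Type v} (F : J → Factorization W) (hF : ∀ j, IsCoacyclic (F j)) :
      IsCoacyclic (Factorization.sigma F)

variable (W) in
/-- The morphisms of `K(Fact(w))` with co-acyclic cone. -/
def coQis : MorphismProperty (HoCat W) :=
  fun E F f => ∃ g : E.as ⟶ F.as, (toHoCat W).map g = f ∧ IsCoacyclic (cone g)

variable (W) in
/-- The co-derived category `D^co(Fact(w))`: the Verdier quotient of the homotopy category of
factorizations by the co-acyclic factorizations. -/
abbrev Dco := (coQis W).Localization

variable (W) in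
/-- The functor `Fact(w) ⥤ D^co(Fact(w))`. -/
noncomputable def toDco : Factorization W ⥤ Dco W := toHoCat W ⋙ (coQis W).Q

variable (W) in
/-- The property of having injective components. -/
def hasInjectiveComponents : ObjectProperty (HoCat W) :=
  fun E => Injective E.as.X₁ ∧ Injective E.as.X₀

variable (W) in
/-- The homotopy category of factorizations with injective components. -/
abbrev KInj := (hasInjectiveComponents W).FullSubcategory

variable (W) in
/-- The functor from the homotopy category of factorizations with injective components to the
co-derived category. -/
noncomputable def Qinj : KInj W ⥤ Dco W := (hasInjectiveComponents W).ι ⋙ (coQis W).Q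

end Coderived
end Factorization

/-! ### Factored functors -/

section Factored

variable {A : Type u₁} [Category.{v₁} A] [Abelian A] {B : Type u₂} [Category.{v₂} B] [Abelian B]

/-- A factored functor `(A, Φ, w) → (B, Ψ, v)`: an additive functor `θ` from `A` to the category of
bounded complexes in `B`, together with a natural isomorphism `ε : θ Φ ≅ Ψ θ` that identifies
`θ(w_X)` with `v_{θ(X)}`. -/
structure FactoredFunctor (W : Potential A) (V : Potential B) where
  /-- the functor `θ` -/
  θ : A ⥤ CochainComplex B ℤ
  additive : θ.Additive
  bounded : ∀ X : A, ∃ a b : ℤ, (θ.obj X).IsStrictlyGE a ∧ (θ.obj X).IsStrictlyLE b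
  /-- the natural isomorphism `ε` -/
  ε : W.Φ.functor ⋙ θ ≅ θ ⋙ V.Φ.functor.mapHomologicalComplex (ComplexShape.up ℤ)
  compat : ∀ (X : A) (n : ℤ),
    (θ.map (W.w.app X)).f n ≫ (ε.hom.app X).f n = V.w.app ((θ.obj X).X n)

namespace FactoredFunctor

attribute [instance] additive

variable {W : Potential A} {V : Potential B} (θ : FactoredFunctor W V)

/-- A factored functor is left exact if the underlying functor is. -/
def LeftExact : Prop := PreservesFiniteLimits θ.θ

/-- The components of `ε`. -/
def εh (X : A) (n : ℤ) :
    (θ.θ.obj (W.Φ.functor.obj X)).X n ⟶ V.Φ.functor.obj ((θ.θ.obj X).X n) :=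
  (θ.ε.hom.app X).f n

/-- The components of the inverse of `ε`. -/
def εi (X : A) (n : ℤ) :
    V.Φ.functor.obj ((θ.θ.obj X).X n) ⟶ (θ.θ.obj (W.Φ.functor.obj X)).X n :=
  (θ.ε.inv.app X).f n

lemma compat' (X : A) (n : ℤ) :
    (θ.θ.map (W.w.app X)).f n ≫ θ.εh X n = V.w.app ((θ.θ.obj X).X n) :=
  θ.compat X n

lemma ε_naturality {X Y : A} (f : X ⟶ Y) (n : ℤ) :
    (θ.θ.map (W.Φ.functor.map f)).f n ≫ θ.εh Y n =
      θ.εh X n ≫ V.Φ.functor.map ((θ.θ.map f).f n) :=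
  HomologicalComplex.congr_hom (θ.ε.hom.naturality f) n

lemma ε_d (X : A) (i j : ℤ) :
    (θ.θ.obj (W.Φ.functor.obj X)).d i j ≫ θ.εh X j =
      θ.εh X i ≫ V.Φ.functor.map ((θ.θ.obj X).d i j) :=
  ((θ.ε.hom.app X).comm i j).symm

lemma ε_hom_inv (X : A) (n : ℤ) : θ.εh X n ≫ θ.εi X n = 𝟙 _ :=
  HomologicalComplex.congr_hom (θ.ε.hom_inv_id_app X) n

lemma ε_inv_hom (X : A) (n : ℤ) : θ.εi X n ≫ θ.εh X n = 𝟙 _ :=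
  HomologicalComplex.congr_hom (θ.ε.inv_hom_id_app X) n

/-- The factorization `(θ(E^{-1})_n, θ(E^0)_n)`. -/
@[simps]
def factorization (E : Factorization W) (n : ℤ) : Factorization V where
  X₁ := (θ.θ.obj E.X₁).X n
  X₀ := (θ.θ.obj E.X₀).X n
  a := (θ.θ.map E.a).f n
  b := (θ.θ.map E.b).f n ≫ θ.εh E.X₁ n
  a_b := by
    rw [← assoc, ← HomologicalComplex.comp_f, ← Functor.map_comp, E.a_b, θ.compat']
  b_a := by
    rw [assoc, ← θ.ε_naturality, ← assoc, ← HomologicalComplex.comp_f, ← Functor.map_comp,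
      E.b_a, θ.compat']

/-- The complex of factorizations with terms `(θ(E^{-1})_n, θ(E^0)_n)`. -/
def complex (E : Factorization W) : CochainComplex (Factorization V) ℤ where
  X n := θ.factorization E n
  d i j :=
    { f₁ := (θ.θ.obj E.X₁).d i j
      f₀ := (θ.θ.obj E.X₀).d i j
      comm_a := ((θ.θ.map E.a).comm i j).symm
      comm_b := by
        dsimp only [factorization]
        rw [← assoc, ← (θ.θ.map E.b).comm i j, assoc, assoc, ε_d] }
  shape i j h := by
    ext
    · exact (θ.θ.obj E.X₁).shape i j h
    · exact (θ.θ.obj E.X₀).shape i j h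
  d_comp_d' i j k _ _ := by
    ext
    · exact (θ.θ.obj E.X₁).d_comp_d i j k
    · exact (θ.θ.obj E.X₀).d_comp_d i j k

/-- The functor sending `E` to the complex of factorizations `(θ(E^{-1}), θ(E^0))`. -/
def complexFunctor : Factorization W ⥤ CochainComplex (Factorization V) ℤ where
  obj E := θ.complex E
  map {E F} f :=
    { f := fun n =>
        { f₁ := (θ.θ.map f.f₁).f n
          f₀ := (θ.θ.map f.f₀).f n
          comm_a := by
            change _ ≫ (θ.θ.map F.a).f n = (θ.θ.map E.a).f n ≫ _
            rw [← HomologicalComplex.comp_f, ← Functor.map_comp, f.comm_a, Functor.map_comp,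
              HomologicalComplex.comp_f]
          comm_b := by
            change (θ.θ.map f.f₀).f n ≫ (θ.θ.map F.b).f n ≫ θ.εh F.X₁ n =
              ((θ.θ.map E.b).f n ≫ θ.εh E.X₁ n) ≫ V.Φ.functor.map ((θ.θ.map f.f₁).f n)
            rw [assoc, ← ε_naturality, ← assoc, ← HomologicalComplex.comp_f, ← Functor.map_comp,
              f.comm_b, Functor.map_comp, HomologicalComplex.comp_f, assoc] }
      comm' := fun i j _ => by
        ext
        · exact (θ.θ.map f.f₁).comm i j
        · exact (θ.θ.map f.f₀).comm i j }
  map_id E := by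
    ext n
    · exact HomologicalComplex.congr_hom (θ.θ.map_id E.X₁) n
    · exact HomologicalComplex.congr_hom (θ.θ.map_id E.X₀) n
  map_comp f g := by
    ext n
    · exact HomologicalComplex.congr_hom (θ.θ.map_comp f.f₁ g.f₁) n
    · exact HomologicalComplex.congr_hom (θ.θ.map_comp f.f₀ g.f₀) n

variable [HasCoproducts.{v₂} B]

/-- The functor `θ^f : Fact(w) ⥤ Fact(v)`: the totalization of the complex of factorizations
`(θ(E^{-1}), θ(E^0))`. -/
noncomputable def onFact : Factorization W ⥤ Factorization V :=
  θ.complexFunctor ⋙ Factorization.totalization V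

lemma onFact_homotopic {E F : Factorization W} (f g : E ⟶ F)
    (hfg : Factorization.homotopic W f g) :
    Factorization.homotopic V (θ.onFact.map f) (θ.onFact.map g) := by
  obtain ⟨h, hh⟩ := hfg
  refine Factorization.totalization_homotopic _ _
    (fun n =>
      { p := (θ.θ.map h.p).f n
        q := θ.εi E.X₁ n ≫ (θ.θ.map h.q).f n }) (fun n => ⟨?_, ?_⟩) fun n => ?_
  · change (θ.θ.map f.f₀).f n - (θ.θ.map g.f₀).f n =
      (θ.θ.map h.p).f n ≫ (θ.θ.map F.a).f n +
        ((θ.θ.map E.b).f n ≫ θ.εh E.X₁ n) ≫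
          θ.εi E.X₁ n ≫ (θ.θ.map h.q).f n
    have e := congrArg (fun k => (θ.θ.map k).f n) hh.zero
    simp only [Functor.map_sub, Functor.map_add, Functor.map_comp, HomologicalComplex.sub_f_apply,
      HomologicalComplex.add_f_apply, HomologicalComplex.comp_f] at e
    rw [e, assoc, ← assoc (θ.εh E.X₁ n), ε_hom_inv, id_comp]
  · change V.Φ.functor.map ((θ.θ.map f.f₁).f n - (θ.θ.map g.f₁).f n) =
      V.Φ.functor.map ((θ.θ.map E.a).f n ≫ (θ.θ.map h.p).f n) +
        (θ.εi E.X₁ n ≫ (θ.θ.map h.q).f n) ≫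
          (θ.θ.map F.b).f n ≫ θ.εh F.X₁ n
    have e := congrArg (fun k => (θ.θ.map k).f n) hh.one
    simp only [Functor.map_sub, Functor.map_add, Functor.map_comp, HomologicalComplex.sub_f_apply,
      HomologicalComplex.add_f_apply, HomologicalComplex.comp_f] at e
    have hi {X Y : A} (k : X ⟶ Y) : V.Φ.functor.map ((θ.θ.map k).f n) =
        θ.εi X n ≫ (θ.θ.map (W.Φ.functor.map k)).f n ≫ θ.εh Y n := by
      rw [ε_naturality, ← assoc, ε_inv_hom, id_comp]
    rw [← HomologicalComplex.comp_f, ← Functor.map_comp, Functor.map_sub, hi, hi, hi]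
    have e' := congrArg (fun k => θ.εi E.X₁ n ≫ k ≫ θ.εh F.X₁ n) e
    simp only [Preadditive.sub_comp, Preadditive.comp_sub, Preadditive.add_comp,
      Preadditive.comp_add, assoc] at e'
    rw [e']
    simp
  · have hi : V.Φ.functor.map ((θ.θ.obj E.X₁).d n (n + 1)) ≫ θ.εi E.X₁ (n + 1) =
        θ.εi E.X₁ n ≫ (θ.θ.obj (W.Φ.functor.obj E.X₁)).d n (n + 1) :=
      ((θ.ε.inv.app E.X₁).comm n (n + 1)).symm
    ext
    · exact (θ.θ.map h.p).comm n (n + 1)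
    · change (θ.εi E.X₁ n ≫ (θ.θ.map h.q).f n) ≫ (θ.θ.obj F.X₀).d n (n + 1) =
        V.Φ.functor.map ((θ.θ.obj E.X₁).d n (n + 1)) ≫
          θ.εi E.X₁ (n + 1) ≫ (θ.θ.map h.q).f (n + 1)
      rw [← assoc, hi, assoc, assoc, (θ.θ.map h.q).comm n (n + 1)]

/-- The functor induced by `θ^f` on homotopy categories. -/
noncomputable def onHoCat : Factorization.HoCat W ⥤ Factorization.HoCat V :=
  CategoryTheory.Quotient.lift _ (θ.onFact ⋙ Factorization.toHoCat V)
    fun _ _ f g h => CategoryTheory.Quotient.sound _ (θ.onFact_homotopic f g h)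

/-- The derived functor `Rθ^f : D^co(Fact(w)) ⥤ D^co(Fact(v))`, defined by applying `θ^f` to
factorizations with injective components; that these represent the co-derived category of
`Fact(w)` is the hypothesis that `Qinj` is an equivalence. -/
noncomputable def derived [HasCoproducts.{v₁} A] [(Factorization.Qinj W).IsEquivalence] :
    Factorization.Dco W ⥤ Factorization.Dco V :=
  (Factorization.Qinj W).inv ⋙ (Factorization.hasInjectiveComponents W).ι ⋙ θ.onHoCat ⋙
    (Factorization.coQis V).Q

end FactoredFunctor
end Factored
/-! ### The derived functor of `θ` -/

section Total

variable {B : Type u₂} [Category.{v₂} B] [Abelian B] [HasCoproducts.{v₂} B]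

instance hasTotal (K : HomologicalComplex₂ B (ComplexShape.up ℤ) (ComplexShape.up ℤ)) :
    K.HasTotal (ComplexShape.up ℤ) :=
  fun _ => inferInstance

/-- Homotopies in the first direction induce homotopies between total complexes. -/
noncomputable def totalHomotopy
    {K L : HomologicalComplex₂ B (ComplexShape.up ℤ) (ComplexShape.up ℤ)} {f g : K ⟶ L}
    (h : Homotopy f g) :
    Homotopy (HomologicalComplex₂.total.map f (ComplexShape.up ℤ))
      (HomologicalComplex₂.total.map g (ComplexShape.up ℤ)) where
  hom n m := K.totalDesc fun p q _ =>
    (h.hom p (p - 1)).f q ≫ L.ιTotalOrZero (ComplexShape.up ℤ) (p - 1) q m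
  zero n m hnm := by
    refine HomologicalComplex₂.total.hom_ext _ fun p q hpq => ?_
    rw [HomologicalComplex₂.ι_totalDesc, comp_zero, L.ιTotalOrZero_eq_zero, comp_zero]
    intro hpq'
    apply hnm
    change p + q = n at hpq
    change p - 1 + q = m at hpq'
    change m + 1 = n
    lia
  comm n := by
    refine HomologicalComplex₂.total.hom_ext _ fun p q hpq => ?_
    change p + q = n at hpq
    have hn : (ComplexShape.up ℤ).Rel n (n + 1) := rfl
    have hn' : (ComplexShape.up ℤ).Rel (n - 1) n := by simp
    have hp : (ComplexShape.up ℤ).Rel p (p + 1) := rfl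
    have hp' : (ComplexShape.up ℤ).Rel (p - 1) p := by simp
    have hq : (ComplexShape.up ℤ).Rel q (q + 1) := rfl
    rw [dNext_eq _ hn, prevD_eq _ hn']
    have hc := congrArg (fun k => k.f q ≫ L.ιTotal (ComplexShape.up ℤ) p q n hpq) (h.comm p)
    rw [dNext_eq _ hp, prevD_eq _ hp'] at hc
    simp only [HomologicalComplex.add_f_apply, HomologicalComplex.comp_f,
      Preadditive.add_comp, assoc] at hc
    simp only [Preadditive.comp_add, HomologicalComplex₂.ιTotal_map]
    rw [hc]
    congr 1
    have key (p p' q n m : ℤ) (hpq : p' + q = n) (hpp : p + 1 = p') :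
        K.ιTotal (ComplexShape.up ℤ) p' q n hpq ≫
          (K.totalDesc fun p q _ =>
            (h.hom p (p - 1)).f q ≫ L.ιTotalOrZero (ComplexShape.up ℤ) (p - 1) q m) =
        (h.hom p' p).f q ≫ L.ιTotalOrZero (ComplexShape.up ℤ) p q m := by
      obtain rfl : p = p' - 1 := by lia
      rw [HomologicalComplex₂.ι_totalDesc]
    have hpq₁ : p + 1 + q = n + 1 := by lia
    have hpq₂ : p + (q + 1) = n + 1 := by lia
    have hpq₃ : p - 1 + q = n - 1 := by lia
    have hpq₄ : p - 1 + (q + 1) = n := by lia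
    have key' (p p' q n m : ℤ) (hpq : p' + q = n) (hpp : p + 1 = p') {Z : B} (z : _ ⟶ Z) :
        K.ιTotal (ComplexShape.up ℤ) p' q n hpq ≫
          (K.totalDesc fun p q _ =>
            (h.hom p (p - 1)).f q ≫ L.ιTotalOrZero (ComplexShape.up ℤ) (p - 1) q m) ≫ z =
        (h.hom p' p).f q ≫ L.ιTotalOrZero (ComplexShape.up ℤ) p q m ≫ z := by
      rw [← assoc, key p p' q n m hpq hpp, assoc]
    have hε : ((ComplexShape.up ℤ).ε₂ (ComplexShape.up ℤ) (ComplexShape.up ℤ) (p, q)) =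
        -((ComplexShape.up ℤ).ε₂ (ComplexShape.up ℤ) (ComplexShape.up ℤ) (p - 1, q)) := by
      change p.negOnePow = -(p - 1).negOnePow
      rw [Int.negOnePow_sub, Int.negOnePow_one]
      simp
    rw [key' (p - 1) p q n (n - 1) hpq (by lia), L.ιTotalOrZero_eq _ _ _ _ hpq₃,
      ← assoc (K.ιTotal _ _ _ _ _), HomologicalComplex₂.total_d, HomologicalComplex₂.total_d,
      Preadditive.comp_add, Preadditive.comp_add, HomologicalComplex₂.ι_D₁,
      HomologicalComplex₂.ι_D₂, HomologicalComplex₂.ι_D₁,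
      HomologicalComplex₂.ι_D₂, HomologicalComplex₂.d₁_eq _ _ hp q (n + 1) hpq₁,
      HomologicalComplex₂.d₂_eq _ _ p hq (n + 1) hpq₂, HomologicalComplex₂.d₁_eq _ _ hp' q n hpq,
      HomologicalComplex₂.d₂_eq _ _ (p - 1) hq n hpq₄, Preadditive.add_comp,
      Linear.units_smul_comp, Linear.units_smul_comp, assoc, assoc,
      key p (p + 1) q (n + 1) n hpq₁ rfl, key (p - 1) p (q + 1) (n + 1) n hpq₂ (by lia),
      L.ιTotalOrZero_eq _ _ _ _ hpq, L.ιTotalOrZero_eq _ _ _ _ hpq₄, hε]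
    have h1 (x y : ℤ) : (ComplexShape.up ℤ).ε₁ (ComplexShape.up ℤ) (ComplexShape.up ℤ) (x, y) = 1 :=
      rfl
    simp only [h1, one_smul, Units.neg_smul, Preadditive.comp_add, Linear.comp_units_smul]
    rw [← assoc ((K.X p).d q (q + 1)), ← (h.hom p (p - 1)).comm q (q + 1), assoc]
    abel

end Total
section DerivedFunctor

variable {A : Type u₁} [Category.{v₁} A] [Abelian A] {B : Type u₂} [Category.{v₂} B] [Abelian B]
  [HasCoproducts.{v₂} B]

/-- The functor `K(A) ⥤ K(B)` sending a complex `K` to the total complex of the double complex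
`θ(K)`, for an additive functor `θ` from `A` to the category of complexes in `B`. -/
noncomputable def totalHoCat (θ : A ⥤ CochainComplex B ℤ) [θ.Additive] :
    HomotopyCategory A (ComplexShape.up ℤ) ⥤ HomotopyCategory B (ComplexShape.up ℤ) :=
  CategoryTheory.Quotient.lift _
    (θ.mapHomologicalComplex (ComplexShape.up ℤ) ⋙
      HomologicalComplex₂.totalFunctor B (ComplexShape.up ℤ) (ComplexShape.up ℤ)
        (ComplexShape.up ℤ) ⋙ HomotopyCategory.quotient B (ComplexShape.up ℤ))
    fun _ _ _ _ ⟨h⟩ => HomotopyCategory.eq_of_homotopy _ _ (totalHomotopy (θ.mapHomotopy h))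

/-- The right derived functor `Rθ : D^+(A) ⥤ D(B)` of an additive functor `θ` from `A` to the
category of complexes in `B`. -/
noncomputable def totalRightDerived [EnoughInjectives A] [HasDerivedCategory.{w₁} A]
    [HasDerivedCategory.{w₂} B] (θ : A ⥤ CochainComplex B ℤ) [θ.Additive] :
    DerivedCategory.Plus A ⥤ DerivedCategory B :=
  (HomotopyCategory.Plus.ι A ⋙ totalHoCat θ ⋙ DerivedCategory.Qh).totalRightDerived
    DerivedCategory.Plus.Qh (HomotopyCategory.Plus.quasiIso A)

/-- An object has finite injective dimension. -/
def HasFiniteInjectiveDimension (X : A) : Prop :=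
  ∃ n : ℕ, HasInjectiveDimensionLE X n

variable (A) in
/-- The abelian category `A` has finite injective dimension: there is an integer `n` such that
every object has an injective resolution of length at most `n`. -/
def FiniteInjectiveDimension : Prop :=
  EnoughInjectives A ∧ ∃ n : ℕ, ∀ X : A, HasInjectiveDimensionLE X n

end DerivedFunctor
end FactCat

/-! Part (1). A factorization is called left orthogonal (`Orth`) if all its morphisms to
factorizations with injective components are null-homotopic. Co-acyclic factorizations are left
orthogonal (`IsCoacyclic.orth`): the property is stable under shifts, cones, retracts and
coproducts, and for the totalization of a bounded exact complex the null-homotopies come from a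
bounded double complex whose rows are built from Hom complexes of acyclic complexes into bounded
complexes of injectives. Hence morphisms in the co-derived category to a factorization with
injective components are homotopy classes (`bijective_Q_map`), and `Qinj` is fully faithful. For
essential surjectivity, the abelian category of factorizations has enough injectives, and an
injective factorization has injective components. An injective resolution of `E` is totalized; the
result has injective components because coproducts of injectives are injective. The cone of the map
from `E` is the totalization of a bounded below exact complex, and such a totalization is co-acyclic
because it is the telescope of the totalizations of bounded exact truncations
(`isCoacyclic_totalization`).

Part (2). Finite injective dimension of the components makes it possible to truncate the
resolutions: `E` and `F[t]` may be replaced by totalizations of bounded complexes `K`, `L` of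
factorizations with injective components. A factorization is unfolded into the sequence of all
`E^i`, which is periodic up to `Φ` and satisfies `d ∘ d = w`. The commutator differential on
periodic families of morphisms squares to zero, because the two contributions of `w` cancel by
naturality. For totalizations, these families form the total complex of a bounded double complex
(`UnfC.rows`), whose rows consist of periodic families of cochains between the complexes `K^q` and
`L^{q'}`; its cohomology in degree `0` is the group of homotopy classes of morphisms
(`isNull_iff_bounds`, `exists_homRow_eq`).

Since the target category has finite injective dimension, `θ^f` of the totalization of `L` also has
a bounded replacement with injective components, obtained by resolving the total complexes of
`θ(L^q)`. The functor `θ` induces a morphism of double complexes (`rowMap`). Its rows are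
quasi-isomorphisms: the cohomology of a Hom complex is a group of morphisms `E^q → F^{q'+t}[p]` in
the derived category, on which `Rθ` is bijective by hypothesis. Periodicity does not obstruct the
choices involved, since a periodic family is freely determined by two consecutive indices. A
morphism of bounded double complexes that is a quasi-isomorphism on rows is one on total complexes
(`Bicomplex.Hom.RowQuasiIso`), which gives the bijection on homotopy classes, and with part (1) the
bijection in the co-derived categories. -/

namespace FactCat

/-! ### Local objects of a localization -/

section LocalObjects

variable {C : Type u} [Category.{v} C] (P : MorphismProperty C)

/-- If the morphisms in `P` induce bijections on morphisms to `Y`, then the morphisms to `Y` do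
not change in the localization with respect to `P`. -/
lemma bijective_Q_map_of_local {Y : C}
    (hY : ∀ ⦃X Z : C⦄ (f : X ⟶ Z), P f → Function.Bijective fun u : Z ⟶ Y => f ≫ u) (X : C) :
    Function.Bijective (P.Q.map : (X ⟶ Y) → (P.Q.obj X ⟶ P.Q.obj Y)) := by
  constructor
  · intro f g hfg
    -- The functor `Hom(-, Y)` inverts `P`, so it factors through the localization; evaluating at `𝟙
    -- Y` recovers a morphism from its image.
    have hF : P.IsInvertedBy (yoneda.obj Y).rightOp := fun X Z f hf => by
      have : IsIso ((yoneda.obj Y).map f.op) := (isIso_iff_bijective _).2 (hY f hf)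
      exact inferInstanceAs (IsIso ((yoneda.obj Y).map f.op).op)
    let e := Localization.fac (yoneda.obj Y).rightOp hF P.Q
    have h : (yoneda.obj Y).rightOp.map f = (yoneda.obj Y).rightOp.map g := by
      rw [← cancel_epi (e.hom.app X), ← e.hom.naturality, ← e.hom.naturality,
        Functor.comp_map, Functor.comp_map, hfg]
    have h' := ConcreteCategory.congr_hom (Quiver.Hom.op_inj h) (𝟙 Y)
    simpa using h'
  -- Precomposition with any morphism of the localization preserves the morphisms to `Y` that come
  -- from `C`. It suffices to check the generators, and for the formal inverse of a morphism of `P`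
  -- this is the locality of `Y`. Objects of the localization are objects of `C`, whence the
  -- equalities of objects.
  · let R : MorphismProperty P.Localization := fun U V g =>
      ∀ v : V ⟶ P.Q.obj Y, (∃ (Z : C) (hZ : V = P.Q.obj Z) (u : Z ⟶ Y),
        v = eqToHom hZ ≫ P.Q.map u) → ∃ (Z : C) (hZ : U = P.Q.obj Z) (u : Z ⟶ Y),
        g ≫ v = eqToHom hZ ≫ P.Q.map u
    have hobj {Z Z' : C} (h : P.Q.obj Z = P.Q.obj Z') : Z = Z' :=
      (Localization.Construction.objEquiv P).injective h
    have : R.IsStableUnderComposition := ⟨fun f g hf hg v hv => by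
      rw [assoc]
      exact hf _ (hg v hv)⟩
    have hR : R = ⊤ := Localization.Construction.morphismProperty_eq_top R
      (by
        rintro U V g v ⟨Z, hZ, u, rfl⟩
        obtain rfl := hobj hZ
        exact ⟨U, rfl, g ≫ u, by simp⟩)
      (by
        rintro U V g hg v ⟨Z, hZ, u, rfl⟩
        obtain rfl := hobj hZ
        obtain ⟨u', hu'⟩ := (hY g hg).2 u
        refine ⟨V, rfl, u', ?_⟩
        dsimp at hu'
        rw [← hu']
        simp only [eqToHom_refl, id_comp, Functor.map_comp]
        exact (Localization.Construction.wIso g hg).inv_hom_id_assoc _)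
    intro g
    have hg : R g := by rw [hR]; trivial
    obtain ⟨Z, hZ, u, hu⟩ := hg (𝟙 _) ⟨Y, rfl, 𝟙 _, by simp⟩
    obtain rfl := hobj hZ
    exact ⟨u, by simpa using hu.symm⟩

end LocalObjects

namespace Factorization

variable {A : Type u} [Category.{v} A] [Abelian A] {W : Potential A}

/-! ### Null-homotopic morphisms of factorizations -/

section Homotopic

variable {E F G : Factorization W}

/-- The boundary of a degree `-1` map. -/
noncomputable def Deg.bd (h : Deg E F) : E ⟶ F where
  f₁ := W.Φ.functor.preimage (W.Φ.functor.map (E.a ≫ h.p) + h.q ≫ F.b)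
  f₀ := h.p ≫ F.a + E.b ≫ h.q
  comm_a := by
    apply W.Φ.functor.map_injective
    simp [W.w_obj, w_naturality]
  comm_b := by
    simp [w_naturality]

@[simp] lemma Deg.map_bd_f₁ (h : Deg E F) :
    W.Φ.functor.map h.bd.f₁ = W.Φ.functor.map (E.a ≫ h.p) + h.q ≫ F.b :=
  W.Φ.functor.map_preimage _

@[simp] lemma Deg.bd_f₀ (h : Deg E F) : h.bd.f₀ = h.p ≫ F.a + E.b ≫ h.q := rfl

lemma Deg.isHomotopy_iff (h : Deg E F) (f g : E ⟶ F) : h.IsHomotopy f g ↔ f - g = h.bd := by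
  constructor
  · intro hh
    ext
    · apply W.Φ.functor.map_injective
      rw [Deg.map_bd_f₁, sub_f₁, hh.one]
    · rw [sub_f₀, hh.zero, Deg.bd_f₀]
  · intro hh
    exact ⟨by rw [← sub_f₀, hh, Deg.bd_f₀], by rw [← sub_f₁, hh, Deg.map_bd_f₁]⟩

lemma homotopic_iff (f g : E ⟶ F) : homotopic W f g ↔ ∃ h : Deg E F, f - g = h.bd :=
  exists_congr fun h => h.isHomotopy_iff f g

/-- A morphism that is homotopic to zero. -/
def IsNull (f : E ⟶ F) : Prop := ∃ h : Deg E F, f = h.bd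

lemma homotopic_iff_isNull (f g : E ⟶ F) : homotopic W f g ↔ IsNull (f - g) :=
  homotopic_iff f g

lemma Deg.bd_eq (h : Deg E F) {f : E ⟶ F} (h₁ : W.Φ.functor.map f.f₁ =
      W.Φ.functor.map (E.a ≫ h.p) + h.q ≫ F.b) (h₀ : f.f₀ = h.p ≫ F.a + E.b ≫ h.q) :
    f = h.bd := by
  ext
  · apply W.Φ.functor.map_injective
    rw [h₁, h.map_bd_f₁]
  · exact h₀

lemma isNull_iff (f : E ⟶ F) : IsNull f ↔ ∃ h : Deg E F, W.Φ.functor.map f.f₁ =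
      W.Φ.functor.map (E.a ≫ h.p) + h.q ≫ F.b ∧ f.f₀ = h.p ≫ F.a + E.b ≫ h.q := by
  constructor
  · rintro ⟨h, rfl⟩
    exact ⟨h, h.map_bd_f₁, rfl⟩
  · rintro ⟨h, h₁, h₀⟩
    exact ⟨h, h.bd_eq h₁ h₀⟩

lemma isNull_zero : IsNull (0 : E ⟶ F) :=
  (isNull_iff _).2 ⟨⟨0, 0⟩, by simp, by simp⟩

lemma IsNull.add {f g : E ⟶ F} (hf : IsNull f) (hg : IsNull g) : IsNull (f + g) := by
  obtain ⟨h, rfl⟩ := hf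
  obtain ⟨k, rfl⟩ := hg
  refine (isNull_iff _).2 ⟨⟨h.p + k.p, h.q + k.q⟩, ?_, ?_⟩
  · simp only [add_f₁, Functor.map_add, Deg.map_bd_f₁, Preadditive.comp_add,
      Preadditive.add_comp]
    abel
  · simp only [add_f₀, Deg.bd_f₀, Preadditive.comp_add, Preadditive.add_comp]
    abel

lemma IsNull.neg {f : E ⟶ F} (hf : IsNull f) : IsNull (-f) := by
  obtain ⟨h, rfl⟩ := hf
  refine (isNull_iff _).2 ⟨⟨-h.p, -h.q⟩, ?_, ?_⟩
  · simp [add_comm]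
  · simp [add_comm]

lemma IsNull.sub {f g : E ⟶ F} (hf : IsNull f) (hg : IsNull g) : IsNull (f - g) := by
  rw [sub_eq_add_neg]
  exact hf.add hg.neg

lemma IsNull.comp_left {g : F ⟶ G} (hg : IsNull g) (f : E ⟶ F) : IsNull (f ≫ g) := by
  obtain ⟨h, rfl⟩ := hg
  refine (isNull_iff _).2 ⟨h.pre f, ?_, ?_⟩
  · have := congrArg (fun k => W.Φ.functor.map (k ≫ h.p)) f.comm_a
    simp only [Functor.map_comp] at this
    simp only [comp_f₁, Functor.map_comp, Deg.map_bd_f₁, Preadditive.comp_add, Deg.pre_p,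
      Deg.pre_q, assoc] at this ⊢
    rw [this]
  · simp only [comp_f₀, Deg.bd_f₀, Preadditive.comp_add, Deg.pre_p,
      Deg.pre_q, assoc]
    rw [← assoc, ← assoc, f.comm_b, assoc]
    simp

lemma IsNull.comp_right {f : E ⟶ F} (hf : IsNull f) (g : F ⟶ G) : IsNull (f ≫ g) := by
  obtain ⟨h, rfl⟩ := hf
  refine (isNull_iff _).2 ⟨h.post g, ?_, ?_⟩
  · simp only [comp_f₁, Functor.map_comp, Deg.map_bd_f₁, Preadditive.add_comp, Deg.post_p,
      Deg.post_q, assoc, g.comm_b]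
  · simp only [comp_f₀, Deg.bd_f₀, Preadditive.add_comp, Deg.post_p,
      Deg.post_q, assoc, g.comm_a]

lemma IsNull.map_T {f : E ⟶ F} (hf : IsNull f) : IsNull ((T W).map f) := by
  obtain ⟨h, hh⟩ := hf
  have := (DegLift.shift W).isHomotopy h f 0 ((h.isHomotopy_iff f 0).2 (by simpa using hh))
  exact ⟨_, by simpa using (Deg.isHomotopy_iff _ _ _).1 this⟩

lemma IsNull.map_S {f : E ⟶ F} (hf : IsNull f) : IsNull ((S W).map f) := by
  obtain ⟨h, hh⟩ := hf
  have := (DegLift.unshift W).isHomotopy h f 0 ((h.isHomotopy_iff f 0).2 (by simpa using hh))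
  exact ⟨_, by simpa using (Deg.isHomotopy_iff _ _ _).1 this⟩

instance : Congruence (homotopic W) where
  equivalence := ⟨fun f => (homotopic_iff_isNull f f).2 (by rw [sub_self]; exact isNull_zero),
    fun {f g} h => by
      rw [homotopic_iff_isNull] at h ⊢
      rw [← neg_sub]
      exact h.neg,
    fun {f g k} h h' => by
      rw [homotopic_iff_isNull] at h h' ⊢
      rw [← sub_add_sub_cancel f g k]
      exact h.add h'⟩
  comp_left {X Y Z} f g g' h := by
    rw [homotopic_iff_isNull] at h ⊢
    rw [← Preadditive.comp_sub]
    exact h.comp_left f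
  comp_right {X Y Z f f'} g h := by
    rw [homotopic_iff_isNull] at h ⊢
    rw [← Preadditive.sub_comp]
    exact h.comp_right g

lemma toHoCat_map_eq_iff (f g : E ⟶ F) :
    (toHoCat W).map f = (toHoCat W).map g ↔ IsNull (f - g) := by
  rw [CategoryTheory.Quotient.functor_map_eq_iff, homotopic_iff_isNull]

end Homotopic

/-- Morphisms to a shift. -/
def toT {E G : Factorization W} (x₁ : G.X₁ ⟶ E.X₀) (x₀ : G.X₀ ⟶ W.Φ.functor.obj E.X₁)
    (ha : G.a ≫ x₀ = -(x₁ ≫ E.b))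
    (hb : x₀ ≫ W.Φ.functor.map E.a = -(G.b ≫ W.Φ.functor.map x₁)) : G ⟶ (T W).obj E where
  f₁ := x₁
  f₀ := x₀
  comm_a := (Preadditive.comp_neg _ _).trans ha.symm
  comm_b := by
    rw [eq_neg_iff_add_eq_zero, add_comm, ← eq_neg_iff_add_eq_zero] at hb
    refine Eq.trans ?_ hb.symm
    exact Preadditive.comp_neg _ _

/-- Morphisms from a shift. -/
def ofT {E G : Factorization W} (x₁ : E.X₀ ⟶ G.X₁) (x₀ : W.Φ.functor.obj E.X₁ ⟶ G.X₀)
    (ha : x₁ ≫ G.a = -(E.b ≫ x₀))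
    (hb : x₀ ≫ G.b = -(W.Φ.functor.map E.a ≫ W.Φ.functor.map x₁)) : (T W).obj E ⟶ G where
  f₁ := x₁
  f₀ := x₀
  comm_a := ha.trans (Preadditive.neg_comp _ _).symm
  comm_b := hb.trans (Preadditive.neg_comp _ _).symm

/-! ### Mapping cones of factorizations -/

section Cone

variable {E F : Factorization W} (g : E ⟶ F)

section Components

/-- The inclusion of the first summand of the cone in degree `-1`. -/
noncomputable def il₁ : E.X₀ ⟶ (cone g).X₁ := (biprod.inl : E.X₀ ⟶ E.X₀ ⊞ F.X₁)

/-- The inclusion of the second summand of the cone in degree `-1`. -/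
noncomputable def ir₁ : F.X₁ ⟶ (cone g).X₁ := (biprod.inr : F.X₁ ⟶ E.X₀ ⊞ F.X₁)

/-- The inclusion of the first summand of the cone in degree `0`. -/
noncomputable def il₀ : W.Φ.functor.obj E.X₁ ⟶ (cone g).X₀ :=
  (biprod.inl : W.Φ.functor.obj E.X₁ ⟶ W.Φ.functor.obj E.X₁ ⊞ F.X₀)

/-- The inclusion of the second summand of the cone in degree `0`. -/
noncomputable def ir₀ : F.X₀ ⟶ (cone g).X₀ :=
  (biprod.inr : F.X₀ ⟶ W.Φ.functor.obj E.X₁ ⊞ F.X₀)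

/-- Morphisms out of the cone in degree `-1`. -/
noncomputable def cd₁ {Z : A} (x : E.X₀ ⟶ Z) (y : F.X₁ ⟶ Z) : (cone g).X₁ ⟶ Z :=
  (biprod.desc x y : E.X₀ ⊞ F.X₁ ⟶ Z)

/-- Morphisms out of the cone in degree `0`. -/
noncomputable def cd₀ {Z : A} (x : W.Φ.functor.obj E.X₁ ⟶ Z) (y : F.X₀ ⟶ Z) : (cone g).X₀ ⟶ Z :=
  (biprod.desc x y : W.Φ.functor.obj E.X₁ ⊞ F.X₀ ⟶ Z)

variable {Z Z' : A}

lemma cone_ext₁ {x y : (cone g).X₁ ⟶ Z} (hl : il₁ g ≫ x = il₁ g ≫ y)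
    (hr : ir₁ g ≫ x = ir₁ g ≫ y) : x = y :=
  biprod.hom_ext' _ _ hl hr

lemma cone_ext₀ {x y : (cone g).X₀ ⟶ Z} (hl : il₀ g ≫ x = il₀ g ≫ y)
    (hr : ir₀ g ≫ x = ir₀ g ≫ y) : x = y :=
  biprod.hom_ext' _ _ hl hr

/-- `Φ` of the components of the cone in degree `-1` is jointly epimorphic. -/
lemma cone_ext_map₁ {x y : W.Φ.functor.obj (cone g).X₁ ⟶ Z}
    (hl : W.Φ.functor.map (il₁ g) ≫ x = W.Φ.functor.map (il₁ g) ≫ y)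
    (hr : W.Φ.functor.map (ir₁ g) ≫ x = W.Φ.functor.map (ir₁ g) ≫ y) : x = y := by
  have e : W.Φ.functor.map (biprod.fst : E.X₀ ⊞ F.X₁ ⟶ _) ≫ W.Φ.functor.map (il₁ g) +
      W.Φ.functor.map (biprod.snd : E.X₀ ⊞ F.X₁ ⟶ _) ≫ W.Φ.functor.map (ir₁ g) = 𝟙 _ := by
    rw [← Functor.map_comp, ← Functor.map_comp, ← Functor.map_add,
      ← CategoryTheory.Functor.map_id]
    exact congrArg _ biprod.total
  have e' (x : W.Φ.functor.obj (cone g).X₁ ⟶ Z) : x =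
      W.Φ.functor.map (biprod.fst : E.X₀ ⊞ F.X₁ ⟶ _) ≫ W.Φ.functor.map (il₁ g) ≫ x +
      W.Φ.functor.map (biprod.snd : E.X₀ ⊞ F.X₁ ⟶ _) ≫ W.Φ.functor.map (ir₁ g) ≫ x := by
    rw [← assoc, ← assoc, ← Preadditive.add_comp]
    exact (id_comp x).symm.trans (congrArg (· ≫ x) e.symm)
  rw [e' x, e' y, hl, hr]

@[simp] lemma il₁_cd₁ (x : E.X₀ ⟶ Z) (y : F.X₁ ⟶ Z) : il₁ g ≫ cd₁ g x y = x :=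
  biprod.inl_desc _ _
@[simp] lemma ir₁_cd₁ (x : E.X₀ ⟶ Z) (y : F.X₁ ⟶ Z) : ir₁ g ≫ cd₁ g x y = y :=
  biprod.inr_desc _ _
@[simp] lemma il₀_cd₀ (x : W.Φ.functor.obj E.X₁ ⟶ Z) (y : F.X₀ ⟶ Z) : il₀ g ≫ cd₀ g x y = x :=
  biprod.inl_desc _ _
@[simp] lemma ir₀_cd₀ (x : W.Φ.functor.obj E.X₁ ⟶ Z) (y : F.X₀ ⟶ Z) : ir₀ g ≫ cd₀ g x y = y :=
  biprod.inr_desc _ _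
@[simp] lemma il₁_cd₁_assoc (x : E.X₀ ⟶ Z) (y : F.X₁ ⟶ Z) (z : Z ⟶ Z') :
    il₁ g ≫ cd₁ g x y ≫ z = x ≫ z := by rw [← assoc, il₁_cd₁]
@[simp] lemma ir₁_cd₁_assoc (x : E.X₀ ⟶ Z) (y : F.X₁ ⟶ Z) (z : Z ⟶ Z') :
    ir₁ g ≫ cd₁ g x y ≫ z = y ≫ z := by rw [← assoc, ir₁_cd₁]
@[simp] lemma il₀_cd₀_assoc (x : W.Φ.functor.obj E.X₁ ⟶ Z) (y : F.X₀ ⟶ Z) (z : Z ⟶ Z') :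
    il₀ g ≫ cd₀ g x y ≫ z = x ≫ z := by rw [← assoc, il₀_cd₀]
@[simp] lemma ir₀_cd₀_assoc (x : W.Φ.functor.obj E.X₁ ⟶ Z) (y : F.X₀ ⟶ Z) (z : Z ⟶ Z') :
    ir₀ g ≫ cd₀ g x y ≫ z = y ≫ z := by rw [← assoc, ir₀_cd₀]

@[simp] lemma map_il₁_cd₁ (x : E.X₀ ⟶ Z) (y : F.X₁ ⟶ Z) :
    W.Φ.functor.map (il₁ g) ≫ W.Φ.functor.map (cd₁ g x y) = W.Φ.functor.map x := by
  rw [← Functor.map_comp, il₁_cd₁]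
@[simp] lemma map_ir₁_cd₁ (x : E.X₀ ⟶ Z) (y : F.X₁ ⟶ Z) :
    W.Φ.functor.map (ir₁ g) ≫ W.Φ.functor.map (cd₁ g x y) = W.Φ.functor.map y := by
  rw [← Functor.map_comp, ir₁_cd₁]
@[simp] lemma map_il₁_cd₁_assoc (x : E.X₀ ⟶ Z) (y : F.X₁ ⟶ Z) (z : _ ⟶ Z') :
    W.Φ.functor.map (il₁ g) ≫ W.Φ.functor.map (cd₁ g x y) ≫ z = W.Φ.functor.map x ≫ z := by
  rw [← assoc, map_il₁_cd₁]
@[simp] lemma map_il₀_cd₀ (x : W.Φ.functor.obj E.X₁ ⟶ Z) (y : F.X₀ ⟶ Z) :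
    W.Φ.functor.map (il₀ g) ≫ W.Φ.functor.map (cd₀ g x y) = W.Φ.functor.map x := by
  rw [← Functor.map_comp, il₀_cd₀]
@[simp] lemma map_ir₀_cd₀ (x : W.Φ.functor.obj E.X₁ ⟶ Z) (y : F.X₀ ⟶ Z) :
    W.Φ.functor.map (ir₀ g) ≫ W.Φ.functor.map (cd₀ g x y) = W.Φ.functor.map y := by
  rw [← Functor.map_comp, ir₀_cd₀]
@[simp] lemma map_ir₁_cd₁_assoc (x : E.X₀ ⟶ Z) (y : F.X₁ ⟶ Z) (z : _ ⟶ Z') :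
    W.Φ.functor.map (ir₁ g) ≫ W.Φ.functor.map (cd₁ g x y) ≫ z = W.Φ.functor.map y ≫ z := by
  rw [← assoc, map_ir₁_cd₁]

@[simp] lemma il₁_a : il₁ g ≫ (cone g).a = -(E.b ≫ il₀ g) + g.f₀ ≫ ir₀ g :=
  (biprod.inl_desc _ _).trans (by rw [Preadditive.neg_comp]; rfl)
@[simp] lemma ir₁_a : ir₁ g ≫ (cone g).a = F.a ≫ ir₀ g :=
  biprod.inr_desc _ _
@[simp] lemma il₀_b : il₀ g ≫ (cone g).b =
    -(W.Φ.functor.map E.a ≫ W.Φ.functor.map (il₁ g)) +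
      W.Φ.functor.map g.f₁ ≫ W.Φ.functor.map (ir₁ g) :=
  (biprod.inl_desc _ _).trans (by rw [Preadditive.neg_comp]; rfl)
@[simp] lemma ir₀_b : ir₀ g ≫ (cone g).b = F.b ≫ W.Φ.functor.map (ir₁ g) :=
  biprod.inr_desc _ _
@[simp] lemma il₁_a_assoc (z : _ ⟶ Z) : il₁ g ≫ (cone g).a ≫ z =
    -(E.b ≫ il₀ g ≫ z) + g.f₀ ≫ ir₀ g ≫ z := by
  rw [← assoc, il₁_a, Preadditive.add_comp, Preadditive.neg_comp, assoc, assoc]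
@[simp] lemma ir₁_a_assoc (z : _ ⟶ Z) : ir₁ g ≫ (cone g).a ≫ z = F.a ≫ ir₀ g ≫ z := by
  rw [← assoc, ir₁_a, assoc]
@[simp] lemma il₀_b_assoc (z : _ ⟶ Z) : il₀ g ≫ (cone g).b ≫ z =
    -(W.Φ.functor.map E.a ≫ W.Φ.functor.map (il₁ g) ≫ z) +
      W.Φ.functor.map g.f₁ ≫ W.Φ.functor.map (ir₁ g) ≫ z := by
  rw [← assoc, il₀_b, Preadditive.add_comp, Preadditive.neg_comp, assoc, assoc]
@[simp] lemma ir₀_b_assoc (z : _ ⟶ Z) : ir₀ g ≫ (cone g).b ≫ z =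
    F.b ≫ W.Φ.functor.map (ir₁ g) ≫ z := by
  rw [← assoc, ir₀_b, assoc]
@[simp] lemma map_il₁_a : W.Φ.functor.map (il₁ g) ≫ W.Φ.functor.map (cone g).a =
    -(W.Φ.functor.map E.b ≫ W.Φ.functor.map (il₀ g)) +
      W.Φ.functor.map g.f₀ ≫ W.Φ.functor.map (ir₀ g) := by
  simp [← Functor.map_comp, il₁_a]
@[simp] lemma map_ir₁_a : W.Φ.functor.map (ir₁ g) ≫ W.Φ.functor.map (cone g).a =
    W.Φ.functor.map F.a ≫ W.Φ.functor.map (ir₀ g) := by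
  simp [← Functor.map_comp, ir₁_a]
@[simp] lemma map_il₁_a_assoc (z : _ ⟶ Z) :
    W.Φ.functor.map (il₁ g) ≫ W.Φ.functor.map (cone g).a ≫ z =
    -(W.Φ.functor.map E.b ≫ W.Φ.functor.map (il₀ g) ≫ z) +
      W.Φ.functor.map g.f₀ ≫ W.Φ.functor.map (ir₀ g) ≫ z := by
  rw [← assoc, map_il₁_a, Preadditive.add_comp, Preadditive.neg_comp, assoc, assoc]
@[simp] lemma map_ir₁_a_assoc (z : _ ⟶ Z) :
    W.Φ.functor.map (ir₁ g) ≫ W.Φ.functor.map (cone g).a ≫ z =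
    W.Φ.functor.map F.a ≫ W.Φ.functor.map (ir₀ g) ≫ z := by
  rw [← assoc, map_ir₁_a, assoc]

end Components

/-- The inclusion of the target in the cone. -/
noncomputable def coneInr : F ⟶ cone g where
  f₁ := ir₁ g
  f₀ := ir₀ g
  comm_a := ir₁_a g
  comm_b := ir₀_b g

@[simp] lemma coneInr_f₁ : (coneInr g).f₁ = ir₁ g := rfl
@[simp] lemma coneInr_f₀ : (coneInr g).f₀ = ir₀ g := rfl

/-- The projection from the cone to the shift of the source. -/
noncomputable def coneFst : cone g ⟶ (T W).obj E :=
  toT (cd₁ g (𝟙 E.X₀) 0) (cd₀ g (𝟙 (W.Φ.functor.obj E.X₁)) 0)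
    (cone_ext₁ g (by simp) (by simp)) (cone_ext₀ g (by simp) (by simp))

/-- Morphisms out of a cone. -/
noncomputable def coneDesc {G : Factorization W} (u : F ⟶ G) (h : Deg E G)
    (hu : g ≫ u = h.bd) : cone g ⟶ G where
  f₁ := cd₁ g h.p u.f₁
  f₀ := cd₀ g h.q u.f₀
  comm_a := by
    have := congrArg Hom.f₀ hu
    simp only [comp_f₀, Deg.bd_f₀] at this
    refine cone_ext₁ g ?_ ?_
    · simp [this]
    · simp [u.comm_a]
  comm_b := by
    have := congrArg (fun k => W.Φ.functor.map (Hom.f₁ k)) hu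
    simp only [comp_f₁, Deg.map_bd_f₁, Functor.map_comp] at this
    refine cone_ext₀ g ?_ ?_
    · simp [this]
    · simp [u.comm_b]

lemma coneInr_coneDesc {G : Factorization W} (u : F ⟶ G) (h : Deg E G)
    (hu : g ≫ u = h.bd) : coneInr g ≫ coneDesc g u h hu = u := by
  ext
  · exact ir₁_cd₁ _ _ _
  · exact ir₀_cd₀ _ _ _

end Cone

/-- The factorizations with injective components. -/
def InjComp (I : Factorization W) : Prop := Injective I.X₁ ∧ Injective I.X₀

lemma InjComp.T {I : Factorization W} (hI : InjComp I) : InjComp ((T W).obj I) :=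
  ⟨hI.2, W.Φ.map_injective_iff _ |>.2 hI.1⟩

lemma InjComp.S {I : Factorization W} (hI : InjComp I) : InjComp ((S W).obj I) :=
  ⟨W.Φ.symm.map_injective_iff _ |>.2 hI.2, hI.1⟩

lemma Deg.pre_bd {E F G : Factorization W} (f : E ⟶ F) (h : Deg F G) :
    (h.pre f).bd = f ≫ h.bd := by
  symm
  refine Deg.bd_eq _ ?_ ?_
  · have := congrArg (fun k => W.Φ.functor.map (k ≫ h.p)) f.comm_a
    simp only [Functor.map_comp] at this
    simp only [comp_f₁, Functor.map_comp, Deg.map_bd_f₁, Preadditive.comp_add, Deg.pre_p,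
      Deg.pre_q, assoc] at this ⊢
    rw [this]
  · simp only [comp_f₀, Deg.bd_f₀, Preadditive.comp_add, Deg.pre_p,
      Deg.pre_q, assoc]
    rw [← assoc, ← assoc, f.comm_b, assoc]
    simp

/-! ### Left orthogonality to factorizations with injective components -/

section Orth

/-- The factorizations without non-trivial morphisms, up to homotopy, to factorizations with
injective components. -/
def Orth (E : Factorization W) : Prop :=
  ∀ (I : Factorization W) (_ : InjComp I) (f : E ⟶ I), IsNull f

variable {E F : Factorization W}

lemma IsNull.of_map_S {f : E ⟶ F} (hf : IsNull ((S W).map f)) : IsNull f := by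
  have h := (hf.map_T.comp_right ((shiftEquiv W).counit.app F)).comp_left
    ((shiftEquiv W).counitInv.app E)
  have key {C : Type _} [Category C] (e : C ≌ C) {X Y : C} (f : X ⟶ Y) :
      e.counitInv.app X ≫ e.functor.map (e.inverse.map f) ≫ e.counit.app Y = f := by simp
  exact Eq.mp (congrArg IsNull (key (shiftEquiv W) f)) h

lemma IsNull.of_map_T {f : E ⟶ F} (hf : IsNull ((T W).map f)) : IsNull f := by
  have h := (hf.map_S.comp_right ((shiftEquiv W).unitInv.app F)).comp_left
    ((shiftEquiv W).unit.app E)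
  have key {C : Type _} [Category C] (e : C ≌ C) {X Y : C} (f : X ⟶ Y) :
      e.unit.app X ≫ e.inverse.map (e.functor.map f) ≫ e.unitInv.app Y = f := by simp
  exact Eq.mp (congrArg IsNull (key (shiftEquiv W) f)) h

lemma Orth.of_iso (hE : Orth E) (e : E ≅ F) : Orth F := fun I hI f => by
  rw [← e.inv_hom_id_assoc f]
  exact (hE I hI _).comp_left _

/-- The inverse shift turns a morphism from `E[1]` into one from `E`, up to isomorphism, and
preserves injectivity of components and null-homotopy in both directions. -/
lemma Orth.T (hE : Orth E) : Orth ((T W).obj E) := fun _ hI f =>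
  (hE.of_iso ((shiftEquiv W).unitIso.app E) _ hI.S ((Factorization.S W).map f)).of_map_S

lemma Orth.S (hE : Orth E) : Orth ((S W).obj E) := fun _ hI f =>
  (hE.of_iso ((shiftEquiv W).counitIso.symm.app E) _ hI.T ((Factorization.T W).map f)).of_map_T

lemma Orth.retract (hF : Orth F) (i : E ⟶ F) (r : F ⟶ E) (h : homotopic W (i ≫ r) (𝟙 E)) :
    Orth E := fun I hI f => by
  rw [homotopic_iff_isNull] at h
  have h' := ((hF I hI (r ≫ f)).comp_left i).sub (h.comp_right f)
  rw [Preadditive.sub_comp, assoc, id_comp, sub_sub_cancel] at h'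
  exact h'

/-- A morphism out of a cone that vanishes on the target factors through the shifted source. -/
noncomputable def coneLift (g : E ⟶ F) {G : Factorization W} (f : Factorization.cone g ⟶ G)
    (hf : coneInr g ≫ f = 0) : (Factorization.T W).obj E ⟶ G :=
  ofT (il₁ g ≫ f.f₁) (il₀ g ≫ f.f₀)
    (by
      have h : ir₀ g ≫ f.f₀ = 0 := congrArg Hom.f₀ hf
      rw [assoc, f.comm_a, il₁_a_assoc, h, comp_zero, add_zero])
    (by
      have h : ir₁ g ≫ f.f₁ = 0 := congrArg Hom.f₁ hf
      rw [assoc, f.comm_b, il₀_b_assoc, ← Functor.map_comp _ (ir₁ g), h, Functor.map_zero,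
        comp_zero, add_zero, ← Functor.map_comp (W.Φ.functor) (il₁ g)])

lemma coneFst_coneLift (g : E ⟶ F) {G : Factorization W} (f : Factorization.cone g ⟶ G)
    (hf : coneInr g ≫ f = 0) : coneFst g ≫ coneLift g f hf = f := by
  have h : ir₀ g ≫ f.f₀ = 0 := congrArg Hom.f₀ hf
  have h' : ir₁ g ≫ f.f₁ = 0 := congrArg Hom.f₁ hf
  ext
  · change cd₁ g (𝟙 E.X₀) 0 ≫ il₁ g ≫ f.f₁ = f.f₁
    refine cone_ext₁ g ?_ ?_
    · simp
    · simp [h']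
  · change cd₀ g (𝟙 (W.Φ.functor.obj E.X₁)) 0 ≫ il₀ g ≫ f.f₀ = f.f₀
    refine cone_ext₀ g ?_ ?_
    · simp
    · simp [h]

lemma Orth.cone (hE : Orth E) (hF : Orth F) (g : E ⟶ F) : Orth (cone g) := fun I hI f => by
  obtain ⟨h, hh⟩ := hF I hI (coneInr g ≫ f)
  -- The null-homotopy on `F` is extended by zero to the summand coming from `E`. Subtracting its
  -- boundary leaves a morphism that vanishes on `F`, hence factors through `E[1]`, which is again
  -- left orthogonal.
  let h' : Deg (Factorization.cone g) I :=
    { p := cd₀ g 0 h.p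
      q := W.Φ.functor.map (cd₁ g 0 (𝟙 F.X₁)) ≫ h.q }
  have hh' : h'.pre (coneInr g) = h := by
    ext
    · exact ir₀_cd₀ _ _ _
    · simp [h']
  have h₀ : coneInr g ≫ (f - h'.bd) = 0 := by
    rw [Preadditive.comp_sub, ← Deg.pre_bd, hh', hh, sub_self]
  have h₁ := (hE.T I hI (coneLift g _ h₀)).comp_left (coneFst g)
  rw [coneFst_coneLift] at h₁
  have := h₁.add ⟨h', rfl⟩
  simpa using this

/-- Null-homotopies on the summands glue. The component `q` starts at `Φ` of a coproduct, which is a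
coproduct because `Φ` is an equivalence. -/
lemma Orth.sigma [HasCoproducts.{v} A] {J : Type v} (F : J → Factorization W)
    (hF : ∀ j, Orth (F j)) : Orth (sigma F) := fun I hI f => by
  let i (j : J) : F j ⟶ Factorization.sigma F :=
    { f₁ := Sigma.ι (fun j => (F j).X₁) j
      f₀ := Sigma.ι (fun j => (F j).X₀) j
      comm_a := by simp [Factorization.sigma]
      comm_b := by simp [Factorization.sigma] }
  choose h hh using fun j => hF j I hI (i j ≫ f)
  let hc₁ := isColimitCofanMkObjOfIsColimit W.Φ.functor _ _
    (coproductIsCoproduct fun j => (F j).X₁)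
  let q : W.Φ.functor.obj (∐ fun j => (F j).X₁) ⟶ I.X₀ := Cofan.IsColimit.desc hc₁ fun j => (h j).q
  have hq (j : J) : W.Φ.functor.map (Sigma.ι (fun j => (F j).X₁) j) ≫ q = (h j).q :=
    Cofan.IsColimit.fac hc₁ _ j
  let k : Deg (Factorization.sigma F) I :=
    { p := Sigma.desc fun j => (h j).p
      q := q }
  have hk (j : J) : k.pre (i j) = h j := by
    ext
    · exact Limits.Sigma.ι_desc _ _
    · exact hq j
  have hk' (j : J) : i j ≫ f = i j ≫ k.bd := by
    rw [← Deg.pre_bd, hk, hh]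
  refine ⟨k, ?_⟩
  ext
  · exact Limits.Sigma.hom_ext _ _ fun j => congrArg Hom.f₁ (hk' j)
  · exact Limits.Sigma.hom_ext _ _ fun j => congrArg Hom.f₀ (hk' j)

/-- Morphisms up to homotopy to a factorization with injective components are inverted by
morphisms whose cone is orthogonal to such factorizations. -/
lemma bijective_of_orth_cone (g : E ⟶ F) (hg : Orth (Factorization.cone g)) {I : Factorization W}
    (hI : InjComp I) :
    Function.Bijective fun u : (toHoCat W).obj F ⟶ (toHoCat W).obj I => (toHoCat W).map g ≫ u := by
  constructor
  · intro u u' huu'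
    obtain ⟨u, rfl⟩ := (toHoCat W).map_surjective u
    obtain ⟨u', rfl⟩ := (toHoCat W).map_surjective u'
    dsimp only at huu'
    rw [← Functor.map_comp, ← Functor.map_comp, toHoCat_map_eq_iff, ← Preadditive.comp_sub] at huu'
    -- A null-homotopy of the composite with `g` extends the difference of the two morphisms to the
    -- cone, where every morphism to `I` is null-homotopic.
    obtain ⟨h, hh⟩ := huu'
    rw [toHoCat_map_eq_iff, ← coneInr_coneDesc g _ h hh]
    exact (hg I hI _).comp_left _
  · intro u
    obtain ⟨u, rfl⟩ := (toHoCat W).map_surjective u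
    -- The obstruction to extending `u` along `g` is the composite of the cone with `u[1]`. A
    -- null-homotopy of it contains the extension `v`, as its restriction to `F`, and a homotopy
    -- between `g ≫ v` and `u`, as its restriction to `E`.
    obtain ⟨h, hh⟩ := hg _ hI.T (coneFst g ≫ (Factorization.T W).map u)
    have h₀ := congrArg Hom.f₀ hh
    have h₁ := congrArg (fun k => W.Φ.functor.map (Hom.f₁ k)) hh
    obtain ⟨p, q⟩ := h
    rw [Deg.map_bd_f₁, comp_f₁, Functor.map_comp] at h₁
    rw [Deg.bd_f₀] at h₀
    change (cone g).X₀ ⟶ I.X₀ at p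
    change W.Φ.functor.obj (cone g).X₁ ⟶ W.Φ.functor.obj I.X₁ at q
    change cd₀ g (𝟙 (W.Φ.functor.obj E.X₁)) 0 ≫ W.Φ.functor.map u.f₁ =
      p ≫ (-I.b) + (cone g).b ≫ q at h₀
    change W.Φ.functor.map (cd₁ g (𝟙 E.X₀) 0) ≫ W.Φ.functor.map u.f₀ =
      W.Φ.functor.map ((cone g).a ≫ p) + q ≫ (-W.Φ.functor.map I.a) at h₁
    -- The relations `a₂`, `b₂` on the summands from `F` say that `v` is a morphism of
    -- factorizations; `a₁`, `b₁` on those from `E` are the homotopy relations.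
    have a₁ := il₀ g ≫= h₀
    have a₂ := ir₀ g ≫= h₀
    have b₁ := W.Φ.functor.map (il₁ g) ≫= h₁
    have b₂ := W.Φ.functor.map (ir₁ g) ≫= h₁
    simp only [il₀_cd₀_assoc, ir₀_cd₀_assoc, map_il₁_cd₁_assoc, map_ir₁_cd₁_assoc, zero_comp,
      Functor.map_zero, Preadditive.comp_add, il₀_b_assoc, ir₀_b_assoc, map_il₁_a_assoc,
      map_ir₁_a_assoc, Preadditive.comp_neg, Functor.map_comp, id_comp,
      CategoryTheory.Functor.map_id] at a₁ a₂ b₁ b₂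
    obtain ⟨v₁, hv₁⟩ : ∃ v₁ : F.X₁ ⟶ I.X₁, W.Φ.functor.map v₁ =
      W.Φ.functor.map (ir₁ g) ≫ q := W.Φ.functor.map_surjective _
    obtain ⟨k, hk⟩ : ∃ k : E.X₀ ⟶ I.X₁, W.Φ.functor.map k =
      W.Φ.functor.map (il₁ g) ≫ q := W.Φ.functor.map_surjective _
    let v : F ⟶ I :=
      { f₁ := v₁
        f₀ := ir₀ g ≫ p
        comm_a := by
          apply W.Φ.functor.map_injective
          rw [Functor.map_comp, hv₁, assoc, Functor.map_comp, Functor.map_comp]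
          rw [← sub_eq_add_neg, eq_comm, sub_eq_zero] at b₂
          exact b₂.symm
        comm_b := by
          rw [hv₁, assoc]
          rw [add_comm, ← sub_eq_add_neg, eq_comm, sub_eq_zero] at a₂
          exact a₂.symm }
    refine ⟨(toHoCat W).map v, ?_⟩
    dsimp only
    rw [← Functor.map_comp, toHoCat_map_eq_iff]
    refine (isNull_iff _).2 ⟨⟨k, il₀ g ≫ p⟩, ?_, ?_⟩
    · rw [sub_f₁, comp_f₁, Functor.map_sub, a₁, Functor.map_comp, Functor.map_comp, hv₁, hk, assoc]
      abel
    · apply W.Φ.functor.map_injective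
      rw [sub_f₀, comp_f₀, Functor.map_sub, b₁, Functor.map_add, Functor.map_comp _ k, hk]
      simp only [Functor.map_comp, assoc, v]
      abel

end Orth

/-! ### Two out of three for co-acyclic factorizations -/

section Coacyclic

variable [HasCoproducts.{v} A] {E F : Factorization W}

lemma IsCoacyclic.of_retract (hF : IsCoacyclic F) (i : E ⟶ F) (r : F ⟶ E) (h : i ≫ r = 𝟙 E) :
    IsCoacyclic E :=
  .retract i r ((homotopic_iff_isNull _ _).2 (by rw [h, sub_self]; exact isNull_zero)) hF

lemma IsCoacyclic.of_iso (hF : IsCoacyclic F) (e : E ≅ F) : IsCoacyclic E :=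
  hF.of_retract e.hom e.inv e.hom_inv_id

lemma IsCoacyclic.of_T (hE : IsCoacyclic ((T W).obj E)) : IsCoacyclic E :=
  hE.unshift.of_iso ((shiftEquiv W).unitIso.app E)

/-- Rotating the triangle, the cone of `cone g → E[1]` is homotopy equivalent to `F[1]`. Only one
half of this is needed: `F[1]` is a retract of that cone, already before passing to homotopy, and
co-acyclic objects are closed under retracts. -/
lemma IsCoacyclic.target_of_cone {g : E ⟶ F} (hg : IsCoacyclic (Factorization.cone g))
    (hE : IsCoacyclic E) : IsCoacyclic F := by
  let c := coneFst g
  -- From here to `e₀'` the cone relations for `c` are restated with the shift of `E` written out,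
  -- so that its signs become visible.
  let j₁ : E.X₀ ⟶ (Factorization.cone c).X₁ := ir₁ c
  let j₀ : W.Φ.functor.obj E.X₁ ⟶ (Factorization.cone c).X₀ := ir₀ c
  let d₁ {Z : A} (x : (Factorization.cone g).X₀ ⟶ Z) (y : E.X₀ ⟶ Z) :
    (Factorization.cone c).X₁ ⟶ Z := cd₁ c x y
  let d₀ {Z : A} (x : W.Φ.functor.obj (Factorization.cone g).X₁ ⟶ Z)
    (y : W.Φ.functor.obj E.X₁ ⟶ Z) : (Factorization.cone c).X₀ ⟶ Z := cd₀ c x y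
  have hi₁ : il₁ c ≫ (Factorization.cone c).a = -((Factorization.cone g).b ≫ il₀ c) +
    cd₀ g (𝟙 (W.Φ.functor.obj E.X₁)) 0 ≫ j₀ := il₁_a c
  have hi₀ : il₀ c ≫ (Factorization.cone c).b =
    -(W.Φ.functor.map (Factorization.cone g).a ≫ W.Φ.functor.map (il₁ c)) +
    W.Φ.functor.map (cd₁ g (𝟙 E.X₀) 0) ≫ W.Φ.functor.map j₁ := il₀_b c
  have hj₁ : j₁ ≫ (Factorization.cone c).a = (-E.b) ≫ j₀ := ir₁_a c
  have hj₀ : j₀ ≫ (Factorization.cone c).b = (-W.Φ.functor.map E.a) ≫ W.Φ.functor.map j₁ :=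
    ir₀_b c
  have e₁ {Z : A} (x : (Factorization.cone g).X₀ ⟶ Z) (y : E.X₀ ⟶ Z) : il₁ c ≫ d₁ x y = x :=
    il₁_cd₁ c x y
  have e₁' {Z : A} (x : (Factorization.cone g).X₀ ⟶ Z) (y : E.X₀ ⟶ Z) : j₁ ≫ d₁ x y = y :=
    ir₁_cd₁ c x y
  have e₀ {Z : A} (x : W.Φ.functor.obj (Factorization.cone g).X₁ ⟶ Z)
    (y : W.Φ.functor.obj E.X₁ ⟶ Z) : il₀ c ≫ d₀ x y = x := il₀_cd₀ c x y
  have e₀' {Z : A} (x : W.Φ.functor.obj (Factorization.cone g).X₁ ⟶ Z)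
    (y : W.Φ.functor.obj E.X₁ ⟶ Z) : j₀ ≫ d₀ x y = y := ir₀_cd₀ c x y
  let i : (T W).obj F ⟶ Factorization.cone c :=
    ofT (ir₀ g ≫ il₁ c) (W.Φ.functor.map (ir₁ g) ≫ il₀ c)
      (by rw [assoc, hi₁]; simp) (by rw [assoc, hi₀]; simp)
  let r : Factorization.cone c ⟶ (T W).obj F :=
    toT (d₁ (cd₀ g 0 (𝟙 F.X₀)) g.f₀)
      (d₀ (W.Φ.functor.map (cd₁ g 0 (𝟙 F.X₁))) (W.Φ.functor.map g.f₁))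
      (by
        refine cone_ext₁ c ?_ ?_
        · rw [← assoc, hi₁, Preadditive.add_comp, Preadditive.neg_comp, assoc, assoc, e₀, e₀',
            Preadditive.comp_neg, ← assoc, e₁]
          exact cone_ext₀ g (by simp) (by simp)
        · change j₁ ≫ _ = j₁ ≫ _
          rw [← assoc, hj₁, assoc, e₀', Preadditive.comp_neg, ← assoc, e₁', g.comm_b,
            Preadditive.neg_comp])
      (by
        refine cone_ext₀ c ?_ ?_
        · rw [Preadditive.comp_neg, ← assoc, ← assoc, hi₀, e₀, Preadditive.add_comp,
            Preadditive.neg_comp, assoc, assoc, ← Functor.map_comp _ (il₁ c), e₁,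
            ← Functor.map_comp _ j₁, e₁']
          exact cone_ext_map₁ g (by simp) (by simp)
        · change j₀ ≫ _ = j₀ ≫ _
          rw [Preadditive.comp_neg, ← assoc, ← assoc, hj₀, e₀', assoc, ← Functor.map_comp _ j₁, e₁',
            Preadditive.neg_comp, neg_neg, ← Functor.map_comp, ← Functor.map_comp, g.comm_a])
  refine IsCoacyclic.of_T ((hg.cone c hE.shift).of_retract i r ?_)
  ext
  · change (ir₀ g ≫ il₁ c) ≫ d₁ _ _ = 𝟙 F.X₀
    rw [assoc, e₁, ir₀_cd₀]
  · change (W.Φ.functor.map (ir₁ g) ≫ il₀ c) ≫ d₀ _ _ = 𝟙 (W.Φ.functor.obj F.X₁)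
    rw [assoc, e₀, map_ir₁_cd₁, CategoryTheory.Functor.map_id]

lemma isIso_toDco_map (g : E ⟶ F) (hg : IsCoacyclic (Factorization.cone g)) :
    IsIso ((toDco W).map g) :=
  (coQis W).Q_inverts ((toHoCat W).map g) ⟨g, rfl, hg⟩

end Coacyclic

end Factorization

namespace Factorization

variable {A : Type u} [Category.{v} A] [Abelian A] {W : Potential A}

/-! ### Adjoints of the component functors -/

section Adjunctions

variable (W) in
/-- The left adjoint of `ev₁`. -/
def free : A ⥤ Factorization W where
  obj X := { X₁ := X, X₀ := X, a := 𝟙 X, b := W.w.app X, a_b := by simp, b_a := by simp }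
  map f := { f₁ := f, f₀ := f, comm_a := by simp, comm_b := w_naturality f }

variable (W) in
/-- The right adjoint of `ev₁`. -/
def cofree : A ⥤ Factorization W where
  obj X :=
    { X₁ := X, X₀ := W.Φ.functor.obj X, a := W.w.app X, b := 𝟙 _, a_b := by simp,
      b_a := by simp [W.w_obj] }
  map f :=
    { f₁ := f
      f₀ := W.Φ.functor.map f
      comm_a := w_naturality f
      comm_b := by simp }

/-- The morphism from a free factorization extending a given morphism. -/
def freeHom {X : A} {E : Factorization W} (f : X ⟶ E.X₁) : (free W).obj X ⟶ E where
  f₁ := f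
  f₀ := f ≫ E.a
  comm_a := (id_comp _).symm
  comm_b := show (f ≫ E.a) ≫ E.b = W.w.app X ≫ W.Φ.functor.map f by
    rw [assoc, E.a_b, w_naturality]

/-- The morphism to a cofree factorization extending a given morphism. -/
def cofreeHom {X : A} {E : Factorization W} (f : E.X₁ ⟶ X) : E ⟶ (cofree W).obj X where
  f₁ := f
  f₀ := E.b ≫ W.Φ.functor.map f
  comm_a := show f ≫ W.w.app X = E.a ≫ E.b ≫ W.Φ.functor.map f by
    rw [← assoc, E.a_b, w_naturality]
  comm_b := comp_id _

variable (W) in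
/-- The adjunction between `free` and `ev₁`. -/
def freeAdj : free W ⊣ ev₁ W :=
  Adjunction.mkOfHomEquiv
    { homEquiv := fun X E =>
        { toFun := fun f => f.f₁
          invFun := fun f => freeHom f
          left_inv := fun f => by
            ext
            · rfl
            · exact f.comm_a.trans (id_comp _)
          right_inv := fun f => rfl }
      homEquiv_naturality_left_symm := fun f g => by
        ext
        · rfl
        · exact assoc _ _ _ }

variable (W) in
/-- The adjunction between `ev₁` and `cofree`. -/
def cofreeAdj : ev₁ W ⊣ cofree W :=
  Adjunction.mkOfHomEquiv
    { homEquiv := fun E X =>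
        { toFun := fun f => cofreeHom f
          invFun := fun f => f.f₁
          left_inv := fun f => rfl
          right_inv := fun f => by
            ext
            · rfl
            · exact f.comm_b.symm.trans (comp_id _) }
      homEquiv_naturality_right := fun {E Y Y'} f g => by
        ext
        · rfl
        · have (f : E.X₁ ⟶ Y) : E.b ≫ W.Φ.functor.map (f ≫ g) =
            (E.b ≫ W.Φ.functor.map f) ≫ W.Φ.functor.map g := by rw [Functor.map_comp, assoc]
          exact this f }

instance : (ev₁ W).IsRightAdjoint := (freeAdj W).isRightAdjoint
instance : (ev₁ W).IsLeftAdjoint := (cofreeAdj W).isLeftAdjoint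
instance : (T W).IsEquivalence := (shiftEquiv W).isEquivalence_functor

/-- The component in degree `0` is the component in degree `-1` of the shift, so it inherits
adjoints on both sides. -/
instance : (ev₀ W).IsRightAdjoint := inferInstanceAs (T W ⋙ ev₁ W).IsRightAdjoint
instance : (ev₀ W).IsLeftAdjoint := inferInstanceAs (T W ⋙ ev₁ W).IsLeftAdjoint

variable {E F : Factorization W} (f : E ⟶ F)

lemma mono_of_components (h₁ : Mono f.f₁) (h₀ : Mono f.f₀) : Mono f where
  right_cancellation g h e := by
    ext
    · exact (cancel_mono f.f₁).1 (congrArg Hom.f₁ e)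
    · exact (cancel_mono f.f₀).1 (congrArg Hom.f₀ e)

lemma epi_of_components (h₁ : Epi f.f₁) (h₀ : Epi f.f₀) : Epi f where
  left_cancellation g h e := by
    ext
    · exact (cancel_epi f.f₁).1 (congrArg Hom.f₁ e)
    · exact (cancel_epi f.f₀).1 (congrArg Hom.f₀ e)

lemma isIso_of_components (h₁ : IsIso f.f₁) (h₀ : IsIso f.f₀) : IsIso f := by
  let e := isoMk (asIso f.f₁) (asIso f.f₀) f.comm_a f.comm_b
  exact inferInstanceAs (IsIso e.hom)

instance : (free W).PreservesMonomorphisms where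
  preserves f _ := mono_of_components _ (inferInstanceAs (Mono f)) (inferInstanceAs (Mono f))

end Adjunctions

/-! ### The abelian category of factorizations -/

section Abelian

variable {E F G : Factorization W}

/-- A kernel fork of factorizations is a limit if its components are. -/
lemma nonempty_isLimit_kernelFork (i : E ⟶ F) (f : F ⟶ G) (w : i ≫ f = 0)
    (l₁ : IsLimit (KernelFork.ofι i.f₁ (congrArg Hom.f₁ w : i.f₁ ≫ f.f₁ = 0)))
    (l₀ : IsLimit (KernelFork.ofι i.f₀ (congrArg Hom.f₀ w : i.f₀ ≫ f.f₀ = 0))) :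
    Nonempty (IsLimit (KernelFork.ofι i w)) := by
  have m₁ : Mono i.f₁ := mono_of_isLimit_fork l₁
  have m₀ : Mono i.f₀ := mono_of_isLimit_fork l₀
  have := mono_of_components i m₁ m₀
  refine ⟨KernelFork.IsLimit.ofι' i w fun {Z} k hk => ?_⟩
  obtain ⟨k₁, h₁⟩ := KernelFork.IsLimit.lift' l₁ k.f₁ (congrArg Hom.f₁ hk)
  obtain ⟨k₀, h₀⟩ := KernelFork.IsLimit.lift' l₀ k.f₀ (congrArg Hom.f₀ hk)
  change k₁ ≫ i.f₁ = k.f₁ at h₁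
  change k₀ ≫ i.f₀ = k.f₀ at h₀
  refine ⟨{ f₁ := k₁, f₀ := k₀, comm_a := ?_, comm_b := ?_ }, ?_⟩
  · rw [← cancel_mono i.f₀, assoc, assoc, ← i.comm_a, h₀, ← assoc, h₁, k.comm_a]
  · rw [← cancel_mono (W.Φ.functor.map i.f₁), assoc, assoc, ← i.comm_b, ← assoc, h₀,
      ← Functor.map_comp, h₁, k.comm_b]
  · ext
    · exact h₁
    · exact h₀

/-- A cokernel cofork of factorizations is a colimit if its components are. -/
lemma nonempty_isColimit_cokernelCofork (f : E ⟶ F) (p : F ⟶ G) (w : f ≫ p = 0)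
    (l₁ : IsColimit (CokernelCofork.ofπ p.f₁ (congrArg Hom.f₁ w : f.f₁ ≫ p.f₁ = 0)))
    (l₀ : IsColimit (CokernelCofork.ofπ p.f₀ (congrArg Hom.f₀ w : f.f₀ ≫ p.f₀ = 0))) :
    Nonempty (IsColimit (CokernelCofork.ofπ p w)) := by
  have m₁ : Epi p.f₁ := epi_of_isColimit_cofork l₁
  have m₀ : Epi p.f₀ := epi_of_isColimit_cofork l₀
  have := epi_of_components p m₁ m₀
  refine ⟨CokernelCofork.IsColimit.ofπ' p w fun {Z} k hk => ?_⟩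
  obtain ⟨k₁, h₁⟩ := CokernelCofork.IsColimit.desc' l₁ k.f₁ (congrArg Hom.f₁ hk)
  obtain ⟨k₀, h₀⟩ := CokernelCofork.IsColimit.desc' l₀ k.f₀ (congrArg Hom.f₀ hk)
  change p.f₁ ≫ k₁ = k.f₁ at h₁
  change p.f₀ ≫ k₀ = k.f₀ at h₀
  refine ⟨{ f₁ := k₁, f₀ := k₀, comm_a := ?_, comm_b := ?_ }, ?_⟩
  · rw [← cancel_epi p.f₁, ← assoc, ← assoc, p.comm_a, h₁, assoc, h₀, k.comm_a]
  · rw [← cancel_epi p.f₀, ← assoc, ← assoc, p.comm_b, h₀, assoc, ← Functor.map_comp, h₁, k.comm_b]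
  · ext
    · exact h₁
    · exact h₀

/-- The kernels of the components carry a structure of factorization: `Φ` preserves kernels, so the
second structure map restricts to them. -/
lemma exists_kernel (f : F ⟶ G) : ∃ (K : Factorization W) (i : K ⟶ F) (w : i ≫ f = 0),
    Nonempty (IsLimit (KernelFork.ofι i.f₁ (congrArg Hom.f₁ w : i.f₁ ≫ f.f₁ = 0))) ∧
    Nonempty (IsLimit (KernelFork.ofι i.f₀ (congrArg Hom.f₀ w : i.f₀ ≫ f.f₀ = 0))) := by
  have hl := KernelFork.mapIsLimit _ (kernelIsKernel f.f₁) W.Φ.functor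
  obtain ⟨b, hb⟩ : ∃ b : kernel f.f₀ ⟶ W.Φ.functor.obj (kernel f.f₁),
      b ≫ W.Φ.functor.map (kernel.ι f.f₁) = kernel.ι f.f₀ ≫ F.b := by
    obtain ⟨b, hb⟩ := KernelFork.IsLimit.lift' hl (kernel.ι f.f₀ ≫ F.b) (by
      rw [assoc, ← f.comm_b, ← assoc, kernel.condition, zero_comp])
    exact ⟨b, hb⟩
  obtain ⟨a, ha⟩ : ∃ a : kernel f.f₁ ⟶ kernel f.f₀, a ≫ kernel.ι f.f₀ = kernel.ι f.f₁ ≫ F.a :=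
    ⟨kernel.lift _ (kernel.ι f.f₁ ≫ F.a)
      (by rw [assoc, ← f.comm_a, ← assoc, kernel.condition, zero_comp]), kernel.lift_ι _ _ _⟩
  let K : Factorization W :=
    { X₁ := kernel f.f₁
      X₀ := kernel f.f₀
      a := a
      b := b
      a_b := by
        rw [← cancel_mono (W.Φ.functor.map (kernel.ι f.f₁)), assoc, hb, ← assoc, ha, assoc, a_b,
          w_naturality]
      b_a := by
        rw [← cancel_mono (W.Φ.functor.map (kernel.ι f.f₀)), assoc, ← Functor.map_comp, ha,
          Functor.map_comp, ← assoc, hb, assoc, b_a, w_naturality] }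
  refine ⟨K, { f₁ := kernel.ι f.f₁, f₀ := kernel.ι f.f₀, comm_a := ha.symm, comm_b := hb.symm },
    ?_, ⟨kernelIsKernel f.f₁⟩, ⟨kernelIsKernel f.f₀⟩⟩
  ext
  · exact kernel.condition _
  · exact kernel.condition _

lemma exists_cokernel (f : E ⟶ F) : ∃ (K : Factorization W) (p : F ⟶ K) (w : f ≫ p = 0),
    Nonempty (IsColimit (CokernelCofork.ofπ p.f₁ (congrArg Hom.f₁ w : f.f₁ ≫ p.f₁ = 0))) ∧
    Nonempty (IsColimit (CokernelCofork.ofπ p.f₀ (congrArg Hom.f₀ w : f.f₀ ≫ p.f₀ = 0))) := by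
  obtain ⟨b, hb⟩ : ∃ b : cokernel f.f₀ ⟶ W.Φ.functor.obj (cokernel f.f₁),
      cokernel.π f.f₀ ≫ b = F.b ≫ W.Φ.functor.map (cokernel.π f.f₁) :=
    ⟨cokernel.desc _ (F.b ≫ W.Φ.functor.map (cokernel.π f.f₁))
      (by rw [← assoc, f.comm_b, assoc, ← Functor.map_comp, cokernel.condition, Functor.map_zero,
        comp_zero]), cokernel.π_desc _ _ _⟩
  obtain ⟨a, ha⟩ : ∃ a : cokernel f.f₁ ⟶ cokernel f.f₀,
      cokernel.π f.f₁ ≫ a = F.a ≫ cokernel.π f.f₀ :=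
    ⟨cokernel.desc _ (F.a ≫ cokernel.π f.f₀)
      (by rw [← assoc, f.comm_a, assoc, cokernel.condition, comp_zero]), cokernel.π_desc _ _ _⟩
  let K : Factorization W :=
    { X₁ := cokernel f.f₁
      X₀ := cokernel f.f₀
      a := a
      b := b
      a_b := by
        rw [← cancel_epi (cokernel.π f.f₁), ← assoc, ha, assoc, hb, ← assoc, a_b, w_naturality]
      b_a := by
        rw [← cancel_epi (cokernel.π f.f₀), ← assoc, hb, assoc, ← Functor.map_comp, ha,
          Functor.map_comp, ← assoc, b_a, w_naturality] }
  refine ⟨K, { f₁ := cokernel.π f.f₁, f₀ := cokernel.π f.f₀, comm_a := ha, comm_b := hb },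
    ?_, ⟨cokernelIsCokernel f.f₁⟩, ⟨cokernelIsCokernel f.f₀⟩⟩
  ext
  · exact cokernel.condition _
  · exact cokernel.condition _

/-- The direct sum of two factorizations. -/
noncomputable def bicone (E F : Factorization W) : BinaryBicone E F where
  pt :=
    { X₁ := E.X₁ ⊞ F.X₁
      X₀ := E.X₀ ⊞ F.X₀
      a := biprod.map E.a F.a
      b := biprod.desc (E.b ≫ W.Φ.functor.map biprod.inl) (F.b ≫ W.Φ.functor.map biprod.inr)
      a_b := by ext <;> simp [w_naturality]
      b_a := by
        ext
        · simp [w_naturality, ← Functor.map_comp]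
          simp
        · simp [w_naturality, ← Functor.map_comp]
          simp }
  fst :=
    { f₁ := biprod.fst
      f₀ := biprod.fst
      comm_a := by simp
      comm_b := by ext <;> simp [← Functor.map_comp] }
  snd :=
    { f₁ := biprod.snd
      f₀ := biprod.snd
      comm_a := by simp
      comm_b := by ext <;> simp [← Functor.map_comp] }
  inl := { f₁ := biprod.inl, f₀ := biprod.inl, comm_a := by simp, comm_b := by simp }
  inr := { f₁ := biprod.inr, f₀ := biprod.inr, comm_a := by simp, comm_b := by simp }
  inl_fst := by ext <;> simp
  inl_snd := by ext <;> simp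
  inr_fst := by ext <;> simp
  inr_snd := by ext <;> simp

instance : HasBinaryBiproducts (Factorization W) where
  has_binary_biproduct E F := HasBinaryBiproduct.mk ⟨bicone E F, isBinaryBilimitOfTotal _ (by
    ext
    · exact biprod.total
    · exact biprod.total)⟩

instance : HasZeroObject (Factorization W) := by
  obtain ⟨Z₀, hZ₀⟩ := HasZeroObject.zero (C := A)
  let Z : Factorization W :=
    { X₁ := Z₀, X₀ := Z₀, a := 0, b := 0, a_b := hZ₀.eq_of_src _ _, b_a := hZ₀.eq_of_src _ _ }
  refine ⟨Z, ?_⟩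
  rw [IsZero.iff_id_eq_zero]
  ext
  · exact hZ₀.eq_of_src _ _
  · exact hZ₀.eq_of_src _ _

instance : HasFiniteProducts (Factorization W) :=
  have : HasBinaryProducts (Factorization W) := inferInstance
  hasFiniteProducts_of_has_binary_and_terminal

/-- The kernel, the cokernel, and the image as kernel of the cokernel are all computed
componentwise, so the comparison of image and coimage is inherited from the base category. -/
lemma nonempty_abelianStruct (f : E ⟶ F) : Nonempty (Abelian.AbelianStruct f) := by
  obtain ⟨K, i, wi, ⟨k₁⟩, ⟨k₀⟩⟩ := exists_kernel f
  obtain ⟨C, p, wp, ⟨c₁⟩, ⟨c₀⟩⟩ := exists_cokernel f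
  obtain ⟨I, j, wj, ⟨j₁⟩, ⟨j₀⟩⟩ := exists_kernel p
  obtain ⟨ck⟩ := nonempty_isLimit_kernelFork i f wi k₁ k₀
  obtain ⟨cp⟩ := nonempty_isColimit_cokernelCofork f p wp c₁ c₀
  obtain ⟨cj⟩ := nonempty_isLimit_kernelFork j p wj j₁ j₀
  obtain ⟨q, hq⟩ := KernelFork.IsLimit.lift' cj f wp
  change q ≫ j = f at hq
  have mj : Mono j := mono_of_isLimit_fork cj
  have wq : i ≫ q = 0 := by rw [← cancel_mono j, assoc, hq, wi, zero_comp]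
  -- In an abelian category the induced map to the kernel of the cokernel is an epimorphism with the
  -- same kernel, hence the cokernel of that kernel.
  have key {X Y Z V U : A} {i : X ⟶ Y} {q : Y ⟶ Z} {j : Z ⟶ V} {p : V ⟶ U} {f : Y ⟶ V}
      (hq : q ≫ j = f) (wp : f ≫ p = 0) (wj : j ≫ p = 0) (wi : i ≫ f = 0) (wq : i ≫ q = 0)
      (k : IsLimit (KernelFork.ofι i wi))
      (c : IsColimit (CokernelCofork.ofπ p wp))
      (l : IsLimit (KernelFork.ofι j wj)) : Nonempty (IsColimit (CokernelCofork.ofπ q wq)) := by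
    have mj : Mono j := mono_of_isLimit_fork l
    have hE : (ShortComplex.mk f p wp).Exact := ShortComplex.exact_of_g_is_cokernel _ c
    have hq' : Epi q := by
      let h : (ShortComplex.mk f p wp).LeftHomologyData :=
        { K := Z, i := j, wi := wj, hi := l
          H := cokernel (l.lift (KernelFork.ofι f wp)), π := cokernel.π _
          wπ := cokernel.condition _, hπ := cokernelIsCokernel _ }
      have hf : h.f' = q := by
        rw [← cancel_mono j, hq]
        exact h.f'_i
      rw [← hf]
      exact hE.epi_f' h
    have mi : Mono i := mono_of_isLimit_fork k
    have k' : IsLimit (KernelFork.ofι i wq) := KernelFork.IsLimit.ofι' i wq fun {Z} x hx =>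
      KernelFork.IsLimit.lift' k x (by rw [← hq, ← assoc, hx, zero_comp])
    exact ⟨Abelian.epiIsCokernelOfKernel _ k'⟩
  obtain ⟨q₁⟩ := key (congrArg Hom.f₁ hq) _ _ _ (congrArg Hom.f₁ wq) k₁ c₁ j₁
  obtain ⟨q₀⟩ := key (congrArg Hom.f₀ hq) _ _ _ (congrArg Hom.f₀ wq) k₀ c₀ j₀
  obtain ⟨cq⟩ := nonempty_isColimit_cokernelCofork i q wq q₁ q₀
  exact ⟨{ kernelFork := KernelFork.ofι i wi
           isLimitKernelFork := ck
           cokernelCofork := CokernelCofork.ofπ p wp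
           isColimitCokernelCofork := cp
           image := I
           imageπ := q
           ι_imageπ := wq
           imageIsCokernel := cq
           imageι := j
           imageι_π := wj
           imageIsKernel := cj
           fac := hq }⟩

noncomputable instance : Abelian (Factorization W) :=
  Abelian.mk' fun _ _ f => nonempty_abelianStruct f

end Abelian

/-! ### Injective factorizations -/

section Injective

variable {E : Factorization W}

/-- The component in degree `-1` has a left adjoint preserving monomorphisms, so it preserves
injectives; the component in degree `0` is handled by shifting. -/
lemma InjComp.of_injective (hE : Injective E) : InjComp E := by
  have h (E : Factorization W) (hE : Injective E) : Injective E.X₁ :=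
    Injective.injective_of_adjoint (freeAdj W) E
  exact ⟨h E hE, h ((Factorization.T W).obj E) (((shiftEquiv W).map_injective_iff E).2 hE)⟩

lemma injective_cofree (J : A) [Injective J] : Injective ((cofree W).obj J) :=
  Injective.injective_of_adjoint (cofreeAdj W) J

/-- The cofree factorization on an injective hull-like embedding of `E^{-1}` receives a map from `E`
that is mono in degree `-1`. The same construction for `E[1]`, shifted back, is mono in degree `0`;
the sum of the two targets works. -/
instance [EnoughInjectives A] : EnoughInjectives (Factorization W) where
  presentation E := by
    have h (E : Factorization W) : ∃ (I : Factorization W) (_ : Injective I) (f : E ⟶ I),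
        Mono f.f₁ := by
      refine ⟨(cofree W).obj (Injective.under E.X₁), injective_cofree _,
        cofreeHom (Injective.ι E.X₁), ?_⟩
      exact inferInstanceAs (Mono (Injective.ι E.X₁))
    obtain ⟨I, hI, f, hf⟩ := h E
    obtain ⟨J, hJ, g, hg⟩ := h ((T W).obj E)
    have hJ' : Injective ((S W).obj J) := ((shiftEquiv W).symm.map_injective_iff J).2 hJ
    let g' : E ⟶ (S W).obj J := (shiftEquiv W).unit.app E ≫ (S W).map g
    have hg' : Mono g'.f₀ := by
      have key {X Y : A} (k : X ⟶ Y) (hk : Mono k) : Mono (𝟙 X ≫ k) := by rwa [id_comp]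
      exact key (X := E.X₀) g.f₁ hg
    refine ⟨{ J := I ⊞ (S W).obj J, f := biprod.lift f g', mono := ?_ }⟩
    refine mono_of_components _ ?_ ?_
    · have : (biprod.lift f g').f₁ ≫ (biprod.fst : I ⊞ (S W).obj J ⟶ _).f₁ = f.f₁ :=
        congrArg Hom.f₁ (biprod.lift_fst f g')
      exact mono_of_mono_fac this
    · have : (biprod.lift f g').f₀ ≫ (biprod.snd : I ⊞ (S W).obj J ⟶ _).f₀ = g'.f₀ :=
        congrArg Hom.f₀ (biprod.lift_snd f g')
      exact mono_of_mono_fac this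

end Injective

end Factorization

section Powers

variable {C : Type u} [Category.{v} C]

instance isEquivalence_natPow (F : C ⥤ C) [F.IsEquivalence] (n : ℕ) : (natPow F n).IsEquivalence :=
    by
  induction n with
  | zero => exact inferInstanceAs (𝟭 C).IsEquivalence
  | succ n ih => exact inferInstanceAs (natPow F n ⋙ F).IsEquivalence

instance isEquivalence_zPow (e : C ≌ C) (n : ℤ) : (zPow e n).IsEquivalence :=
  match n with
  | Int.ofNat n => isEquivalence_natPow e.functor n
  | Int.negSucc n => isEquivalence_natPow e.inverse (n + 1)

end Powers

namespace Factorization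

variable {A : Type u} [Category.{v} A] [Abelian A] {W : Potential A}

/-! ### Exactness is componentwise -/

section Exactness

instance : (ev₁ W).PreservesHomology := by
  have : PreservesFiniteLimits (ev₁ W) := inferInstance
  have : PreservesFiniteColimits (ev₁ W) := inferInstance
  infer_instance

instance : (ev₀ W).PreservesHomology := by
  have : PreservesFiniteLimits (ev₀ W) := inferInstance
  have : PreservesFiniteColimits (ev₀ W) := inferInstance
  infer_instance

lemma isZero_iff (E : Factorization W) : IsZero E ↔ IsZero E.X₁ ∧ IsZero E.X₀ := by
  simp only [IsZero.iff_id_eq_zero]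
  constructor
  · intro h
    exact ⟨congrArg Hom.f₁ h, congrArg Hom.f₀ h⟩
  · rintro ⟨h₁, h₀⟩
    ext
    · exact h₁
    · exact h₀

/-- The component functors commute with homology, and a factorization vanishes when both components
do. -/
lemma exact_iff (S : ShortComplex (Factorization W)) :
    S.Exact ↔ (S.map (ev₁ W)).Exact ∧ (S.map (ev₀ W)).Exact := by
  constructor
  · exact fun h => ⟨h.map _, h.map _⟩
  · rintro ⟨h₁, h₀⟩
    rw [ShortComplex.exact_iff_isZero_homology] at h₁ h₀ ⊢
    rw [isZero_iff]
    exact ⟨h₁.of_iso (S.mapHomologyIso (ev₁ W)).symm, h₀.of_iso (S.mapHomologyIso (ev₀ W)).symm⟩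

lemma acyclic_iff (K : CochainComplex (Factorization W) ℤ) : K.Acyclic ↔
    (((ev₁ W).mapHomologicalComplex (ComplexShape.up ℤ)).obj K).Acyclic ∧
    (((ev₀ W).mapHomologicalComplex (ComplexShape.up ℤ)).obj K).Acyclic := by
  simp only [HomologicalComplex.acyclic_iff, HomologicalComplex.exactAt_iff]
  rw [← forall_and]
  exact forall_congr' fun i => exact_iff (K.sc i)

variable (W) in
/-- The functor `E ↦ (E[q])^0`. -/
def comp (q : ℤ) : Factorization W ⥤ A := shiftBy W q ⋙ ev₀ W

instance (q : ℤ) : (comp W q).Additive := inferInstanceAs (shiftBy W q ⋙ ev₀ W).Additive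
instance (q : ℤ) : PreservesFiniteLimits (comp W q) :=
  have : PreservesFiniteLimits (ev₀ W) := inferInstance
  comp_preservesFiniteLimits (shiftBy W q) (ev₀ W)
instance (q : ℤ) : PreservesFiniteColimits (comp W q) :=
  have : PreservesFiniteColimits (ev₀ W) := inferInstance
  comp_preservesFiniteColimits (shiftBy W q) (ev₀ W)
instance (q : ℤ) : (comp W q).PreservesHomology := inferInstance

end Exactness

end Factorization

/-! ### Sequences of period two -/

section Periodic

/-- A sequence that is periodic in the sense of equivalences `H i ≃ H (i + 2)` is determined by two
consecutive terms. -/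
lemma exists_periodic {H : ℤ → Type*} (e : ∀ i j : ℤ, i + 2 = j → (H i ≃ H j))
    (x₁ : H (-1)) (x₀ : H 0) :
    ∃ x : ∀ i, H i, x (-1) = x₁ ∧ x 0 = x₀ ∧ ∀ i j h, e i j h (x i) = x j := by
  let up : ∀ n : ℕ, H (n : ℤ) := Nat.twoStepInduction x₀ (e (-1) 1 (by lia) x₁)
    fun n x _ => e n (n + 2 : ℕ) (by lia) x
  let dn : ∀ n : ℕ, H (Int.negSucc n) := Nat.twoStepInduction x₁
    ((e (Int.negSucc 1) 0 (by lia)).symm x₀)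
    fun n x _ => (e (Int.negSucc (n + 2)) (Int.negSucc n) (by lia)).symm x
  let x : ∀ i, H i := fun i => match i with
    | Int.ofNat n => up n
    | Int.negSucc n => dn n
  refine ⟨x, rfl, rfl, ?_⟩
  rintro (n | n) j h
  · obtain rfl : j = ((n + 2 : ℕ) : ℤ) := by rw [← h]; simp
    rfl
  · match n with
    | 0 =>
      obtain rfl : j = (1 : ℤ) := by rw [← h]; rfl
      rfl
    | 1 =>
      obtain rfl : j = (0 : ℤ) := by rw [← h]; rfl
      exact (e (Int.negSucc 1) 0 h).apply_symm_apply _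
    | n + 2 =>
      obtain rfl : j = Int.negSucc n := by lia
      exact (e (Int.negSucc (n + 2)) (Int.negSucc n) h).apply_symm_apply _

/-- Only the choices in degrees `-1` and `0` are kept; the others are transported along the
periodicity, which respects `P`. -/
lemma exists_periodic_of_exists {H : ℤ → Type*} (e : ∀ i j : ℤ, i + 2 = j → (H i ≃ H j))
    (P : ∀ i, H i → Prop) (hP : ∀ i j h x, P i x ↔ P j (e i j h x)) (hx : ∀ i, ∃ x, P i x) :
    ∃ x : ∀ i, H i, (∀ i, P i (x i)) ∧ ∀ i j h, e i j h (x i) = x j := by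
  choose y hy using hx
  obtain ⟨x, -, -, hx⟩ := exists_periodic (H := fun i => { x : H i // P i x })
    (fun i j h => (e i j h).subtypeEquiv (hP i j h)) ⟨_, hy (-1)⟩ ⟨_, hy 0⟩
  exact ⟨fun i => (x i).1, fun i => (x i).2, fun i j h => congrArg Subtype.val (hx i j h)⟩

/-- Every integer is reached from `-1` or `0` by steps of length two, in either direction. -/
lemma periodic_induction {P : ℤ → Prop} (h₁ : P (-1)) (h₀ : P 0)
    (h : ∀ i j : ℤ, i + 2 = j → (P i ↔ P j)) (i : ℤ) : P i := by
  obtain ⟨x, -⟩ := exists_periodic (H := fun i => PLift (P i))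
    (fun i j hij => Equiv.plift.trans ((Equiv.ofIff (h i j hij)).trans Equiv.plift.symm)) ⟨h₁⟩ ⟨h₀⟩
  exact (x i).down

end Periodic

/-- An unfolded factorization: a sequence of objects with `X (i + 2) ≅ F (X i)` and morphisms whose
squares are given by `w`. -/
structure Unf {C : Type u} [Category.{v} C] (F : C ⥤ C) (w : 𝟭 C ⟶ F) where
  /-- the objects -/
  X : ℤ → C
  /-- the morphisms -/
  d : ∀ i j : ℤ, i + 1 = j → (X i ⟶ X j)
  /-- the periodicity -/
  π : ∀ i j : ℤ, i + 2 = j → (F.obj (X i) ≅ X j)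
  d_d : ∀ i j k (h : i + 1 = j) (h' : j + 1 = k) (h'' : i + 2 = k),
    d i j h ≫ d j k h' = w.app (X i) ≫ (π i k h'').hom
  π_d : ∀ i j i' j' (h : i + 1 = j) (h' : i' + 1 = j') (hi : i + 2 = i') (hj : j + 2 = j'),
    F.map (d i j h) ≫ (π j j' hj).hom = (π i i' hi).hom ≫ d i' j' h'

/-! ### Morphisms of unfolded factorizations -/

namespace Unf

section

variable {C : Type u} [Category.{v} C] {F : C ⥤ C} {w : 𝟭 C ⟶ F}

/-- Morphisms of unfolded factorizations. -/
@[ext]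
structure Hom (G H : Unf F w) where
  /-- the components -/
  f : ∀ i, G.X i ⟶ H.X i
  comm_d : ∀ i j h, f i ≫ H.d i j h = G.d i j h ≫ f j
  comm_π : ∀ i j h, F.map (f i) ≫ (H.π i j h).hom = (G.π i j h).hom ≫ f j

instance : Category (Unf F w) where
  Hom := Hom
  id G := { f := fun i => 𝟙 _, comm_d := by simp, comm_π := by simp }
  comp f g :=
    { f := fun i => f.f i ≫ g.f i
      comm_d := fun i j h => by rw [assoc, g.comm_d, ← assoc, f.comm_d, assoc]
      comm_π := fun i j h => by
        rw [Functor.map_comp, assoc, g.comm_π, ← assoc, f.comm_π, assoc] }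

@[ext]
lemma hom_ext {G H : Unf F w} {f g : G ⟶ H} (h : ∀ i, f.f i = g.f i) : f = g :=
  Hom.ext (funext h)

@[simp] lemma id_f (G : Unf F w) (i : ℤ) : Hom.f (𝟙 G) i = 𝟙 (G.X i) := rfl
@[simp] lemma comp_f {G H K : Unf F w} (f : G ⟶ H) (g : H ⟶ K) (i : ℤ) :
    (f ≫ g).f i = f.f i ≫ g.f i := rfl

variable [F.Full] [F.Faithful]

/-- The periodicity of morphisms. -/
noncomputable def homEquiv (G H : Unf F w) (i j i' j' : ℤ) (hi : i + 2 = i') (hj : j + 2 = j') :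
    (G.X i ⟶ H.X j) ≃ (G.X i' ⟶ H.X j') :=
  (Functor.FullyFaithful.ofFullyFaithful F).homEquiv.trans
    (Iso.homCongr (G.π i i' hi) (H.π j j' hj))

lemma homEquiv_apply (G H : Unf F w) (i j i' j' : ℤ) (hi : i + 2 = i') (hj : j + 2 = j')
    (f : G.X i ⟶ H.X j) : homEquiv G H i j i' j' hi hj f =
      (G.π i i' hi).inv ≫ F.map f ≫ (H.π j j' hj).hom := by
  simp [homEquiv, Iso.homCongr]

lemma homEquiv_comp (G H K : Unf F w) (i j k i' j' k' : ℤ) (hi : i + 2 = i') (hj : j + 2 = j')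
    (hk : k + 2 = k') (f : G.X i ⟶ H.X j) (g : H.X j ⟶ K.X k) :
    homEquiv G K i k i' k' hi hk (f ≫ g) =
      homEquiv G H i j i' j' hi hj f ≫ homEquiv H K j k j' k' hj hk g := by
  simp [homEquiv_apply]

lemma homEquiv_d (G : Unf F w) (i j i' j' : ℤ) (hi : i + 2 = i') (hj : j + 2 = j')
    (h : i + 1 = j) (h' : i' + 1 = j') :
    homEquiv G G i j i' j' hi hj (G.d i j h) = G.d i' j' h' := by
  rw [homEquiv_apply, G.π_d i j i' j' h h' hi hj, Iso.inv_hom_id_assoc]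

lemma homEquiv_eq_iff (G H : Unf F w) (i j i' j' : ℤ) (hi : i + 2 = i') (hj : j + 2 = j')
    (f : G.X i ⟶ H.X j) (g : G.X i' ⟶ H.X j') : homEquiv G H i j i' j' hi hj f = g ↔
      F.map f ≫ (H.π j j' hj).hom = (G.π i i' hi).hom ≫ g := by
  rw [homEquiv_apply, Iso.inv_comp_eq]

/-- A morphism of unfolded factorizations is determined by two consecutive components. -/
lemma existsUnique_hom (G H : Unf F w) (f₁ : G.X (-1) ⟶ H.X (-1)) (f₀ : G.X 0 ⟶ H.X 0)
    (h₁ : f₁ ≫ H.d (-1) 0 (by lia) = G.d (-1) 0 (by lia) ≫ f₀)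
    (h₀ : f₀ ≫ H.d 0 1 (by lia) =
      G.d 0 1 (by lia) ≫ homEquiv G H (-1) (-1) 1 1 (by lia) (by lia) f₁) :
    ∃! f : G ⟶ H, f.f (-1) = f₁ ∧ f.f 0 = f₀ := by
  obtain ⟨f, hf₁, hf₀, hf⟩ := exists_periodic (H := fun i => G.X i ⟶ H.X i)
    (fun i j h => homEquiv G H i i j j h h) f₁ f₀
  refine ⟨{ f := f, comm_d := ?_, comm_π := fun i j h => ?_ }, ⟨hf₁, hf₀⟩, ?_⟩
  · have : ∀ i, f i ≫ H.d i (i + 1) rfl = G.d i (i + 1) rfl ≫ f (i + 1) := by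
      -- The periodicity of morphisms is injective, multiplicative and fixes the differentials, so
      -- the commutation relation passes from degree `i` to degree `i + 2`.
      refine periodic_induction ?_ ?_ ?_
      · change f (-1) ≫ H.d (-1) 0 _ = G.d (-1) 0 _ ≫ f 0
        rw [hf₁, hf₀, h₁]
      · change f 0 ≫ H.d 0 1 _ = G.d 0 1 _ ≫ f 1
        rw [hf₀, h₀, ← hf (-1) 1 (by lia), hf₁]
      · rintro i _ rfl
        rw [← (homEquiv G H i (i + 1) (i + 2) (i + 2 + 1) rfl (by lia)).injective.eq_iff,
          homEquiv_comp G H H i i (i + 1) (i + 2) (i + 2) (i + 2 + 1) rfl rfl (by lia),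
          homEquiv_comp G G H i (i + 1) (i + 1) (i + 2) (i + 2 + 1) (i + 2 + 1) rfl (by lia)
            (by lia), hf, hf, homEquiv_d _ _ _ _ _ _ _ rfl rfl,
          homEquiv_d _ _ _ _ _ _ _ rfl rfl]
    rintro i _ rfl
    exact this i
  · rw [← homEquiv_eq_iff, hf]
  · rintro g ⟨hg₁, hg₀⟩
    ext i
    change g.f i = f i
    revert i
    refine periodic_induction (hg₁.trans hf₁.symm) (hg₀.trans hf₀.symm) fun i j h => ?_
    rw [← hf i j h, ← (homEquiv_eq_iff _ _ _ _ _ _ h h _ _).2 (g.comm_π i j h)]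
    exact (Equiv.injective _).eq_iff.symm

/-- Isomorphisms of unfolded factorizations from isomorphisms of two consecutive components. -/
lemma exists_iso (G H : Unf F w) (f₁ : G.X (-1) ≅ H.X (-1)) (f₀ : G.X 0 ≅ H.X 0)
    (h₁ : f₁.hom ≫ H.d (-1) 0 (by lia) = G.d (-1) 0 (by lia) ≫ f₀.hom)
    (h₀ : f₀.hom ≫ H.d 0 1 (by lia) =
      G.d 0 1 (by lia) ≫ homEquiv G H (-1) (-1) 1 1 (by lia) (by lia) f₁.hom) :
    ∃ f : G ≅ H, f.hom.f (-1) = f₁.hom ∧ f.hom.f 0 = f₀.hom := by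
  obtain ⟨f, ⟨hf₁, hf₀⟩, -⟩ := existsUnique_hom G H f₁.hom f₀.hom h₁ h₀
  have : ∀ i, IsIso (f.f i) := by
    refine periodic_induction (by rw [hf₁]; infer_instance) (by rw [hf₀]; infer_instance)
      fun i j h => ?_
    have e := f.comm_π i j h
    constructor
    · intro _
      have : IsIso ((G.π i j h).hom ≫ f.f j) := by rw [← e]; infer_instance
      exact IsIso.of_isIso_comp_left (G.π i j h).hom _
    · intro _
      have : IsIso (F.map (f.f i) ≫ (H.π i j h).hom) := by rw [e]; infer_instance
      have : IsIso (F.map (f.f i)) := IsIso.of_isIso_comp_right _ (H.π i j h).hom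
      exact isIso_of_fully_faithful F _
  let g : H ⟶ G :=
    { f := fun i => inv (f.f i)
      comm_d := fun i j h => by
        rw [IsIso.inv_comp_eq, ← assoc, f.comm_d, assoc, IsIso.hom_inv_id, comp_id]
      comm_π := fun i j h => by
        rw [Functor.map_inv, IsIso.inv_comp_eq, ← assoc, f.comm_π, assoc, IsIso.hom_inv_id,
          comp_id] }
  refine ⟨⟨f, g, ?_, ?_⟩, hf₁, hf₀⟩
  · ext i
    exact IsIso.hom_inv_id (f.f i)
  · ext i
    exact IsIso.inv_hom_id (f.f i)

end

end Unf

namespace Factorization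

variable {A : Type u} [Category.{v} A] [Abelian A] {W : Potential A}

/-! ### Unfolding a factorization -/

section Unfold

variable (W) in
/-- The isomorphism `E[j] ≅ E[i][1]`. -/
def τ (i j : ℤ) (h : i + 1 = j) : shiftBy W j ≅ shiftBy W i ⋙ T W :=
  zPowIso (shiftEquiv W) j i h

/-- The component `(E[i])^0 ⟶ (E[j])^{-1}` of the isomorphism `E[i][1] ≅ E[j]`. -/
def t₁ (E : Factorization W) (i j : ℤ) (h : i + 1 = j) :
    ((shiftBy W i).obj E).X₀ ≅ ((shiftBy W j).obj E).X₁ :=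
  (ev₁ W).mapIso ((τ W i j h).symm.app E)

/-- The component `Φ((E[i])^{-1}) ⟶ (E[j])^0` of the isomorphism `E[i][1] ≅ E[j]`. -/
def t₀ (E : Factorization W) (i j : ℤ) (h : i + 1 = j) :
    W.Φ.functor.obj ((shiftBy W i).obj E).X₁ ≅ ((shiftBy W j).obj E).X₀ :=
  (ev₀ W).mapIso ((τ W i j h).symm.app E)

lemma t₁_a (E : Factorization W) (i j : ℤ) (h : i + 1 = j) :
    (E.t₁ i j h).hom ≫ ((shiftBy W j).obj E).a = -(((shiftBy W i).obj E).b ≫ (E.t₀ i j h).hom) := by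
  have := ((τ W i j h).inv.app E).comm_a
  refine this.trans ?_
  change (-(((shiftBy W i).obj E).b)) ≫ (E.t₀ i j h).hom = _
  rw [Preadditive.neg_comp]

lemma t₀_b (E : Factorization W) (i j : ℤ) (h : i + 1 = j) :
    (E.t₀ i j h).hom ≫ ((shiftBy W j).obj E).b =
      -(W.Φ.functor.map (((shiftBy W i).obj E).a ≫ (E.t₁ i j h).hom)) := by
  have := ((τ W i j h).inv.app E).comm_b
  refine this.trans ?_
  change (-(W.Φ.functor.map ((shiftBy W i).obj E).a)) ≫ W.Φ.functor.map (E.t₁ i j h).hom = _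
  rw [Preadditive.neg_comp, Functor.map_comp]

lemma t₁_naturality {E F : Factorization W} (f : E ⟶ F) (i j : ℤ) (h : i + 1 = j) :
    ((shiftBy W i).map f).f₀ ≫ (F.t₁ i j h).hom = (E.t₁ i j h).hom ≫ ((shiftBy W j).map f).f₁ :=
  congrArg Hom.f₁ ((τ W i j h).inv.naturality f)

lemma t₀_naturality {E F : Factorization W} (f : E ⟶ F) (i j : ℤ) (h : i + 1 = j) :
    W.Φ.functor.map ((shiftBy W i).map f).f₁ ≫ (F.t₀ i j h).hom =
      (E.t₀ i j h).hom ≫ ((shiftBy W j).map f).f₀ :=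
  congrArg Hom.f₀ ((τ W i j h).inv.naturality f)

variable (W) in
/-- The morphism `(E[i])^0 ⟶ (E[j])^0` induced by `φ`, for `i + 1 = j`. -/
def compD (i j : ℤ) (h : i + 1 = j) : comp W i ⟶ comp W j where
  app E := i.negOnePow • (((shiftBy W i).obj E).b ≫ (E.t₀ i j h).hom)
  naturality E F f := by
    have e := ((shiftBy W i).map f).comm_b
    have e' := t₀_naturality f i j h
    change ((shiftBy W i).map f).f₀ ≫ (i.negOnePow • (((shiftBy W i).obj F).b ≫ (F.t₀ i j h).hom)) =
      (i.negOnePow • (((shiftBy W i).obj E).b ≫ (E.t₀ i j h).hom)) ≫ ((shiftBy W j).map f).f₀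
    rw [Linear.comp_units_smul, Linear.units_smul_comp, ← assoc, e, assoc, e', assoc]

variable (W) in
/-- The isomorphism `Φ((E[i])^0) ≅ (E[k])^0`, for `i + 2 = k`. -/
def compπ (i k : ℤ) (h : i + 2 = k) : comp W i ⋙ W.Φ.functor ≅ comp W k :=
  NatIso.ofComponents (fun E => W.Φ.functor.mapIso (E.t₁ i (i + 1) rfl) ≪≫
      E.t₀ (i + 1) k (by lia)) fun {E F} f => by
    have e := t₁_naturality f i (i + 1) rfl
    have e' := t₀_naturality f (i + 1) k (by lia)
    change W.Φ.functor.map ((shiftBy W i).map f).f₀ ≫ W.Φ.functor.map (F.t₁ i (i + 1) rfl).hom ≫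
      (F.t₀ (i + 1) k _).hom = (W.Φ.functor.map (E.t₁ i (i + 1) rfl).hom ≫
      (E.t₀ (i + 1) k _).hom) ≫ ((shiftBy W k).map f).f₀
    rw [← Functor.map_comp_assoc, e, Functor.map_comp_assoc, e', assoc]

lemma compD_app (E : Factorization W) (i j : ℤ) (h : i + 1 = j) : (compD W i j h).app E =
    i.negOnePow • (((shiftBy W i).obj E).b ≫ (E.t₀ i j h).hom) := rfl

lemma compπ_app (E : Factorization W) (i j k : ℤ) (h : i + 2 = k) (hj : i + 1 = j) :
    (compπ W i k h).hom.app E =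
    W.Φ.functor.map (E.t₁ i j hj).hom ≫ (E.t₀ j k (by lia)).hom := by
  subst hj
  rfl

/-- Each shift negates the structure maps, so the unsigned composite is `-w`. The factors `(-1)^i`
and `(-1)^{i+1}` of two consecutive maps multiply to `-1` and restore `w`. -/
lemma compD_compD (E : Factorization W) (i j k : ℤ) (h : i + 1 = j) (h' : j + 1 = k)
    (h'' : i + 2 = k) : (compD W i j h).app E ≫ (compD W j k h').app E =
      W.w.app ((comp W i).obj E) ≫ (compπ W i k h'').hom.app E := by
  rw [compπ_app E i j k h'' h, compD_app, compD_app]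
  change _ = W.w.app (((shiftBy W i).obj E).X₀) ≫ _
  have key : ((((shiftBy W i).obj E).b ≫ (E.t₀ i j h).hom) ≫ ((shiftBy W j).obj E).b ≫
      (E.t₀ j k h').hom : ((shiftBy W i).obj E).X₀ ⟶ _) =
      -(W.w.app (((shiftBy W i).obj E).X₀) ≫ W.Φ.functor.map (E.t₁ i j h).hom ≫
      (E.t₀ j k h').hom) := by
    rw [assoc, ← assoc (E.t₀ i j h).hom, t₀_b, Functor.map_comp]
    simp
  have sgn : i.negOnePow * j.negOnePow = -1 := by
    rw [← h, Int.negOnePow_succ, mul_neg, ← Int.negOnePow_add, ← two_mul, Int.negOnePow_two_mul]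
  have := congrArg (fun z => (i.negOnePow * j.negOnePow) • z) key
  simp only [sgn] at this
  refine Eq.trans ?_ (this.trans ?_)
  · refine (Linear.units_smul_comp _ _ _).trans ?_
    refine (congrArg (i.negOnePow • ·) (Linear.comp_units_smul _ _ _)).trans ?_
    rw [smul_smul, sgn]
    rfl
  · rw [Units.neg_smul, one_smul, neg_neg]
    rfl

lemma compπ_compD (E : Factorization W) (i j i' j' : ℤ) (h : i + 1 = j) (h' : i' + 1 = j')
    (hi : i + 2 = i') (hj : j + 2 = j') :
    W.Φ.functor.map ((compD W i j h).app E) ≫ (compπ W j j' hj).hom.app E =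
      (compπ W i i' hi).hom.app E ≫ (compD W i' j' h').app E := by
  rw [compπ_app E i j i' hi h, compπ_app E j i' j' hj (by lia), compD_app, compD_app]
  have sgn : i'.negOnePow = i.negOnePow := by
    rw [← hi, Int.negOnePow_add, Int.negOnePow_even 2 (by decide), mul_one]
  rw [sgn]
  have key : (W.Φ.functor.map (((shiftBy W i).obj E).b ≫ (E.t₀ i j h).hom) ≫
      W.Φ.functor.map (E.t₁ j i' (by lia)).hom ≫ (E.t₀ i' j' h').hom :
      W.Φ.functor.obj ((shiftBy W i).obj E).X₀ ⟶ _) =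
      (W.Φ.functor.map (E.t₁ i j h).hom ≫ (E.t₀ j i' (by lia)).hom) ≫
        ((shiftBy W i').obj E).b ≫ (E.t₀ i' j' h').hom := by
    have e₁ := t₁_a E i j h
    have e₀ := t₀_b E j i' (by lia)
    rw [assoc, ← assoc (E.t₀ j i' (by lia)).hom, e₀, Functor.map_comp W.Φ.functor _
      (E.t₁ j i' _).hom,
      Preadditive.neg_comp, Preadditive.comp_neg, assoc,
      ← Functor.map_comp_assoc W.Φ.functor (E.t₁ i j h).hom, e₁]
    simp
  have := congrArg (fun z => i.negOnePow • z) key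
  refine Eq.trans ?_ (this.trans ?_)
  · refine Eq.trans ?_ (Linear.units_smul_comp _ _ _)
    congr 1
    exact Functor.map_units_smul _ _ _
  · exact (Linear.comp_units_smul _ _ _).symm

variable (W) in
/-- The unfolding of a factorization: the sequence of the `(E[i])^0`. -/
def unf : Factorization W ⥤ Unf W.Φ.functor W.w where
  obj E :=
    { X := fun i => (comp W i).obj E
      d := fun i j h => (compD W i j h).app E
      π := fun i j h => (compπ W i j h).app E
      d_d := fun i j k h h' h'' => compD_compD E i j k h h' h''
      π_d := fun i j i' j' h h' hi hj => compπ_compD E i j i' j' h h' hi hj }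
  map f :=
    { f := fun i => (comp W i).map f
      comm_d := fun i j h => (compD W i j h).naturality f
      comm_π := fun i j h => (compπ W i j h).hom.naturality f }
  map_id E := Unf.hom_ext fun i => (comp W i).map_id E
  map_comp f g := Unf.hom_ext fun i => (comp W i).map_comp f g

lemma unf_d (E : Factorization W) (i j : ℤ) (h : i + 1 = j) :
  ((unf W).obj E).d i j h = (compD W i j h).app E := rfl

/-- The isomorphism `E^{-1} ≅ (E[-1])^0`. -/
def s₁ (E : Factorization W) : E.X₁ ≅ ((shiftBy W (-1)).obj E).X₀ :=
  @Functor.mapIso _ _ _ _ (ev₁ W) E ((T W).obj ((shiftBy W (-1)).obj E))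
    ((τ W (-1) 0 (by lia)).app E)

/-- The component of the unfolding in degree `-1`. -/
def unfX₁ (E : Factorization W) : E.X₁ ≅ ((unf W).obj E).X (-1) := E.s₁

/-- The component of the unfolding in degree `0`. -/
def unfX₀ (E : Factorization W) : E.X₀ ≅ ((unf W).obj E).X 0 :=
  Iso.refl E.X₀

lemma s₁_t₁ (E : Factorization W) {Z : A} (z : E.X₁ ⟶ Z) :
    E.s₁.hom ≫ (E.t₁ (-1) 0 (by lia)).hom ≫ (show ((shiftBy W 0).obj E).X₁ ⟶ Z from z) = z := by
  have e := (τ W (-1) 0 (by lia)).hom_inv_id_app E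
  have e' : E.s₁.hom ≫ (E.t₁ (-1) 0 (by lia)).hom = 𝟙 ((shiftBy W 0).obj E).X₁ :=
    congrArg Hom.f₁ e
  rw [← assoc]
  exact (congrArg (· ≫ (show ((shiftBy W 0).obj E).X₁ ⟶ Z from z)) e').trans (id_comp _)

/-- In degree `-1` the sign `(-1)^i` cancels the sign of the shift, so the unfolding recovers `φ^0`
itself. -/
lemma unfX₁_d (E : Factorization W) :
    E.unfX₁.hom ≫ ((unf W).obj E).d (-1) 0 (by lia) = E.a ≫ E.unfX₀.hom := by
  have e₀ := t₁_a E (-1) 0 (by lia)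
  have key : E.s₁.hom ≫ (-(((shiftBy W (-1)).obj E).b ≫ (E.t₀ (-1) 0 (by lia)).hom)) = E.a := by
    rw [← e₀]
    exact s₁_t₁ E E.a
  refine Eq.trans ?_ (key.trans (comp_id _).symm)
  rw [unf_d, compD_app]
  have : (-1 : ℤ).negOnePow = -1 := by simp
  rw [this, Units.neg_smul, one_smul]
  rfl

/-- In degree `0` there is no sign, and the period from `-1` to `1` identifies `Φ(E^{-1})` with the
component of index `1`. -/
lemma unfX₀_d (E : Factorization W) :
    E.unfX₀.hom ≫ ((unf W).obj E).d 0 1 (by lia) =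
      E.b ≫ W.Φ.functor.map E.unfX₁.hom ≫ (((unf W).obj E).π (-1) 1 (by lia)).hom := by
  have e₂ : (((unf W).obj E).π (-1) 1 (by lia)).hom =
    W.Φ.functor.map (E.t₁ (-1) 0 (by lia)).hom ≫ (E.t₀ 0 1 (by lia)).hom :=
    compπ_app E (-1) 0 1 (by lia) (by lia)
  have key : W.Φ.functor.map E.s₁.hom ≫
      W.Φ.functor.map (E.t₁ (-1) 0 (by lia)).hom ≫ (E.t₀ 0 1 (by lia)).hom =
      (E.t₀ 0 1 (by lia)).hom := by
    rw [← Functor.map_comp_assoc]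
    refine (congrArg (fun z => W.Φ.functor.map z ≫ (E.t₀ 0 1 (by lia)).hom)
      ((congrArg (E.s₁.hom ≫ ·) (comp_id _).symm).trans (s₁_t₁ E (𝟙 _)))).trans ?_
    exact (congrArg (· ≫ (E.t₀ 0 1 (by lia)).hom)
      (W.Φ.functor.map_id ((shiftBy W 0).obj E).X₁)).trans (id_comp _)
  rw [unf_d, compD_app, Int.negOnePow_zero, one_smul, e₂]
  exact (id_comp (E.b ≫ (E.t₀ 0 1 (by lia)).hom)).trans (congrArg (E.b ≫ ·) key.symm)

lemma unf_map_f₁ {E F : Factorization W} (f : E ⟶ F) :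
    E.unfX₁.hom ≫ Unf.Hom.f ((unf W).map f) (-1) = f.f₁ ≫ F.unfX₁.hom := by
  have e := (τ W (-1) 0 (by lia)).hom.naturality f
  have e' : f.f₁ ≫ F.s₁.hom = E.s₁.hom ≫ ((shiftBy W (-1)).map f).f₀ := congrArg Hom.f₁ e
  exact e'.symm

lemma unf_map_f₀ {E F : Factorization W} (f : E ⟶ F) :
    E.unfX₀.hom ≫ Unf.Hom.f ((unf W).map f) 0 = f.f₀ ≫ F.unfX₀.hom :=
  (id_comp f.f₀).trans (comp_id f.f₀).symm

/-- The components of index `-1` and `0` of the unfolded morphism are the two original components,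
up to `unfX₁` and `unfX₀`. -/
instance : (unf W).Faithful where
  map_injective {E F f g} h := by
    have h' (i : ℤ) : Unf.Hom.f ((unf W).map f) i = Unf.Hom.f ((unf W).map g) i := by rw [h]
    ext
    · rw [← cancel_mono F.unfX₁.hom, ← unf_map_f₁, ← unf_map_f₁, h']
    · rw [← cancel_mono F.unfX₀.hom, ← unf_map_f₀, ← unf_map_f₀, h']

/-- The relations at indices `-1` and `0` say that the corresponding two components form a morphism
of factorizations, and the remaining components are determined by these two. -/
instance : (unf W).Full where
  map_surjective {E F} g := by
    let f : E ⟶ F :=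
      { f₁ := E.unfX₁.hom ≫ Unf.Hom.f g (-1) ≫ F.unfX₁.inv
        f₀ := E.unfX₀.hom ≫ Unf.Hom.f g 0 ≫ F.unfX₀.inv
        comm_a := by
          rw [← cancel_mono F.unfX₀.hom]
          simp only [assoc, Iso.inv_hom_id, comp_id]
          rw [← unfX₁_d, Iso.inv_hom_id_assoc, g.comm_d, ← assoc, unfX₁_d, assoc]
        comm_b := by
          rw [← cancel_mono (W.Φ.functor.map F.unfX₁.hom ≫ (((unf W).obj F).π (-1) 1 (by lia)).hom)]
          simp only [assoc]
          rw [← unfX₀_d, Iso.inv_hom_id_assoc, g.comm_d, ← assoc, unfX₀_d]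
          simp only [assoc]
          rw [← g.comm_π (-1) 1 (by lia)]
          simp only [← assoc, ← Functor.map_comp]
          simp }
    refine ⟨f, ?_⟩
    have h₁ : E.unfX₁.hom ≫ Unf.Hom.f ((unf W).map f) (-1) = E.unfX₁.hom ≫ Unf.Hom.f g (-1) := by
      rw [unf_map_f₁]
      simp [f]
    have h₀ : E.unfX₀.hom ≫ Unf.Hom.f ((unf W).map f) 0 = E.unfX₀.hom ≫ Unf.Hom.f g 0 := by
      rw [unf_map_f₀]
      simp [f]
    rw [cancel_epi] at h₁ h₀
    obtain ⟨_, _, hu⟩ := Unf.existsUnique_hom ((unf W).obj E) ((unf W).obj F)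
      (Unf.Hom.f g (-1)) (Unf.Hom.f g 0) (g.comm_d _ _ _) (by
        rw [g.comm_d]
        congr 1
        symm
        rw [Unf.homEquiv_eq_iff, g.comm_π])
    exact (hu _ ⟨h₁, h₀⟩).trans (hu _ ⟨rfl, rfl⟩).symm

end Unfold

end Factorization

/-- A double complex of abelian groups: `R n p` is the part of total degree `n` in row degree `p`.
-/
structure Bicomplex where
  /-- the groups -/
  R : ℤ → ℤ → Type w₁
  /-- the group structure -/
  grp : ∀ n p, AddCommGroup (R n p)
  /-- the differential that preserves the row degree -/
  d₁ : ∀ n n' p, n + 1 = n' → (R n p →+ R n' p)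
  /-- the differential that raises the row degree -/
  d₂ : ∀ n n' p p', n + 1 = n' → p + 1 = p' → (R n p →+ R n' p')
  d₁_d₁ : ∀ n n' n'' p h h' x, d₁ n' n'' p h' (d₁ n n' p h x) = 0
  d₂_d₂ : ∀ n n' n'' p p' p'' h h' k k' x, d₂ n' n'' p' p'' h' k' (d₂ n n' p p' h k x) = 0
  d₁_d₂ : ∀ n n' n'' p p' h h' k x, d₁ n' n'' p' h' (d₂ n n' p p' h k x) +
    d₂ n' n'' p p' h' k (d₁ n n' p h x) = 0

attribute [instance] Bicomplex.grp

/-! ### Bounded double complexes and quasi-isomorphisms on rows -/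

namespace Bicomplex

variable (S : Bicomplex.{w₁})

/-- Closed elements of the total complex. -/
def Closed {n : ℤ} (z : ∀ p, S.R n p) : Prop :=
  ∀ n' p p' h k, S.d₁ n n' p' h (z p') + S.d₂ n n' p p' h k (z p) = 0

/-- The relation `z = D y` in the total complex. -/
def Bounds {n n' : ℤ} (h : n + 1 = n') (y : ∀ p, S.R n p) (z : ∀ p, S.R n' p) : Prop :=
  ∀ p p' k, S.d₁ n n' p' h (y p') + S.d₂ n n' p p' h k (y p) = z p'

variable {S}

lemma Bounds.add {n n' : ℤ} {h : n + 1 = n'} {y y' : ∀ p, S.R n p} {z z' : ∀ p, S.R n' p}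
    (hy : S.Bounds h y z) (hy' : S.Bounds h y' z') :
    S.Bounds h (fun p => y p + y' p) (fun p => z p + z' p) := by
  intro p p' k
  dsimp only
  rw [map_add, map_add, ← hy p p' k, ← hy' p p' k]
  abel

lemma Bounds.closed {n n' : ℤ} {h : n + 1 = n'} {y : ∀ p, S.R n p} {z : ∀ p, S.R n' p}
    (hy : S.Bounds h y z) : S.Closed z := by
  intro n'' p p' h' k
  rw [← hy p p' k, ← hy (p - 1) p (by lia), map_add, map_add, S.d₁_d₁, S.d₂_d₂, zero_add, add_zero,
    S.d₁_d₂]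

lemma Closed.sub {n : ℤ} {z z' : ∀ p, S.R n p} (hz : S.Closed z) (hz' : S.Closed z') :
    S.Closed fun p => z p - z' p := by
  intro n' p p' h k
  have e := hz n' p p' h k
  have e' := hz' n' p p' h k
  dsimp only
  rw [map_sub, map_sub]
  calc _ = S.d₁ n n' p' h (z p') + S.d₂ n n' p p' h k (z p) -
      (S.d₁ n n' p' h (z' p') + S.d₂ n n' p p' h k (z' p)) := by abel
    _ = 0 := by rw [e, e', sub_zero]

/-- The total complex of a bounded double complex with exact rows is exact. -/
lemma exists_bounds_of_exact (a b : ℤ) (ha : ∀ n p, p < a → Subsingleton (S.R n p))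
    (hb : ∀ n p, b < p → Subsingleton (S.R n p))
    (hS : ∀ n n' p p' h k (x : S.R n' p'), (∀ n'' p'' h' k', S.d₂ n' n'' p' p'' h' k' x = 0) →
      ∃ y, S.d₂ n n' p p' h k y = x)
    {n n' : ℤ} (h : n + 1 = n') (z : ∀ p, S.R n' p) (hz : S.Closed z) :
    ∃ y, S.Bounds h y z := by
  -- Induction on an upper bound `a + m` for the support of `z`, starting from the bound `b + 1`
  -- given by boundedness.
  suffices H : ∀ (m : ℕ) (z : ∀ p, S.R n' p), S.Closed z → (∀ p, a + m ≤ p → z p = 0) →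
      ∃ y, S.Bounds h y z by
    refine H (b + 1 - a).toNat z hz fun p hp => ?_
    have := hb n' p (by lia)
    exact Subsingleton.elim _ _
  intro m
  induction m with
  | zero =>
    intro z _ hz
    obtain rfl : z = fun _ => 0 := by
      ext p
      rcases lt_or_ge p a with hp | hp
      · have := ha n' p hp
        exact Subsingleton.elim _ _
      · exact hz p (by simpa using hp)
    exact ⟨fun _ => 0, fun p p' k => by simp⟩
  | succ m ih =>
    intro z hz hz'
    -- The top component of `z` is closed for `d₂`, because the next component of `z` vanishes. It
    -- is therefore `d₂ x`; subtracting the total boundary of `x` kills it and changes only the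
    -- component below.
    obtain ⟨x, hx⟩ := hS n n' (a + m - 1) (a + m) h (by lia) (z (a + m)) fun n'' p'' h' k' => by
      have := hz n'' (a + m) p'' h' k'
      rwa [hz' p'' (by lia), map_zero, zero_add] at this
    have hD : S.Bounds h (Pi.single (a + m - 1) x) (fun p => S.d₁ n n' p h
      (Pi.single (a + m - 1) x p) +
        S.d₂ n n' (p - 1) p h (by lia) (Pi.single (a + m - 1) x (p - 1))) := by
      intro p p' k
      obtain rfl : p = p' - 1 := by lia
      rfl
    obtain ⟨y, hy⟩ := ih _ (hz.sub hD.closed) fun p hp => by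
      rw [Pi.single_eq_of_ne (by lia), map_zero, zero_add]
      rcases eq_or_lt_of_le hp with rfl | hp
      · rw [Pi.single_eq_same, hx, sub_self]
      · rw [Pi.single_eq_of_ne (by lia), map_zero, sub_zero, hz' p (by push_cast; lia)]
    refine ⟨_, (congrArg (S.Bounds h _) ?_).mp (hy.add hD)⟩
    ext p
    exact sub_add_cancel _ _

variable (S) in
/-- Morphisms of double complexes. -/
structure Hom (S' : Bicomplex.{w₂}) where
  /-- the components -/
  f : ∀ n p, S.R n p →+ S'.R n p
  comm₁ : ∀ n n' p h x, f n' p (S.d₁ n n' p h x) = S'.d₁ n n' p h (f n p x)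
  comm₂ : ∀ n n' p p' h k x, f n' p' (S.d₂ n n' p p' h k x) = S'.d₂ n n' p p' h k (f n p x)

variable {S' : Bicomplex.{w₂}}

/-- The mapping cone. -/
def Hom.cone (l : S.Hom S') : Bicomplex where
  R n p := S.R (n + 1) (p + 1) × S'.R n p
  grp n p := inferInstance
  d₁ n n' p h := AddMonoidHom.mk' (fun x => (-S.d₁ (n + 1) (n' + 1) (p + 1) (by lia) x.1,
    S'.d₁ n n' p h x.2)) fun x y => by
      ext
      · dsimp
        rw [map_add]
        abel
      · exact map_add _ _ _
  d₂ n n' p p' h k := AddMonoidHom.mk' (fun x => (-S.d₂ (n + 1) (n' + 1) (p + 1) (p' + 1)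
    (by lia) (by lia) x.1, (by subst h k; exact l.f _ _ x.1) + S'.d₂ n n' p p' h k x.2)) fun x y =>
      by
      subst h k
      ext
      · dsimp
        rw [map_add]
        abel
      · dsimp
        rw [map_add, map_add]
        abel
  d₁_d₁ n n' n'' p h h' x := by
    ext
    · change -S.d₁ _ _ _ _ (-S.d₁ _ _ _ _ x.1) = 0
      rw [map_neg, S.d₁_d₁, neg_zero, neg_zero]
    · exact S'.d₁_d₁ _ _ _ _ _ _ _
  d₂_d₂ n n' n'' p p' p'' h h' k k' x := by
    subst h h' k k'
    ext
    · change -S.d₂ _ _ _ _ _ _ (-S.d₂ _ _ _ _ _ _ x.1) = 0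
      rw [map_neg, S.d₂_d₂, neg_zero, neg_zero]
    · change l.f _ _ (-S.d₂ _ _ _ _ _ _ x.1) + S'.d₂ _ _ _ _ _ _ (l.f _ _ x.1 +
        S'.d₂ _ _ _ _ _ _ x.2) = 0
      rw [map_neg, map_add, S'.d₂_d₂, l.comm₂, add_zero, neg_add_cancel]
  d₁_d₂ n n' n'' p p' h h' k x := by
    subst h h' k
    ext
    · change -S.d₁ _ _ _ _ (-S.d₂ _ _ _ _ _ _ x.1) + -S.d₂ _ _ _ _ _ _ (-S.d₁ _ _ _ _ x.1) = 0
      rw [map_neg, map_neg, neg_neg, neg_neg, S.d₁_d₂]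
    · change S'.d₁ _ _ _ _ (l.f _ _ x.1 + S'.d₂ _ _ _ _ _ _ x.2) +
        (l.f _ _ (-S.d₁ _ _ _ _ x.1) + S'.d₂ _ _ _ _ _ _ (S'.d₁ _ _ _ _ x.2)) = 0
      have := S'.d₁_d₂ n (n + 1) (n + 1 + 1) p (p + 1) rfl rfl rfl x.2
      rw [map_neg, map_add, l.comm₁, ← this]
      abel

variable (S S') in
/-- The two double complexes live in finitely many row degrees. -/
def Bounded : Prop := ∃ a b : ℤ, ∀ n p, (p < a ∨ b < p) →
  Subsingleton (S.R n p) ∧ Subsingleton (S'.R n p)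

/-- A morphism of bounded double complexes which is bijective on the cohomology of the rows. -/
structure Hom.RowQuasiIso (l : S.Hom S') : Prop where
  bounded : Bounded S S'
  inj : ∀ n n' p p' h k (x : S.R n' p') (y : S'.R n p),
    (∀ n'' p'' h' k', S.d₂ n' n'' p' p'' h' k' x = 0) →
    l.f _ _ x = S'.d₂ n n' p p' h k y → ∃ x', S.d₂ n n' p p' h k x' = x
  surj : ∀ n n' p p' h k (y : S'.R n' p'), (∀ n'' p'' h' k', S'.d₂ n' n'' p' p'' h' k' y = 0) →
    ∃ x y', (∀ n'' p'' h' k', S.d₂ n' n'' p' p'' h' k' x = 0) ∧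
      y = l.f _ _ x + S'.d₂ n n' p p' h k y'

namespace Hom.RowQuasiIso

variable {l : S.Hom S'} 

/-- The rows of the cone are exact because `l` is a quasi-isomorphism on rows, so the total complex
of the cone is exact as well. -/
lemma cone_exact (hl : l.RowQuasiIso) {n n' : ℤ} (h : n + 1 = n') (z : ∀ p, l.cone.R n' p)
    (hz : l.cone.Closed z) :
    ∃ y, l.cone.Bounds h y z := by
  obtain ⟨a, b, hab⟩ := hl.bounded
  -- The source enters the cone in row degree `p + 1`, which moves the lower bound down by one.
  refine exists_bounds_of_exact (a - 1) b (fun n p hp => ?_) (fun n p hp => ?_) ?_ h z hz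
  · have := (hab (n + 1) (p + 1) (Or.inl (by lia))).1
    have := (hab n p (Or.inl (by lia))).2
    exact inferInstanceAs (Subsingleton (S.R (n + 1) (p + 1) × S'.R n p))
  · have := (hab (n + 1) (p + 1) (Or.inr (by lia))).1
    have := (hab n p (Or.inr (by lia))).2
    exact inferInstanceAs (Subsingleton (S.R (n + 1) (p + 1) × S'.R n p))
  · rintro n _ p _ rfl rfl ⟨x, y⟩ hxy
    have hx : ∀ n'' p'' h' k', S.d₂ (n + 1 + 1) n'' (p + 1 + 1) p'' h' k' x = 0 := by
      rintro _ _ rfl rfl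
      have := congrArg Prod.fst (hxy _ _ rfl rfl)
      exact neg_eq_zero.1 this
    have hy : l.f _ _ x + S'.d₂ _ _ _ _ rfl rfl y = 0 := congrArg Prod.snd (hxy _ _ rfl rfl)
    -- Closedness of `(x, y)` means that `x` is closed and `l x` is the boundary of `-y`.
    -- Injectivity on row cohomology writes `x` as the boundary of `x'`; then `y + l x'` is closed,
    -- and surjectivity corrects it.
    obtain ⟨x', hx'⟩ := hl.inj (n + 1) _ (p + 1) _ rfl rfl x (-y) hx
      (by rw [map_neg]; exact eq_neg_of_add_eq_zero_left hy)
    obtain ⟨x'', y'', hx'', hy''⟩ := hl.surj n _ p _ rfl rfl (y + l.f _ _ x') (by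
      rintro _ _ rfl rfl
      rw [map_add, ← l.comm₂, hx']
      exact (add_comm _ _).trans hy)
    refine ⟨(x'' - x', y''), Prod.ext ?_ ?_⟩
    · change -S.d₂ _ _ _ _ _ _ (x'' - x') = x
      rw [map_sub, hx'' _ _ _ rfl, hx', zero_sub, neg_neg]
    · change l.f _ _ (x'' - x') + S'.d₂ _ _ _ _ _ _ y'' = y
      rw [map_sub, ← add_left_inj (l.f _ _ x'), hy'']
      abel

lemma exists_shift {Q : ℤ → Type*} (x : ∀ p, Q (p + 1)) : ∃ y : ∀ p, Q p, ∀ p, y (p + 1) = x p :=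
  ⟨Equiv.piCongrLeft Q (Equiv.addRight (1 : ℤ)) x, fun p =>
    Equiv.piCongrLeft_apply_apply Q (Equiv.addRight (1 : ℤ)) x p⟩

/-- Exactness of the cone is applied to `(0, y)`: the first components of a bounding element form a
closed lift of `y`, the second ones the correcting cochain. -/
lemma surjective (hl : l.RowQuasiIso) {n n' : ℤ} (h : n + 1 = n') (y : ∀ p, S'.R n' p)
    (hy : S'.Closed y) :
    ∃ (x : ∀ p, S.R n' p) (y' : ∀ p, S'.R n p), S.Closed x ∧
      S'.Bounds h y' (fun p => y p - l.f _ _ (x p)) := by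
  subst h
  obtain ⟨z, hz⟩ := hl.cone_exact (n := n) rfl (fun p => ((0 : S.R (n + 1 + 1) (p + 1)), y p)) (by
    rintro _ p _ rfl rfl
    refine Prod.ext ?_ ?_
    · change -S.d₁ _ _ _ _ 0 + -S.d₂ _ _ _ _ _ _ 0 = 0
      simp
    · change S'.d₁ _ _ _ _ (y (p + 1)) + (l.f _ _ 0 + S'.d₂ _ _ _ _ _ _ (y p)) = 0
      rw [map_zero, zero_add]
      exact hy _ _ _ rfl rfl)
  obtain ⟨x, hx⟩ := exists_shift (Q := fun p => S.R (n + 1) p) (fun p => (z p).1)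
  refine ⟨x, fun p => (z p).2, ?_, ?_⟩
  · rintro _ p _ rfl rfl
    obtain ⟨q, rfl⟩ : ∃ q, p = q + 1 := ⟨p - 1, by lia⟩
    rw [hx, hx]
    have : -S.d₁ _ _ _ _ (z (q + 1)).1 + -S.d₂ _ _ _ _ _ _ (z q).1 = 0 :=
      congrArg Prod.fst (hz q _ rfl)
    rw [← neg_add, neg_eq_zero] at this
    exact this
  · rintro p _ rfl
    have : S'.d₁ _ _ _ _ (z (p + 1)).2 + (l.f _ _ (z p).1 + S'.d₂ _ _ _ _ _ _ (z p).2) =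
      y (p + 1) := congrArg Prod.snd (hz p _ rfl)
    change S'.d₁ _ _ _ _ (z (p + 1)).2 + S'.d₂ _ _ _ _ _ _ (z p).2 = y (p + 1) - l.f _ _ (x (p + 1))
    rw [← this, hx]
    abel

/-- If `y` bounds the image of `x`, then `(x, -y)` is closed in the cone, and the first components
of a bounding element bound `x` up to sign. -/
lemma injective (hl : l.RowQuasiIso) {n n' : ℤ} (h : n + 1 = n') (x : ∀ p, S.R n' p)
    (hx : S.Closed x)
    (y : ∀ p, S'.R n p) (hy : S'.Bounds h y (fun p => l.f _ _ (x p))) :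
    ∃ x', S.Bounds h x' x := by
  subst h
  obtain ⟨m, rfl⟩ : ∃ m, n = m + 1 := ⟨n - 1, by lia⟩
  obtain ⟨z, hz⟩ := hl.cone_exact (n := m) rfl (fun p => (x (p + 1), -y p)) (by
    rintro _ p _ rfl rfl
    refine Prod.ext ?_ ?_
    · change -S.d₁ _ _ _ _ (x (p + 1 + 1)) + -S.d₂ _ _ _ _ _ _ (x (p + 1)) = 0
      rw [← neg_add, neg_eq_zero]
      exact hx _ _ _ rfl rfl
    · change S'.d₁ _ _ _ _ (-y (p + 1)) + (l.f _ _ (x (p + 1)) + S'.d₂ _ _ _ _ _ _ (-y p)) = 0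
      have e : S'.d₁ _ _ _ _ (y (p + 1)) + S'.d₂ _ _ _ _ _ _ (y p) = l.f _ _ (x (p + 1)) :=
        hy p _ rfl
      rw [← e, map_neg, map_neg]
      abel)
  obtain ⟨x', hx'⟩ := exists_shift (Q := fun p => S.R (m + 1) p) (fun p => -(z p).1)
  refine ⟨x', ?_⟩
  rintro p _ rfl
  obtain ⟨q, rfl⟩ : ∃ q, p = q + 1 := ⟨p - 1, by lia⟩
  rw [hx', hx', map_neg, map_neg]
  exact congrArg Prod.fst (hz q _ rfl)

end Hom.RowQuasiIso

end Bicomplex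

end FactCat

namespace FactCat

open CochainComplex HomComplex

/-! ### Periodic families of cochains -/

section

variable {A : Type u} [Category.{v} A] [Abelian A] {F : A ⥤ A} [F.Additive]

/-- Families of elements of an abelian group that are indexed by the proofs of a proposition. -/
instance addCommGroupProp {P : Prop} {X : P → Type w₁} [∀ h, AddCommGroup (X h)] :
    AddCommGroup (∀ h, X h) :=
  letI : Zero (∀ h, X h) := ⟨fun _ => 0⟩
  letI : Add (∀ h, X h) := ⟨fun x y h => x h + y h⟩
  letI : Neg (∀ h, X h) := ⟨fun x h => -x h⟩
  { AddGroup.ofLeftAxioms (G := ∀ h, X h)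
      (fun x y z => funext fun h => add_assoc (x h) (y h) (z h))
      (fun x => funext fun h => zero_add (x h))
      (fun x => funext fun h => neg_add_cancel (x h)) with
    sub := fun x y h => x h - y h
    sub_eq_add_neg := fun x y => funext fun h => sub_eq_add_neg (x h) (y h)
    add_comm := fun x y => funext fun h => add_comm (x h) (y h) }

/-- The extension of a natural transformation `w : Id ⟶ F` to complexes. -/
def complexW (w : 𝟭 A ⟶ F) :
    𝟭 (CochainComplex A ℤ) ⟶ F.mapHomologicalComplex (ComplexShape.up ℤ) where
  app K :=
    { f := fun k => w.app (K.X k)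
      comm' := fun i j _ => (w.naturality (K.d i j)).symm }
  naturality K L f := by
    ext k
    exact w.naturality (f.f k)

/-- Unfolded factorizations in the category of complexes. -/
abbrev UnfC (w : 𝟭 A ⟶ F) := Unf (F.mapHomologicalComplex (ComplexShape.up ℤ)) (complexW w)

variable {w : 𝟭 A ⟶ F}

namespace UnfC

section

variable {M N : UnfC w}

/-- The periodicity relation between cochains. -/
def PerRel {q q' r r' p : ℤ} (h : q + 2 = r) (h' : q' + 2 = r')
    (z : Cochain (M.X q) (N.X q') p) (z' : Cochain (M.X r) (N.X r') p) : Prop :=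
  (z.map F).comp (Cochain.ofHom (N.π q' r' h').hom) (add_zero p) =
    (Cochain.ofHom (M.π q r h).hom).comp z' (zero_add p)

variable {q q' r r' p : ℤ} {h : q + 2 = r} {h' : q' + 2 = r'}

lemma PerRel.zero : PerRel (M := M) (N := N) (p := p) h h' 0 0 := by
  simp [PerRel]

lemma PerRel.add {z₁ z₂ : Cochain (M.X q) (N.X q') p} {z₁' z₂' : Cochain (M.X r) (N.X r') p}
    (h₁ : PerRel h h' z₁ z₁') (h₂ : PerRel h h' z₂ z₂') : PerRel h h' (z₁ + z₂) (z₁' + z₂') := by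
  unfold PerRel at *
  rw [Cochain.map_add, Cochain.add_comp, Cochain.comp_add, h₁, h₂]

lemma PerRel.neg {z₁ : Cochain (M.X q) (N.X q') p} {z₁' : Cochain (M.X r) (N.X r') p}
    (h₁ : PerRel h h' z₁ z₁') : PerRel h h' (-z₁) (-z₁') := by
  unfold PerRel at *
  rw [Cochain.map_neg, Cochain.neg_comp, Cochain.comp_neg, h₁]

lemma PerRel.sub {z₁ z₂ : Cochain (M.X q) (N.X q') p} {z₁' z₂' : Cochain (M.X r) (N.X r') p}
    (h₁ : PerRel h h' z₁ z₁') (h₂ : PerRel h h' z₂ z₂') : PerRel h h' (z₁ - z₂) (z₁' - z₂') := by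
  rw [sub_eq_add_neg, sub_eq_add_neg]
  exact h₁.add h₂.neg

lemma PerRel.smul {z₁ : Cochain (M.X q) (N.X q') p} {z₁' : Cochain (M.X r) (N.X r') p}
    (h₁ : PerRel h h' z₁ z₁') (e e' : ℤˣ) (he : e = e') : PerRel h h' (e • z₁) (e' • z₁') := by
  subst he
  obtain rfl | rfl := Int.units_eq_one_or e
  · simpa using h₁
  · simpa using h₁.neg

lemma PerRel.delta {z₁ : Cochain (M.X q) (N.X q') p} {z₁' : Cochain (M.X r) (N.X r') p}
    (h₁ : PerRel h h' z₁ z₁') (p' : ℤ) : PerRel h h' (δ p p' z₁) (δ p p' z₁') := by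
  unfold PerRel at *
  rw [← δ_map, ← δ_comp_ofHom, h₁, δ_ofHom_comp]

lemma PerRel.comp_d {z₁ : Cochain (M.X q) (N.X q') p} {z₁' : Cochain (M.X r) (N.X r') p}
    (h₁ : PerRel h h' z₁ z₁') (k k' : ℤ) (hk : k + 2 = k') (e : q' + 1 = k) (e' : r' + 1 = k') :
    PerRel h hk (z₁.comp (Cochain.ofHom (N.d q' k e)) (add_zero p))
      (z₁'.comp (Cochain.ofHom (N.d r' k' e')) (add_zero p)) := by
  unfold PerRel at *
  rw [Cochain.map_comp, Cochain.map_ofHom, Cochain.comp_assoc_of_third_is_zero_cochain,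
    ← Cochain.ofHom_comp, N.π_d q' k r' k' e e' h' hk, Cochain.ofHom_comp,
    ← Cochain.comp_assoc_of_third_is_zero_cochain, h₁, Cochain.comp_assoc_of_first_is_zero_cochain]

lemma PerRel.d_comp {z₁ : Cochain (M.X q) (N.X q') p} {z₁' : Cochain (M.X r) (N.X r') p}
    (h₁ : PerRel h h' z₁ z₁') (k k' : ℤ) (hk : k + 2 = k') (e : k + 1 = q) (e' : k' + 1 = r) :
    PerRel hk h' ((Cochain.ofHom (M.d k q e)).comp z₁ (zero_add p))
      ((Cochain.ofHom (M.d k' r e')).comp z₁' (zero_add p)) := by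
  unfold PerRel at *
  rw [Cochain.map_comp, Cochain.map_ofHom, Cochain.comp_assoc_of_first_is_zero_cochain,
    h₁, ← Cochain.comp_assoc_of_first_is_zero_cochain,
    ← Cochain.comp_assoc_of_first_is_zero_cochain, ← Cochain.ofHom_comp, ← Cochain.ofHom_comp,
    M.π_d k q k' r e e' hk h]

/-- The square of the differentials of `N` and `M` agree under the periodicity. -/
lemma PerRel.w_comp {z₁ : Cochain (M.X q) (N.X q') p} {z₁' : Cochain (M.X r) (N.X r') p}
    (h₁ : PerRel h h' z₁ z₁') :
    z₁.comp (Cochain.ofHom ((complexW w).app (N.X q') ≫ (N.π q' r' h').hom)) (add_zero p) =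
      (Cochain.ofHom ((complexW w).app (M.X q) ≫ (M.π q r h).hom)).comp z₁' (zero_add p) := by
  unfold PerRel at *
  rw [Cochain.ofHom_comp, Cochain.ofHom_comp, Cochain.comp_assoc_of_first_is_zero_cochain, ← h₁,
    ← Cochain.comp_assoc_of_third_is_zero_cochain, ← Cochain.comp_assoc_of_third_is_zero_cochain]
  congr 1
  ext a b hab
  rw [Cochain.comp_zero_cochain_v, Cochain.zero_cochain_comp_v, Cochain.ofHom_v, Cochain.ofHom_v]
  exact (w.naturality (z₁.v a b hab) :)

section

variable [F.Full] [F.Faithful] (h h')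

variable (M N p) in
/-- The periodicity of cochains. -/
noncomputable def perEquiv : Cochain (M.X q) (N.X q') p ≃ Cochain (M.X r) (N.X r') p where
  toFun z := (Cochain.ofHom (M.π q r h).inv).comp
    ((z.map F).comp (Cochain.ofHom (N.π q' r' h').hom) (add_zero p)) (zero_add p)
  invFun z := Cochain.mk fun a b hab => F.preimage (((Cochain.ofHom (M.π q r h).hom).comp
    (z.comp (Cochain.ofHom (N.π q' r' h').inv) (add_zero p)) (zero_add p)).v a b hab)
  left_inv z := by
    ext a b hab
    apply F.map_injective
    rw [Cochain.mk_v]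
    refine (F.map_preimage _).trans ?_
    dsimp only
    rw [Cochain.comp_assoc_of_first_is_zero_cochain,
      Cochain.comp_assoc_of_third_is_zero_cochain, ← Cochain.ofHom_comp, Iso.hom_inv_id,
      Cochain.comp_id, ← Cochain.comp_assoc_of_first_is_zero_cochain, ← Cochain.ofHom_comp,
      Iso.hom_inv_id, Cochain.id_comp]
    rfl
  right_inv z := by
    have e : (Cochain.mk fun a b hab => F.preimage (((Cochain.ofHom (M.π q r h).hom).comp
      (z.comp (Cochain.ofHom (N.π q' r' h').inv) (add_zero p)) (zero_add p)).v a b hab) :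
        Cochain (M.X q) (N.X q') p).map F =
      (Cochain.ofHom (M.π q r h).hom).comp
      (z.comp (Cochain.ofHom (N.π q' r' h').inv) (add_zero p)) (zero_add p) := by
      ext a b hab
      exact F.map_preimage _
    dsimp only
    rw [e, Cochain.comp_assoc_of_first_is_zero_cochain,
      Cochain.comp_assoc_of_third_is_zero_cochain, ← Cochain.ofHom_comp, Iso.inv_hom_id,
      Cochain.comp_id, ← Cochain.comp_assoc_of_first_is_zero_cochain, ← Cochain.ofHom_comp,
      Iso.inv_hom_id, Cochain.id_comp]

lemma perRel_iff (z : Cochain (M.X q) (N.X q') p) (z' : Cochain (M.X r) (N.X r') p) :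
    PerRel h h' z z' ↔ perEquiv M N p h h' z = z' := by
  unfold PerRel
  change _ ↔ (Cochain.ofHom (M.π q r h).inv).comp
    ((z.map F).comp (Cochain.ofHom (N.π q' r' h').hom) (add_zero p)) (zero_add p) = _
  constructor
  · intro e
    rw [e, ← Cochain.comp_assoc_of_first_is_zero_cochain, ← Cochain.ofHom_comp,
      Iso.inv_hom_id, Cochain.id_comp]
  · intro e
    rw [← e, ← Cochain.comp_assoc_of_first_is_zero_cochain, ← Cochain.ofHom_comp,
      Iso.hom_inv_id, Cochain.id_comp]

end

end

section

variable (M N : UnfC w)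

/-- Periodic families of cochains. -/
def rowGroup (n p : ℤ) : AddSubgroup (∀ q q' : ℤ, q + n = q' + p → Cochain (M.X q) (N.X q') p) where
  carrier := { z | ∀ q q' r r' e e' h h', PerRel h h' (z q q' e) (z r r' e') }
  add_mem' hx hy := fun q q' r r' e e' h h' =>
    (hx q q' r r' e e' h h').add (hy q q' r r' e e' h h')
  zero_mem' := fun q q' r r' e e' h h' => PerRel.zero
  neg_mem' hx := fun q q' r r' e e' h h' => (hx q q' r r' e e' h h').neg

variable {M N}

variable (M N) in
-- Problems that are invariant under the periodicity and solvable for each pair of indices have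
-- periodic solutions. The index `q'` is determined by `q`, so only a sequence in `q` has to be
-- chosen.
lemma exists_row [F.Full] [F.Faithful] (n p : ℤ)
    (P : ∀ q q', q + n = q' + p → Cochain (M.X q) (N.X q') p → Prop)
    (hP : ∀ q q' r r' e e' h h' z z', PerRel (q := q) (q' := q') (r := r) (r' := r') h h' z z' →
      (P q q' e z ↔ P r r' e' z'))
    (hz : ∀ q q' e, ∃ z, P q q' e z) : ∃ z : rowGroup M N n p, ∀ q q' e, P q q' e (z.1 q q' e) := by
  obtain ⟨x, hx, hx'⟩ := exists_periodic_of_exists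
    (H := fun q => Cochain (M.X q) (N.X (q + n - p)) p)
    (fun i j h => perEquiv M N p h (by lia)) (fun q => P q (q + n - p) (by lia))
    (fun i j h x => hP _ _ _ _ _ _ h (by lia) _ _ ((perRel_iff h (by lia) _ _).2 rfl))
    (fun q => hz _ _ _)
  refine ⟨⟨fun q q' e => Cochain.mk fun a b hab =>
    (x q).v a b hab ≫ eqToHom (by obtain rfl : q' = q + n - p := by lia
                                  rfl), ?_⟩, ?_⟩
  · rintro q q' r r' e e' h h'
    obtain rfl : q' = q + n - p := by lia
    obtain rfl : r' = r + n - p := by lia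
    have := (perRel_iff h (by lia) _ _).2 (hx' q r h)
    convert this using 1 <;> (ext; simp)
  · rintro q q' e
    obtain rfl : q' = q + n - p := by lia
    convert hx q
    ext
    simp

lemma row_ext {n p : ℤ} {z z' : rowGroup M N n p} (h : ∀ q q' e, z.1 q q' e = z'.1 q q' e) :
    z = z' :=
  Subtype.ext (funext fun q => funext fun q' => funext fun e => h q q' e)

variable (M N)

/-- The differential on families of cochains that is induced by the differentials of `M`, `N`. -/
def d₁Fun {n n' p : ℤ} (h : n + 1 = n') (z : ∀ q q' : ℤ, q + n = q' + p → Cochain (M.X q) (N.X q')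
    p)
    (q q' : ℤ) (e : q + n' = q' + p) : Cochain (M.X q) (N.X q') p :=
  (z q (q' - 1) (by lia)).comp (Cochain.ofHom (N.d (q' - 1) q' (by lia))) (add_zero p) -
    n.negOnePow • (Cochain.ofHom (M.d q (q + 1) rfl)).comp (z (q + 1) q' (by lia)) (zero_add p)

lemma negOnePow_two_add (q r : ℤ) (h : q + 2 = r) : q.negOnePow = r.negOnePow := by
  rw [← h, Int.negOnePow_add, Int.negOnePow_even 2 (by decide), mul_one]

lemma negOnePow_add_one (q r : ℤ) (h : q + 1 = r) : r.negOnePow = -q.negOnePow := by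
  rw [← h, Int.negOnePow_succ]

/-- The double complex of periodic families of cochains. -/
def rows : Bicomplex.{v} where
  R n p := rowGroup M N n p
  grp n p := inferInstance
  d₁ n n' p h := AddMonoidHom.mk' (fun z => ⟨d₁Fun M N h z.1, fun q q' r r' e e' hq hq' =>
    ((z.2 _ _ _ _ _ _ _ (by lia)).comp_d _ _ _ _ _).sub
      (((z.2 _ _ _ _ _ _ (by lia) _).d_comp _ _ _ _ _).smul _ _ rfl)⟩) fun x y => by
      refine row_ext fun q q' e => ?_
      have ha : ∀ q q' e, (x.1 + y.1) q q' e = x.1 q q' e + y.1 q q' e := fun _ _ _ => rfl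
      change d₁Fun M N h (x.1 + y.1) q q' e = d₁Fun M N h x.1 q q' e + d₁Fun M N h y.1 q q' e
      simp only [d₁Fun, ha, Cochain.add_comp, Cochain.comp_add, smul_add]
      abel
  -- The sign `(-1)^{q'}` flips under postcomposition with the differential of `N`, and the sign
  -- `(-1)^n` in `d₁Fun` flips with `n`; so both terms of `d₁` anticommute with `d₂`.
  d₂ n n' p p' h h' := AddMonoidHom.mk' (fun z => ⟨fun q q' e =>
    q'.negOnePow • δ p p' (z.1 q q' (by lia)), fun q q' r r' e e' hq hq' =>
      ((z.2 _ _ _ _ _ _ _ _).delta p').smul _ _ (negOnePow_two_add _ _ hq')⟩) fun x y => by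
      refine row_ext fun q q' e => ?_
      change q'.negOnePow • δ p p' (x.1 q q' _ + y.1 q q' _) =
        q'.negOnePow • δ p p' (x.1 q q' _) + q'.negOnePow • δ p p' (y.1 q q' _)
      rw [δ_add, smul_add]
  d₁_d₁ n n' n'' p h h' x := by
    refine row_ext fun q q' e => ?_
    change d₁Fun M N h' (d₁Fun M N h x.1) q q' e = 0
    -- The differentials of `M` and `N` square to `w` rather than to zero. For a periodic family,
    -- the naturality of `w` makes postcomposition with the one square equal to precomposition with
    -- the other, so the two contributions cancel.
    have e₁ := (x.2 q (q' - 1 - 1) (q + 1 + 1) q' (by lia) (by lia) (by lia) (by lia)).w_comp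
    rw [← N.d_d _ (q' - 1) _ (by lia) (by lia), ← M.d_d _ (q + 1) _ (by lia) (by lia)] at e₁
    simp only [d₁Fun, Cochain.sub_comp, Cochain.comp_sub, Cochain.comp_units_smul,
      Cochain.units_smul_comp, Cochain.comp_assoc_of_third_is_zero_cochain,
      ← Cochain.ofHom_comp, smul_sub, smul_smul, negOnePow_add_one n n' h] 
    rw [e₁, Cochain.ofHom_comp]
    simp only [Cochain.comp_assoc_of_first_is_zero_cochain, neg_mul, ← Int.negOnePow_add,
      ← two_mul, Int.negOnePow_two_mul, Units.neg_smul, one_smul]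
    exact sub_eq_zero.2 (neg_sub_neg _ _).symm
  d₂_d₂ n n' n'' p p' p'' h h' k k' x := by
    refine row_ext fun q q' e => ?_
    change q'.negOnePow • δ p' p'' (q'.negOnePow • δ p p' (x.1 q q' _)) = 0
    rw [δ_units_smul, δ_δ, smul_zero, smul_zero]
  d₁_d₂ n n' n'' p p' h h' k x := by
    refine row_ext fun q q' e => ?_
    change d₁Fun M N h' (fun q q' e => q'.negOnePow • δ p p' (x.1 q q' (by lia))) q q' e +
      q'.negOnePow • δ p p' (d₁Fun M N h x.1 q q' (by lia)) = 0
    simp only [d₁Fun, δ_sub, δ_units_smul, δ_comp_ofHom, δ_ofHom_comp, Cochain.units_smul_comp,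
      Cochain.comp_units_smul, negOnePow_add_one n n' h, negOnePow_add_one (q' - 1) q' (by lia),
      smul_sub, smul_smul, Cochain.comp_neg, Units.neg_smul, smul_neg, neg_mul, mul_neg, mul_comm
        n.negOnePow]
    abel

lemma rows_d₁_apply {n n' p : ℤ} (h : n + 1 = n') (z : rowGroup M N n p) (q q' : ℤ)
    (e : q + n' = q' + p) : Subtype.val ((rows M N).d₁ n n' p h z) q q' e =
    (z.1 q (q' - 1) (by lia)).comp (Cochain.ofHom (N.d (q' - 1) q' (by lia))) (add_zero p) -
    n.negOnePow • (Cochain.ofHom (M.d q (q + 1) rfl)).comp (z.1 (q + 1) q' (by lia)) (zero_add p) :=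
  rfl

lemma rows_d₂_apply {n n' p p' : ℤ} (h : n + 1 = n') (h' : p + 1 = p') (z : rowGroup M N n p)
    (q q' : ℤ) (e : q + n' = q' + p') : Subtype.val ((rows M N).d₂ n n' p p' h h' z) q q' e =
    q'.negOnePow • δ p p' (z.1 q q' (by lia)) :=
  rfl

end

end UnfC

end

section

variable {A : Type u} [Category.{v} A] [Abelian A] {F : A ⥤ A} [F.Additive] {w : 𝟭 A ⟶ F}

/-! ### Graded families of morphisms between unfoldings -/

namespace Unf

/-- Periodic families of morphisms of degree `n` between unfolded factorizations. -/
@[ext]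
structure Coch (G H : Unf F w) (n : ℤ) where
  /-- the morphisms -/
  c : ∀ i j, i + n = j → (G.X i ⟶ H.X j)
  periodic : ∀ i j i' j' e e' hi hj,
    F.map (c i j e) ≫ (H.π j j' hj).hom = (G.π i i' hi).hom ≫ c i' j' e'

/-- The differential of a periodic family. -/
def Coch.D {G H : Unf F w} {n : ℤ} (x : Coch G H n) (n' : ℤ) (h : n + 1 = n') : Coch G H n' where
  c i j e := x.c i (j - 1) (by lia) ≫ H.d (j - 1) j (by lia) -
    n.negOnePow • G.d i (i + 1) rfl ≫ x.c (i + 1) j (by lia)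
  periodic i j i' j' e e' hi hj := by
    have h₁ := H.π_d (j - 1) j (j' - 1) j' (by lia) (by lia) (by lia) hj
    have h₂ := G.π_d i (i + 1) i' (i' + 1) rfl rfl hi (by lia)
    rw [Functor.map_sub, Functor.map_units_smul, Preadditive.sub_comp, Preadditive.comp_sub,
      Linear.units_smul_comp, Linear.comp_units_smul, Functor.map_comp, assoc, h₁, ← assoc,
      x.periodic _ _ i' (j' - 1) _ (by lia) hi (by lia), Functor.map_comp, assoc, assoc,
      x.periodic _ _ (i' + 1) j' _ (by lia) (by lia) hj, ← assoc (F.map _), h₂, assoc]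

lemma Coch.D_c {G H : Unf F w} {n : ℤ} (x : Coch G H n) (n' : ℤ) (h : n + 1 = n') (i j i' j' : ℤ)
    (e : i + n' = j) (hi : i + 1 = i') (hj : j' + 1 = j) : (x.D n' h).c i j e =
      x.c i j' (by lia) ≫ H.d j' j hj - n.negOnePow • G.d i i' hi ≫ x.c i' j (by lia) := by
  subst hi
  obtain rfl : j' = j - 1 := by lia
  rfl

/-- A morphism, as a family of degree `0`. -/
def Coch.ofHom {G H : Unf F w} (f : G ⟶ H) : Coch G H 0 where
  c i j e := f.f i ≫ eqToHom (by rw [← e, add_zero])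
  periodic i j i' j' e e' hi hj := by
    obtain rfl : i = j := by lia
    obtain rfl : i' = j' := by lia
    simpa using f.comm_π i i' hi

lemma Coch.ofHom_c {G H : Unf F w} (f : G ⟶ H) (i : ℤ) :
    (Coch.ofHom f).c i i (add_zero i) = f.f i := by
  simp [ofHom]

end Unf

open Unf

/-- The components of the periodicity isomorphisms. -/
def UnfC.πf (M : UnfC w) (q q' : ℤ) (h : q + 2 = q') (k : ℤ) :
    F.obj ((M.X q).X k) ≅ (M.X q').X k :=
  (HomologicalComplex.eval A (ComplexShape.up ℤ) k).mapIso (M.π q q' h)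

lemma UnfC.perRel_iff_v {M N : UnfC w} {q q' r r' p : ℤ} (h : q + 2 = r) (h' : q' + 2 = r')
    (z : Cochain (M.X q) (N.X q') p) (z' : Cochain (M.X r) (N.X r') p) :
    PerRel h h' z z' ↔ ∀ k l hkl, F.map (z.v k l hkl) ≫ (N.πf q' r' h' l).hom =
      (M.πf q r h k).hom ≫ z'.v k l hkl := by
  unfold PerRel
  constructor
  · intro e k l hkl
    have := Cochain.congr_v e k l hkl
    rw [Cochain.comp_zero_cochain_v, Cochain.zero_cochain_comp_v, Cochain.ofHom_v,
      Cochain.ofHom_v] at this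
    exact this
  · intro e
    ext k l hkl
    rw [Cochain.comp_zero_cochain_v, Cochain.zero_cochain_comp_v, Cochain.ofHom_v,
      Cochain.ofHom_v]
    exact e k l hkl

/-- The decomposition of an unfolded factorization as the total object of an unfolded factorization
in the category of complexes. -/
structure Dec (M : UnfC w) (G : Unf F w) (a b : ℤ) where
  /-- the inclusions -/
  ι : ∀ k q i, k + q = i → ((M.X q).X k ⟶ G.X i)
  /-- the projections -/
  pr : ∀ k q i, k + q = i → (G.X i ⟶ (M.X q).X k)
  ι_pr : ∀ k q i h, ι k q i h ≫ pr k q i h = 𝟙 _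
  ι_pr_ne : ∀ k q k' q' i h h', k ≠ k' → ι k q i h ≫ pr k' q' i h' = 0
  sum_eq : ∀ i, ∑ k ∈ Finset.Icc a b, pr k (i - k) i (by lia) ≫ ι k (i - k) i (by lia) = 𝟙 _
  ι_d : ∀ k q i j h h', ι k q i h ≫ G.d i j h' =
    (M.d q (q + 1) rfl).f k ≫ ι k (q + 1) j (by lia) +
      q.negOnePow • (M.X q).d k (k + 1) ≫ ι (k + 1) q j (by lia)
  ι_π : ∀ k q q' i i' h h' hq hi, F.map (ι k q i h) ≫ (G.π i i' hi).hom =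
    (M.πf q q' hq k).hom ≫ ι k q' i' h'

/-! ### Splitting graded families into rows -/

namespace Dec

section

variable {M : UnfC w} {G : Unf F w} {a b : ℤ} (Δ : Dec M G a b)

lemma ι_pr_assoc (k q i h) {Z : A} (z : _ ⟶ Z) : Δ.ι k q i h ≫ Δ.pr k q i h ≫ z = z := by
  rw [← assoc, ι_pr, id_comp]

lemma ι_pr_ne_assoc (k q k' q' i h h') (hk : k ≠ k') {Z : A} (z : _ ⟶ Z) :
    Δ.ι k q i h ≫ Δ.pr k' q' i h' ≫ z = 0 := by
  rw [← assoc, ι_pr_ne _ _ _ _ _ _ _ _ hk, zero_comp]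

lemma hom_ext {i : ℤ} {Z : A} {f g : G.X i ⟶ Z}
    (h : ∀ k q hk, Δ.ι k q i hk ≫ f = Δ.ι k q i hk ≫ g) : f = g := by
  rw [← id_comp f, ← id_comp g, ← Δ.sum_eq i, Preadditive.sum_comp, Preadditive.sum_comp]
  exact Finset.sum_congr rfl fun k _ => by rw [assoc, assoc, h]

lemma hom_ext' {i : ℤ} {Z : A} {f g : Z ⟶ G.X i}
    (h : ∀ k q hk, f ≫ Δ.pr k q i hk = g ≫ Δ.pr k q i hk) : f = g := by
  rw [← comp_id f, ← comp_id g, ← Δ.sum_eq i, Preadditive.comp_sum, Preadditive.comp_sum]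
  exact Finset.sum_congr rfl fun k _ => by rw [← assoc, ← assoc, h]

/-- The identity of such a term factors through the sum of the projections with index in `[a, b]`,
all of which vanish on it. -/
lemma isZero (Δ : Dec M G a b) (k q : ℤ) (hk : k ∉ Finset.Icc a b) : IsZero ((M.X q).X k) := by
  rw [IsZero.iff_id_eq_zero, ← Δ.ι_pr k q (k + q) rfl, ← id_comp (Δ.pr _ _ _ _), ← Δ.sum_eq,
    Preadditive.sum_comp, Preadditive.comp_sum]
  refine Finset.sum_eq_zero fun l hl => ?_
  have : k ≠ l := by
    rintro rfl
    exact hk hl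
  rw [assoc, Δ.ι_pr_ne_assoc _ _ _ _ _ _ _ this]

lemma pr_d (l l₀ q q₀ i j : ℤ) (hl : l₀ + 1 = l) (hq : q₀ + 1 = q) (h : l + q = j)
    (h' : i + 1 = j) : G.d i j h' ≫ Δ.pr l q j h =
    Δ.pr l q₀ i (by lia) ≫ (M.d q₀ q hq).f l +
      q.negOnePow • Δ.pr l₀ q i (by lia) ≫ (M.X q).d l₀ l := by
  subst hl hq
  refine Δ.hom_ext fun k r hk => ?_
  rw [← assoc, Δ.ι_d k r i j hk h', Preadditive.add_comp, Preadditive.comp_add, assoc,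
    Linear.units_smul_comp, Linear.comp_units_smul, assoc]
  by_cases hkl : k = l₀ + 1
  · subst hkl
    obtain rfl : r = q₀ := by lia
    rw [Δ.ι_pr, comp_id, Δ.ι_pr_assoc, Δ.ι_pr_ne _ _ _ _ _ _ _ (by lia), comp_zero, smul_zero,
      Δ.ι_pr_ne_assoc _ _ _ _ _ _ _ (by lia), smul_zero]
  · rw [Δ.ι_pr_ne _ _ _ _ _ _ _ hkl, comp_zero, Δ.ι_pr_ne_assoc _ _ _ _ _ _ _ hkl]
    by_cases hkl' : k = l₀
    · subst hkl'
      obtain rfl : r = q₀ + 1 := by lia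
      rw [Δ.ι_pr_assoc, Δ.ι_pr, comp_id]
    · rw [Δ.ι_pr_ne _ _ _ _ _ _ _ (by lia), comp_zero,
        Δ.ι_pr_ne_assoc _ _ _ _ _ _ _ (by lia), smul_zero, smul_zero]

lemma pr_π (k q q' i i' : ℤ) (h h' hq hi) : F.map (Δ.pr k q i h) ≫ (M.πf q q' hq k).hom =
    (G.π i i' hi).hom ≫ Δ.pr k q' i' h' := by
  rw [← Iso.inv_comp_eq]
  refine Δ.hom_ext fun l r hr => ?_
  have e : (M.πf (r - 2) r (by lia) l).hom ≫ Δ.ι l r i' hr ≫ (G.π i i' hi).inv =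
      F.map (Δ.ι l (r - 2) i (by lia)) := by
    rw [← assoc, Iso.comp_inv_eq, Δ.ι_π l (r - 2) r i i' (by lia) hr (by lia) hi]
  rw [← cancel_epi (M.πf (r - 2) r (by lia) l).hom, ← assoc (Δ.ι _ _ _ _),
    ← assoc (M.πf _ _ _ _).hom, e, ← Functor.map_comp_assoc]
  by_cases hlk : l = k
  · subst hlk
    obtain rfl : r = q' := by lia
    obtain rfl : q = r - 2 := by lia
    rw [Δ.ι_pr, Δ.ι_pr, CategoryTheory.Functor.map_id, id_comp, comp_id]
  · rw [Δ.ι_pr_ne _ _ _ _ _ _ _ hlk, Δ.ι_pr_ne _ _ _ _ _ _ _ hlk, Functor.map_zero, zero_comp,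
      comp_zero]

end

section

variable {M N : UnfC w} {G H : Unf F w} {a b a' b' : ℤ} (Δ : Dec M G a b) (Δ' : Dec N H a' b')

/-- The rows of a periodic family of morphisms. -/
def row {n : ℤ} (x : Coch G H n) (p : ℤ) : M.rowGroup N n p :=
  ⟨fun q q' e => Cochain.mk fun k l h => Δ.ι k q (k + q) rfl ≫
    x.c (k + q) (l + q') (by lia) ≫ Δ'.pr l q' (l + q') rfl, by
    intro q q' r r' e e' h h'
    rw [UnfC.perRel_iff_v]
    intro k l hkl
    rw [Cochain.mk_v, Cochain.mk_v, Functor.map_comp, Functor.map_comp, assoc, assoc,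
      Δ'.pr_π l q' r' (l + q') (l + r') rfl rfl h' (by lia), ← assoc (F.map (x.c _ _ _)),
      x.periodic _ _ (k + r) (l + r') _ (by lia) (by lia) (by lia), assoc, ← assoc (F.map _),
      Δ.ι_π k q r (k + q) (k + r) rfl rfl h (by lia), assoc]⟩

lemma row_v {n : ℤ} (x : Coch G H n) (p q q' : ℤ) (e : q + n = q' + p) (k l : ℤ) (h : k + p = l)
    (i j : ℤ) (hi : k + q = i) (hj : l + q' = j) : ((row Δ Δ' x p).1 q q' e).v k l h =
      Δ.ι k q i hi ≫ x.c i j (by lia) ≫ Δ'.pr l q' j hj := by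
  subst hi hj
  rfl

/-- The differentials of `G` and `H` have two parts. Those coming from `M.d` and `N.d` keep the
complex degree and give `d₁`; the internal differentials raise the row degree by one and give `d₂`.
Thus the families of morphisms form the total complex of the double complex of rows. -/
lemma row_D {n n' : ℤ} (h : n + 1 = n') (x : Coch G H n) (p p' : ℤ) (hp : p + 1 = p') :
    row Δ Δ' (x.D n' h) p' = (M.rows N).d₁ n n' p' h (row Δ Δ' x p') +
      (M.rows N).d₂ n n' p p' h hp (row Δ Δ' x p) := by
  refine UnfC.row_ext fun q q' e => ?_
  change _ = Subtype.val ((M.rows N).d₁ n n' p' h (row Δ Δ' x p')) q q' e +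
    Subtype.val ((M.rows N).d₂ n n' p p' h hp (row Δ Δ' x p)) q q' e
  rw [UnfC.rows_d₁_apply, UnfC.rows_d₂_apply]
  ext k l hkl
  obtain ⟨i, hi⟩ : ∃ i, k + q = i := ⟨_, rfl⟩
  obtain ⟨j, hj⟩ : ∃ j, l + q' = j := ⟨_, rfl⟩
  rw [row_v Δ Δ' _ _ _ _ _ _ _ _ i j hi hj, Cochain.add_v, Cochain.sub_v, Cochain.units_smul_v,
    Cochain.units_smul_v, Cochain.comp_zero_cochain_v, Cochain.zero_cochain_comp_v,
    Cochain.ofHom_v, Cochain.ofHom_v, δ_v p p' hp _ k l hkl (l - 1) (k + 1) rfl rfl,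
    row_v Δ Δ' _ _ _ _ _ _ _ _ i (j - 1) hi (by lia),
    row_v Δ Δ' _ _ _ _ _ _ _ _ (i + 1) j (by lia) (by lia),
    row_v Δ Δ' _ _ _ _ _ _ _ _ i (j - 1) hi (by lia),
    row_v Δ Δ' _ _ _ _ _ _ _ _ (i + 1) j (by lia) (by lia)]
  have e₁ := Δ'.pr_d l (l - 1) q' (q' - 1) (j - 1) j (by lia) (by lia) hj (by lia)
  have e₂ := Δ.ι_d k q i (i + 1) hi rfl
  -- Since `q + n + 1 = q' + p'`, the integers `n + q` and `q' + p'` have opposite parity.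
  have s : n.negOnePow * q.negOnePow = - (q'.negOnePow * p'.negOnePow) := by
    rw [← Int.negOnePow_add, ← Int.negOnePow_add, show q' + p' = n + q + 1 by lia,
      Int.negOnePow_succ, neg_neg]
  simp only [Coch.D, Preadditive.sub_comp, Preadditive.comp_sub, assoc, Linear.units_smul_comp,
    Linear.comp_units_smul]
  rw [e₁, ← assoc (Δ.ι _ _ _ _) (G.d _ _ _), e₂]
  simp only [Preadditive.add_comp, Preadditive.comp_add, assoc, Linear.units_smul_comp,
    Linear.comp_units_smul, smul_add, smul_smul, s, Units.neg_smul]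
  abel

lemma row_injective {n : ℤ} {x y : Coch G H n} (h : ∀ p, row Δ Δ' x p = row Δ Δ' y p) : x = y := by
  ext i j e
  refine Δ.hom_ext fun k q hk => Δ'.hom_ext' fun l q' hl => ?_
  rw [assoc, assoc, ← row_v Δ Δ' x (l - k) q q' (by lia) k l (by lia) i j hk hl, h,
    ← row_v Δ Δ' y (l - k) q q' (by lia) k l (by lia) i j hk hl]

/-- Together with `row_injective`, this identifies graded families with arbitrary families of rows;
boundedness of both decompositions makes the matrix finite. -/
lemma exists_row_eq {n : ℤ} (z : ∀ p, M.rowGroup N n p) : ∃ x : Coch G H n, ∀ p,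
    row Δ Δ' x p = z p := by
  let x : Coch G H n :=
    { c := fun i j e => ∑ k ∈ Finset.Icc a b, ∑ l ∈ Finset.Icc a' b', Δ.pr k (i - k) i (by lia) ≫
        ((z (l - k)).1 (i - k) (j - l) (by lia)).v k l (by lia) ≫ Δ'.ι l (j - l) j (by lia)
      periodic := fun i j i' j' e e' hi hj => by
        simp only [Functor.map_sum, Preadditive.sum_comp, Preadditive.comp_sum]
        refine Finset.sum_congr rfl fun k _ => Finset.sum_congr rfl fun l _ => ?_
        have := (UnfC.perRel_iff_v _ _ _ _).1 ((z (l - k)).2 (i - k) (j - l) (i' - k) (j' - l)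
          (by lia) (by lia) (by lia) (by lia)) k l (by lia)
        rw [Functor.map_comp, Functor.map_comp, assoc, assoc,
          Δ'.ι_π l (j - l) (j' - l) j j' (by lia) (by lia) (by lia) hj, ← assoc
            (F.map (Cochain.v _ _ _ _)),
          this, assoc, ← assoc (F.map _), Δ.pr_π k (i - k) (i' - k) i i' (by lia) (by lia) (by lia)
            hi,
          assoc] }
  refine ⟨x, fun p => UnfC.row_ext fun q q' e => ?_⟩
  ext k l hkl
  obtain ⟨i, hi⟩ : ∃ i, k + q = i := ⟨_, rfl⟩
  obtain ⟨j, hj⟩ : ∃ j, l + q' = j := ⟨_, rfl⟩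
  rw [row_v Δ Δ' _ _ _ _ _ _ _ _ i j hi hj]
  by_cases hk : k ∈ Finset.Icc a b
  · by_cases hl : l ∈ Finset.Icc a' b'
    · change Δ.ι k q i hi ≫ (∑ k ∈ Finset.Icc a b, ∑ l ∈ Finset.Icc a' b', Δ.pr k (i - k) i _ ≫
        ((z (l - k)).1 (i - k) (j - l) _).v k l _ ≫ Δ'.ι l (j - l) j _) ≫ Δ'.pr l q' j hj = _
      rw [Preadditive.sum_comp, Preadditive.comp_sum, Finset.sum_eq_single k,
        Preadditive.sum_comp, Preadditive.comp_sum, Finset.sum_eq_single l]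
      · obtain rfl : q = i - k := by lia
        obtain rfl : q' = j - l := by lia
        obtain rfl : p = l - k := by lia
        rw [assoc, assoc, Δ.ι_pr_assoc, Δ'.ι_pr, comp_id]
      · intro l' _ hl'
        rw [assoc, assoc, Δ'.ι_pr_ne _ _ _ _ _ _ _ hl', comp_zero, comp_zero, comp_zero]
      · exact fun h => (h hl).elim
      · intro k' _ hk'
        rw [Preadditive.sum_comp, Preadditive.comp_sum]
        refine Finset.sum_eq_zero fun l' _ => ?_
        rw [assoc, Δ.ι_pr_ne_assoc _ _ _ _ _ _ _ hk'.symm]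
      · exact fun h => (h hk).elim
    · exact (Δ'.isZero l q' hl).eq_of_tgt _ _
  · exact (Δ.isZero k q hk).eq_of_src _ _

/-- A cochain from degrees in `[a, b]` to degrees in `[a', b']` can be nonzero only if its degree
lies between `a' - b` and `b' - a`. This is the boundedness needed for the double complex. -/
lemma subsingleton_rowGroup (Δ : Dec M G a b) (Δ' : Dec N H a' b') (n p : ℤ)
    (hp : p < a' - b ∨ b' - a < p) :
    Subsingleton (M.rowGroup N n p) := by
  refine ⟨fun x y => UnfC.row_ext fun q q' e => ?_⟩
  ext k l hkl
  by_cases hk : k ∈ Finset.Icc a b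
  · refine (Δ'.isZero l q' ?_).eq_of_tgt _ _
    rw [Finset.mem_Icc] at hk ⊢
    lia
  · exact (Δ.isZero k q hk).eq_of_src _ _

end

end Dec

end

namespace Unf

variable {A : Type u} [Category.{v} A] [Abelian A] {F : A ⥤ A} [F.Additive] {w : 𝟭 A ⟶ F}

/-- Indices `0` and `1` are used because for families of degree `-1` these are the positions of the
two components of a homotopy. -/
lemma Coch.ext_of [F.Faithful] {G H : Unf F w} {n : ℤ} {x y : Coch G H n}
    (h₀ : ∀ e, x.c 0 n e = y.c 0 n e) (h₁ : ∀ j e, x.c 1 j e = y.c 1 j e) : x = y := by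
  have h : ∀ i i' : ℤ, i + 2 = i' →
      ((∀ j e, x.c i j e = y.c i j e) ↔ (∀ j e, x.c i' j e = y.c i' j e)) := by
    intro i i' hi
    constructor
    · intro hx j e
      rw [← cancel_epi (G.π i i' hi).hom, ← x.periodic i (j - 2) i' j (by lia) e hi (by lia),
        ← y.periodic i (j - 2) i' j (by lia) e hi (by lia), hx]
    · intro hx j e
      apply F.map_injective
      rw [← cancel_mono (H.π j (j + 2) rfl).hom, x.periodic i j i' (j + 2) e (by lia) hi rfl,
        y.periodic i j i' (j + 2) e (by lia) hi rfl, hx]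
  ext i j e
  revert j e
  revert i
  refine periodic_induction ((h (-1) 1 (by lia)).2 h₁) ?_ h
  rintro j e
  obtain rfl : n = j := by lia
  exact h₀ e

lemma Coch.D_ofHom {G H : Unf F w} (f : G ⟶ H) (n : ℤ) (h : 0 + 1 = n) (i j : ℤ) (e) :
    ((Coch.ofHom f).D n h).c i j e = 0 := by
  obtain rfl : j = i + 1 := by lia
  rw [Coch.D_c _ n h i (i + 1) (i + 1) i e rfl rfl, Coch.ofHom_c, Coch.ofHom_c, f.comm_d,
    Int.negOnePow_zero, one_smul, sub_self]

/-- The closed families of degree `0` are exactly the morphisms: periodicity is built in, and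
closedness is compatibility with the differentials. -/
lemma Coch.exists_ofHom {G H : Unf F w} (x : Coch G H 0) (hx : ∀ i j e, (x.D 1 rfl).c i j e = 0) :
    ∃ f : G ⟶ H, Coch.ofHom f = x := by
  let f : G ⟶ H :=
    { f := fun i => x.c i i (add_zero i)
      comm_d := fun i j h => by
        subst h
        have := hx i (i + 1) rfl
        rw [Coch.D_c _ _ _ i (i + 1) (i + 1) i _ rfl rfl, Int.negOnePow_zero, one_smul,
          sub_eq_zero] at this
        exact this
      comm_π := fun i j h => x.periodic _ _ _ _ _ _ _ _ }
  refine ⟨f, ?_⟩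
  ext i j e
  obtain rfl : i = j := by lia
  rw [Coch.ofHom_c]

end Unf

open Unf

/-! ### Homotopy classes as cohomology of the double complex -/

namespace Factorization

variable {A : Type u} [Category.{v} A] [Abelian A] {W : Potential A}

/-- Degree `-1` maps of factorizations correspond to periodic families of degree `-1`. -/
structure DegCompat {E F : Factorization W} (h : Deg E F)
    (y : Coch ((unf W).obj E) ((unf W).obj F) (-1)) : Prop where
  p : E.unfX₀.hom ≫ y.c 0 (-1) (by lia) = h.p ≫ F.unfX₁.hom
  q : W.Φ.functor.map E.unfX₁.hom ≫ (((unf W).obj E).π (-1) 1 (by lia)).hom ≫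
    y.c 1 0 (by lia) = h.q ≫ F.unfX₀.hom

/-- The equation `D y = u` at indices `0` and `1` gives the two homotopy relations. In degree `-1`
the sign in `D` turns the difference into a sum; the relation at index `1` is the one after applying
`Φ`. -/
lemma DegCompat.iff {E F : Factorization W} {h : Deg E F}
    {y : Coch ((unf W).obj E) ((unf W).obj F) (-1)} (hy : DegCompat h y) (u : E ⟶ F) :
    y.D 0 (by lia) = Coch.ofHom ((unf W).map u) ↔
      (W.Φ.functor.map u.f₁ = W.Φ.functor.map (E.a ≫ h.p) + h.q ≫ F.b ∧
        u.f₀ = h.p ≫ F.a + E.b ≫ h.q) := by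
  have D₀ : (y.D 0 (by lia)).c 0 0 (by lia) = y.c 0 (-1) (by lia) ≫ ((unf W).obj F).d (-1) 0
    (by lia) +
      ((unf W).obj E).d 0 1 (by lia) ≫ y.c 1 0 (by lia) := by
    have : (-1 : ℤ).negOnePow = -1 := by simp
    rw [Coch.D_c _ _ _ 0 0 1 (-1) _ (by lia) (by lia), this, Units.neg_smul, one_smul,
      sub_neg_eq_add]
  have D₁ : (y.D 0 (by lia)).c 1 1 (by lia) = y.c 1 0 (by lia) ≫ ((unf W).obj F).d 0 1 (by lia) +
      ((unf W).obj E).d 1 2 (by lia) ≫ y.c 2 1 (by lia) := by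
    have : (-1 : ℤ).negOnePow = -1 := by simp
    rw [Coch.D_c _ _ _ 1 1 2 0 _ (by lia) (by lia), this, Units.neg_smul, one_smul, sub_neg_eq_add]
  have key₀ : ((y.D 0 (by lia)).c 0 0 (by lia) = Hom.f ((unf W).map u) 0) ↔
      u.f₀ = h.p ≫ F.a + E.b ≫ h.q := by
    rw [D₀, ← cancel_epi E.unfX₀.hom, unf_map_f₀, Preadditive.comp_add, ← assoc, hy.p, assoc,
      unfX₁_d, ← assoc E.unfX₀.hom, unfX₀_d, assoc, assoc, hy.q, ← assoc, ← assoc,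
      ← Preadditive.add_comp, cancel_mono, eq_comm]
  have key₁ : ((y.D 0 (by lia)).c 1 1 (by lia) = Hom.f ((unf W).map u) 1) ↔
      W.Φ.functor.map u.f₁ = W.Φ.functor.map (E.a ≫ h.p) + h.q ≫ F.b := by
    have e₁ := Unf.Hom.comm_π ((unf W).map u) (-1) 1 (by lia)
    have e₂ := ((unf W).obj E).π_d (-1) 0 1 2 (by lia) (by lia) (by lia) (by lia)
    have e₃ := y.periodic 0 (-1) 2 1 (by lia) (by lia) (by lia) (by lia)
    rw [D₁, ← cancel_epi (W.Φ.functor.map E.unfX₁.hom ≫ (((unf W).obj E).π (-1) 1 (by lia)).hom),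
      assoc, assoc, ← e₁, Preadditive.comp_add, Preadditive.comp_add, ← assoc (Iso.hom _)
        (y.c 1 0 _),
      ← assoc (W.Φ.functor.map _), hy.q, assoc, unfX₀_d, ← assoc (Iso.hom _) (Unf.d _ _ _ _), ← e₂,
      assoc, ← e₃, ← Functor.map_comp_assoc, ← Functor.map_comp_assoc, ← Functor.map_comp_assoc,
      unf_map_f₁, unfX₁_d, assoc, hy.p, Functor.map_comp, assoc,
      ← Functor.map_comp_assoc W.Φ.functor E.a, ← assoc E.a,
      Functor.map_comp _ (E.a ≫ h.p), Functor.map_comp _ u.f₁, assoc, assoc, ← assoc h.q,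
      ← Preadditive.add_comp, cancel_mono, eq_comm, add_comm]
  rw [← key₀, ← key₁]
  constructor
  · intro e
    rw [e, Coch.ofHom_c, Coch.ofHom_c]
    exact ⟨rfl, rfl⟩
  · rintro ⟨e₁, e₀⟩
    refine Coch.ext_of (fun e => ?_) (fun j e => ?_)
    · rw [e₀, Coch.ofHom_c]
    · obtain rfl : j = 1 := by lia
      rw [e₁, Coch.ofHom_c]

/-- The two components of a homotopy extend uniquely to a periodic family of degree `-1`, whose
boundary is then the given morphism. -/
lemma isNull_iff_exists_coch {E F : Factorization W} (u : E ⟶ F) :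
    IsNull u ↔ ∃ y : Coch ((unf W).obj E) ((unf W).obj F) (-1),
      y.D 0 (by lia) = Coch.ofHom ((unf W).map u) := by
  rw [isNull_iff]
  constructor
  · rintro ⟨h, h₁, h₀⟩
    let G := (unf W).obj E
    let H := (unf W).obj F
    let y₁ : G.X 1 ⟶ H.X 0 := (G.π (-1) 1 (by lia)).inv ≫ W.Φ.functor.map E.unfX₁.inv ≫ h.q ≫
      F.unfX₀.hom
    let y₀ : G.X 0 ⟶ H.X (-1) := E.unfX₀.inv ≫ h.p ≫ F.unfX₁.hom
    let e (i i' : ℤ) (hi : i + 2 = i') : (G.X i ⟶ H.X (i - 1)) ≃ (G.X i' ⟶ H.X (i' - 1)) :=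
      homEquiv G H _ _ _ _ hi (by lia)
    obtain ⟨x, hx₁, hx₀, hx⟩ := exists_periodic e ((e (-1) 1 (by lia)).symm y₁) y₀
    have hx₁ : x 1 = y₁ := by
      rw [← hx (-1) 1 (by lia), hx₁, Equiv.apply_symm_apply]
    let y : Coch G H (-1) :=
      { c := fun i j e => x i ≫ eqToHom (by rw [← e]; rfl)
        periodic := fun i j i' j' e e' hi hj => by
          obtain rfl : j = i - 1 := by lia
          obtain rfl : j' = i' - 1 := by lia
          have := (homEquiv_eq_iff _ _ _ _ _ _ _ _ _ _).1 (hx i i' hi)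
          simpa using this }
    have hy : DegCompat h y := by
      constructor
      · change E.unfX₀.hom ≫ x 0 ≫ eqToHom _ = _
        rw [hx₀, eqToHom_refl, comp_id]
        simp only [y₀, Iso.hom_inv_id_assoc]
      · change _ ≫ _ ≫ x 1 ≫ eqToHom _ = _
        rw [hx₁, eqToHom_refl, comp_id]
        simp only [y₁, G, Iso.hom_inv_id_assoc]
        rw [← Functor.map_comp_assoc, Iso.hom_inv_id, CategoryTheory.Functor.map_id, id_comp]
    exact ⟨y, (hy.iff u).2 ⟨h₁, h₀⟩⟩
  · rintro ⟨y, hy⟩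
    let h : Deg E F :=
      { p := E.unfX₀.hom ≫ y.c 0 (-1) (by lia) ≫ F.unfX₁.inv
        q := W.Φ.functor.map E.unfX₁.hom ≫ (((unf W).obj E).π (-1) 1 (by lia)).hom ≫
          y.c 1 0 (by lia) ≫ F.unfX₀.inv }
    have hy' : DegCompat h y := ⟨by simp [h], by simp [h]⟩
    exact ⟨h, (hy'.iff u).1 hy⟩

section

variable {E F : Factorization W} {M N : UnfC W.w} {a b a' b' : ℤ}
  (Δ : Dec M ((unf W).obj E) a b) (Δ' : Dec N ((unf W).obj F) a' b')

/-- The rows of a morphism of factorizations. -/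
def homRow (u : E ⟶ F) (p : ℤ) : (M.rows N).R 0 p :=
  Dec.row Δ Δ' (Coch.ofHom ((unf W).map u)) p

lemma homRow_v (u : E ⟶ F) (p q q' : ℤ) (e : q + 0 = q' + p) (k l : ℤ) (h : k + p = l) (i : ℤ)
    (hi : k + q = i) (hj : l + q' = i) : (Subtype.val (homRow Δ Δ' u p) q q' e).v k l h =
      Δ.ι k q i hi ≫ Unf.Hom.f ((unf W).map u) i ≫ Δ'.pr l q' i hj := by
  refine (Dec.row_v Δ Δ' _ _ _ _ _ _ _ _ i i hi hj).trans ?_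
  rw [Coch.ofHom_c]

lemma closed_homRow (u : E ⟶ F) : (M.rows N).Closed (homRow Δ Δ' u) := by
  intro n p p' h k
  have := Dec.row_D Δ Δ' h (Coch.ofHom ((unf W).map u)) p p' k
  refine this.symm.trans (UnfC.row_ext fun q q' e => ?_)
  ext k l hkl
  rw [Dec.row_v Δ Δ' _ _ _ _ _ _ _ _ _ _ rfl rfl, Coch.D_ofHom, zero_comp, comp_zero]
  rfl

/-- A family of rows assembles to a graded family of degree `0`; if it is closed, it is a morphism
of unfoldings, which comes from one of factorizations by fullness. -/
lemma exists_homRow_eq (z : ∀ p, (M.rows N).R 0 p) (hz : (M.rows N).Closed z) :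
    ∃ u : E ⟶ F, homRow Δ Δ' u = z := by
  obtain ⟨x, hx⟩ := Dec.exists_row_eq Δ Δ' z
  obtain ⟨f, rfl⟩ := x.exists_ofHom (by
    have : x.D 1 rfl = (⟨fun i j e => 0, by simp⟩ : Coch _ _ 1) := by
      refine Dec.row_injective Δ Δ' fun p => ?_
      rw [Dec.row_D Δ Δ' _ _ (p - 1) p (by lia), hx, hx]
      refine (hz 1 (p - 1) p rfl (by lia)).trans (UnfC.row_ext fun q q' e => ?_)
      ext k l hkl
      rw [Dec.row_v Δ Δ' _ _ _ _ _ _ _ _ _ _ rfl rfl, zero_comp, comp_zero]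
      rfl
    rw [this]
    exact fun _ _ _ => rfl)
  obtain ⟨u, rfl⟩ := (unf W).map_surjective f
  exact ⟨u, funext hx⟩

/-- With `closed_homRow` and `exists_homRow_eq`, homotopy classes of morphisms become the cohomology
of the double complex in total degree `0`. -/
lemma isNull_iff_bounds (u : E ⟶ F) : IsNull u ↔
    ∃ y : ∀ p, (M.rows N).R (-1) p, (M.rows N).Bounds (by lia) y (homRow Δ Δ' u) := by
  rw [isNull_iff_exists_coch]
  constructor
  · rintro ⟨y, hy⟩
    refine ⟨Dec.row Δ Δ' y, fun p p' k => ?_⟩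
    have := Dec.row_D Δ Δ' (n' := 0) (by lia) y p p' k
    rw [hy] at this
    exact this.symm
  · rintro ⟨z, hz⟩
    obtain ⟨y, hy⟩ := Dec.exists_row_eq Δ Δ' z
    refine ⟨y, Dec.row_injective Δ Δ' fun p => ?_⟩
    rw [Dec.row_D Δ Δ' _ _ (p - 1) p (by lia), hy, hy]
    exact hz _ _ _

lemma unf_map_sub_f {E F : Factorization W} (u u' : E ⟶ F) (i : ℤ) :
    Unf.Hom.f ((unf W).map (u - u')) i =
      Unf.Hom.f ((unf W).map u) i - Unf.Hom.f ((unf W).map u') i :=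
  (comp W i).map_sub

lemma homRow_sub (u u' : E ⟶ F) (p : ℤ) :
    homRow Δ Δ' (u - u') p = homRow Δ Δ' u p - homRow Δ Δ' u' p := by
  refine UnfC.row_ext fun q q' e => ?_
  change Subtype.val (homRow Δ Δ' (u - u') p) q q' e = Subtype.val (homRow Δ Δ' u p) q q' e -
    Subtype.val (homRow Δ Δ' u' p) q q' e
  ext k l hkl
  obtain ⟨i, hi⟩ : ∃ i, k + q = i := ⟨_, rfl⟩
  rw [Cochain.sub_v, homRow_v Δ Δ' _ _ _ _ _ _ _ _ i hi (by lia),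
    homRow_v Δ Δ' _ _ _ _ _ _ _ _ i hi (by lia), homRow_v Δ Δ' _ _ _ _ _ _ _ _ i hi (by lia),
    unf_map_sub_f, Preadditive.sub_comp, Preadditive.comp_sub]

end

section

variable {B : Type u₂} [Category.{v₂} B] [Abelian B] {V : Potential B}
  {E F : Factorization W} {M N : UnfC W.w} {a b a' b' : ℤ}
  (Δ : Dec M ((unf W).obj E) a b) (Δ' : Dec N ((unf W).obj F) a' b')
  {E' F' : Factorization V} {M' N' : UnfC V.w} {c d c' d' : ℤ}
  (Γ : Dec M' ((unf V).obj E') c d) (Γ' : Dec N' ((unf V).obj F') c' d')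

/-- A morphism of the double complexes of rows that is a quasi-isomorphism on rows induces a
bijection on homotopy classes of morphisms. -/
lemma bijective_of_rowQuasiIso (l : (M.rows N).Hom (M'.rows N')) (hl : l.RowQuasiIso)
    (L : (E ⟶ F) → (E' ⟶ F'))
    (hL : ∀ u p, homRow Γ Γ' (L u) p = l.f 0 p (homRow Δ Δ' u p)) :
    (∀ u, IsNull (L u) → IsNull u) ∧ (∀ u', ∃ u, IsNull (u' - L u)) := by
  constructor
  · intro u hu
    rw [isNull_iff_bounds Γ Γ'] at hu
    obtain ⟨y, hy⟩ := hu
    rw [isNull_iff_bounds Δ Δ']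
    refine hl.injective _ _ (closed_homRow Δ Δ' u) y ?_
    have : (fun p => l.f 0 p (homRow Δ Δ' u p)) = homRow Γ Γ' (L u) := funext fun p => (hL u p).symm
    rw [this]
    exact hy
  · intro u'
    obtain ⟨x, y', hx, hy'⟩ := hl.surjective (n := -1) (by lia) _ (closed_homRow Γ Γ' u')
    obtain ⟨u, rfl⟩ := exists_homRow_eq Δ Δ' x hx
    refine ⟨u, ?_⟩
    rw [isNull_iff_bounds Γ Γ']
    refine ⟨y', ?_⟩
    have : (fun p => homRow Γ Γ' u' p - l.f 0 p (homRow Δ Δ' u p)) = homRow Γ Γ' (u' - L u) :=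
      funext fun p => by rw [homRow_sub, hL]
    rw [← this]
    exact hy'

lemma isNull_of_exact_rows (Δ : Dec M ((unf W).obj E) a b) (Δ' : Dec N ((unf W).obj F) a' b')
    (hS : ∀ n n' p p' h k (x : (M.rows N).R n' p'),
      (∀ n'' p'' h' k', (M.rows N).d₂ n' n'' p' p'' h' k' x = 0) →
      ∃ y, (M.rows N).d₂ n n' p p' h k y = x) (u : E ⟶ F) : IsNull u := by
  rw [isNull_iff_bounds Δ Δ']
  exact Bicomplex.exists_bounds_of_exact (a' - b) (b' - a)
    (fun n p hp => Dec.subsingleton_rowGroup Δ Δ' n p (Or.inl hp))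
    (fun n p hp => Dec.subsingleton_rowGroup Δ Δ' n p (Or.inr hp)) hS _ _ (closed_homRow Δ Δ' u)

end

end Factorization

/-! ### Finite direct sums and construction of decompositions -/

section

variable {A : Type u} [Category.{v} A] [Abelian A]

/-- The morphisms `ι k : X k ⟶ Z` identify `Z` with the direct sum of the `X k` for
`a ≤ k ≤ b`, and the other `X k` vanish. -/
def IsDec {X : ℤ → A} {Z : A} (a b : ℤ) (ι : ∀ k, X k ⟶ Z) : Prop :=
  ∃ pr : ∀ k, Z ⟶ X k, (∀ k, ι k ≫ pr k = 𝟙 _) ∧ (∀ k l, k ≠ l → ι k ≫ pr l = 0) ∧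
    ∑ k ∈ Finset.Icc a b, pr k ≫ ι k = 𝟙 _

namespace IsDec

variable {X X' : ℤ → A} {Z Z' : A} {a b : ℤ} {ι : ∀ k, X k ⟶ Z}

lemma of_iso (h : IsDec a b ι) (e : ∀ k, X' k ≅ X k) (f : Z ≅ Z') {ι' : ∀ k, X' k ⟶ Z'}
    (hι : ∀ k, ι' k = (e k).hom ≫ ι k ≫ f.hom) : IsDec a b ι' := by
  obtain ⟨pr, h₁, h₂, h₃⟩ := h
  obtain rfl : ι' = fun k => (e k).hom ≫ ι k ≫ f.hom := funext hι
  refine ⟨fun k => f.inv ≫ pr k ≫ (e k).inv, fun k => ?_, fun k l hkl => ?_, ?_⟩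
  · simp only [assoc, Iso.hom_inv_id_assoc]
    rw [← assoc (ι k), h₁, id_comp, Iso.hom_inv_id]
  · simp only [assoc, Iso.hom_inv_id_assoc]
    rw [← assoc (ι k), h₂ k l hkl, zero_comp, comp_zero]
  · simp only [assoc, Iso.inv_hom_id_assoc]
    have := congrArg (fun z => f.inv ≫ z ≫ f.hom) h₃
    simpa [Preadditive.sum_comp, Preadditive.comp_sum] using this

lemma units_smul (h : IsDec a b ι) (ε : ℤ → ℤˣ) : IsDec a b fun k => ε k • ι k := by
  obtain ⟨pr, h₁, h₂, h₃⟩ := h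
  refine ⟨fun k => ε k • pr k, fun k => ?_, fun k l hkl => ?_, ?_⟩
  · rw [Linear.units_smul_comp, Linear.comp_units_smul, h₁, smul_smul, Int.units_mul_self, one_smul]
  · rw [Linear.units_smul_comp, Linear.comp_units_smul, h₂ _ _ hkl, smul_zero, smul_zero]
  · rw [← h₃]
    refine Finset.sum_congr rfl fun k _ => ?_
    rw [Linear.units_smul_comp, Linear.comp_units_smul, smul_smul, Int.units_mul_self, one_smul]

lemma map (h : IsDec a b ι) {B : Type u₂} [Category.{v₂} B] [Abelian B] (F : A ⥤ B) [F.Additive] :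
    IsDec a b fun k => F.map (ι k) := by
  obtain ⟨pr, h₁, h₂, h₃⟩ := h
  refine ⟨fun k => F.map (pr k), fun k => ?_, fun k l hkl => ?_, ?_⟩
  · rw [← Functor.map_comp, h₁, CategoryTheory.Functor.map_id]
  · rw [← Functor.map_comp, h₂ _ _ hkl, Functor.map_zero]
  · simp only [← Functor.map_comp]
    rw [← Functor.map_sum, h₃, CategoryTheory.Functor.map_id]

lemma of_map {B : Type u₂} [Category.{v₂} B] [Abelian B] (F : A ⥤ B) [F.Additive]
    [F.Full] [F.Faithful] (h : IsDec a b fun k => F.map (ι k)) : IsDec a b ι := by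
  obtain ⟨pr, h₁, h₂, h₃⟩ := h
  refine ⟨fun k => F.preimage (pr k), fun k => ?_, fun k l hkl => ?_, ?_⟩
  · apply F.map_injective
    rw [Functor.map_comp, Functor.map_preimage, h₁, CategoryTheory.Functor.map_id]
  · apply F.map_injective
    rw [Functor.map_comp, Functor.map_preimage, h₂ _ _ hkl, Functor.map_zero]
  · apply F.map_injective
    rw [Functor.map_sum, CategoryTheory.Functor.map_id, ← h₃]
    simp only [Functor.map_comp, Functor.map_preimage]

lemma sigma (X : ℤ → A) [HasCoproduct X] (a b : ℤ) (hX : ∀ k, k ∉ Finset.Icc a b → IsZero (X k)) :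
    IsDec a b (Sigma.ι X) := by
  have h (k l : ℤ) (hkl : k = l) : X k = X l := by rw [hkl]
  let pr (l : ℤ) : ∐ X ⟶ X l := Sigma.desc fun k => if hkl : k = l then eqToHom (h k l hkl) else 0
  have h₁ (k : ℤ) : Sigma.ι X k ≫ pr k = 𝟙 _ := by
    refine (Limits.Sigma.ι_desc _ _).trans ?_
    simp
  have h₂ (k l : ℤ) (hkl : k ≠ l) : Sigma.ι X k ≫ pr l = 0 := by
    refine (Limits.Sigma.ι_desc _ _).trans ?_
    simp [hkl]
  refine ⟨pr, h₁, h₂, ?_⟩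
  refine Limits.Sigma.hom_ext _ _ fun k => ?_
  by_cases hk : k ∈ Finset.Icc a b
  · rw [Preadditive.comp_sum, Finset.sum_eq_single k, ← assoc, h₁, id_comp, comp_id]
    · intro l _ hl
      rw [← assoc, h₂ _ _ hl.symm, zero_comp]
    · exact fun h => (h hk).elim
  · exact (hX k hk).eq_of_src _ _

end IsDec

variable {F : A ⥤ A} [F.Additive] {w : 𝟭 A ⟶ F}

namespace Dec

open Unf

/-- A decomposition can be constructed in degrees `-1` and `0`. -/
lemma exists_of_two [F.Full] [F.Faithful] (M : UnfC w) (G : Unf F w) (a b : ℤ)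
    (ι₁ : ∀ k q, k + q = -1 → ((M.X q).X k ⟶ G.X (-1)))
    (ι₀ : ∀ k q, k + q = 0 → ((M.X q).X k ⟶ G.X 0))
    (h₁ : IsDec a b fun k => ι₁ k (-1 - k) (by lia))
    (h₀ : IsDec a b fun k => ι₀ k (0 - k) (by lia))
    (hd₁ : ∀ k q h, ι₁ k q h ≫ G.d (-1) 0 (by lia) =
      (M.d q (q + 1) rfl).f k ≫ ι₀ k (q + 1) (by lia) +
        q.negOnePow • (M.X q).d k (k + 1) ≫ ι₀ (k + 1) q (by lia))
    (hd₀ : ∀ ιp : ∀ k q, k + q = 1 → ((M.X q).X k ⟶ G.X 1),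
      (∀ k q q' h h' hq, F.map (ι₁ k q h) ≫ (G.π (-1) 1 (by lia)).hom =
        (M.πf q q' hq k).hom ≫ ιp k q' h') → ∀ k q h, ι₀ k q h ≫ G.d 0 1 (by lia) =
      (M.d q (q + 1) rfl).f k ≫ ιp k (q + 1) (by lia) +
        q.negOnePow • (M.X q).d k (k + 1) ≫ ιp (k + 1) q (by lia)) :
    ∃ Δ : Dec M G a b, (∀ k q h, Δ.ι k q (-1) h = ι₁ k q h) ∧
      (∀ k q h, Δ.ι k q 0 h = ι₀ k q h) := by
  let H (i : ℤ) : Type _ := ∀ k, (M.X (i - k)).X k ⟶ G.X i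
  let e (i j : ℤ) (h : i + 2 = j) : H i ≃ H j := Equiv.piCongrRight fun k =>
    (Functor.FullyFaithful.ofFullyFaithful F).homEquiv.trans
      (Iso.homCongr (M.πf (i - k) (j - k) (by omega) k) (G.π i j h))
  have he (i j : ℤ) (h : i + 2 = j) (x : H i) (k : ℤ) : e i j h x k =
      (M.πf (i - k) (j - k) (by omega) k).inv ≫ F.map (x k) ≫ (G.π i j h).hom := by
    simp [e, Iso.homCongr]
    rfl
  obtain ⟨x, hx₁, hx₀, hx⟩ := exists_periodic (H := fun i => { x : H i // IsDec a b x })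
    (fun i j h => (e i j h).subtypeEquiv fun x => by
      constructor
      · intro hx
        refine (hx.map F).of_iso (fun k => (M.πf (i - k) (j - k) (by omega) k).symm) (G.π i j h)
          fun k => ?_
        rw [he]
        rfl
      · intro hx
        refine IsDec.of_map F (hx.of_iso (fun k => M.πf (i - k) (j - k) (by omega) k)
          (G.π i j h).symm fun k => ?_)
        rw [he]
        simp)
    ⟨fun k => ι₁ k (-1 - k) (by omega), h₁⟩ ⟨fun k => ι₀ k (0 - k) (by omega), h₀⟩
  -- The periodic sequence `x` only records the inclusions with `q = i - k`; arbitrary triples of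
  -- indices are reduced to these.
  let ι (k q i : ℤ) (h : k + q = i) : (M.X q).X k ⟶ G.X i :=
    eqToHom (by rw [eq_sub_of_add_eq' h]) ≫ (x i).1 k
  have hι (k i : ℤ) (h) : ι k (i - k) i h = (x i).1 k := id_comp _
  choose pr₀ hpr₁ hpr₂ hpr₃ using fun i => (x i).2
  let pr (k q i : ℤ) (h : k + q = i) : G.X i ⟶ (M.X q).X k :=
    pr₀ i k ≫ eqToHom (by rw [eq_sub_of_add_eq' h])
  have hpr (k i : ℤ) (h) : pr k (i - k) i h = pr₀ i k := comp_id _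
  clear_value ι pr
  have hι₁ (k q : ℤ) (h) : ι k q (-1) h = ι₁ k q h := by
    obtain rfl := eq_sub_of_add_eq' h
    rw [hι _ _ h, hx₁]
  have hι₀ (k q : ℤ) (h) : ι k q 0 h = ι₀ k q h := by
    obtain rfl := eq_sub_of_add_eq' h
    rw [hι _ _ h, hx₀]
  have hπ : ∀ k q q' i i' h h' hq hi, F.map (ι k q i h) ≫ (G.π i i' hi).hom =
    (M.πf q q' hq k).hom ≫ ι k q' i' h' := by
    intro k q q' i i' h h' hq hi
    obtain rfl := eq_sub_of_add_eq' h
    obtain rfl := eq_sub_of_add_eq' h'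
    have := congrFun (congrArg Subtype.val (hx i i' hi)) k
    rw [hι _ _ h, hι _ _ h', ← this]
    change _ = _ ≫ e i i' hi (x i).1 k
    rw [he, Iso.hom_inv_id_assoc]
  refine ⟨⟨ι, pr, ?_, ?_, ?_, ?_, hπ⟩, hι₁, hι₀⟩
  · intro k q i h
    obtain rfl := eq_sub_of_add_eq' h
    rw [hι _ _ h, hpr _ _ h, hpr₁]
  · intro k q l q' i h h' hkl
    obtain rfl := eq_sub_of_add_eq' h
    obtain rfl := eq_sub_of_add_eq' h'
    rw [hι _ _ h, hpr _ _ h', hpr₂ _ _ _ hkl]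
  · intro i
    refine Eq.trans (Finset.sum_congr rfl fun k _ => ?_) (hpr₃ i)
    rw [hι _ _ (by omega), hpr _ _ (by omega)]
  · suffices ∀ i : ℤ, ∀ k q h j (hj : i + 1 = j), ι k q i h ≫ G.d i j hj =
        (M.d q (q + 1) rfl).f k ≫ ι k (q + 1) j (by omega) +
          q.negOnePow • (M.X q).d k (k + 1) ≫ ι (k + 1) q j (by omega) from
      fun k q i j h hj => this i k q h j hj
    refine periodic_induction ?_ ?_ ?_
    · intro k q h j hj
      obtain rfl : j = 0 := by omega
      rw [hι₁ _ _ h, hd₁, hι₀ _ _ (by omega), hι₀ _ _ (by omega)]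
    · intro k q h j hj
      obtain rfl : j = 1 := by omega
      rw [hι₀ _ _ h, hd₀ (fun k q h => ι k q 1 h)]
      intro k q q' h h' hq
      rw [← hι₁ _ _ h, hπ _ _ _ _ _ h h' hq]
    · intro i i' hi
      -- Applying the faithful functor `F` and the periods carries the relation at `i` to the
      -- relation at `i + 2`; the sign `(-1)^q` does not change.
      have key : ∀ k q q' h h' (hq : q + 2 = q') j j' (hj : i + 1 = j) (hj' : i' + 1 = j'),
          (ι k q i h ≫ G.d i j hj = (M.d q (q + 1) rfl).f k ≫ ι k (q + 1) j (by omega) +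
            q.negOnePow • (M.X q).d k (k + 1) ≫ ι (k + 1) q j (by omega)) ↔
          (ι k q' i' h' ≫ G.d i' j' hj' = (M.d q' (q' + 1) rfl).f k ≫ ι k (q' + 1) j' (by omega) +
            q'.negOnePow • (M.X q').d k (k + 1) ≫ ι (k + 1) q' j' (by omega)) := by
        intro k q q' h h' hq j j' hj hj'
        have e₁ : F.map ((M.d q (q + 1) rfl).f k) ≫ (M.πf (q + 1) (q' + 1) (by omega) k).hom =
            (M.πf q q' hq k).hom ≫ (M.d q' (q' + 1) rfl).f k :=
          HomologicalComplex.congr_hom (M.π_d q (q + 1) q' (q' + 1) rfl rfl hq (by omega)) k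
        have e₂ : F.map ((M.X q).d k (k + 1)) ≫ (M.πf q q' hq (k + 1)).hom =
            (M.πf q q' hq k).hom ≫ (M.X q').d k (k + 1) :=
          ((M.π q q' hq).hom.comm k (k + 1)).symm
        rw [← F.map_injective.eq_iff, ← cancel_mono (G.π j j' (by omega)).hom,
          ← cancel_epi (M.πf q q' hq k).hom, Functor.map_comp, assoc,
          G.π_d i j i' j' hj hj' hi (by omega), ← assoc, hπ _ _ _ _ _ h h' hq hi, assoc,
          Functor.map_add, Functor.map_comp, Functor.map_units_smul, Functor.map_comp,
          Preadditive.add_comp, Linear.units_smul_comp, assoc, assoc,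
          hπ _ _ (q' + 1) _ j' _ (by omega) (by omega) (by omega),
          hπ _ _ q' _ j' _ (by omega) (by omega) (by omega), ← assoc (F.map _), ← assoc (F.map _),
            e₁, e₂,
          Preadditive.comp_add, Linear.comp_units_smul, assoc, assoc,
          UnfC.negOnePow_two_add q q' hq]
      constructor
      · intro hP k q h j hj
        exact (key k (q - 2) q (by omega) h (by omega) (j - 2) j (by omega) hj).1 (hP _ _ _ _ _)
      · intro hP k q h j hj
        exact (key k q (q + 2) h (by omega) (by omega) j (j + 2) hj (by omega)).2 (hP _ _ _ _ _)

/-- Naturality of decompositions can be checked in degrees `-1` and `0`. -/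
lemma naturality_of_two [F.Faithful] {M M' : UnfC w} {G G' : Unf F w} {a b a' b' : ℤ}
    (Δ : Dec M G a b) (Δ' : Dec M' G' a' b') (r : M ⟶ M') (s : G ⟶ G')
    (h₁ : ∀ k q h, Δ.ι k q (-1) h ≫ s.f (-1) = (r.f q).f k ≫ Δ'.ι k q (-1) h)
    (h₀ : ∀ k q h, Δ.ι k q 0 h ≫ s.f 0 = (r.f q).f k ≫ Δ'.ι k q 0 h) (k q i h) :
    Δ.ι k q i h ≫ s.f i = (r.f q).f k ≫ Δ'.ι k q i h := by
  revert k q h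
  revert i
  refine periodic_induction h₁ h₀ ?_
  intro i i' hi
  have key : ∀ k q q' h h' (hq : q + 2 = q'),
      (Δ.ι k q i h ≫ s.f i = (r.f q).f k ≫ Δ'.ι k q i h) ↔
      (Δ.ι k q' i' h' ≫ s.f i' = (r.f q').f k ≫ Δ'.ι k q' i' h') := by
    intro k q q' h h' hq
    have e₁ : F.map ((r.f q).f k) ≫ (M'.πf q q' hq k).hom =
        (M.πf q q' hq k).hom ≫ (r.f q').f k :=
      HomologicalComplex.congr_hom (r.comm_π q q' hq) k
    rw [← F.map_injective.eq_iff, ← cancel_mono (G'.π i i' hi).hom,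
      ← cancel_epi (M.πf q q' hq k).hom, Functor.map_comp, assoc, s.comm_π i i' hi, ← assoc,
      Δ.ι_π _ _ _ _ _ h h' hq hi, assoc, Functor.map_comp, assoc, Δ'.ι_π _ _ _ _ _ h h' hq hi,
      ← assoc (F.map _), e₁, assoc]
  constructor
  · intro hP k q h
    exact (key k (q - 2) q (by lia) h (by lia)).1 (hP _ _ _)
  · intro hP k q h
    exact (key k q (q + 2) h (by lia) (by lia)).2 (hP _ _ _)

end Dec

end

/-! ### Unfolding the totalization of a bounded complex -/

namespace Factorization

variable {A : Type u} [Category.{v} A] [Abelian A] {W : Potential A}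

variable (W) in
/-- The unfolding of a complex of factorizations. -/
def unfC : CochainComplex (Factorization W) ℤ ⥤ UnfC W.w where
  obj K :=
    { X := fun q => ((comp W q).mapHomologicalComplex (ComplexShape.up ℤ)).obj K
      d := fun i j h => (NatTrans.mapHomologicalComplex (compD W i j h) (ComplexShape.up ℤ)).app K
      π := fun i j h => HomologicalComplex.Hom.isoOfComponents
        (fun k => (compπ W i j h).app (K.X k))
        (fun k l _ => ((compπ W i j h).hom.naturality (K.d k l)).symm)
      d_d := fun i j k h h' h'' => by
        ext l
        exact compD_compD (K.X l) i j k h h' h''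
      π_d := fun i j i' j' h h' hi hj => by
        ext l
        exact compπ_compD (K.X l) i j i' j' h h' hi hj }
  map f :=
    { f := fun q => ((comp W q).mapHomologicalComplex (ComplexShape.up ℤ)).map f
      comm_d := fun i j h => by
        ext k
        exact (compD W i j h).naturality (f.f k)
      comm_π := fun i j h => by
        ext k
        exact (compπ W i j h).hom.naturality (f.f k) }
  map_id K := Unf.hom_ext fun i =>
    CategoryTheory.Functor.map_id ((comp W i).mapHomologicalComplex (ComplexShape.up ℤ)) K
  map_comp f g := Unf.hom_ext fun i =>
    Functor.map_comp ((comp W i).mapHomologicalComplex (ComplexShape.up ℤ)) f g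

section

variable [HasCoproducts.{v} A] (K : CochainComplex (Factorization W) ℤ)

/-- The inclusion of a summand of the unfolded totalization, in degree `-1`. -/
noncomputable def totι₁ (k q : ℤ) (h : k + q = -1) :
    (((unfC W).obj K).X q).X k ⟶ ((unf W).obj ((totalization W).obj K)).X (-1) :=
  ((K.X k).t₁ q (-k) (by lia)).hom ≫ (twistedObj K).i₁ k ≫ ((totalization W).obj K).unfX₁.hom

/-- The inclusion of a summand of the unfolded totalization, in degree `0`. -/
noncomputable def totι₀ (k q : ℤ) (h : k + q = 0) :
    (((unfC W).obj K).X q).X k ⟶ ((unf W).obj ((totalization W).obj K)).X 0 :=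
  k.negOnePow • (eqToHom (by rw [eq_neg_of_add_eq_zero_right h]; rfl) ≫ (twistedObj K).i₀ k ≫
    ((totalization W).obj K).unfX₀.hom)

lemma totι₀_eq (k : ℤ) (h) : totι₀ K k (-k) h =
    k.negOnePow • ((twistedObj K).i₀ k ≫ ((totalization W).obj K).unfX₀.hom) := by
  unfold totι₀
  congr 1
  exact id_comp _

lemma totι₁_isDec (a b : ℤ) [K.IsStrictlyGE a] [K.IsStrictlyLE b] :
    IsDec a b fun k => totι₁ K k (-1 - k) (by lia) := by
  refine (IsDec.sigma (fun k => ((shiftBy W (-k)).obj (K.X k)).X₁) a b fun k hk => ?_).of_iso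
    (fun k => (K.X k).t₁ (-1 - k) (-k) (by lia)) ((totalization W).obj K).unfX₁ fun k => rfl
  refine (shiftBy W (-k) ⋙ ev₁ W).map_isZero ?_
  rw [Finset.mem_Icc, not_and_or, not_le, not_le] at hk
  obtain hk | hk := hk
  · exact K.isZero_of_isStrictlyGE a k hk
  · exact K.isZero_of_isStrictlyLE b k hk

lemma totι₀_isDec (a b : ℤ) [K.IsStrictlyGE a] [K.IsStrictlyLE b] :
    IsDec a b fun k => totι₀ K k (0 - k) (by lia) := by
  refine ((IsDec.sigma (fun k => ((shiftBy W (-k)).obj (K.X k)).X₀) a b fun k hk => ?_).of_iso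
    (fun k => eqToIso (by rw [zero_sub]; rfl)) ((totalization W).obj K).unfX₀
      fun k => rfl).units_smul (fun k => k.negOnePow)
  refine (shiftBy W (-k) ⋙ ev₀ W).map_isZero ?_
  rw [Finset.mem_Icc, not_and_or, not_le, not_le] at hk
  obtain hk | hk := hk
  · exact K.isZero_of_isStrictlyGE a k hk
  · exact K.isZero_of_isStrictlyLE b k hk

lemma t₁_shiftByIso (E : Factorization W) (k q : ℤ) (h : k + q = -1) (hq : q = -(k + 1)) :
    (E.t₁ q (-k) (by lia)).hom ≫ ((shiftByIso W k).hom.app E).f₁ =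
      eqToHom (by subst hq; rfl) := by
  subst hq
  exact congrArg Hom.f₁ ((shiftByIso W k).inv_hom_id_app E)

lemma shiftByIso_t₀ (E : Factorization W) (k : ℤ) :
    ((shiftByIso W k).hom.app E).f₀ ≫ (E.t₀ (-(k + 1)) (-k) (by lia)).hom =
      𝟙 ((shiftBy W (-k)).obj E).X₀ :=
  congrArg Hom.f₀ ((shiftByIso W k).hom_inv_id_app E)

lemma comp_a_eq {X Y₁ Y₀ Y₀' T₁ T₀ U₁ U₀ : A} {t : X ⟶ Y₁} {i₁ : Y₁ ⟶ T₁} {x₁ : T₁ ⟶ U₁}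
    {d : U₁ ⟶ U₀} {α : T₁ ⟶ T₀} {x₀ : T₀ ⟶ U₀} {i₀ : Y₀ ⟶ T₀} {i₀' : Y₀' ⟶ T₀} {a : Y₁ ⟶ Y₀}
    {s : Y₁ ⟶ Y₀'} {c : X ⟶ Y₀} {m : X ⟶ Y₀'} {ε η η' : ℤˣ} (h : ε * η = -1) (h' : ε * η' = 1)
    (e₁ : x₁ ≫ d = α ≫ x₀) (e₂ : i₁ ≫ α = a ≫ i₀ + s ≫ i₀') (e₃ : t ≫ a = -c) (e₄ : t ≫ s = m) :
    (t ≫ i₁ ≫ x₁) ≫ d = (ε • c) ≫ (η • (i₀ ≫ x₀)) + ε • m ≫ (η' • (i₀' ≫ x₀)) := by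
  rw [Linear.units_smul_comp, Linear.comp_units_smul, smul_smul, h, Linear.comp_units_smul,
    smul_smul, h', assoc, assoc, e₁, ← assoc i₁, e₂, Preadditive.add_comp, Preadditive.comp_add,
    assoc, assoc, ← assoc t, e₃, ← assoc t, e₄, Preadditive.neg_comp, Units.neg_smul, one_smul,
    one_smul]

lemma comp_b_eq {X Z X' T₁ U P Q : A} {F : A ⥤ A} {i₀ : X ⟶ Z} {x₀ : Z ⟶ U} {d : U ⟶ P}
    {β : Z ⟶ F.obj T₁} {b : X ⟶ F.obj Q} {x : F.obj T₁ ⟶ P} {j : F.obj Q ⟶ F.obj T₁}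
    {j' : F.obj X' ⟶ F.obj T₁} {r : X ⟶ F.obj X'} {Y Y' : A} {t : F.obj Q ⟶ Y} {ι : Y ⟶ P}
    {ι' : Y' ⟶ P} {t' : F.obj X' ⟶ Y'} {m : X ⟶ Y'} (ε : ℤˣ) (e₁ : x₀ ≫ d = β ≫ x)
    (e₂ : i₀ ≫ β = b ≫ j + r ≫ j') (e₃ : j ≫ x = t ≫ ι) (e₄ : j' ≫ x = t' ≫ ι')
    (e₅ : r ≫ t' = m) :
    (ε • (i₀ ≫ x₀)) ≫ d = (ε • (b ≫ t)) ≫ ι + ε • m ≫ ι' := by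
  rw [Linear.units_smul_comp, Linear.units_smul_comp, assoc, e₁, ← assoc, e₂,
    Preadditive.add_comp, smul_add, assoc, assoc, e₃, e₄, ← assoc r, e₅, assoc]

/-- The unfolded differential carries `(-1)^q` with `q = -(k + 1)`, while the structure maps in the
totalization carry the signs of the shifts. The factor `(-1)^k` in `totι₀` reconciles the two
conventions. -/
lemma totι₁_d (k q r : ℤ) (h : k + q = -1) (hr : q + 1 = r) :
    totι₁ K k q h ≫ ((unf W).obj ((totalization W).obj K)).d (-1) 0 (by lia) =
      (((unfC W).obj K).d q r hr).f k ≫ totι₀ K k r (by lia) +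
        q.negOnePow • (((unfC W).obj K).X q).d k (k + 1) ≫ totι₀ K (k + 1) q (by lia) := by
  obtain rfl : q = -(k + 1) := by lia
  obtain rfl : r = -k := by lia
  have sgn : (-(k + 1)).negOnePow = -k.negOnePow := by
    rw [Int.negOnePow_neg, Int.negOnePow_succ]
  have sgn' : (k + 1).negOnePow = -k.negOnePow := Int.negOnePow_succ _
  have e₁ := t₁_naturality (K.d k (k + 1)) (-(k + 1)) (-k) hr
  have e₂ := t₁_shiftByIso (K.X (k + 1)) k (-(k + 1)) h rfl
  have key : (t₁ (K.X k) (-(k + 1)) (-k) hr).hom ≫ (twistedObj K).s k =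
      ((shiftBy W (-(k + 1))).map (K.d k (k + 1))).f₀ := by
    change (t₁ (K.X k) (-(k + 1)) (-k) hr).hom ≫ ((shiftBy W (-k)).map (K.d k (k + 1))).f₁ ≫
      ((shiftByIso W k).hom.app (K.X (k + 1))).f₁ = _
    rw [← assoc, ← e₁, assoc, e₂]
    exact comp_id _
  have res := comp_a_eq (ε := (-(k + 1)).negOnePow) (η := k.negOnePow) (η' := (k + 1).negOnePow)
    (by rw [sgn, neg_mul, Int.units_mul_self]) (by rw [sgn, sgn', neg_mul_neg, Int.units_mul_self])
    ((totalization W).obj K).unfX₁_d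
    ((twistedObj K).i₁_a k) (t₁_a (K.X k) (-(k + 1)) (-k) hr) key
  rw [totι₀_eq, totι₀_eq]
  exact res

/-- The inclusions into the component of index `1` are not given by a formula of their own: they are
forced by periodicity from those of index `-1`, which is what `hιp` expresses. -/
lemma totι₀_d (ιp : ∀ k q, k + q = 1 →
      ((((unfC W).obj K).X q).X k ⟶ ((unf W).obj ((totalization W).obj K)).X 1))
    (hιp : ∀ k q q' h h' hq, W.Φ.functor.map (totι₁ K k q h) ≫
      (((unf W).obj ((totalization W).obj K)).π (-1) 1 (by omega)).hom =
        (((unfC W).obj K).πf q q' hq k).hom ≫ ιp k q' h') (k q r : ℤ) (h : k + q = 0)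
    (hr : q + 1 = r) :
    totι₀ K k q h ≫ ((unf W).obj ((totalization W).obj K)).d 0 1 (by omega) =
      (((unfC W).obj K).d q r hr).f k ≫ ιp k r (by omega) +
        q.negOnePow • (((unfC W).obj K).X q).d k (k + 1) ≫ ιp (k + 1) q (by omega) := by
  obtain rfl : q = -k := by omega
  have key (k r s : ℤ) (hr : -k + 1 = r) (hs : s + 1 = -k) :
      W.Φ.functor.map ((twistedObj K).i₁ k) ≫
        W.Φ.functor.map ((totalization W).obj K).unfX₁.hom ≫
        (((unf W).obj ((totalization W).obj K)).π (-1) 1 (by omega)).hom =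
      (t₀ (K.X k) (-k) r hr).hom ≫ ιp k r (by omega) := by
    have e := hιp k s r (by omega) (by omega) (by omega)
    have e' : (((unfC W).obj K).πf s r (by omega) k).hom =
      W.Φ.functor.map (t₁ (K.X k) s (-k) hs).hom ≫ (t₀ (K.X k) (-k) r (by omega)).hom :=
        compπ_app (K.X k) s (-k) r (by omega) hs
    have e₁ : W.Φ.functor.map (totι₁ K k s (by omega)) =
      W.Φ.functor.map (t₁ (K.X k) s (-k) hs).hom ≫ W.Φ.functor.map ((twistedObj K).i₁ k) ≫
        W.Φ.functor.map ((totalization W).obj K).unfX₁.hom :=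
      (W.Φ.functor.map_comp _ _).trans (congrArg (_ ≫ ·) (W.Φ.functor.map_comp _ _))
    refine (cancel_epi (W.Φ.functor.map (t₁ (K.X k) s (-k) hs).hom)).1 ?_
    refine Eq.trans ?_ ((congrArg (· ≫ _) e₁).symm.trans (e.trans ?_))
    · exact (congrArg (_ ≫ ·) (assoc _ _ _).symm).trans (assoc _ _ _).symm
    · exact (congrArg (· ≫ _) e').trans (assoc _ _ _)
  have e₁ := key k r (-k-1) hr (by omega)
  have e₂ := key (k + 1) (-k) (-(k + 1) - 1) (by omega) (by omega)
  have e₃ : (twistedObj K).t k ≫ (t₀ (K.X (k + 1)) (-(k + 1)) (-k) (by omega)).hom =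
      ((shiftBy W (-k)).map (K.d k (k + 1))).f₀ :=
    (assoc _ _ _).trans ((congrArg (_ ≫ ·) (shiftByIso_t₀ (K.X (k + 1)) k)).trans (comp_id _))
  have sgn : (-k).negOnePow = k.negOnePow := Int.negOnePow_neg _
  have res := comp_b_eq k.negOnePow (((totalization W).obj K).unfX₀_d)
    ((twistedObj K).i₀_b k) e₁ e₂ e₃
  rw [totι₀_eq, sgn]
  refine res.trans ?_
  rw [← sgn]
  rfl

variable (a b : ℤ) [K.IsStrictlyGE a] [K.IsStrictlyLE b]

lemma exists_decTot : ∃ Δ : Dec ((unfC W).obj K) ((unf W).obj ((totalization W).obj K)) a b,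
    (∀ k q h, Δ.ι k q (-1) h = totι₁ K k q h) ∧ (∀ k q h, Δ.ι k q 0 h = totι₀ K k q h) :=
  Dec.exists_of_two _ _ _ _ (totι₁ K) (totι₀ K) (totι₁_isDec K a b) (totι₀_isDec K a b)
    (fun k q h => totι₁_d K k q (q + 1) h rfl)
    (fun ιp hιp k q h => totι₀_d K ιp hιp k q (q + 1) h rfl)

/-- The unfolding of the totalization of a bounded complex of factorizations, as a direct sum. -/
noncomputable def decTot : Dec ((unfC W).obj K) ((unf W).obj ((totalization W).obj K)) a b :=
  (exists_decTot K a b).choose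

lemma decTot_naturality {L : CochainComplex (Factorization W) ℤ} (f : K ⟶ L) (a' b' : ℤ)
    [L.IsStrictlyGE a'] [L.IsStrictlyLE b'] (k q i h) :
    (decTot K a b).ι k q i h ≫ Unf.Hom.f ((unf W).map ((totalization W).map f)) i =
      (Unf.Hom.f ((unfC W).map f) q).f k ≫ (decTot L a' b').ι k q i h := by
  refine Dec.naturality_of_two _ _ _ _ (fun k q h => ?_) (fun k q h => ?_) k q i h
  · have e₁ := (exists_decTot K a b).choose_spec.1 k q h
    have e₂ := (exists_decTot L a' b').choose_spec.1 k q h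
    refine (congrArg (· ≫ _) e₁).trans (Eq.trans ?_ (congrArg (_ ≫ ·) e₂).symm)
    have e₃ := t₁_naturality (f.f k) q (-k) (by lia)
    have e₄ := unf_map_f₁ ((totalization W).map f)
    have e₅ : (twistedObj K).i₁ k ≫ ((totalization W).map f).f₁ =
      ((shiftBy W (-k)).map (f.f k)).f₁ ≫ (twistedObj L).i₁ k := Twisted.i₁_totMap _ _
    refine Eq.trans ?_ ((congrArg (fun z => (t₁ (K.X k) q (-k) (by omega)).hom ≫ z ≫
      ((totalization W).obj L).unfX₁.hom) e₅).trans ?_)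
    · refine (assoc _ _ _).trans (congrArg (_ ≫ ·) ((assoc _ _ _).trans ?_))
      exact (congrArg (_ ≫ ·) e₄).trans (assoc _ _ _).symm
    · refine (congrArg (_ ≫ ·) (assoc _ _ _)).trans ((assoc _ _ _).symm.trans ?_)
      exact (congrArg (· ≫ _) e₃.symm).trans (assoc _ _ _)
  · have e₁ := (exists_decTot K a b).choose_spec.2 k q h
    have e₂ := (exists_decTot L a' b').choose_spec.2 k q h
    refine (congrArg (· ≫ _) e₁).trans (Eq.trans ?_ (congrArg (_ ≫ ·) e₂).symm)
    obtain rfl : q = -k := by lia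
    have e₄ := unf_map_f₀ ((totalization W).map f)
    have e₅ : (twistedObj K).i₀ k ≫ ((totalization W).map f).f₀ =
      ((shiftBy W (-k)).map (f.f k)).f₀ ≫ (twistedObj L).i₀ k := Twisted.i₀_totMap _ _
    rw [totι₀_eq, totι₀_eq]
    refine (Linear.units_smul_comp _ _ _).trans (Eq.trans (congrArg (k.negOnePow • ·) ?_)
      (Linear.comp_units_smul _ _ _).symm)
    refine Eq.trans ?_ ((congrArg (· ≫ ((totalization W).obj L).unfX₀.hom) e₅).trans ?_)
    · exact (assoc _ _ _).trans ((congrArg (_ ≫ ·) e₄).trans (assoc _ _ _).symm)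
    · exact assoc _ _ _

end

end Factorization

/-! ### Orthogonality of co-acyclic factorizations -/

section

variable {A : Type u} [Category.{v} A] [Abelian A] {F : A ⥤ A} [F.Additive] [F.Full] [F.Faithful]
  {w : 𝟭 A ⟶ F}

/-- The double complex of families of cochains is row exact, if the source is acyclic and the target
is K-injective. -/
lemma UnfC.rows_exact (M N : UnfC w) (hM : ∀ q, (M.X q).Acyclic)
    (hN : ∀ q, CochainComplex.IsKInjective (N.X q))
    (n n' p p' : ℤ) (h : n + 1 = n') (k : p + 1 = p') (x : (M.rows N).R n' p')
    (hx : ∀ n'' p'' h' k', (M.rows N).d₂ n' n'' p' p'' h' k' x = 0) :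
    ∃ y, (M.rows N).d₂ n n' p p' h k y = x := by
  obtain ⟨y, hy⟩ := UnfC.exists_row M N n p
    (fun q q' e z => q'.negOnePow • δ p p' z = Subtype.val x q q' (by lia)) (by
      intro q q' r r' e e' hr hr' z z' hz
      have h₁ := (hz.delta p').smul _ _ (negOnePow_two_add _ _ hr')
      have h₂ := x.2 q q' r r' (by lia) (by lia) hr hr'
      rw [perRel_iff] at h₁ h₂
      rw [← h₁, ← h₂, (perEquiv M N p' hr hr').apply_eq_iff_eq]) (by
      intro q q' e
      have := hN q'
      have e' := congrFun (congrFun (congrFun (congrArg Subtype.val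
        (hx (n' + 1) (p' + 1) rfl rfl)) q) q') (by lia)
      change q'.negOnePow • δ p' (p' + 1) (Subtype.val x q q' (by lia)) = 0 at e'
      rw [smul_eq_zero_iff_eq] at e'
      obtain ⟨z, hz⟩ := IsKInjective.eq_δ_of_cocycle
        (Cocycle.mk (Subtype.val x q q' (by lia)) (p' + 1) rfl e') (hM q) p k
      refine ⟨q'.negOnePow • z, ?_⟩
      rw [δ_units_smul, smul_smul, Int.units_mul_self, one_smul]
      exact hz)
  exact ⟨y, UnfC.row_ext fun q q' e => hy q q' _⟩

end

lemma IsDec.isIso {A : Type u} [Category.{v} A] [Abelian A] {X : ℤ → A} {Z : A} {a : ℤ}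
    {ι : ∀ k, X k ⟶ Z} (h : IsDec a a ι) : IsIso (ι a) := by
  obtain ⟨pr, h₁, _, h₂⟩ := h
  rw [Finset.Icc_self, Finset.sum_singleton] at h₂
  exact ⟨pr a, h₁ a, h₂⟩

namespace Factorization

variable {A : Type u} [Category.{v} A] [Abelian A] {W : Potential A}

lemma InjComp.of_isZero {I : Factorization W} (h : IsZero I) : InjComp I := by
  rw [isZero_iff] at h
  exact ⟨h.1.injective, h.2.injective⟩

lemma InjComp.shiftBy {I : Factorization W} (hI : InjComp I) (q : ℤ) :
    InjComp ((shiftBy W q).obj I) := by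
  have h₁ (n : ℕ) : InjComp ((natPow (Factorization.T W) n).obj I) := by
    induction n with
    | zero => exact hI
    | succ n ih => exact ih.T
  have h₂ (n : ℕ) : InjComp ((natPow (Factorization.S W) n).obj I) := by
    induction n with
    | zero => exact hI
    | succ n ih => exact ih.S
  match q with
  | Int.ofNat n => exact h₁ n
  | Int.negSucc n => exact h₂ (n + 1)

lemma isKInjective_comp (K : CochainComplex (Factorization W) ℤ) (a : ℤ) [K.IsStrictlyGE a]
    (hK : ∀ n, InjComp (K.X n)) (q : ℤ) : IsKInjective (((unfC W).obj K).X q) := by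
  have (n : ℤ) : Injective ((((unfC W).obj K).X q).X n) := ((hK n).shiftBy q).2
  have : CochainComplex.IsStrictlyGE (((unfC W).obj K).X q) a :=
    inferInstanceAs (CochainComplex.IsStrictlyGE
      (((comp W q).mapHomologicalComplex (ComplexShape.up ℤ)).obj K) a)
  exact isKInjective_of_injective _ a

lemma acyclic_comp (K : CochainComplex (Factorization W) ℤ) (hK : K.Acyclic) (q : ℤ) :
    (((unfC W).obj K).X q).Acyclic := fun n =>
  (hK n).map (comp W q)

section

variable [HasCoproducts.{v} A]

/-- The totalization of a complex concentrated in degree `0`. -/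
lemma nonempty_totSingle (E : Factorization W) :
    Nonempty (E ≅ (totalization W).obj ((singleFunctor _ 0).obj E)) := by
  let K : CochainComplex (Factorization W) ℤ := (singleFunctor (Factorization W) 0).obj E
  have h₁ : IsIso ((twistedObj K).i₁ 0) := by
    refine (IsDec.sigma (fun k => ((shiftBy W (-k)).obj (K.X k)).X₁) 0 0 fun k hk => ?_).isIso
    exact (shiftBy W (-k) ⋙ ev₁ W).map_isZero
      (HomologicalComplex.isZero_single_obj_X _ _ _ _ (by simpa using hk))
  have h₀ : IsIso ((twistedObj K).i₀ 0) := by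
    refine (IsDec.sigma (fun k => ((shiftBy W (-k)).obj (K.X k)).X₀) 0 0 fun k hk => ?_).isIso
    exact (shiftBy W (-k) ⋙ ev₀ W).map_isZero
      (HomologicalComplex.isZero_single_obj_X _ _ _ _ (by simpa using hk))
  have hγ : (twistedObj K).γ 0 = 0 := by
    have : K.d 0 (0 + 1) = 0 := HomologicalComplex.single_obj_d _ _ _ _ _
    change (shiftBy W (-0)).map (K.d 0 (0 + 1)) ≫ _ = 0
    rw [this, Functor.map_zero, zero_comp]
  have hs : (twistedObj K).s 0 = 0 := congrArg Hom.f₁ hγ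
  have ht : (twistedObj K).t 0 = 0 := congrArg Hom.f₀ hγ
  let s : E ≅ (twistedObj K).X 0 := (HomologicalComplex.singleObjXSelf (ComplexShape.up ℤ) 0 E).symm
  refine ⟨s ≪≫ isoMk (F := (twistedObj K).tot) (asIso ((twistedObj K).i₁ 0))
    (asIso ((twistedObj K).i₀ 0)) ?_ ?_⟩
  · rw [asIso_hom, asIso_hom, Twisted.i₁_a, hs, zero_comp, add_zero]
  · rw [asIso_hom, asIso_hom, Twisted.i₀_b, ht, zero_comp, add_zero]

/-- The factorization `I` is regarded as the totalization of a complex in degree `0`, so both sides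
are decomposed. The rows are then built from Hom complexes of acyclic complexes into K-injective
ones and are exact, and a bounded double complex with exact rows has no cohomology. -/
lemma orth_totalization (K : CochainComplex (Factorization W) ℤ) (a b : ℤ) [K.IsStrictlyGE a]
    [K.IsStrictlyLE b] (hK : K.Acyclic) : Orth ((totalization W).obj K) := by
  intro I hI f
  obtain ⟨e⟩ := nonempty_totSingle I
  let L : CochainComplex (Factorization W) ℤ := (singleFunctor (Factorization W) 0).obj I
  have hL (n : ℤ) : InjComp (L.X n) := by
    by_cases hn : n = 0
    · subst hn
      exact hI
    · exact .of_isZero (HomologicalComplex.isZero_single_obj_X _ _ _ _ hn)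
  have key : IsNull (f ≫ e.hom) :=
    isNull_of_exact_rows (decTot K a b) (decTot L 0 0) (fun n n' p p' h k x hx =>
      UnfC.rows_exact _ _ (acyclic_comp K hK) (isKInjective_comp L 0 hL) n n' p p' h k x hx)
        (f ≫ e.hom)
  have := key.comp_right e.inv
  rwa [assoc, e.hom_inv_id, comp_id] at this

/-- Left orthogonal factorizations are closed under all operations generating the co-acyclic ones,
and contain the generators by `orth_totalization`. -/
lemma IsCoacyclic.orth {E : Factorization W} (hE : IsCoacyclic E) : Orth E := by
  induction hE with
  | tot K hK =>
    obtain ⟨a, b, _, _⟩ := hK.bounded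
    exact orth_totalization K a b ((acyclic_iff K).2 ⟨hK.exact₁, hK.exact₀⟩)
  | shift E _ ih => exact ih.T
  | unshift E _ ih => exact ih.S
  | cone g _ _ ih ih' => exact ih.cone ih' g
  | retract i r h _ ih => exact ih.retract i r h
  | sigma F _ ih => exact .sigma F ih

end

end Factorization

/-! ### Truncations and acyclic cones -/

section

variable {A : Type u} [Category.{v} A] [Abelian A]

lemma isIso_ιTruncLE_f (K : CochainComplex A ℤ) (n i : ℤ) (hi : i < n) :
    IsIso ((K.ιTruncLE n).f i) := by
  let e := ComplexShape.embeddingUpIntLE n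
  have h : e.f (n - i).natAbs = i := by
    change n - ((n - i).natAbs : ℤ) = i
    omega
  have hb : ¬ e.BoundaryLE (n - i).natAbs := fun h ↦ by
    rw [ComplexShape.boundaryLE_embeddingUpIntLE_iff, Int.natAbs_eq_zero] at h
    lia
  have : IsIso ((HomologicalComplex.πTruncGE K.op e.op).f i) :=
    (e.op.isIso_liftExtend_f_iff _ _ h).2 (K.op.isIso_restrictionToTruncGE' e.op _ (by simpa))
  exact inferInstanceAs (IsIso ((HomologicalComplex.πTruncGE K.op e.op).f i).unop)

/-- A morphism from the truncation in degrees `≤ n` to the truncation in degrees `≤ m`. -/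
lemma exists_truncLE_trans (K : CochainComplex A ℤ) (n m : ℤ) (h : n ≤ m) :
    ∃ g : K.truncLE n ⟶ K.truncLE m, g ≫ K.ιTruncLE m = K.ιTruncLE n := by
  have : CochainComplex.IsStrictlyLE (K.truncLE n) m := isStrictlyLE_of_le _ n m h
  exact ⟨inv (ιTruncLE (K.truncLE n) m) ≫ truncLEMap (K.ιTruncLE n) m, by simp⟩

lemma acyclic_truncLE (K : CochainComplex A ℤ) (hK : K.Acyclic) (n : ℤ) : (K.truncLE n).Acyclic :=
    by
  rw [K.acyclic_truncLE_iff n (n + 1)]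
  exact (K.isGE_iff _).2 fun i _ => hK i

lemma acyclic_mappingCone {K L : CochainComplex A ℤ} (φ : K ⟶ L) [QuasiIso φ] :
    (mappingCone φ).Acyclic := by
  have h : HomotopyCategory.quasiIso A (ComplexShape.up ℤ)
      ((HomotopyCategory.quotient A (ComplexShape.up ℤ)).map φ) := by
    rwa [HomotopyCategory.quotient_map_mem_quasiIso_iff, HomologicalComplex.mem_quasiIso_iff]
  rw [HomotopyCategory.quasiIso_eq_trW_subcategoryAcyclic] at h
  have := ((HomotopyCategory.subcategoryAcyclic A).trW_iff_of_distinguished _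
    (HomotopyCategory.mappingCone_triangleh_distinguished φ)).1 h
  exact (HomotopyCategory.quotient_obj_mem_subcategoryAcyclic_iff_acyclic _).1 this

end

/-! ### The telescope of an eventually constant sequence -/

section Telescope

variable {A : Type u} [Category.{v} A]

/-- The morphisms `ι k : X k ⟶ Z` exhibit `Z` as a coproduct. -/
def IsCop {J : Type*} {X : J → A} {Z : A} (ι : ∀ k, X k ⟶ Z) : Prop :=
  ∀ ⦃T : A⦄ (u : ∀ k, X k ⟶ T), ∃! m : Z ⟶ T, ∀ k, ι k ≫ m = u k

lemma IsCop.hom_ext {J : Type*} {X : J → A} {Z : A} {ι : ∀ k, X k ⟶ Z} (h : IsCop ι) {T : A}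
    {f g : Z ⟶ T} (hfg : ∀ k, ι k ≫ f = ι k ≫ g) : f = g :=
  (h fun k => ι k ≫ g).unique hfg fun _ => rfl

lemma IsCop.sigma {J : Type*} (X : J → A) [HasCoproduct X] : IsCop (Sigma.ι X) := fun T u =>
  ⟨Sigma.desc u, fun k => Limits.Sigma.ι_desc _ _, fun m hm =>
    Limits.Sigma.hom_ext _ _ fun k => (hm k).trans (Limits.Sigma.ι_desc _ _).symm⟩

variable [Abelian A]

/-- From index `N` on, the equation is solved upwards by inverting `g`, starting with the value
zero; below `N` it determines each term from the next one. -/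
lemma exists_sub_comp_eq (N : ℕ) : ∀ {x : ℕ → A} (g : ∀ n, x n ⟶ x (n + 1))
    (_ : ∀ n, N ≤ n → IsIso (g n)) {Z : A} (e : ∀ n, x n ⟶ Z),
    ∃ u : ∀ n, x n ⟶ Z, ∀ n, u n - g n ≫ u (n + 1) = e n := by
  induction N with
  | zero =>
    intro x g hg Z e
    have hg (n) : IsIso (g n) := hg n (Nat.zero_le n)
    let u (n : ℕ) : x n ⟶ Z := Nat.rec 0 (fun n z => inv (g n) ≫ (z - e n)) n
    refine ⟨u, fun n => ?_⟩
    change u n - g n ≫ inv (g n) ≫ (u n - e n) = e n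
    rw [IsIso.hom_inv_id_assoc, sub_sub_cancel]
  | succ N ih =>
    intro x g hg Z e
    obtain ⟨u, hu⟩ := ih (fun n => g (n + 1)) (fun n hn => hg _ (by lia)) (fun n => e (n + 1))
    refine ⟨fun n => Nat.casesOn n (e 0 + g 0 ≫ u 0) u, fun n => ?_⟩
    cases n with
    | zero => exact add_sub_cancel_right _ _
    | succ n => exact hu n

/-- The telescope of a sequence of coproducts, each component of which is eventually constant. -/
lemma telescope {J : Type*} {X : ℕ → A} {T S : A} {x : ℕ → J → A} {y : J → A}
    {i : ∀ n k, x n k ⟶ X n} {i' : ∀ k, y k ⟶ T} (hi : ∀ n, IsCop (i n)) (hi' : IsCop i')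
    {e : ∀ n, X n ⟶ S} (he : IsCop e) {g : ∀ n, X n ⟶ X (n + 1)} {j : ∀ n, X n ⟶ T}
    {gk : ∀ n k, x n k ⟶ x (n + 1) k} {jk : ∀ n k, x n k ⟶ y k}
    (hg : ∀ n k, i n k ≫ g n = gk n k ≫ i (n + 1) k) (hj : ∀ n k, i n k ≫ j n = jk n k ≫ i' k)
    (hgj : ∀ n k, gk n k ≫ jk (n + 1) k = jk n k) (hN : ∀ k, ∃ N, ∀ n, N ≤ n → IsIso (jk n k))
    {σ : S ⟶ S} (hσ : ∀ n, e n ≫ σ = e n - g n ≫ e (n + 1)) {p : S ⟶ T}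
    (hp : ∀ n, e n ≫ p = j n) :
    Mono σ ∧ ∃ h : σ ≫ p = 0, Nonempty (IsColimit (CokernelCofork.ofπ p h)) := by
  have hgN (k) : ∃ N, ∀ n, N ≤ n → IsIso (gk n k) := by
    obtain ⟨N, hN⟩ := hN k
    refine ⟨N, fun n hn => ?_⟩
    have := hN n hn
    have := hN (n + 1) (by lia)
    have : IsIso (gk n k ≫ jk (n + 1) k) := by rwa [hgj]
    exact IsIso.of_isIso_comp_right (gk n k) (jk (n + 1) k)
  have hS {Z : A} {f f' : S ⟶ Z} (h : ∀ n k, i n k ≫ e n ≫ f = i n k ≫ e n ≫ f') : f = f' :=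
    he.hom_ext fun n => (hi n).hom_ext (h n)
  -- A retraction of `σ` is constructed on each summand by solving the telescope equation with
  -- right-hand side the inclusions, which is possible because the transition maps of each summand
  -- are eventually invertible.
  obtain ⟨r, hr⟩ : ∃ r, σ ≫ r = 𝟙 S := by
    choose N hN using hgN
    choose u hu using fun k => exists_sub_comp_eq (N k) (fun n => gk n k) (hN k)
      (fun n => i n k ≫ e n)
    choose m hm using fun n => (hi n (fun k => u k n)).exists
    obtain ⟨r, hr⟩ := (he m).exists
    refine ⟨r, hS fun n k => ?_⟩
    rw [← assoc (e n), hσ, Preadditive.sub_comp, Preadditive.comp_sub, hr, assoc, hr, hm, ← assoc,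
      hg, assoc, hm, comp_id]
    exact hu k n
  have hm : Mono σ := by
    have : Mono (σ ≫ r) := by rw [hr]; infer_instance
    exact mono_of_mono σ r
  have h₀ : σ ≫ p = 0 := hS fun n k => by
    rw [← assoc (e n), hσ, Preadditive.sub_comp, Preadditive.comp_sub, hp, assoc, hp, hj, ← assoc,
      hg, assoc, hj, ← assoc, hgj, sub_self, comp_zero, comp_zero]
  -- Each summand of `T` is already hit by a stage at which the transition to the limit is
  -- invertible.
  have hpe : Epi p := by
    refine ⟨fun z z' hz => hi'.hom_ext fun k => ?_⟩
    obtain ⟨N, hN⟩ := hN k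
    have := hN N le_rfl
    rw [← cancel_epi (jk N k), ← assoc, ← assoc, ← hj, ← hp, assoc, assoc, assoc, assoc, hz]
  suffices ∀ {Z : A} (z : S ⟶ Z), σ ≫ z = 0 → ∃ t, p ≫ t = z from
    ⟨hm, h₀, ⟨CokernelCofork.IsColimit.ofπ' _ _ fun z hz =>
      Classical.indefiniteDescription _ (this z hz)⟩⟩
  intro Z z hz
  have hz' (n k) : i n k ≫ e n ≫ z = gk n k ≫ i (n + 1) k ≫ e (n + 1) ≫ z := by
    have := congrArg (fun t => i n k ≫ e n ≫ t) hz
    rw [← assoc (e n), hσ, Preadditive.sub_comp, Preadditive.comp_sub, comp_zero, comp_zero,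
      sub_eq_zero, assoc, ← assoc _ (g n), hg, assoc] at this
    exact this
  choose N hN using hN
  have hN' (k) := hN k (N k) le_rfl
  -- The factorization through `p` is read off on each summand at a stage where it has become
  -- constant. Since `z` kills `σ`, it agrees with `z` at all later and earlier stages.
  choose l hl using fun k => (show ∃ l, jk (N k) k ≫ l = i (N k) k ≫ e (N k) ≫ z from
    ⟨inv (jk (N k) k) ≫ i (N k) k ≫ e (N k) ≫ z, by simp⟩)
  have hl' (n k) : jk n k ≫ l k = i n k ≫ e n ≫ z := by
    have up (m) : jk (N k + m) k ≫ l k = i (N k + m) k ≫ e (N k + m) ≫ z := by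
      induction m with
      | zero => exact hl k
      | succ m ih =>
        have := hN k (N k + m) (by lia)
        have := hN k (N k + m + 1) (by lia)
        have h : IsIso (gk (N k + m) k ≫ jk (N k + m + 1) k) := by rwa [hgj]
        have := IsIso.of_isIso_comp_right (gk (N k + m) k) (jk (N k + m + 1) k)
        change jk (N k + m + 1) k ≫ l k = i (N k + m + 1) k ≫ e (N k + m + 1) ≫ z
        rw [← cancel_epi (gk (N k + m) k), ← assoc, hgj, ih, hz']
    have down (m) : ∀ n, n + m = N k → jk n k ≫ l k = i n k ≫ e n ≫ z := by
      induction m with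
      | zero =>
        rintro n rfl
        exact up 0
      | succ m ih =>
        intro n hn
        rw [← hgj, assoc, ih (n + 1) (by lia), ← hz']
    obtain h | h := le_total n (N k)
    · exact down (N k - n) n (by lia)
    · obtain ⟨m, rfl⟩ := Nat.exists_eq_add_of_le h
      exact up m
  obtain ⟨t, ht⟩ := (hi' l).exists
  refine ⟨t, hS fun n k => ?_⟩
  rw [← assoc (e n), hp, ← assoc, hj, assoc, ht, hl']

end Telescope

/-! ### Totalization commutes with mapping cones -/

namespace Factorization

variable {A : Type u} [Category.{v} A] [Abelian A] {W : Potential A}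

namespace Twisted

variable [HasCoproducts.{v} A]

lemma ext₀' (M : Twisted W) {Z : A} {f g : M.tot.X₀ ⟶ Z}
    (h : ∀ l, M.i₀ (l + 1) ≫ f = M.i₀ (l + 1) ≫ g) : f = g :=
  M.ext₀ fun l => by
    obtain ⟨l, rfl⟩ : ∃ k, l = k + 1 := ⟨l - 1, by lia⟩
    exact h l

lemma isCop_map₁ (M : Twisted W) : IsCop fun l => W.Φ.functor.map (M.i₁ l) := by
  intro T u
  let hc := isColimitCofanMkObjOfIsColimit W.Φ.functor _ _
    (coproductIsCoproduct fun l => (M.X l).X₁)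
  exact ⟨Cofan.IsColimit.desc hc u, fun l => Cofan.IsColimit.fac hc u l, fun m hm =>
    Cofan.IsColimit.hom_ext hc _ _ fun l => (hm l).trans (Cofan.IsColimit.fac hc u l).symm⟩

lemma ext_map₁' (M : Twisted W) {Z : A} {f g : W.Φ.functor.obj M.tot.X₁ ⟶ Z}
    (h : ∀ l, W.Φ.functor.map (M.i₁ (l + 1)) ≫ f = W.Φ.functor.map (M.i₁ (l + 1)) ≫ g) : f = g :=
  M.isCop_map₁.hom_ext fun l => by
    obtain ⟨l, rfl⟩ : ∃ k, l = k + 1 := ⟨l - 1, by lia⟩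
    exact h l

/-- The totalization of a degreewise cone is the cone of the totalizations. -/
lemma nonempty_tot_cone {M N P : Twisted W} (φ : M ⟶ N) (j : N ⟶ P)
    (c : ∀ l, (T W).obj (M.X (l + 1)) ⟶ P.X l) (π : ∀ l, P.X l ⟶ (T W).obj (M.X (l + 1)))
    (r : ∀ l, P.X l ⟶ N.X l)
    (hE : ∀ l, c l ≫ P.γ l + (T W).map (M.γ (l + 1) ≫ c (l + 1)) =
      (T W).map (φ.f (l + 1) ≫ j.f (l + 1)))
    (hcπ : ∀ l, c l ≫ π l = 𝟙 _) (hjπ : ∀ l, j.f l ≫ π l = 0) (hjr : ∀ l, j.f l ≫ r l = 𝟙 _)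
    (hcr : ∀ l, c l ≫ r l = 0) (hP : ∀ l, π l ≫ c l + r l ≫ j.f l = 𝟙 _) :
    Nonempty (Factorization.cone (totMap φ) ≅ P.tot) := by
  obtain ⟨c₁, c₀, π₁, π₀, hE₁, hE₀, hca, hcb, hcπ₁, hcπ₀, hcr₁, hcr₀, hjπ₁, hjπ₀, hP₁, hP₀⟩ :
      ∃ (c₁ : ∀ l, (M.X (l + 1)).X₀ ⟶ (P.X l).X₁)
        (c₀ : ∀ l, W.Φ.functor.obj (M.X (l + 1)).X₁ ⟶ (P.X l).X₀)
        (π₁ : ∀ l, (P.X l).X₁ ⟶ (M.X (l + 1)).X₀)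
        (π₀ : ∀ l, (P.X l).X₀ ⟶ W.Φ.functor.obj (M.X (l + 1)).X₁),
        (∀ l, c₁ l ≫ P.s l + M.t (l + 1) ≫ c₀ (l + 1) = (φ.f (l + 1)).f₀ ≫ (j.f (l + 1)).f₀) ∧
        (∀ l, c₀ l ≫ P.t l + W.Φ.functor.map (M.s (l + 1) ≫ c₁ (l + 1)) =
          W.Φ.functor.map ((φ.f (l + 1)).f₁ ≫ (j.f (l + 1)).f₁)) ∧
        (∀ l, c₁ l ≫ (P.X l).a = (-(M.X (l + 1)).b) ≫ c₀ l) ∧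
        (∀ l, c₀ l ≫ (P.X l).b = (-W.Φ.functor.map (M.X (l + 1)).a) ≫ W.Φ.functor.map (c₁ l)) ∧
        (∀ l, c₁ l ≫ π₁ l = 𝟙 _) ∧ (∀ l, c₀ l ≫ π₀ l = 𝟙 _) ∧
        (∀ l, c₁ l ≫ (r l).f₁ = 0) ∧ (∀ l, c₀ l ≫ (r l).f₀ = 0) ∧
        (∀ l, (j.f l).f₁ ≫ π₁ l = 0) ∧ (∀ l, (j.f l).f₀ ≫ π₀ l = 0) ∧
        (∀ l, π₁ l ≫ c₁ l + (r l).f₁ ≫ (j.f l).f₁ = 𝟙 _) ∧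
        (∀ l, π₀ l ≫ c₀ l + (r l).f₀ ≫ (j.f l).f₀ = 𝟙 _) :=
    ⟨fun l => (c l).f₁, fun l => (c l).f₀, fun l => (π l).f₁, fun l => (π l).f₀,
      fun l => congrArg Factorization.Hom.f₁ (hE l), fun l => congrArg Factorization.Hom.f₀ (hE l),
      fun l => (c l).comm_a, fun l => (c l).comm_b,
      fun l => congrArg Factorization.Hom.f₁ (hcπ l), fun l => congrArg Factorization.Hom.f₀
        (hcπ l),
      fun l => congrArg Factorization.Hom.f₁ (hcr l), fun l => congrArg Factorization.Hom.f₀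
        (hcr l),
      fun l => congrArg Factorization.Hom.f₁ (hjπ l), fun l => congrArg Factorization.Hom.f₀
        (hjπ l),
      fun l => congrArg Factorization.Hom.f₁ (hP l), fun l => congrArg Factorization.Hom.f₀ (hP l)⟩
  -- In a mapping cone the term of index `l` contains the source term of index `l + 1`; hence the
  -- shift of indices in the homotopy assembled from the maps `c`.
  obtain ⟨p, hp⟩ : ∃ p : M.tot.X₀ ⟶ P.tot.X₁, ∀ l, M.i₀ (l + 1) ≫ p = c₁ l ≫ P.i₁ l := by
    obtain ⟨y, hy⟩ := Bicomplex.Hom.RowQuasiIso.exists_shift (Q := fun l => (M.X l).X₀ ⟶ P.tot.X₁)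
      fun l => c₁ l ≫ P.i₁ l
    exact ⟨M.desc₀ y, fun l => (M.i₀_desc₀ y (l + 1)).trans (hy l)⟩
  obtain ⟨q, hq⟩ : ∃ q : W.Φ.functor.obj M.tot.X₁ ⟶ P.tot.X₀,
      ∀ l, W.Φ.functor.map (M.i₁ (l + 1)) ≫ q = c₀ l ≫ P.i₀ l := by
    obtain ⟨y, hy⟩ := Bicomplex.Hom.RowQuasiIso.exists_shift
      (Q := fun l => W.Φ.functor.obj (M.X l).X₁ ⟶ P.tot.X₀) fun l => c₀ l ≫ P.i₀ l
    obtain ⟨q, hq, _⟩ := M.isCop_map₁ y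
    exact ⟨q, fun l => (hq (l + 1)).trans (hy l)⟩
  have hp' (l : ℤ) {Z : A} (z : _ ⟶ Z) : M.i₀ (l + 1) ≫ p ≫ z = c₁ l ≫ P.i₁ l ≫ z := by
    rw [← assoc, hp, assoc]
  have hq' (l : ℤ) {Z : A} (z : _ ⟶ Z) :
      W.Φ.functor.map (M.i₁ (l + 1)) ≫ q ≫ z = c₀ l ≫ P.i₀ l ≫ z := by
    rw [← assoc, hq, assoc]
  let h : Deg M.tot P.tot := { p := p, q := q }
  -- The hypothesis `hE` is what makes `(p, q)` a null-homotopy of the composite, so that the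
  -- inclusion of the target extends to the cone.
  have key : totMap φ ≫ totMap j = h.bd := by
    refine Deg.bd_eq h ?_ ?_
    · refine M.ext_map₁' fun l => ?_
      have e := hE₀ l
      have e' := hcb l
      change W.Φ.functor.map (M.i₁ (l + 1)) ≫ W.Φ.functor.map ((totMap φ).f₁ ≫ (totMap j).f₁) =
        W.Φ.functor.map (M.i₁ (l + 1)) ≫ (W.Φ.functor.map (M.tot.a ≫ p) + q ≫ P.tot.b)
      rw [Preadditive.comp_add, ← Functor.map_comp, ← Functor.map_comp, hq', i₀_b,
        Preadditive.comp_add, i₁_a_assoc, hp, hp, reassoc_of% e', ← assoc (M.i₁ _), i₁_totMap,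
        assoc, i₁_totMap]
      have e'' := congrArg (· ≫ W.Φ.functor.map (P.i₁ (l + 1))) e
      simp only [Preadditive.add_comp, assoc, Functor.map_comp] at e''
      simp only [Functor.map_add, Functor.map_comp, Preadditive.neg_comp, assoc]
      rw [← e'']
      abel
    · refine M.ext₀' fun l => ?_
      have e := hE₁ l
      have e' := hca l
      change M.i₀ (l + 1) ≫ (totMap φ).f₀ ≫ (totMap j).f₀ =
        M.i₀ (l + 1) ≫ (p ≫ P.tot.a + M.tot.b ≫ q)
      rw [Preadditive.comp_add, hp', i₁_a, i₀_b_assoc, hq, hq, Preadditive.comp_add,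
        reassoc_of% e', ← assoc, i₀_totMap, assoc, i₀_totMap]
      have e'' := congrArg (· ≫ P.i₀ (l + 1)) e
      simp only [Preadditive.add_comp, assoc] at e''
      rw [← e'', Preadditive.neg_comp]
      abel
  let Ψ := coneDesc (totMap φ) (totMap j) h key
  have h₁ : IsIso Ψ.f₁ := by
    refine ⟨P.desc₁ fun l => π₁ l ≫ M.i₀ (l + 1) ≫ il₁ (totMap φ) +
      (r l).f₁ ≫ N.i₁ l ≫ ir₁ (totMap φ), ?_, ?_⟩
    · change cd₁ (totMap φ) p (totMap j).f₁ ≫ _ = 𝟙 _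
      refine cone_ext₁ _ (M.ext₀' fun l => ?_) (N.ext₁ fun l => ?_)
      · have e₁ := hcπ₁ l
        have e₂ := hcr₁ l
        rw [il₁_cd₁_assoc, hp', i₁_desc₁, Preadditive.comp_add, reassoc_of% e₁, reassoc_of% e₂,
          zero_comp, add_zero, comp_id]
      · have e₁ := hjπ₁ l
        have e₂ : (j.f l).f₁ ≫ (r l).f₁ = 𝟙 _ := congrArg Factorization.Hom.f₁ (hjr l)
        rw [ir₁_cd₁_assoc, ← assoc, i₁_totMap, assoc, i₁_desc₁, Preadditive.comp_add,
          reassoc_of% e₁, reassoc_of% e₂, zero_comp, zero_add, comp_id]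
    · change _ ≫ cd₁ (totMap φ) p (totMap j).f₁ = 𝟙 _
      refine P.ext₁ fun l => ?_
      have e := hP₁ l
      rw [i₁_desc₁_assoc, Preadditive.add_comp, assoc, assoc, il₁_cd₁, hp, assoc, assoc, ir₁_cd₁,
        i₁_totMap, ← assoc, ← assoc, ← Preadditive.add_comp, e, id_comp, comp_id]
  have h₀ : IsIso Ψ.f₀ := by
    refine ⟨P.desc₀ fun l => π₀ l ≫ W.Φ.functor.map (M.i₁ (l + 1)) ≫ il₀ (totMap φ) +
      (r l).f₀ ≫ N.i₀ l ≫ ir₀ (totMap φ), ?_, ?_⟩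
    · change cd₀ (totMap φ) q (totMap j).f₀ ≫ _ = 𝟙 _
      refine cone_ext₀ _ (M.ext_map₁' fun l => ?_) (N.ext₀ fun l => ?_)
      · have e₁ := hcπ₀ l
        have e₂ := hcr₀ l
        rw [il₀_cd₀_assoc, hq', i₀_desc₀, Preadditive.comp_add, reassoc_of% e₁, reassoc_of% e₂,
          zero_comp, add_zero, comp_id]
      · have e₁ := hjπ₀ l
        have e₂ : (j.f l).f₀ ≫ (r l).f₀ = 𝟙 _ := congrArg Factorization.Hom.f₀ (hjr l)
        rw [ir₀_cd₀_assoc, ← assoc, i₀_totMap, assoc, i₀_desc₀, Preadditive.comp_add,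
          reassoc_of% e₁, reassoc_of% e₂, zero_comp, zero_add, comp_id]
    · change _ ≫ cd₀ (totMap φ) q (totMap j).f₀ = 𝟙 _
      refine P.ext₀ fun l => ?_
      have e := hP₀ l
      rw [i₀_desc₀_assoc, Preadditive.add_comp, assoc, assoc, il₀_cd₀, hq, assoc, assoc, ir₀_cd₀,
        i₀_totMap, ← assoc, ← assoc, ← Preadditive.add_comp, e, id_comp, comp_id]
  have := isIso_of_components Ψ h₁ h₀
  exact ⟨asIso Ψ⟩

end Twisted

section

variable {C : Type u} [Category.{v} C] [Preadditive C] {G G' T : C ⥤ C} (σ : G ≅ G' ⋙ T)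

lemma cone_comm_aux [G'.Additive] [T.Additive] {K₁ K₂ L P₀ P₁ : C} {x : K₁ ⟶ P₀}
    {dP : P₀ ⟶ P₁} {dK : K₁ ⟶ K₂} {x' : K₂ ⟶ P₁} {f : K₁ ⟶ L} {g : L ⟶ P₁}
    (h : x ≫ dP = f ≫ g - dK ≫ x') {Z : C} {s : G'.obj K₂ ⟶ Z} {s' : Z ⟶ G'.obj K₂}
    (hs : s ≫ s' = 𝟙 _) {a : T.obj (G'.obj K₁) ⟶ G.obj K₁} {c : G.obj P₁ ⟶ T.obj (G'.obj P₁)}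
    (hσ : ∀ y : K₁ ⟶ P₁, a ≫ G.map y ≫ c = T.map (G'.map y)) :
    (a ≫ G.map x) ≫ G.map dP ≫ c + T.map ((G'.map dK ≫ s) ≫ s' ≫ G'.map x') =
      T.map (G'.map f ≫ G'.map g) := by
  rw [assoc, ← Functor.map_comp_assoc, hσ, h, assoc, reassoc_of% hs, ← Functor.map_comp,
    ← Functor.map_comp, ← Functor.map_add, ← Functor.map_add, sub_add_cancel]

lemma inv_map_comp_map_hom {K P : C} {x : K ⟶ P} {y : P ⟶ K} (h : x ≫ y = 𝟙 _) :
    (σ.inv.app K ≫ G.map x) ≫ G.map y ≫ σ.hom.app K = 𝟙 _ := by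
  rw [assoc, ← Functor.map_comp_assoc, h, CategoryTheory.Functor.map_id, id_comp,
    Iso.inv_hom_id_app]

lemma map_hom_comp_inv_map {K P : C} {x : K ⟶ P} {y : P ⟶ K} :
    (G.map y ≫ σ.hom.app K) ≫ σ.inv.app K ≫ G.map x = G.map (y ≫ x) := by
  rw [assoc, Iso.hom_inv_id_app_assoc, ← Functor.map_comp]

end

/-- The totalization of the mapping cone of a morphism of complexes is the cone of the
totalizations. -/
lemma nonempty_totalization_mappingCone [HasCoproducts.{v} A]
    {K L : CochainComplex (Factorization W) ℤ} (φ : K ⟶ L) :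
    Nonempty (Factorization.cone ((totalization W).map φ) ≅
      (totalization W).obj (mappingCone φ)) := by
  refine Twisted.nonempty_tot_cone ((twisted W).map φ) ((twisted W).map (mappingCone.inr φ))
    (fun l => (shiftByIso W l).inv.app (K.X (l + 1)) ≫ (shiftBy W (-l)).map
      ((mappingCone.inl φ).v (l + 1) l (by lia)))
    (fun l => (shiftBy W (-l)).map ((mappingCone.fst φ).1.v l (l + 1) (by lia)) ≫
      (shiftByIso W l).hom.app (K.X (l + 1)))
    (fun l => (shiftBy W (-l)).map ((mappingCone.snd φ).v l l (by lia))) ?_ ?_ ?_ ?_ ?_ ?_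
  · intro l
    exact cone_comm_aux
      (mappingCone.inl_v_d φ (l + 1) l (l + 1 + 1) (by lia) (by lia))
      ((shiftByIso W (l + 1)).hom_inv_id_app _)
      fun y => NatIso.naturality_1 (shiftByIso W l) y
  · intro l
    exact inv_map_comp_map_hom (shiftByIso W l) (mappingCone.inl_v_fst_v φ (l + 1) l (by lia))
  · intro l
    have h := (shiftBy W (-l)).congr_map (mappingCone.inr_f_fst_v φ l (l + 1) (by lia))
    rw [Functor.map_comp, Functor.map_zero] at h
    have h' := congrArg (· ≫ (shiftByIso W l).hom.app (K.X (l + 1))) h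
    exact (assoc _ _ _).symm.trans (h'.trans zero_comp)
  · intro l
    have h := (shiftBy W (-l)).congr_map (mappingCone.inr_f_snd_v φ l)
    rw [Functor.map_comp, CategoryTheory.Functor.map_id] at h
    exact h
  · intro l
    have h := (shiftBy W (-l)).congr_map (mappingCone.inl_v_snd_v φ (l + 1) l (by lia))
    rw [Functor.map_comp, Functor.map_zero] at h
    have h' := congrArg ((shiftByIso W l).inv.app (K.X (l + 1)) ≫ ·) h
    exact (assoc _ _ _).trans (h'.trans comp_zero)
  · intro l
    have h := (shiftBy W (-l)).congr_map (mappingCone.id_X φ l (l + 1) (by lia))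
    rw [Functor.map_add, CategoryTheory.Functor.map_id] at h
    have e : _ = (shiftBy W (-l)).map ((mappingCone.snd φ).v l l (by lia)) ≫
      (shiftBy W (-l)).map ((mappingCone.inr φ).f l) := (shiftBy W (-l)).map_comp _ _
    rw [e, ← map_hom_comp_inv_map (shiftByIso W l)] at h
    exact h

end Factorization

section

variable {A : Type u} [Category.{v} A] [Abelian A] {K L : CochainComplex A ℤ} (φ : K ⟶ L)

lemma isZero_mappingCone_X (n m : ℤ) (h : n + 1 = m) (hK : IsZero (K.X m)) (hL : IsZero (L.X n)) :
    IsZero ((mappingCone φ).X n) := by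
  refine (IsZero.iff_id_eq_zero _).2 ((mappingCone.id_X φ n m h).symm.trans ?_)
  exact (congrArg₂ (· + ·) ((congrArg (· ≫ _) (hK.eq_of_tgt _ 0)).trans zero_comp)
    ((congrArg (· ≫ _) (hL.eq_of_tgt _ 0)).trans zero_comp)).trans (add_zero _)

lemma isStrictlyGE_mappingCone (a : ℤ) [K.IsStrictlyGE a] [L.IsStrictlyGE a] :
    CochainComplex.IsStrictlyGE (mappingCone φ) (a - 1) :=
  (isStrictlyGE_iff _ _).2 fun n hn => isZero_mappingCone_X φ n (n + 1) rfl
    (isZero_of_isStrictlyGE _ a _ (by lia)) (isZero_of_isStrictlyGE _ a _ (by lia))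

lemma isStrictlyLE_mappingCone (a : ℤ) [K.IsStrictlyLE a] [L.IsStrictlyLE a] :
    CochainComplex.IsStrictlyLE (mappingCone φ) a :=
  (isStrictlyLE_iff _ _).2 fun n hn => isZero_mappingCone_X φ n (n + 1) rfl
    (isZero_of_isStrictlyLE _ a _ (by lia)) (isZero_of_isStrictlyLE _ a _ (by lia))

end

/-! ### Co-acyclicity for bounded below exact complexes -/

namespace Factorization

variable {A : Type u} [Category.{v} A] [Abelian A] [HasCoproducts.{v} A] {W : Potential A}

section Sigma

variable {J : Type v} (F : J → Factorization W)

/-- The inclusion of a summand of a coproduct. -/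
noncomputable def sigmaι (j : J) : F j ⟶ sigma F where
  f₁ := Sigma.ι (fun j => (F j).X₁) j
  f₀ := Sigma.ι (fun j => (F j).X₀) j
  comm_a := Limits.Sigma.ι_desc _ _
  comm_b := Limits.Sigma.ι_desc _ _

lemma exists_sigmaι_comp_eq {G : Factorization W} (u : ∀ j, F j ⟶ G) :
    ∃ m : sigma F ⟶ G, ∀ j, sigmaι F j ≫ m = u j := by
  have c₁ : IsCop fun j => (sigmaι F j).f₁ := IsCop.sigma fun j => (F j).X₁
  have c₀ : IsCop fun j => (sigmaι F j).f₀ := IsCop.sigma fun j => (F j).X₀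
  obtain ⟨d₁, h₁⟩ := (c₁ fun j => (u j).f₁).exists
  obtain ⟨d₀, h₀⟩ := (c₀ fun j => (u j).f₀).exists
  refine ⟨{ f₁ := d₁
            f₀ := d₀
            comm_a := c₁.hom_ext fun j => ?_
            comm_b := c₀.hom_ext fun j => ?_ }, fun j => hom_ext (h₁ j) (h₀ j)⟩
  · rw [← assoc, h₁, (u j).comm_a, ← assoc, (sigmaι F j).comm_a, assoc, h₀]
  · rw [← assoc, h₀, (u j).comm_b, ← assoc, (sigmaι F j).comm_b, assoc, ← Functor.map_comp, h₁]

end Sigma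

lemma isCoacyclic_totalization_of_bounded (K : CochainComplex (Factorization W) ℤ) (a b : ℤ)
    [K.IsStrictlyGE a] [K.IsStrictlyLE b] (hK : K.Acyclic) : IsCoacyclic ((totalization W).obj K) :=
  .tot K ⟨⟨a, b, inferInstance, inferInstance⟩, ((acyclic_iff K).1 hK).1, ((acyclic_iff K).1 hK).2⟩

/-- With all terms placed in degree `0`, the mapping cone of the first map is quasi-isomorphic to
the third term, so the cone of that quasi-isomorphism is a bounded exact complex. Its totalization
is co-acyclic and is the cone of a map from the cone of `S.X₁ → S.X₂` to `S.X₃`; two out of three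
concludes. -/
lemma IsCoacyclic.of_shortExact {S : ShortComplex (Factorization W)} (hS : S.ShortExact)
    (h₁ : IsCoacyclic S.X₁) (h₂ : IsCoacyclic S.X₂) : IsCoacyclic S.X₃ := by
  let S' := S.map (HomologicalComplex.single (Factorization W) (ComplexShape.up ℤ) 0)
  have hS' : S'.ShortExact := hS.map_of_exact _
  have hq := mappingCone.quasiIso_descShortComplex hS'
  have hs (E : Factorization W) (hE : IsCoacyclic E) :
      IsCoacyclic ((totalization W).obj ((singleFunctor _ 0).obj E)) := by
    obtain ⟨e⟩ := nonempty_totSingle E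
    exact hE.of_iso e.symm
  have i₁ : CochainComplex.IsStrictlyGE S'.X₁ (0 : ℤ) :=
    inferInstanceAs (CochainComplex.IsStrictlyGE ((singleFunctor _ 0).obj S.X₁) 0)
  have i₁' : CochainComplex.IsStrictlyLE S'.X₁ (0 : ℤ) :=
    inferInstanceAs (CochainComplex.IsStrictlyLE ((singleFunctor _ 0).obj S.X₁) 0)
  have i₂ : CochainComplex.IsStrictlyGE S'.X₂ (0 : ℤ) :=
    inferInstanceAs (CochainComplex.IsStrictlyGE ((singleFunctor _ 0).obj S.X₂) 0)
  have i₂' : CochainComplex.IsStrictlyLE S'.X₂ (0 : ℤ) :=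
    inferInstanceAs (CochainComplex.IsStrictlyLE ((singleFunctor _ 0).obj S.X₂) 0)
  have i₃ : CochainComplex.IsStrictlyGE S'.X₃ (0 : ℤ) :=
    inferInstanceAs (CochainComplex.IsStrictlyGE ((singleFunctor _ 0).obj S.X₃) 0)
  have i₃' : CochainComplex.IsStrictlyLE S'.X₃ (0 : ℤ) :=
    inferInstanceAs (CochainComplex.IsStrictlyLE ((singleFunctor _ 0).obj S.X₃) 0)
  have i₄ := isStrictlyGE_mappingCone S'.f 0
  have i₄' := isStrictlyLE_mappingCone S'.f 0
  have i₅ : CochainComplex.IsStrictlyGE S'.X₃ (0 - 1 : ℤ) := isStrictlyGE_of_ge _ _ 0 (by lia)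
  have i₆ := isStrictlyGE_mappingCone (mappingCone.descShortComplex S') (0 - 1)
  have i₆' := isStrictlyLE_mappingCone (mappingCone.descShortComplex S') 0
  have h := isCoacyclic_totalization_of_bounded _ (0 - 1 - 1) 0
    (acyclic_mappingCone (mappingCone.descShortComplex S'))
  obtain ⟨e⟩ := nonempty_totalization_mappingCone (mappingCone.descShortComplex S')
  obtain ⟨e'⟩ := nonempty_totalization_mappingCone S'.f
  obtain ⟨e''⟩ := nonempty_totSingle S.X₃
  have h' : IsCoacyclic ((totalization W).obj (mappingCone S'.f)) :=
    (IsCoacyclic.cone ((totalization W).map S'.f) (hs _ h₁) (hs _ h₂)).of_iso e'.symm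
  exact (IsCoacyclic.target_of_cone (h.of_iso e) h').of_iso e''

lemma IsCoacyclic.of_isColimit {E F G : Factorization W} {f : E ⟶ F} {p : F ⟶ G} (w : f ≫ p = 0)
    (hf : Mono f) (hp : IsColimit (CokernelCofork.ofπ p w)) (hE : IsCoacyclic E)
    (hF : IsCoacyclic F) : IsCoacyclic G :=
  IsCoacyclic.of_shortExact (S := ShortComplex.mk f p w)
    { exact := ShortComplex.exact_of_g_is_cokernel _ hp
      mono_f := hf
      epi_g := epi_of_isColimit_cofork hp } hE hF

/-- The truncations of `K` in degrees `≤ n` are bounded and acyclic. The telescope is a short exact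
sequence whose first two terms are the coproduct of their totalizations and whose third term is the
totalization of `K`. -/
lemma isCoacyclic_totalization (K : CochainComplex (Factorization W) ℤ) (a : ℤ)
    [K.IsStrictlyGE a] (hK : K.Acyclic) : IsCoacyclic ((totalization W).obj K) := by
  let X (n : ℕ) : CochainComplex (Factorization W) ℤ := K.truncLE n
  have hX (n : ℕ) : IsCoacyclic ((totalization W).obj (X n)) :=
    isCoacyclic_totalization_of_bounded _ a n (acyclic_truncLE K hK n)
  choose g hg using fun n : ℕ => exists_truncLE_trans K n (n + 1 : ℕ) (by lia)
  let j (n : ℕ) : X n ⟶ K := K.ιTruncLE n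
  -- The index set is lifted because co-acyclic factorizations are closed under coproducts indexed
  -- by types in the universe `v`.
  let D (n : ULift.{v} ℕ) : Factorization W := (totalization W).obj (X n.down)
  let e (n : ℕ) : (totalization W).obj (X n) ⟶ sigma D := sigmaι D ⟨n⟩
  obtain ⟨σ, hσ⟩ := exists_sigmaι_comp_eq D fun n =>
    e n.down - (totalization W).map (g n.down) ≫ e (n.down + 1)
  obtain ⟨p, hp⟩ := exists_sigmaι_comp_eq D fun n => (totalization W).map (j n.down)
  -- The truncation at `n` does not change the terms of degree strictly below `n`; at `n` itself it
  -- takes cycles, hence the bound `k + 1`.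
  have hN (k : ℤ) : ∃ N : ℕ, ∀ n : ℕ, N ≤ n →
      IsIso ((shiftBy W (-k)).map ((j n).f k)) := by
    refine ⟨(k + 1).toNat, fun n hn => ?_⟩
    have := isIso_ιTruncLE_f K n k (by lia)
    infer_instance
  have hgj (n : ℕ) (k : ℤ) : (shiftBy W (-k)).map ((g n).f k) ≫ (shiftBy W (-k)).map
    ((j (n + 1)).f k) =
      (shiftBy W (-k)).map ((j n).f k) := by
    rw [← Functor.map_comp, ← HomologicalComplex.comp_f, hg]
  have t₁ := telescope (fun n => IsCop.sigma fun k => ((twistedObj (X n)).X k).X₁)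
    (IsCop.sigma fun k => ((twistedObj K).X k).X₁) (e := fun n => (e n).f₁)
    (fun T u => by
      obtain ⟨m, hm, hm'⟩ := IsCop.sigma (fun n : ULift.{v} ℕ => (D n).X₁) fun n => u n.down
      exact ⟨m, fun n => hm ⟨n⟩, fun m' h => hm' m' fun n => h n.down⟩)
    (g := fun n => ((totalization W).map (g n)).f₁) (j := fun n => ((totalization W).map (j n)).f₁)
    (gk := fun n k => ((shiftBy W (-k)).map ((g n).f k)).f₁)
    (jk := fun n k => ((shiftBy W (-k)).map ((j n).f k)).f₁)
    (fun n k => Twisted.i₁_totMap _ _) (fun n k => Twisted.i₁_totMap _ _)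
    (fun n k => congrArg Hom.f₁ (hgj n k))
    (fun k => (hN k).imp fun N h n hn =>
      @Functor.map_isIso _ _ _ _ _ _ (ev₁ W) _ (h n hn))
    (σ := σ.f₁) (p := p.f₁) (fun n => (congrArg Hom.f₁ (hσ ⟨n⟩)).trans (sub_f₁ _ _))
      (fun n => congrArg Hom.f₁ (hp ⟨n⟩))
  have t₀ := telescope (fun n => IsCop.sigma fun k => ((twistedObj (X n)).X k).X₀)
    (IsCop.sigma fun k => ((twistedObj K).X k).X₀) (e := fun n => (e n).f₀)
    (fun T u => by
      obtain ⟨m, hm, hm'⟩ := IsCop.sigma (fun n : ULift.{v} ℕ => (D n).X₀) fun n => u n.down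
      exact ⟨m, fun n => hm ⟨n⟩, fun m' h => hm' m' fun n => h n.down⟩)
    (g := fun n => ((totalization W).map (g n)).f₀) (j := fun n => ((totalization W).map (j n)).f₀)
    (gk := fun n k => ((shiftBy W (-k)).map ((g n).f k)).f₀)
    (jk := fun n k => ((shiftBy W (-k)).map ((j n).f k)).f₀)
    (fun n k => Twisted.i₀_totMap _ _) (fun n k => Twisted.i₀_totMap _ _)
    (fun n k => congrArg Hom.f₀ (hgj n k))
    (fun k => (hN k).imp fun N h n hn =>
      @Functor.map_isIso _ _ _ _ _ _ (ev₀ W) _ (h n hn))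
    (σ := σ.f₀) (p := p.f₀) (fun n => (congrArg Hom.f₀ (hσ ⟨n⟩)).trans (sub_f₀ _ _))
      (fun n => congrArg Hom.f₀ (hp ⟨n⟩))
  obtain ⟨m₁, w₁, ⟨c₁⟩⟩ := t₁
  obtain ⟨m₀, w₀, ⟨c₀⟩⟩ := t₀
  have w : σ ≫ p = 0 := hom_ext w₁ w₀
  obtain ⟨c⟩ := nonempty_isColimit_cokernelCofork σ p w c₁ c₀
  have hD : IsCoacyclic (sigma D) := .sigma D fun n => hX n.down
  exact hD.of_isColimit w (mono_of_components σ m₁ m₀) c hD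

/-- The mapping cone is acyclic and bounded below, and its totalization is the cone of the totalized
map. Thus resolutions become isomorphisms in the co-derived category. -/
lemma isCoacyclic_cone_totalization {K L : CochainComplex (Factorization W) ℤ} (φ : K ⟶ L)
    [QuasiIso φ] (a : ℤ) [K.IsStrictlyGE a] [L.IsStrictlyGE a] :
    IsCoacyclic (Factorization.cone ((totalization W).map φ)) := by
  have := isStrictlyGE_mappingCone φ a
  obtain ⟨e⟩ := nonempty_totalization_mappingCone φ
  exact (isCoacyclic_totalization _ (a - 1) (acyclic_mappingCone φ)).of_iso e

end Factorization

/-! ### The co-derived category through injective components -/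

namespace Factorization

variable {A : Type u} [Category.{v} A] [Abelian A] [HasCoproducts.{v} A] {W : Potential A}

lemma injective_sigma_int
    (hA : ∀ (J : Type v) (I : J → A), (∀ j, Injective (I j)) → Injective (∐ I)) (I : ℤ → A)
    (hI : ∀ l, Injective (I l)) : Injective (∐ I) :=
  Injective.of_iso (Sigma.reindex Equiv.ulift I) (hA (ULift.{v} ℤ) (fun l => I l.down) fun l => hI
    _)

lemma injComp_totalization
    (hA : ∀ (J : Type v) (I : J → A), (∀ j, Injective (I j)) → Injective (∐ I))
    (K : CochainComplex (Factorization W) ℤ) (hK : ∀ n, InjComp (K.X n)) :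
    InjComp ((totalization W).obj K) :=
  ⟨injective_sigma_int hA _ fun l => ((hK l).shiftBy (-l)).1,
    injective_sigma_int hA _ fun l => ((hK l).shiftBy (-l)).2⟩

/-- The totalization of an injective resolution of `E` in the category of factorizations. The
resolution may be infinite, so closure of injectives under coproducts is what gives injective
components. -/
lemma exists_injComp_resolution [EnoughInjectives A]
    (hA : ∀ (J : Type v) (I : J → A), (∀ j, Injective (I j)) → Injective (∐ I))
    (E : Factorization W) :
    ∃ (I : Factorization W) (_ : InjComp I) (f : E ⟶ I), IsIso ((toDco W).map f) := by
  let R := InjectiveResolution.of E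
  obtain ⟨e⟩ := nonempty_totSingle E
  have := isIso_toDco_map _ (isCoacyclic_cone_totalization R.ι' 0)
  refine ⟨(totalization W).obj R.cochainComplex, injComp_totalization hA _ fun n =>
    .of_injective inferInstance, e.hom ≫ (totalization W).map R.ι', ?_⟩
  rw [Functor.map_comp]
  infer_instance

/-- Factorizations with injective components are local for the morphisms with co-acyclic cone,
because such cones are left orthogonal to them. -/
lemma bijective_Q_map (E : Factorization W) {I : Factorization W} (hI : InjComp I) :
    Function.Bijective fun f : (toHoCat W).obj E ⟶ (toHoCat W).obj I => (coQis W).Q.map f :=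
  bijective_Q_map_of_local _ (fun X Z f hf => by
    obtain ⟨g, rfl, hg⟩ := hf
    exact bijective_of_orth_cone g hg.orth hI) _

/-- Locality gives full faithfulness, and the totalized injective resolutions give essential
surjectivity. -/
lemma isEquivalence_Qinj [EnoughInjectives A]
    (hA : ∀ (J : Type v) (I : J → A), (∀ j, Injective (I j)) → Injective (∐ I)) :
    (Qinj W).IsEquivalence := by
  have h (X Y : KInj W) : Function.Bijective ((Qinj W).map : (X ⟶ Y) → _) :=
    (bijective_Q_map X.obj.as Y.property).comp
      ((hasInjectiveComponents W).fullyFaithfulι.map_bijective X Y)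
  have h₁ : (Qinj W).Faithful := ⟨fun {X Y} _ _ e => (h X Y).1 e⟩
  have h₂ : (Qinj W).Full := ⟨fun {X Y} => (h X Y).2⟩
  have h₃ : (Qinj W).EssSurj := by
    refine ⟨fun Y => ?_⟩
    obtain ⟨X, ⟨e⟩⟩ : ∃ X : HoCat W, Nonempty ((coQis W).Q.obj X ≅ Y) :=
      ⟨_, ⟨(coQis W).Q.objObjPreimageIso Y⟩⟩
    obtain ⟨I, hI, f, hf⟩ := exists_injComp_resolution hA X.as
    exact ⟨⟨(toHoCat W).obj I, hI⟩, ⟨(asIso ((toDco W).map f)).symm ≪≫ e⟩⟩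
  exact {}

end Factorization

/-! ### Total complexes and cochains -/

section

variable {A : Type u₁} [Category.{v₁} A] [Abelian A] {B : Type u₂} [Category.{v₂} B] [Abelian B]
  [HasCoproducts.{v₂} B]

lemma ιTotal_comp_d (K : HomologicalComplex₂ B (ComplexShape.up ℤ) (ComplexShape.up ℤ))
    (k n k' n' i j : ℤ) (h : k + n = i) (hk : k + 1 = k') (hn : n + 1 = n') (hj : i + 1 = j) :
    K.ιTotal (ComplexShape.up ℤ) k n i h ≫ (K.total (ComplexShape.up ℤ)).d i j =
      (K.d k k').f n ≫ K.ιTotal (ComplexShape.up ℤ) k' n j (by change k' + n = j; lia) +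
        k.negOnePow • (K.X k).d n n' ≫
          K.ιTotal (ComplexShape.up ℤ) k n' j (by change k + n' = j; lia) := by
  have hk' : (ComplexShape.up ℤ).Rel k k' := hk
  have hn' : (ComplexShape.up ℤ).Rel n n' := hn
  rw [HomologicalComplex₂.total_d, Preadditive.comp_add, HomologicalComplex₂.ι_D₁,
    HomologicalComplex₂.ι_D₂, HomologicalComplex₂.d₁_eq _ _ hk' n j (by change k' + n = j; lia),
    HomologicalComplex₂.d₂_eq _ _ k hn' j (by change k + n' = j; lia)]
  exact congrArg (· + _) (one_smul _ _)

variable (θ : A ⥤ CochainComplex B ℤ) [θ.Additive]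

/-- The functor sending a complex `X` to the total complex of the double complex `θ(X)`. -/
noncomputable abbrev totFun : CochainComplex A ℤ ⥤ CochainComplex B ℤ :=
  θ.mapHomologicalComplex (ComplexShape.up ℤ) ⋙
    HomologicalComplex₂.totalFunctor B (ComplexShape.up ℤ) (ComplexShape.up ℤ) (ComplexShape.up ℤ)

namespace totFun

variable (X Y Z : CochainComplex A ℤ)

/-- The inclusion of a summand in the total complex. -/
noncomputable def ι (k n i : ℤ) (h : k + n = i) :
    (θ.obj (X.X k)).X n ⟶ ((totFun θ).obj X).X i :=
  HomologicalComplex₂.ιTotal ((θ.mapHomologicalComplex (ComplexShape.up ℤ)).obj X)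
    (ComplexShape.up ℤ) k n i h

variable {X Y Z}

/-- The morphism out of the total complex with prescribed components. -/
noncomputable def desc {i : ℤ} {T : B} (u : ∀ k n, k + n = i → ((θ.obj (X.X k)).X n ⟶ T)) :
    ((totFun θ).obj X).X i ⟶ T :=
  HomologicalComplex₂.totalDesc ((θ.mapHomologicalComplex (ComplexShape.up ℤ)).obj X) u

@[simp] lemma ι_desc {i : ℤ} {T : B} (u : ∀ k n, k + n = i → ((θ.obj (X.X k)).X n ⟶ T))
    (k n : ℤ) (h : k + n = i) : ι θ X k n i h ≫ desc θ u = u k n h :=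
  HomologicalComplex₂.ι_totalDesc _ _ _ _ _

@[simp] lemma ι_desc_assoc {i : ℤ} {T T' : B} (u : ∀ k n, k + n = i → ((θ.obj (X.X k)).X n ⟶ T))
    (k n : ℤ) (h : k + n = i) (z : T ⟶ T') : ι θ X k n i h ≫ desc θ u ≫ z = u k n h ≫ z := by
  rw [← assoc, ι_desc]

lemma hom_ext {i : ℤ} {T : B} {f g : ((totFun θ).obj X).X i ⟶ T}
    (h : ∀ k n hk, ι θ X k n i hk ≫ f = ι θ X k n i hk ≫ g) : f = g :=
  HomologicalComplex₂.total.hom_ext _ h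

lemma ι_d (k n k' n' i j : ℤ) (h : k + n = i) (hk : k + 1 = k') (hn : n + 1 = n') (hj : i + 1 = j) :
    ι θ X k n i h ≫ ((totFun θ).obj X).d i j =
      (θ.map (X.d k k')).f n ≫ ι θ X k' n j (by lia) +
        k.negOnePow • (θ.obj (X.X k)).d n n' ≫ ι θ X k n' j (by lia) := by
  exact ιTotal_comp_d ((θ.mapHomologicalComplex (ComplexShape.up ℤ)).obj X) k n k' n' i j h hk hn hj

lemma ι_map (f : X ⟶ Y) (k n i : ℤ) (h : k + n = i) :
    ι θ X k n i h ≫ ((totFun θ).map f).f i = (θ.map (f.f k)).f n ≫ ι θ Y k n i h :=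
  HomologicalComplex₂.ιTotal_map _ _ _ _ _ _ _ _

/-- The cochain between total complexes that is induced by a cochain. -/
noncomputable def cochain {p : ℤ} (z : Cochain X Y p) :
    Cochain ((totFun θ).obj X) ((totFun θ).obj Y) p :=
  Cochain.mk fun i j h => desc θ fun k n hk =>
    (θ.map (z.v k (k + p) rfl)).f n ≫ ι θ Y (k + p) n j (by lia)

lemma ι_cochain {p : ℤ} (z : Cochain X Y p) (k n i l j : ℤ) (h : k + n = i) (hl : k + p = l)
    (hj : i + p = j) : ι θ X k n i h ≫ (cochain θ z).v i j hj =
      (θ.map (z.v k l hl)).f n ≫ ι θ Y l n j (by lia) := by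
  subst hl
  rw [cochain, Cochain.mk_v, ι_desc]

lemma cochain_ofHom (f : X ⟶ Y) :
    cochain θ (Cochain.ofHom f) = Cochain.ofHom ((totFun θ).map f) := by
  ext i
  refine hom_ext θ fun k n h => ?_
  rw [ι_cochain θ _ k n i k i h (add_zero k) (add_zero i), Cochain.ofHom_v, Cochain.ofHom_v, ι_map]

lemma cochain_comp {p q r : ℤ} (z : Cochain X Y p) (z' : Cochain Y Z q) (h : p + q = r) :
    cochain θ (z.comp z' h) = (cochain θ z).comp (cochain θ z') h := by
  ext i j hj
  refine hom_ext θ fun k n hk => ?_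
  rw [ι_cochain θ _ k n i (k + r) j hk rfl hj, Cochain.comp_v _ _ h i (i + p) j rfl (by lia),
    Cochain.comp_v _ _ h k (k + p) (k + r) rfl (by lia), ← assoc,
    ι_cochain θ _ k n i (k + p) _ hk rfl rfl, assoc,
    ι_cochain θ _ (k + p) n (i + p) (k + r) j _ (by lia) (by lia), Functor.map_comp,
    HomologicalComplex.comp_f, assoc]

lemma cochain_add {p : ℤ} (z z' : Cochain X Y p) :
    cochain θ (z + z') = cochain θ z + cochain θ z' := by
  ext i j hj
  refine hom_ext θ fun k n hk => ?_
  rw [Cochain.add_v, Preadditive.comp_add, ι_cochain θ _ k n i (k + p) j hk rfl hj,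
    ι_cochain θ _ k n i (k + p) j hk rfl hj, ι_cochain θ _ k n i (k + p) j hk rfl hj, Cochain.add_v,
    Functor.map_add, HomologicalComplex.add_f_apply, Preadditive.add_comp]

/-- Since `θ` of a component of a cochain is a morphism of complexes, it commutes with the internal
differentials; only the part of the total differential coming from `X` and `Y` survives. -/
lemma cochain_δ {p q : ℤ} (h : p + 1 = q) (z : Cochain X Y p) :
    cochain θ (δ p q z) = δ p q (cochain θ z) := by
  ext i j hj
  refine hom_ext θ fun k n hk => ?_
  rw [ι_cochain θ _ k n i (k + q) j hk rfl hj, δ_v p q h _ i j hj (i + p) (i + 1) (by lia) rfl,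
    δ_v p q h _ k (k + q) rfl (k + p) (k + 1) (by lia) rfl, Preadditive.comp_add,
    Linear.comp_units_smul, ← assoc, ι_cochain θ _ k n i (k + p) _ hk rfl rfl, assoc,
    ι_d θ (k + p) n (k + q) (n + 1) (i + p) j (by lia) (by lia) rfl (by lia), ← assoc,
    ι_d θ k n (k + 1) (n + 1) i (i + 1) hk rfl rfl rfl, Preadditive.add_comp,
    Linear.units_smul_comp, assoc, assoc, ι_cochain θ _ (k + 1) n (i + 1) (k + q) j _ (by lia)
      (by lia),
    ι_cochain θ _ k (n + 1) (i + 1) (k + p) j _ rfl (by lia)]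
  have e := (θ.map (z.v k (k + p) rfl)).comm n (n + 1)
  -- This sign makes the two internal terms cancel: the sign of the total complex depends on the
  -- first degree, which a cochain of degree `p` changes from `k` to `k + p`.
  have s : q.negOnePow * k.negOnePow = -(k + p).negOnePow := by
    rw [← Int.negOnePow_add, ← h, show p + 1 + k = k + p + 1 by lia, Int.negOnePow_succ]
  simp only [Functor.map_add, Functor.map_units_smul, Functor.map_comp, HomologicalComplex.comp_f,
    HomologicalComplex.add_f_apply, Preadditive.comp_add, Preadditive.add_comp, smul_add, smul_smul,
      s,
    Linear.comp_units_smul, Linear.units_smul_comp, HomologicalComplex.units_smul_f_apply, assoc]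
  rw [← assoc ((θ.map _).f n) ((θ.obj _).d _ _), e, assoc, Units.neg_smul]
  abel

end totFun

end

lemma bijective_of_comp_iso_eq {C : Type u} [Category.{v} C] {S : Type*} {P P' Q Q' : C}
    {f : S → (P ⟶ Q)} {g : S → (P' ⟶ Q')} (a : P ≅ P') (b : Q ≅ Q')
    (h : ∀ x, f x ≫ b.hom = a.hom ≫ g x) (hg : Function.Bijective g) : Function.Bijective f := by
  have e : f = (a.homCongr b).symm ∘ g := funext fun x => by
    change f x = a.hom ≫ g x ≫ b.inv
    rw [← assoc, ← h, assoc, Iso.hom_inv_id, comp_id]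
  rw [e]
  exact (a.homCongr b).symm.bijective.comp hg

/-! ### Comparison with the derived functor of `θ` -/

section

variable {A : Type u₁} [Category.{v₁} A] [Abelian A] {B : Type u₂} [Category.{v₂} B] [Abelian B]
  [HasCoproducts.{v₂} B] (θ : A ⥤ CochainComplex B ℤ) [θ.Additive]

namespace totFun

variable {X Y : CochainComplex A ℤ}

/-- The cocycle between total complexes that is induced by a cocycle. -/
noncomputable def cocycle {p : ℤ} (z : Cocycle X Y p) :
    Cocycle ((totFun θ).obj X) ((totFun θ).obj Y) p :=
  Cocycle.mk (cochain θ z.1) (p + 1) rfl (by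
    rw [← cochain_δ θ rfl, Cocycle.δ_eq_zero]
    ext i j hj
    refine hom_ext θ fun k n hk => ?_
    rw [ι_cochain θ _ k n i (k + (p + 1)) j hk rfl hj, Cochain.zero_v, Functor.map_zero,
      HomologicalComplex.zero_f, zero_comp, Cochain.zero_v, comp_zero])

lemma cocycle_precomp {X' : CochainComplex A ℤ} {p : ℤ} (z : Cocycle X Y p) (f : X' ⟶ X) :
    cocycle θ (z.precomp f) = (cocycle θ z).precomp ((totFun θ).map f) := by
  refine Subtype.ext ?_
  change cochain θ ((Cochain.ofHom f).comp z.1 (zero_add p)) =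
    (Cochain.ofHom _).comp (cochain θ z.1) (zero_add p)
  rw [cochain_comp, cochain_ofHom]

variable (Y) in
/-- The comparison of the shift of the total complex with the total complex of the shift. -/
noncomputable def shiftComparison (p : ℤ) : (totFun θ).obj (Y⟦p⟧) ⟶ ((totFun θ).obj Y)⟦p⟧ :=
  Cocycle.equivHomShift.symm (cocycle θ (Cocycle.equivHomShift (𝟙 (Y⟦p⟧))))

/-- The identities between `Y` and `Y⟦p⟧` are mutually inverse cochains of degrees `p` and `-p`.
Their images under `cochain` are again inverse to each other, and the first gives the comparison in
each degree. -/
instance (p : ℤ) : IsIso (shiftComparison θ Y p) := by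
  have (i : ℤ) : IsIso ((shiftComparison θ Y p).f i) := by
    let s : Cochain (Y⟦p⟧) Y p := (Cocycle.equivHomShift (𝟙 (Y⟦p⟧))).1
    let s' : Cochain Y (Y⟦p⟧) (-p) := (Cochain.ofHom (𝟙 Y)).rightShift p (-p) (by lia)
    have e₁ : s.comp s' (add_neg_cancel p) = Cochain.ofHom (𝟙 _) := by
      ext k
      rw [Cochain.comp_v _ _ _ k (k + p) k rfl (by lia)]
      simp [s, s', Cocycle.equivHomShift_apply, Cochain.rightShift_v _ _ _ _ _ _ _ _ (add_zero _),
        Cochain.rightUnshift_v _ _ _ _ _ _ _ (add_zero k)]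
      exact (id_comp _).trans (id_comp _)
    have e₂ : s'.comp s (neg_add_cancel p) = Cochain.ofHom (𝟙 _) := by
      ext k
      rw [Cochain.comp_v _ _ _ k (k - p) k (by lia) (by lia)]
      simp [s, s', Cocycle.equivHomShift_apply, Cochain.rightShift_v _ _ _ _ _ _ _ _ (add_zero _),
        Cochain.rightUnshift_v _ _ _ _ _ _ _ (add_zero _)]
    have e₁' := Cochain.congr_v (congrArg (cochain θ) e₁) i i (add_zero i)
    have e₂' := Cochain.congr_v (congrArg (cochain θ) e₂) (i + p) (i + p) (add_zero _)
    rw [cochain_comp, cochain_ofHom, Cochain.ofHom_v,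
      Cochain.comp_v _ _ _ _ (i + p) _ rfl (by lia)] at e₁'
    rw [cochain_comp, cochain_ofHom, Cochain.ofHom_v,
      Cochain.comp_v _ _ _ _ i _ (by lia) rfl] at e₂'
    have h : IsIso ((cochain θ s).v i (i + p) rfl) :=
      ⟨_, e₁'.trans (congrArg (fun f : (totFun θ).obj (Y⟦p⟧) ⟶ _ => f.f i) ((totFun θ).map_id _)),
        e₂'.trans (congrArg (fun f : (totFun θ).obj Y ⟶ _ => f.f (i + p)) ((totFun θ).map_id _))⟩
    have e : (shiftComparison θ Y p).f i = (cochain θ s).v i (i + p) rfl ≫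
        (((totFun θ).obj Y).shiftFunctorObjXIso p i (i + p) rfl).inv := by
      simp only [shiftComparison, Cocycle.equivHomShift_symm_apply]
      exact Cochain.rightShift_v _ p 0 (zero_add p) i i (add_zero i) (i + p) rfl
    rw [e]
    infer_instance
  exact HomologicalComplex.Hom.isIso_of_components _

end totFun

lemma totalHoCat_map_zero (X Y : CochainComplex A ℤ) : (totalHoCat θ).map
    (0 : (HomotopyCategory.quotient A (ComplexShape.up ℤ)).obj X ⟶
      (HomotopyCategory.quotient A (ComplexShape.up ℤ)).obj Y) = 0 := by
  rw [← Functor.map_zero (HomotopyCategory.quotient A (ComplexShape.up ℤ))]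
  refine Eq.trans (b := (HomotopyCategory.quotient B (ComplexShape.up ℤ)).map
    ((totFun θ).map (0 : X ⟶ Y))) rfl ?_
  have e : (totFun θ).map (0 : X ⟶ Y) = 0 := by
    ext i
    refine totFun.hom_ext θ fun k n hk => ?_
    rw [totFun.ι_map]
    simp
  rw [e, Functor.map_zero]
  rfl

variable [EnoughInjectives A] [HasDerivedCategory.{w₁} A] [HasDerivedCategory.{w₂} B]

/-- On bounded below complexes of injectives the unit of the right derived functor is invertible, so
`Rθ` is computed by applying `θ` to homotopy classes. Composing with the quasi-isomorphism `r` to a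
K-injective complex replaces morphisms in the derived category of the target by homotopy classes. -/
lemma bijective_totalHoCat_map (X Y : CochainComplex.Plus A)
    [hX : ∀ n, Injective (X.obj.X n)] [hY : ∀ n, Injective (Y.obj.X n)]
    (hR : Function.Bijective ((totalRightDerived θ).map :
      (DerivedCategory.Plus.Q.obj X ⟶ DerivedCategory.Plus.Q.obj Y) → _))
    {Y' : CochainComplex B ℤ} [CochainComplex.IsKInjective Y'] (r : (totFun θ).obj Y.obj ⟶ Y')
    [QuasiIso r] :
    Function.Bijective fun f : (HomotopyCategory.quotient A (ComplexShape.up ℤ)).obj X.obj ⟶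
        (HomotopyCategory.quotient A (ComplexShape.up ℤ)).obj Y.obj =>
      (totalHoCat θ).map f ≫ (HomotopyCategory.quotient B (ComplexShape.up ℤ)).map r := by
  let F := HomotopyCategory.Plus.ι A ⋙ totalHoCat θ ⋙ DerivedCategory.Qh
  let α : F ⟶ DerivedCategory.Plus.Qh ⋙ totalRightDerived θ :=
    F.totalRightDerivedUnit DerivedCategory.Plus.Qh (HomotopyCategory.Plus.quasiIso A)
  let X₁ := (HomotopyCategory.Plus.quotient A).obj X
  let Y₁ := (HomotopyCategory.Plus.quotient A).obj Y
  have : (totalRightDerived θ).IsRightDerivedFunctor α (HomotopyCategory.Plus.quasiIso A) :=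
    inferInstanceAs ((F.totalRightDerived DerivedCategory.Plus.Qh
      (HomotopyCategory.Plus.quasiIso A)).IsRightDerivedFunctor
        (F.totalRightDerivedUnit DerivedCategory.Plus.Qh _) _)
  have : IsIso (α.app X₁) :=
    have (n : ℤ) : Injective (X₁.obj.as.X n) := hX n
    inferInstance
  have : IsIso (α.app Y₁) :=
    have (n : ℤ) : Injective (Y₁.obj.as.X n) := hY n
    inferInstance
  have hY' : CochainComplex.IsKInjective Y₁.1.as := by
    obtain ⟨a, _⟩ := Y.property
    exact isKInjective_of_injective Y.obj a
  -- Morphisms to `Y₁` in the derived category are homotopy classes, and the unit identifies `F`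
  -- with `Rθ` on both objects.
  have hF : Function.Bijective (F.map : (X₁ ⟶ Y₁) → _) := by
    have h := (hR.comp (DerivedCategory.Plus.Qh_map_bijective_of_isKInjective X₁ Y₁ hY'))
    exact bijective_of_comp_iso_eq (asIso (α.app X₁)) (asIso (α.app Y₁))
      (fun f => α.naturality f) h
  let ρ := (HomotopyCategory.quotient B (ComplexShape.up ℤ)).map r
  have hρ : IsIso (DerivedCategory.Qh.map ρ) := by
    refine Localization.inverts DerivedCategory.Qh (HomotopyCategory.quasiIso B _) ρ ?_
    rwa [HomotopyCategory.quotient_map_mem_quasiIso_iff, HomologicalComplex.mem_quasiIso_iff]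
  have hB := IsKInjective.Qh_map_bijective ((totalHoCat θ).obj X₁.obj) Y'
  have hι := (HomotopyCategory.Plus.fullyFaithfulι A).map_bijective X₁ Y₁
  have key : Function.Bijective fun f : X₁ ⟶ Y₁ =>
      DerivedCategory.Qh.map ((totalHoCat θ).map ((HomotopyCategory.Plus.ι A).map f) ≫ ρ) :=
    bijective_of_comp_iso_eq (Iso.refl _) (asIso (DerivedCategory.Qh.map ρ)).symm
      (fun f => by
        refine (congrArg (· ≫ _) (DerivedCategory.Qh.map_comp _ ρ)).trans ?_
        exact (assoc _ _ _).trans ((congrArg (_ ≫ ·) (IsIso.hom_inv_id _)).trans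
          ((comp_id _).trans (id_comp _).symm))) hF
  exact (Function.Bijective.of_comp_iff' hB _).1 ((Function.Bijective.of_comp_iff _ hι).1 key)

/-- The shift of a bounded below complex. -/
abbrev plusShift (Y : CochainComplex.Plus A) (p : ℤ) : CochainComplex.Plus A :=
  ⟨Y.obj⟦p⟧, (CochainComplex.plus A).le_shift p _ Y.property⟩

section

variable (X Y : CochainComplex.Plus A) [∀ n, Injective (X.obj.X n)]
    [∀ n, Injective (Y.obj.X n)]
    {Y' : CochainComplex B ℤ} [CochainComplex.IsKInjective Y'] (r : (totFun θ).obj Y.obj ⟶ Y')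
    [QuasiIso r]

lemma bijective_map_comp_shiftComparison
    (hR : ∀ p : ℤ, Function.Bijective ((totalRightDerived θ).map :
      (DerivedCategory.Plus.Q.obj X ⟶ DerivedCategory.Plus.Q.obj (plusShift Y p)) → _)) (p : ℤ) :
        Function.Bijective
    fun f : (HomotopyCategory.quotient A (ComplexShape.up ℤ)).obj X.obj ⟶
        (HomotopyCategory.quotient A (ComplexShape.up ℤ)).obj (Y.obj⟦p⟧) =>
      (totalHoCat θ).map f ≫ (HomotopyCategory.quotient B (ComplexShape.up ℤ)).map
        (totFun.shiftComparison θ Y.obj p ≫ r⟦p⟧') := by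
  have h (n : ℤ) : Injective ((plusShift Y p).obj.X n) :=
    inferInstanceAs (Injective (Y.obj.X (n + p)))
  exact bijective_totalHoCat_map θ X (plusShift Y p) (hR p)
    (totFun.shiftComparison θ Y.obj p ≫ r⟦p⟧')

lemma totFun.equivHomShift_symm_cocycle_postcomp {p : ℤ} (z : Cocycle X.obj Y.obj p) :
    Cocycle.equivHomShift.symm ((totFun.cocycle θ z).postcomp r) =
      (totFun θ).map (Cocycle.equivHomShift.symm z) ≫
        totFun.shiftComparison θ Y.obj p ≫ r⟦p⟧' := by
  rw [Cocycle.equivHomShift_symm_postcomp, ← assoc]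
  refine congrArg (· ≫ _) ?_
  rw [shiftComparison, ← Cocycle.equivHomShift_symm_precomp, ← cocycle_precomp,
    ← Cocycle.equivHomShift_comp, comp_id, AddEquiv.apply_symm_apply]

/-- A cocycle of degree `p` is a morphism to the shift by `p`, and it is a coboundary when that
morphism is null-homotopic. This is injectivity on the cohomology of Hom complexes. -/
lemma mem_coboundaries_of_cocycle
    (hR : ∀ p : ℤ, Function.Bijective ((totalRightDerived θ).map :
      (DerivedCategory.Plus.Q.obj X ⟶ DerivedCategory.Plus.Q.obj (plusShift Y p)) → _)) {p : ℤ}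
        (z : Cocycle X.obj Y.obj p)
    (hz : (totFun.cocycle θ z).postcomp r ∈ coboundaries _ _ p) :
    z ∈ coboundaries _ _ p := by
  rw [← CohomologyClass.toHom_mk_eq_zero_iff, CohomologyClass.toHom_mk,
    totFun.equivHomShift_symm_cocycle_postcomp, Functor.map_comp] at hz
  rw [← CohomologyClass.toHom_mk_eq_zero_iff, CohomologyClass.toHom_mk]
  refine (bijective_map_comp_shiftComparison θ X Y r hR p).1 (hz.trans ?_)
  exact (((congrArg (· ≫ _) (totalHoCat_map_zero θ _ _))).trans zero_comp).symm

/-- The corresponding surjectivity: the homotopy class of the morphism defined by `y` is lifted, and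
a representative is read as a cocycle. -/
lemma exists_cocycle_sub_mem_coboundaries
    (hR : ∀ p : ℤ, Function.Bijective ((totalRightDerived θ).map :
      (DerivedCategory.Plus.Q.obj X ⟶ DerivedCategory.Plus.Q.obj (plusShift Y p)) → _)) {p : ℤ}
        (y : Cocycle ((totFun θ).obj X.obj) Y' p) :
    ∃ z : Cocycle X.obj Y.obj p,
      y - (totFun.cocycle θ z).postcomp r ∈ coboundaries _ _ p := by
  obtain ⟨f, hf⟩ := (bijective_map_comp_shiftComparison θ X Y r hR p).2
    ((HomotopyCategory.quotient B (ComplexShape.up ℤ)).map (Cocycle.equivHomShift.symm y))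
  obtain ⟨g, rfl⟩ := (HomotopyCategory.quotient A (ComplexShape.up ℤ)).map_surjective f
  refine ⟨Cocycle.equivHomShift g, ?_⟩
  rw [← CohomologyClass.toHom_mk_eq_zero_iff, CohomologyClass.toHom_mk, map_sub,
    totFun.equivHomShift_symm_cocycle_postcomp, AddEquiv.symm_apply_apply, Functor.map_sub,
    sub_eq_zero, Functor.map_comp]
  exact hf.symm

end

end

lemma IsCop.map_equivalence {A : Type u} [Category.{v} A] {B : Type u₂} [Category.{v₂} B]
    {J : Type*} {X : J → A} {Z : A} {ι : ∀ k, X k ⟶ Z} (h : IsCop ι) (Φ : A ≌ B) :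
    IsCop fun k => Φ.functor.map (ι k) := by
  intro T u
  let e {X : A} : (Φ.functor.obj X ⟶ T) ≃ (X ⟶ Φ.inverse.obj T) := Φ.toAdjunction.homEquiv X T
  have he {X Y : A} (f : X ⟶ Y) (g : Φ.functor.obj Y ⟶ T) : e (Φ.functor.map f ≫ g) = f ≫ e g :=
    Φ.toAdjunction.homEquiv_naturality_left f g
  obtain ⟨m, hm, hm'⟩ := h fun k => e (u k)
  refine ⟨e.symm m, fun k => e.injective ?_, fun m' h' => ?_⟩
  · rw [he, Equiv.apply_symm_apply, hm]
  · rw [Equiv.eq_symm_apply]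
    exact hm' _ fun k => by rw [← he, h']

lemma IsCop.isIso {A : Type u} [Category.{v} A] {J : Type*} {X X' : J → A} {Z Z' : A}
    {ι : ∀ k, X k ⟶ Z} {ι' : ∀ k, X' k ⟶ Z'} (h : IsCop ι) (h' : IsCop ι') (e : ∀ k, X k ≅ X' k)
    {f : Z ⟶ Z'} (hf : ∀ k, ι k ≫ f = (e k).hom ≫ ι' k) : IsIso f := by
  obtain ⟨g, hg, -⟩ := h' fun k => (e k).inv ≫ ι k
  refine ⟨g, h.hom_ext fun k => ?_, h'.hom_ext fun k => ?_⟩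
  · rw [← assoc, hf, assoc, hg, Iso.hom_inv_id_assoc, comp_id]
  · rw [← assoc, hg, assoc, hf, Iso.inv_hom_id_assoc, comp_id]

/-! ### Factored functors on periodic families of cochains -/

section

variable {A : Type u₁} [Category.{v₁} A] [Abelian A] {B : Type u₂} [Category.{v₂} B] [Abelian B]
  [HasCoproducts.{v₂} B] {W : Potential A} {V : Potential B}

lemma totFun.isCop (θ : A ⥤ CochainComplex B ℤ) [θ.Additive] (X : CochainComplex A ℤ) (i : ℤ) :
    IsCop fun k : ℤ => totFun.ι θ X k (i - k) i (by lia) := by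
  intro T u
  have hu (k n : ℤ) (h : k + n = i) : n = i - k := by lia
  refine ⟨desc θ fun k n h => eqToHom (by rw [hu k n h]) ≫ u k, fun k => ?_, fun m hm => ?_⟩
  · rw [ι_desc, eqToHom_refl, id_comp]
  · refine totFun.hom_ext θ fun k n h => ?_
    obtain rfl := hu k n h
    rw [ι_desc, eqToHom_refl, id_comp]
    exact hm k

namespace FactoredFunctor

variable (θ : FactoredFunctor W V)

lemma εi_naturality {X Y : A} (f : X ⟶ Y) (n : ℤ) :
    V.Φ.functor.map ((θ.θ.map f).f n) ≫ θ.εi Y n =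
      θ.εi X n ≫ (θ.θ.map (W.Φ.functor.map f)).f n :=
  HomologicalComplex.congr_hom (θ.ε.inv.naturality f) n

/-- The comparison of the total complexes for the autoequivalences. -/
noncomputable def κ (X : CochainComplex A ℤ) :
    (totFun θ.θ).obj ((W.Φ.functor.mapHomologicalComplex (ComplexShape.up ℤ)).obj X) ⟶
      (V.Φ.functor.mapHomologicalComplex (ComplexShape.up ℤ)).obj ((totFun θ.θ).obj X) where
  f i := totFun.desc θ.θ fun k n h => θ.εh (X.X k) n ≫ V.Φ.functor.map (totFun.ι θ.θ X k n i h)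
  comm' i j hij := by
    refine totFun.hom_ext θ.θ fun k n h => ?_
    have h₁ := totFun.ι_d θ.θ (X := (W.Φ.functor.mapHomologicalComplex (ComplexShape.up ℤ)).obj X)
      k n (k + 1) (n + 1) i j h rfl rfl hij
    have h₂ := totFun.ι_d θ.θ (X := X) k n (k + 1) (n + 1) i j h rfl rfl hij
    rw [totFun.ι_desc_assoc, ← assoc (totFun.ι _ _ _ _ _ _), h₁, Preadditive.add_comp,
      Linear.units_smul_comp, assoc, assoc, totFun.ι_desc, totFun.ι_desc]
    refine (assoc _ _ _).trans ?_
    refine (congrArg (_ ≫ ·) ((V.Φ.functor.map_comp _ _).symm.trans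
      ((congrArg V.Φ.functor.map h₂).trans (V.Φ.functor.map_add)))).trans ?_
    rw [Functor.map_units_smul, Functor.map_comp, Functor.map_comp]
    refine (Preadditive.comp_add _ _ _ _ _ _).trans ?_
    refine (congrArg (_ + ·) (Linear.comp_units_smul _ _ _)).trans ?_
    refine congrArg₂ (· + _ • ·) ?_ ?_
    · exact (assoc _ _ _).symm.trans ((congrArg (· ≫ _)
        (θ.ε_naturality (X.d k (k + 1)) n)).symm.trans (assoc _ _ _))
    · exact (assoc _ _ _).symm.trans ((congrArg (· ≫ _)
        (θ.ε_d (X.X k) n (n + 1))).symm.trans (assoc _ _ _))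

lemma ι_κ (X : CochainComplex A ℤ) (k n i : ℤ) (h : k + n = i) :
    totFun.ι θ.θ ((W.Φ.functor.mapHomologicalComplex (ComplexShape.up ℤ)).obj X) k n i h ≫
      (θ.κ X).f i = θ.εh (X.X k) n ≫ V.Φ.functor.map (totFun.ι θ.θ X k n i h) :=
  totFun.ι_desc θ.θ (X := (W.Φ.functor.mapHomologicalComplex (ComplexShape.up ℤ)).obj X)
    (fun k n h => θ.εh (X.X k) n ≫ V.Φ.functor.map (totFun.ι θ.θ X k n i h)) k n h

instance (X : CochainComplex A ℤ) : IsIso (θ.κ X) := by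
  have (i : ℤ) : IsIso ((θ.κ X).f i) :=
    (totFun.isCop θ.θ ((W.Φ.functor.mapHomologicalComplex (ComplexShape.up ℤ)).obj X) i).isIso
      ((totFun.isCop θ.θ X i).map_equivalence V.Φ)
      (fun k => ⟨θ.εh (X.X k) (i - k), θ.εi (X.X k) (i - k), θ.ε_hom_inv _ _, θ.ε_inv_hom _ _⟩)
      fun k => θ.ι_κ X k (i - k) i (by lia)
  exact HomologicalComplex.Hom.isIso_of_components _

lemma map_ι_inv_κ (X : CochainComplex A ℤ) (k n i : ℤ) (h : k + n = i) :
    V.Φ.functor.map (totFun.ι θ.θ X k n i h) ≫ (inv (θ.κ X)).f i = θ.εi (X.X k) n ≫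
      totFun.ι θ.θ ((W.Φ.functor.mapHomologicalComplex (ComplexShape.up ℤ)).obj X) k n i h := by
  have e : (θ.κ X).f i ≫ (inv (θ.κ X)).f i = 𝟙 _ := by
    rw [← HomologicalComplex.comp_f, IsIso.hom_inv_id, HomologicalComplex.id_f]
  have abs {a b c d : B} {f : a ⟶ b} {g : b ⟶ c} {g' : c ⟶ b} {e : a ⟶ d} {e' : d ⟶ a}
      {f' : d ⟶ c} (h₁ : f ≫ g = e ≫ f') (h₂ : g ≫ g' = 𝟙 _) (h₃ : e' ≫ e = 𝟙 _) :
      f' ≫ g' = e' ≫ f := by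
    rw [← id_comp f', ← h₃, assoc, assoc, ← assoc e, ← h₁, assoc, h₂, comp_id]
  exact abs (θ.ι_κ X k n i h) e (θ.ε_inv_hom _ _)

lemma κ_naturality {X Y : CochainComplex A ℤ} (f : X ⟶ Y) :
    (totFun θ.θ).map ((W.Φ.functor.mapHomologicalComplex (ComplexShape.up ℤ)).map f) ≫ θ.κ Y =
      θ.κ X ≫ (V.Φ.functor.mapHomologicalComplex (ComplexShape.up ℤ)).map
        ((totFun θ.θ).map f) := by
  ext i
  refine totFun.hom_ext θ.θ fun k n h => ?_
  have h₁ := totFun.ι_map θ.θ ((W.Φ.functor.mapHomologicalComplex (ComplexShape.up ℤ)).map f)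
    k n i h
  have h₂ := totFun.ι_map θ.θ f k n i h
  have h₃ : V.Φ.functor.map (totFun.ι θ.θ X k n i h) ≫
      V.Φ.functor.map (((totFun θ.θ).map f).f i) =
        V.Φ.functor.map ((θ.θ.map (f.f k)).f n) ≫ V.Φ.functor.map (totFun.ι θ.θ Y k n i h) := by
    rw [← Functor.map_comp, h₂, Functor.map_comp]
  have abs {a b c d b' c' e x : B} {f₁ : a ⟶ b} {f₂ : b ⟶ c} {f₃ : c ⟶ d} {g₁ : a ⟶ x}
      {g₂ : x ⟶ c} {p : x ⟶ b'} {q : b' ⟶ d} {f₄ : b ⟶ c'} {f₅ : c' ⟶ d} {r : a ⟶ e} {s : e ⟶ c'}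
      {t : e ⟶ b'} (h₁ : f₁ ≫ f₂ = g₁ ≫ g₂) (h₂ : g₂ ≫ f₃ = p ≫ q) (h₃ : f₁ ≫ f₄ = r ≫ s)
      (h₄ : s ≫ f₅ = t ≫ q) (h₅ : g₁ ≫ p = r ≫ t) : f₁ ≫ f₂ ≫ f₃ = f₁ ≫ f₄ ≫ f₅ := by
    rw [← assoc, h₁, assoc, h₂, ← assoc, h₅, ← assoc f₁, h₃, assoc, assoc, h₄]
  exact abs h₁ (θ.ι_κ Y k n i h) (θ.ι_κ X k n i h) h₃ (θ.ε_naturality (f.f k) n)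

/-- The compatibility of `ε` with the potentials passes to total complexes summand by summand; it
yields the relation `d ∘ d = v` for `totUnf`. -/
lemma map_complexW_κ (X : CochainComplex A ℤ) :
    (totFun θ.θ).map ((complexW W.w).app X) ≫ θ.κ X = (complexW V.w).app ((totFun θ.θ).obj X) := by
  ext i
  refine totFun.hom_ext θ.θ fun k n h => ?_
  have h₁ := totFun.ι_map θ.θ ((complexW W.w).app X) k n i h
  rw [HomologicalComplex.comp_f, ← assoc, h₁, assoc]
  refine (congrArg (_ ≫ ·) (θ.ι_κ X k n i h)).trans ?_
  refine Eq.trans ?_ (V.w.naturality (totFun.ι θ.θ X k n i h)).symm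
  exact (assoc _ _ _).symm.trans (congrArg (· ≫ _) (θ.compat' (X.X k) n))

/-- The unfolded factorization of total complexes that is induced by an unfolded factorization of
complexes. -/
noncomputable abbrev totUnf (M : UnfC W.w) : UnfC V.w where
  X q := (totFun θ.θ).obj (M.X q)
  d i j h := (totFun θ.θ).map (M.d i j h)
  π i j h := (asIso (θ.κ (M.X i))).symm ≪≫ (totFun θ.θ).mapIso (M.π i j h)
  d_d i j k h h' h'' := by
    rw [← θ.map_complexW_κ, Iso.trans_hom, Iso.symm_hom, asIso_inv, assoc, IsIso.hom_inv_id_assoc,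
      Functor.mapIso_hom, ← Functor.map_comp, ← Functor.map_comp, M.d_d]
  π_d i j i' j' h h' hi hj := by
    rw [Iso.trans_hom, Iso.symm_hom, asIso_inv, Iso.trans_hom, Iso.symm_hom, asIso_inv, assoc,
      Functor.mapIso_hom, Functor.mapIso_hom, ← Functor.map_comp, ← M.π_d i j i' j' h h' hi hj,
      Functor.map_comp, ← assoc, ← assoc]
    refine congrArg (· ≫ _) ?_
    rw [IsIso.comp_inv_eq, assoc, κ_naturality, IsIso.inv_hom_id_assoc]

lemma map_ι_totUnf_πf (M : UnfC W.w) (q q' : ℤ) (hq : q + 2 = q') (k n i : ℤ) (h : k + n = i) :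
    V.Φ.functor.map (totFun.ι θ.θ (M.X q) k n i h) ≫ ((θ.totUnf M).πf q q' hq i).hom =
      θ.εi ((M.X q).X k) n ≫ (θ.θ.map (M.πf q q' hq k).hom).f n ≫
        totFun.ι θ.θ (M.X q') k n i h := by
  have e : ((θ.totUnf M).πf q q' hq i).hom =
    (inv (θ.κ (M.X q))).f i ≫ ((totFun θ.θ).map (M.π q q' hq).hom).f i := rfl
  have h₁ := totFun.ι_map θ.θ (M.π q q' hq).hom k n i h
  refine (congrArg (_ ≫ ·) e).trans ((assoc _ _ _).symm.trans ?_)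
  refine (congrArg (· ≫ _) (θ.map_ι_inv_κ (M.X q) k n i h)).trans ((assoc _ _ _).trans ?_)
  exact congrArg (_ ≫ ·) h₁

lemma hom_ext_map {X : CochainComplex A ℤ} {i : ℤ} {T : B}
    {f g : V.Φ.functor.obj (((totFun θ.θ).obj X).X i) ⟶ T}
    (h : ∀ k n hk, V.Φ.functor.map (totFun.ι θ.θ X k n i hk) ≫ f =
      V.Φ.functor.map (totFun.ι θ.θ X k n i hk) ≫ g) : f = g :=
  ((totFun.isCop θ.θ X i).map_equivalence V.Φ).hom_ext fun k => h k (i - k) _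

/-- Periods of total complexes are built from `ε` and the periods of the original complexes, so the
claim reduces on each summand to the naturality of `ε` and the periodicity of `z`. -/
lemma perRel_cochain {M N : UnfC W.w} {q q' r r' p : ℤ} {h : q + 2 = r} {h' : q' + 2 = r'}
    {z : Cochain (M.X q) (N.X q') p} {z' : Cochain (M.X r) (N.X r') p}
    (hz : UnfC.PerRel h h' z z') : UnfC.PerRel (M := θ.totUnf M) (N := θ.totUnf N) h h'
      (totFun.cochain θ.θ z) (totFun.cochain θ.θ z') := by
  rw [UnfC.perRel_iff_v] at hz
  refine (UnfC.perRel_iff_v (M := θ.totUnf M) (N := θ.totUnf N) h h' _ _).2 fun i j hij => ?_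
  refine θ.hom_ext_map fun k n hk => ?_
  have e₁ := totFun.ι_cochain θ.θ z k n i (k + p) j hk rfl hij
  have e₁' := totFun.ι_cochain θ.θ z' k n i (k + p) j hk rfl hij
  have e₂ := θ.map_ι_totUnf_πf M q r h k n i hk
  have e₃ := θ.map_ι_totUnf_πf N q' r' h' (k + p) n j (by lia)
  have e₄ := congrArg (fun f => (θ.θ.map f).f n) (hz k (k + p) rfl)
  have e₅ := θ.εi_naturality (z.v k (k + p) rfl) n
  simp only [Functor.map_comp, HomologicalComplex.comp_f] at e₄
  have abs {a b c d d' x x' x'' y y' : B} {f₁ : a ⟶ b} {f₂ : b ⟶ c} {f₃ : c ⟶ d} {g₁ : a ⟶ x}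
      {g₂ : x ⟶ c} {g₃ : x ⟶ x'} {g₄ : x' ⟶ x''} {g₅ : x'' ⟶ d} {k₁ : a ⟶ y} {k₂ : y ⟶ x'}
      {p₁ : b ⟶ d'} {p₂ : d' ⟶ d} {p₃ : y ⟶ y'} {p₄ : y' ⟶ d'} {p₅ : y' ⟶ x''}
      (h₁ : f₁ ≫ f₂ = g₁ ≫ g₂) (h₂ : g₂ ≫ f₃ = g₃ ≫ g₄ ≫ g₅) (h₃ : g₁ ≫ g₃ = k₁ ≫ k₂)
      (h₄ : k₂ ≫ g₄ = p₃ ≫ p₅) (h₅ : f₁ ≫ p₁ = k₁ ≫ p₃ ≫ p₄) (h₆ : p₄ ≫ p₂ = p₅ ≫ g₅) :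
      f₁ ≫ f₂ ≫ f₃ = f₁ ≫ p₁ ≫ p₂ := by
    rw [← assoc, h₁, assoc, h₂, ← assoc g₁, h₃, assoc, ← assoc k₂, h₄, ← assoc f₁, h₅, assoc, assoc,
      assoc, h₆]
  exact abs ((V.Φ.functor.map_comp _ _).symm.trans ((congrArg V.Φ.functor.map e₁).trans
    (V.Φ.functor.map_comp _ _))) e₃ e₅ e₄ e₂ e₁'

end FactoredFunctor

lemma UnfC.PerRel.comp_hom {M N N' : UnfC W.w} {q q' r r' p : ℤ} {h : q + 2 = r} {h' : q' + 2 = r'}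
    {z : Cochain (M.X q) (N.X q') p} {z' : Cochain (M.X r) (N.X r') p}
    (hz : UnfC.PerRel h h' z z') (f : N ⟶ N') : UnfC.PerRel h h'
      (z.comp (Cochain.ofHom (f.f q')) (add_zero p))
      (z'.comp (Cochain.ofHom (f.f r')) (add_zero p)) := by
  unfold UnfC.PerRel at *
  rw [Cochain.map_comp, Cochain.map_ofHom, Cochain.comp_assoc_of_third_is_zero_cochain,
    ← Cochain.ofHom_comp, f.comm_π, Cochain.ofHom_comp,
    ← Cochain.comp_assoc_of_third_is_zero_cochain, hz, Cochain.comp_assoc_of_first_is_zero_cochain]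

namespace totFun

variable (θ : A ⥤ CochainComplex B ℤ) [θ.Additive] {X Y : CochainComplex A ℤ}

lemma cochain_neg {p : ℤ} (z : Cochain X Y p) : cochain θ (-z) = -cochain θ z :=
  (AddMonoidHom.mk' (cochain θ (X := X) (Y := Y) (p := p)) (cochain_add θ)).map_neg z

lemma cochain_sub {p : ℤ} (z z' : Cochain X Y p) :
    cochain θ (z - z') = cochain θ z - cochain θ z' := by
  rw [sub_eq_add_neg, cochain_add, cochain_neg, ← sub_eq_add_neg]

lemma cochain_units_smul {p : ℤ} (e : ℤˣ) (z : Cochain X Y p) :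
    cochain θ (e • z) = e • cochain θ z := by
  obtain rfl | rfl := Int.units_eq_one_or e
  · rw [one_smul, one_smul]
  · rw [Units.neg_smul, one_smul, cochain_neg, Units.neg_smul, one_smul]

end totFun

namespace FactoredFunctor

variable (θ : FactoredFunctor W V) {M N P : UnfC W.w}

/-- The action on cochains. -/
noncomputable def coch {q q' p : ℤ} (z : Cochain (M.X q) (N.X q') p) :
    Cochain ((θ.totUnf M).X q) ((θ.totUnf N).X q') p :=
  totFun.cochain θ.θ z

section

variable {q q' q'' p p' p'' : ℤ}

lemma coch_add (x y : Cochain (M.X q) (N.X q') p) : θ.coch (x + y) = θ.coch x + θ.coch y :=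
  totFun.cochain_add _ _ _

lemma coch_sub (x y : Cochain (M.X q) (N.X q') p) : θ.coch (x - y) = θ.coch x - θ.coch y :=
  totFun.cochain_sub _ _ _

lemma coch_units_smul (e : ℤˣ) (x : Cochain (M.X q) (N.X q') p) :
    θ.coch (e • x) = e • θ.coch x :=
  totFun.cochain_units_smul _ _ _

lemma coch_comp (x : Cochain (M.X q) (N.X q') p) (y : Cochain (N.X q') (P.X q'') p')
    (h : p + p' = p'') : θ.coch (x.comp y h) = (θ.coch x).comp (θ.coch y) h :=
  totFun.cochain_comp _ _ _ _

lemma coch_d (h : q + 1 = q') :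
    θ.coch (Cochain.ofHom (M.d q q' h)) = Cochain.ofHom ((θ.totUnf M).d q q' h) :=
  totFun.cochain_ofHom _ _

lemma coch_δ (h : p + 1 = p') (z : Cochain (M.X q) (N.X q') p) :
    θ.coch (δ p p' z) = δ p p' (θ.coch z) :=
  totFun.cochain_δ _ h z

end

variable {N' : UnfC V.w} (r : θ.totUnf N ⟶ N')

/-- The map on families of cochains. -/
noncomputable def rowMapFun (n p : ℤ) (z : M.rowGroup N n p) : (θ.totUnf M).rowGroup N' n p :=
  ⟨fun q q' e => (θ.coch (z.1 q q' e)).comp (Cochain.ofHom (r.f q')) (add_zero p),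
    fun q q' s s' e e' h h' => (θ.perRel_cochain (z.2 q q' s s' e e' h h')).comp_hom r⟩

/-- The morphism of double complexes of periodic families that is induced by a factored functor. -/
noncomputable def rowMap : (M.rows N).Hom ((θ.totUnf M).rows N') where
  f n p := AddMonoidHom.mk' (θ.rowMapFun r n p) fun x y => by
    refine UnfC.row_ext fun q q' e => ?_
    have h : (θ.coch (x.1 q q' e + y.1 q q' e)).comp (Cochain.ofHom (r.f q')) (add_zero p) =
        (θ.coch (x.1 q q' e)).comp (Cochain.ofHom (r.f q')) (add_zero p) +
        (θ.coch (y.1 q q' e)).comp (Cochain.ofHom (r.f q')) (add_zero p) := by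
      rw [coch_add, Cochain.add_comp]
    exact h
  comm₁ n n' p h x := by
    refine UnfC.row_ext fun q q' e => ?_
    have e₁ := (θ.totUnf M).rows_d₁_apply N' h (θ.rowMapFun r n p x) q q' e
    have e₂ := M.rows_d₁_apply N h x q q' e
    refine Eq.trans ?_ e₁.symm
    refine (congrArg (fun z => (θ.coch z).comp (Cochain.ofHom (r.f q'))
      (add_zero p)) e₂).trans ?_
    have e₃ := r.comm_d (q' - 1) q' (by lia)
    rw [coch_sub, coch_units_smul, coch_comp, coch_comp,
      coch_d, coch_d, Cochain.sub_comp, Cochain.units_smul_comp,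
      Cochain.comp_assoc_of_third_is_zero_cochain, ← Cochain.ofHom_comp,
      Cochain.comp_assoc_of_first_is_zero_cochain, ← e₃, Cochain.ofHom_comp,
      ← Cochain.comp_assoc_of_third_is_zero_cochain]
    rfl
  comm₂ n n' p p' h k x := by
    refine UnfC.row_ext fun q q' e => ?_
    have e₁ := (θ.totUnf M).rows_d₂_apply N' h k (θ.rowMapFun r n p x) q q' e
    have e₂ := M.rows_d₂_apply N h k x q q' e
    refine Eq.trans ?_ e₁.symm
    refine (congrArg (fun z => (θ.coch z).comp (Cochain.ofHom (r.f q'))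
      (add_zero p')) e₂).trans ?_
    rw [coch_units_smul, θ.coch_δ k, Cochain.units_smul_comp, ← δ_comp_ofHom]
    rfl

lemma rowMap_f_v (n p : ℤ) (z : M.rowGroup N n p) (q q' : ℤ) (e : q + n = q' + p)
    (k m i l j : ℤ) (h : k + m = i) (hl : k + p = l) (hj : i + p = j) :
    totFun.ι θ.θ (M.X q) k m i h ≫
      (Subtype.val ((θ.rowMap (M := M) r).f n p z) q q' e).v i j hj =
      (θ.θ.map ((z.1 q q' e).v k l hl)).f m ≫ totFun.ι θ.θ (N.X q') l m j (by lia) ≫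
        (r.f q').f j := by
  have e₁ : (Subtype.val ((θ.rowMap (M := M) r).f n p z) q q' e).v i j hj =
      (θ.coch (z.1 q q' e)).v i j hj ≫ (r.f q').f j := by
    refine (Cochain.comp_zero_cochain_v _ _ _ _ _).trans ?_
    rw [Cochain.ofHom_v]
  have e₂ := totFun.ι_cochain θ.θ (z.1 q q' e) k m i l j h hl hj
  refine (congrArg (_ ≫ ·) e₁).trans ((assoc _ _ _).symm.trans ?_)
  exact (congrArg (· ≫ _) e₂).trans (assoc _ _ _)

end FactoredFunctor

section

variable {M N : UnfC W.w} {q q' s s' p : ℤ} {h : q + 2 = s} {h' : q' + 2 = s'}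

lemma UnfC.PerRel.eq_iff {z₁ z₂ : Cochain (M.X q) (N.X q') p} {y₁ y₂ : Cochain (M.X s) (N.X s') p}
    (h₁ : UnfC.PerRel h h' z₁ y₁) (h₂ : UnfC.PerRel h h' z₂ y₂) : z₁ = z₂ ↔ y₁ = y₂ := by
  rw [UnfC.perRel_iff] at h₁ h₂
  rw [← h₁, ← h₂, EmbeddingLike.apply_eq_iff_eq]

end

namespace FactoredFunctor

variable (θ : FactoredFunctor W V) {M N : UnfC W.w} {N' : UnfC V.w} (r : θ.totUnf N ⟶ N')

/-- The action on cocycles. -/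
noncomputable def cocyc {q q' p : ℤ} (z : Cocycle (M.X q) (N.X q') p) :
    Cocycle ((θ.totUnf M).X q) ((θ.totUnf N).X q') p :=
  totFun.cocycle θ.θ z

/-- Bijectivity on the cohomology of each single Hom complex suffices. Being a bounding cochain, or
a lift up to a coboundary, is invariant under the periodicity, so solutions for the individual index
pairs can be chosen periodically. -/
lemma rowQuasiIso_rowMap (hb : Bicomplex.Bounded (M.rows N) ((θ.totUnf M).rows N'))
    (hi : ∀ q q' p (z : Cocycle (M.X q) (N.X q') p),
      (θ.cocyc z).postcomp (r.f q') ∈ coboundaries _ _ p → z ∈ coboundaries _ _ p)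
    (hs : ∀ q q' p (y : Cocycle ((θ.totUnf M).X q) (N'.X q') p), ∃ z : Cocycle (M.X q) (N.X q') p,
      y - (θ.cocyc z).postcomp (r.f q') ∈ coboundaries _ _ p) :
    (θ.rowMap (M := M) r).RowQuasiIso where
  bounded := hb
  inj n n' p p' h k x y hx hxy := by
    have hδ (q q' : ℤ) (e) : δ p' (p' + 1) (x.1 q q' e) = 0 := by
      have := M.rows_d₂_apply N (n := n') (p := p') rfl rfl x q q' (by lia)
      rw [hx] at this
      exact (smul_eq_zero_iff_eq _).1 this.symm
    -- The factor `(-1)^{q'}` compensates for the sign in the row differential, which is `δ` up to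
    -- this sign.
    obtain ⟨z, hz⟩ := UnfC.exists_row M N n p
      (fun q q' e z => δ p p' z = q'.negOnePow • x.1 q q' (by lia))
      (fun q q' s s' e e' h h' z z' hz => by
        rw [UnfC.negOnePow_two_add _ _ h']
        exact (hz.delta p').eq_iff ((x.2 _ _ _ _ _ _ h h').smul _ _ rfl))
      (fun q q' e => by
        have hx' : (⟨x.1 q q' (by lia), (Cocycle.mem_iff _ _ rfl _).2 (hδ q q' _)⟩ :
            Cocycle (M.X q) (N.X q') p') ∈ coboundaries _ _ p' := by
          refine hi q q' p' _ ((mem_coboundaries_iff _ p k).2 ⟨q'.negOnePow • y.1 q q' e, ?_⟩)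
          have := congrFun (congrFun (congrFun (congrArg Subtype.val hxy) q) q') (by lia)
          rw [δ_units_smul]
          exact this.symm
        obtain ⟨w, hw⟩ := (mem_coboundaries_iff _ p k).1 hx'
        exact ⟨q'.negOnePow • w, by rw [δ_units_smul, hw]⟩)
    refine ⟨z, UnfC.row_ext fun q q' e => ?_⟩
    rw [UnfC.rows_d₂_apply, hz, smul_smul, Int.units_mul_self, one_smul]
  surj n n' p p' h k y hy := by
    have hδ (q q' : ℤ) (e) : δ p' (p' + 1) (y.1 q q' e) = 0 := by
      have := (θ.totUnf M).rows_d₂_apply N' (n := n') (p := p') rfl rfl y q q' (by lia)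
      rw [hy] at this
      exact (smul_eq_zero_iff_eq _).1 this.symm
    -- The periodic lift is chosen first, with only the existence of a correcting cochain for each
    -- index pair; the correcting cochains are made periodic in a second step.
    obtain ⟨z, hz⟩ := UnfC.exists_row M N n' p'
      (fun q q' e z => δ p' (p' + 1) z = 0 ∧ ∃ w : Cochain ((θ.totUnf M).X q) (N'.X q') p,
        δ p p' w = y.1 q q' e -
          (θ.coch z).comp (Cochain.ofHom (r.f q')) (add_zero p'))
      (fun q q' s s' e e' h h' z z' hz => by
        have hw (w w') (hw : UnfC.PerRel (M := θ.totUnf M) (N := N') (p := p) h h' w w') :=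
          (hw.delta p').eq_iff ((y.2 _ _ _ _ e e' h h').sub ((θ.perRel_cochain hz).comp_hom r))
        refine and_congr ((hz.delta _).eq_iff UnfC.PerRel.zero) ⟨?_, ?_⟩
        · rintro ⟨w, e⟩
          exact ⟨_, (hw w _ ((UnfC.perRel_iff _ _ _ _).2 rfl)).1 e⟩
        · rintro ⟨w, e⟩
          exact ⟨(UnfC.perEquiv (θ.totUnf M) N' p h h').symm w,
            (hw _ _ ((UnfC.perRel_iff _ _ _ _).2 (Equiv.apply_symm_apply _ _))).2 e⟩)
      (fun q q' e => by
        obtain ⟨z, hz⟩ := hs q q' p' ⟨y.1 q q' e, (Cocycle.mem_iff _ _ rfl _).2 (hδ q q' _)⟩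
        obtain ⟨w, hw⟩ := (mem_coboundaries_iff _ p k).1 hz
        exact ⟨z.1, (Cocycle.mem_iff _ _ rfl _).1 z.2, w, hw⟩)
    obtain ⟨w, hw⟩ := UnfC.exists_row (θ.totUnf M) N' n p
      (fun q q' e w => δ p p' w = q'.negOnePow • (y.1 q q' (by lia) -
          (θ.coch (z.1 q q' (by lia))).comp (Cochain.ofHom (r.f q')) (add_zero p')))
      (fun q q' s s' e e' h h' w w' hw => by
        rw [UnfC.negOnePow_two_add _ _ h']
        exact (hw.delta p').eq_iff (((y.2 _ _ _ _ _ _ h h').sub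
          ((θ.perRel_cochain (z.2 _ _ _ _ _ _ h h')).comp_hom r)).smul _ _ rfl))
      (fun q q' e => by
        obtain ⟨w, hw⟩ := (hz q q' (by lia)).2
        exact ⟨q'.negOnePow • w, by rw [δ_units_smul, hw]⟩)
    refine ⟨z, w, fun n'' p'' h' k' => UnfC.row_ext fun q q' e => ?_, UnfC.row_ext fun q q' e => ?_⟩
    · subst k'
      rw [UnfC.rows_d₂_apply, (hz q q' _).1]
      exact smul_zero _
    · refine Eq.trans ?_ (congrArg (Subtype.val ((θ.rowMap r).f n' p' z) q q' e + ·)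
        ((θ.totUnf M).rows_d₂_apply N' h k w q q' e).symm)
      rw [hw, smul_smul, Int.units_mul_self, one_smul]
      exact (add_sub_cancel _ _).symm

end FactoredFunctor

end

lemma comp_eq_of_squares {C : Type u} [Category.{v} C] {x x' y y' z z' : C} {a : x ⟶ y}
    {f : y ⟶ y'} {b : y' ⟶ z'} {g : x ⟶ x'} {a' : x' ⟶ y'} {c : y ⟶ z} {f' : z ⟶ z'} {d : x ⟶ z}
    {d' : x' ⟶ z'} (h : a ≫ f = g ≫ a') (h₁ : a' ≫ b = d') (h₂ : a ≫ c = d)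
    (h' : d ≫ f' = g ≫ d') : a ≫ f ≫ b = a ≫ c ≫ f' := by
  rw [← assoc, h, assoc, h₁, ← assoc, h₂, h']

lemma Unf.hom_ext_of_two {C : Type u} [Category.{v} C] {F : C ⥤ C} [F.Full] [F.Faithful]
    {w : 𝟭 C ⟶ F} {G H : Unf F w} {f g : G ⟶ H} (h₁ : f.f (-1) = g.f (-1))
    (h₀ : f.f 0 = g.f 0) : f = g := by
  obtain ⟨_, _, hu⟩ := existsUnique_hom G H (g.f (-1)) (g.f 0) (g.comm_d _ _ _) (by
    rw [g.comm_d]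
    congr 1
    symm
    rw [homEquiv_eq_iff, g.comm_π])
  exact (hu f ⟨h₁, h₀⟩).trans (hu g ⟨rfl, rfl⟩).symm

/-! ### Transport of decompositions -/

section

variable {A : Type u} [Category.{v} A] [Abelian A] {F : A ⥤ A} [F.Additive] {w : 𝟭 A ⟶ F}

namespace Dec

/-- Transport of a decomposition along an isomorphism. -/
def ofIso {M M' : UnfC w} (e : M' ≅ M) {G : Unf F w} {a b : ℤ} (Δ : Dec M G a b) :
    Dec M' G a b where
  ι k q i h := (e.hom.f q).f k ≫ Δ.ι k q i h
  pr k q i h := Δ.pr k q i h ≫ (e.inv.f q).f k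
  ι_pr k q i h := by
    rw [assoc, Δ.ι_pr_assoc, ← HomologicalComplex.comp_f, ← Unf.comp_f, e.hom_inv_id, Unf.id_f,
      HomologicalComplex.id_f]
  ι_pr_ne k q k' q' i h h' hk := by
    rw [assoc, Δ.ι_pr_ne_assoc _ _ _ _ _ _ _ hk, comp_zero]
  sum_eq i := by
    rw [← Δ.sum_eq i]
    refine Finset.sum_congr rfl fun k _ => ?_
    rw [assoc, ← assoc ((e.inv.f _).f k), ← HomologicalComplex.comp_f, ← Unf.comp_f, e.inv_hom_id,
      Unf.id_f, HomologicalComplex.id_f, id_comp]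
  ι_d k q i j h h' := by
    rw [assoc, Δ.ι_d k q i j h h', Preadditive.comp_add, Linear.comp_units_smul, ← assoc,
      ← HomologicalComplex.comp_f, e.hom.comm_d, HomologicalComplex.comp_f,
        HomologicalComplex.Hom.comm_assoc, assoc]
  ι_π k q q' i i' h h' hq hi := by
    have e₁ := congrArg (fun f => HomologicalComplex.Hom.f f k) (e.hom.comm_π q q' hq)
    have e₂ : F.map ((e.hom.f q).f k) ≫ (M.πf q q' hq k).hom =
      (M'.πf q q' hq k).hom ≫ (e.hom.f q').f k := e₁
    rw [Functor.map_comp, assoc, Δ.ι_π k q q' i i' h h' hq hi, ← assoc, e₂, assoc]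

/-- A morphism between the underlying complexes induces a morphism of total objects. -/
lemma exists_hom {M N : UnfC w} {G H : Unf F w} {a b a' b' : ℤ} (Δ : Dec M G a b)
    (Δ' : Dec N H a' b') (φ : M ⟶ N) :
    ∃ f : G ⟶ H, ∀ k q i h, Δ.ι k q i h ≫ f.f i = (φ.f q).f k ≫ Δ'.ι k q i h := by
  let f (i : ℤ) : G.X i ⟶ H.X i := ∑ k ∈ Finset.Icc a b, Δ.pr k (i - k) i (by lia) ≫
    (φ.f (i - k)).f k ≫ Δ'.ι k (i - k) i (by lia)
  have hf (k q i h) : Δ.ι k q i h ≫ f i = (φ.f q).f k ≫ Δ'.ι k q i h := by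
    by_cases hk : k ∈ Finset.Icc a b
    · rw [Preadditive.comp_sum, Finset.sum_eq_single k]
      · obtain rfl : q = i - k := by lia
        rw [Δ.ι_pr_assoc]
      · intro l _ hl
        rw [Δ.ι_pr_ne_assoc _ _ _ _ _ _ _ hl.symm]
      · exact fun h => (h hk).elim
    · exact (Δ.isZero k q hk).eq_of_src _ _
  refine ⟨⟨f, fun i j h => Δ.hom_ext fun k q hk => ?_, fun i j h => ?_⟩, hf⟩
  · rw [← assoc, hf, assoc, Δ'.ι_d k q i j hk h, ← assoc, Δ.ι_d k q i j hk h, Preadditive.add_comp,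
      Preadditive.comp_add, Linear.units_smul_comp, Linear.comp_units_smul, assoc, assoc, hf, hf,
      ← assoc, ← HomologicalComplex.comp_f, φ.comm_d, HomologicalComplex.comp_f, assoc,
      ← assoc ((φ.f q).f k), (φ.f q).comm, assoc]
  · simp only [f]
    rw [Functor.map_sum, Preadditive.sum_comp]
    have hk : Finset.Icc a b = Finset.Icc a b := rfl
    rw [Preadditive.comp_sum]
    refine Finset.sum_congr rfl fun k _ => ?_
    have e₂ : F.map ((φ.f (i - k)).f k) ≫ (N.πf (i - k) (j - k) (by lia) k).hom =
        (M.πf (i - k) (j - k) (by lia) k).hom ≫ (φ.f (j - k)).f k :=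
      congrArg (fun f => HomologicalComplex.Hom.f f k) (φ.comm_π (i - k) (j - k) (by lia))
    have e₃ := Δ.pr_π k (i - k) (j - k) i j (by lia) (by lia) (by lia) h
    rw [Functor.map_comp, Functor.map_comp, assoc, assoc,
      Δ'.ι_π k (i - k) (j - k) i j (by lia) (by lia) (by lia) h, ← assoc (F.map ((φ.f _).f _)), e₂,
      assoc, ← assoc (F.map _), e₃, assoc]

lemma exists_iso {M N : UnfC w} {G H : Unf F w} {a b a' b' : ℤ} (Δ : Dec M G a b)
    (Δ' : Dec N H a' b') (φ : M ≅ N) :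
    ∃ f : G ≅ H, ∀ k q i h, Δ.ι k q i h ≫ f.hom.f i = (φ.hom.f q).f k ≫ Δ'.ι k q i h := by
  obtain ⟨f, hf⟩ := Δ.exists_hom Δ' φ.hom
  obtain ⟨g, hg⟩ := Δ'.exists_hom Δ φ.inv
  refine ⟨⟨f, g, ?_, ?_⟩, hf⟩
  · ext i
    refine Δ.hom_ext fun k q h => ?_
    rw [Unf.comp_f, ← assoc, hf, assoc, hg, ← assoc, ← HomologicalComplex.comp_f, ← Unf.comp_f,
      φ.hom_inv_id, Unf.id_f, HomologicalComplex.id_f, id_comp, Unf.id_f, comp_id]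
  · ext i
    refine Δ'.hom_ext fun k q h => ?_
    rw [Unf.comp_f, ← assoc, hg, assoc, hf, ← assoc, ← HomologicalComplex.comp_f, ← Unf.comp_f,
      φ.inv_hom_id, Unf.id_f, HomologicalComplex.id_f, id_comp, Unf.id_f, comp_id]

end Dec

end

/-! ### The image of an unfolded factorization -/

section

variable {A : Type u₁} [Category.{v₁} A] [Abelian A] {B : Type u₂} [Category.{v₂} B] [Abelian B]
  {W : Potential A} {V : Potential B}

namespace FactoredFunctor

variable (θ : FactoredFunctor W V)

/-- The image of an unfolded factorization under a factored functor. -/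
abbrev mapUnf (Q : Unf W.Φ.functor W.w) : UnfC V.w where
  X q := θ.θ.obj (Q.X q)
  d i j h := θ.θ.map (Q.d i j h)
  π i j h := (θ.ε.app (Q.X i)).symm ≪≫ θ.θ.mapIso (Q.π i j h)
  d_d i j k h h' h'' := by
    have e : (complexW V.w).app (θ.θ.obj (Q.X i)) = θ.θ.map (W.w.app (Q.X i)) ≫
        θ.ε.hom.app (Q.X i) := by
      ext n
      exact (θ.compat (Q.X i) n).symm
    rw [← Functor.map_comp, Q.d_d i j k h h' h'', e, Functor.map_comp]
    refine Eq.trans ?_ (assoc _ _ _).symm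
    exact congrArg (_ ≫ ·) (Iso.hom_inv_id_assoc (θ.ε.app (Q.X i)) _).symm
  π_d i j i' j' h h' hi hj := by
    have e := θ.ε.inv.naturality (Q.d i j h)
    refine (assoc _ _ _).symm.trans ((congrArg (· ≫ _) e).trans ((assoc _ _ _).trans
      ((congrArg (_ ≫ ·) ?_).trans (assoc _ _ _).symm)))
    exact (θ.θ.map_comp _ _).symm.trans ((congrArg θ.θ.map (Q.π_d i j i' j' h h' hi hj)).trans
      (θ.θ.map_comp _ _))

/-- The action on morphisms of unfolded factorizations. -/
def mapUnfMap {Q R : Unf W.Φ.functor W.w} (f : Q ⟶ R) : θ.mapUnf Q ⟶ θ.mapUnf R where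
  f q := θ.θ.map (f.f q)
  comm_d i j h := by
    change θ.θ.map _ ≫ θ.θ.map _ = θ.θ.map _ ≫ θ.θ.map _
    rw [← Functor.map_comp, f.comm_d, Functor.map_comp]
  comm_π i j h := by
    have e := θ.ε.inv.naturality (f.f i)
    refine (assoc _ _ _).symm.trans ((congrArg (· ≫ _) e).trans ((assoc _ _ _).trans
      ((congrArg (_ ≫ ·) ?_).trans (assoc _ _ _).symm)))
    exact (θ.θ.map_comp _ _).symm.trans ((congrArg θ.θ.map (f.comm_π i j h)).trans
      (θ.θ.map_comp _ _))

open Factorization in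
-- Applying `θ` to the unfolding of `E`, and unfolding the complex of factorizations obtained from
-- `E`, give the same result: both have the components `θ(E^{-1})` and `θ(E^0)` at the indices `-1`
-- and `0` with the same structure maps, and everything else follows by periodicity.
lemma exists_mapUnfIso : ∃ β : ∀ E, θ.mapUnf ((unf W).obj E) ≅ (unfC V).obj (θ.complex E),
    ∀ {E F : Factorization W} (u : E ⟶ F), θ.mapUnfMap ((unf W).map u) ≫ (β F).hom =
      (β E).hom ≫ (unfC V).map (θ.complexFunctor.map u) := by
  have key (E : Factorization W) : ∃ β : θ.mapUnf ((unf W).obj E) ≅ (unfC V).obj (θ.complex E),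
      (∀ k, (θ.θ.map E.unfX₁.hom).f k ≫ (β.hom.f (-1)).f k =
        (θ.factorization E k).unfX₁.hom) ∧
      (∀ k, (θ.θ.map E.unfX₀.hom).f k ≫ (β.hom.f 0).f k =
        (θ.factorization E k).unfX₀.hom) := by
    let e₁ : θ.θ.obj E.X₁ ≅ ((unfC V).obj (θ.complex E)).X (-1) :=
      HomologicalComplex.Hom.isoOfComponents (fun k => (θ.factorization E k).unfX₁)
        fun k l _ => unf_map_f₁ ((θ.complex E).d k l)
    let e₀ : θ.θ.obj E.X₀ ≅ ((unfC V).obj (θ.complex E)).X 0 :=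
      HomologicalComplex.Hom.isoOfComponents (fun k => (θ.factorization E k).unfX₀)
        fun k l _ => unf_map_f₀ ((θ.complex E).d k l)
    let f₁ := (θ.θ.mapIso E.unfX₁).symm ≪≫ e₁
    let f₀ := (θ.θ.mapIso E.unfX₀).symm ≪≫ e₀
    have hf₁ : θ.θ.map E.unfX₁.hom ≫ f₁.hom = e₁.hom := (θ.θ.mapIso E.unfX₁).hom_inv_id_assoc _
    have hf₀ : θ.θ.map E.unfX₀.hom ≫ f₀.hom = e₀.hom := (θ.θ.mapIso E.unfX₀).hom_inv_id_assoc _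
    obtain ⟨β, h₁, h₀⟩ := Unf.exists_iso (θ.mapUnf ((unf W).obj E)) ((unfC V).obj (θ.complex E))
      f₁ f₀ (by
        have h : e₁.hom ≫ ((unfC V).obj (θ.complex E)).d (-1) 0 (by lia) =
            θ.θ.map E.a ≫ e₀.hom := by
          ext k
          exact (θ.factorization E k).unfX₁_d
        have h' : θ.θ.map E.unfX₁.hom ≫ θ.θ.map (((unf W).obj E).d (-1) 0 (by lia)) =
            θ.θ.map E.a ≫ θ.θ.map E.unfX₀.hom := by
          rw [← Functor.map_comp, E.unfX₁_d, Functor.map_comp]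
        exact (cancel_epi (θ.θ.map E.unfX₁.hom)).1 (comp_eq_of_squares h' hf₀ hf₁ h).symm) (by
        have h : e₀.hom ≫ ((unfC V).obj (θ.complex E)).d 0 1 (by lia) =
            θ.θ.map E.b ≫ θ.ε.hom.app E.X₁ ≫
            (V.Φ.functor.mapHomologicalComplex (ComplexShape.up ℤ)).map e₁.hom ≫
            (((unfC V).obj (θ.complex E)).π (-1) 1 (by lia)).hom := by
          ext k
          exact ((θ.factorization E k).unfX₀_d).trans (assoc _ _ _)
        have h' : θ.θ.map E.unfX₀.hom ≫ θ.θ.map (((unf W).obj E).d 0 1 (by lia)) =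
            θ.θ.map E.b ≫ θ.θ.map (W.Φ.functor.map E.unfX₁.hom) ≫
            θ.θ.map (((unf W).obj E).π (-1) 1 (by lia)).hom := by
          rw [← Functor.map_comp, E.unfX₀_d, Functor.map_comp, Functor.map_comp]
        have e : θ.θ.map (((unf W).obj E).π (-1) 1 (by lia)).hom ≫
            ((θ.mapUnf ((unf W).obj E)).π (-1) 1 (by lia)).inv =
              θ.ε.hom.app (((unf W).obj E).X (-1)) :=
          (θ.θ.mapIso (((unf W).obj E).π (-1) 1 (by lia))).hom_inv_id_assoc _
        have n := θ.ε.hom.naturality E.unfX₁.hom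
        have abs {c₀ c₁ c₂ c₃ c₄ d₀ d₁ d₂ d₃ : CochainComplex B ℤ} {x : c₀ ⟶ c₁}
            {d : c₁ ⟶ c₂} {y : c₂ ⟶ c₃} {z : c₃ ⟶ c₄} {t : c₄ ⟶ d₀} {b : c₀ ⟶ d₁} {p : d₁ ⟶ d₂}
            {q : d₂ ⟶ c₂} {r : d₂ ⟶ c₃} {s : d₁ ⟶ d₃} {k : d₃ ⟶ c₃} {m : d₃ ⟶ c₄}
            (h₁ : x ≫ d = b ≫ p ≫ q) (h₂ : q ≫ y = r) (h₃ : p ≫ r = s ≫ k) (h₄ : k ≫ z = m) :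
            x ≫ d ≫ y ≫ z ≫ t = b ≫ s ≫ m ≫ t := by
          rw [← assoc, h₁, assoc, assoc, ← assoc q, h₂, ← assoc p, h₃, assoc, ← assoc k, h₄]
        have hh := Unf.homEquiv_apply (θ.mapUnf ((unf W).obj E)) ((unfC V).obj (θ.complex E))
          (-1) (-1) 1 1 (by lia) (by lia) f₁.hom
        rw [hh]
        refine (cancel_epi (θ.θ.map E.unfX₀.hom)).1 ((assoc _ _ _).symm.trans
          ((congrArg (· ≫ _) hf₀).trans (h.trans (Eq.symm ?_))))
        refine abs h' e n ?_
        exact ((V.Φ.functor.mapHomologicalComplex (ComplexShape.up ℤ)).map_comp _ _).symm.trans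
          (congrArg (V.Φ.functor.mapHomologicalComplex (ComplexShape.up ℤ)).map hf₁))
    exact ⟨β, fun k => by rw [h₁]; exact HomologicalComplex.congr_hom hf₁ k,
      fun k => by rw [h₀]; exact HomologicalComplex.congr_hom hf₀ k⟩
  choose β h₁ h₀ using key
  refine ⟨β, fun {E F} u => Unf.hom_ext_of_two ?_ ?_⟩
  · refine (cancel_epi (θ.θ.map E.unfX₁.hom)).1 ?_
    ext k
    have n := congrArg (fun f => (θ.θ.map f).f k) (unf_map_f₁ u)
    have n' := unf_map_f₁ ((θ.complexFunctor.map u).f k)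
    simp only [Functor.map_comp, HomologicalComplex.comp_f] at n
    exact comp_eq_of_squares n (h₁ F k) (h₁ E k) n'
  · refine (cancel_epi (θ.θ.map E.unfX₀.hom)).1 ?_
    ext k
    have n := congrArg (fun f => (θ.θ.map f).f k) (unf_map_f₀ u)
    have n' := unf_map_f₀ ((θ.complexFunctor.map u).f k)
    simp only [Functor.map_comp, HomologicalComplex.comp_f] at n
    exact comp_eq_of_squares n (h₀ F k) (h₀ E k) n'

end FactoredFunctor

end

/-! ### Decomposing the image of a totalization by total complexes -/

section

variable {A : Type u₁} [Category.{v₁} A] [Abelian A] {B : Type u₂} [Category.{v₂} B] [Abelian B]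
  [HasCoproducts.{v₂} B] {W : Potential A} {V : Potential B}

namespace FactoredFunctor

variable (θ : FactoredFunctor W V)

lemma map_f_comp {X Y Z : A} {f : X ⟶ Y} {g : Y ⟶ Z} {h : X ⟶ Z} (e : f ≫ g = h) (n : ℤ) {T : B}
    (z : (θ.θ.obj Z).X n ⟶ T) : (θ.θ.map f).f n ≫ (θ.θ.map g).f n ≫ z = (θ.θ.map h).f n ≫ z := by
  rw [← assoc, ← HomologicalComplex.comp_f, ← Functor.map_comp, e]

section

variable {M : UnfC W.w} {Q : Unf W.Φ.functor W.w} {a b : ℤ} (Δ : Dec M Q a b)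

lemma mapDec_hom_ext {i n : ℤ} {T : B} {f g : (θ.θ.obj (Q.X i)).X n ⟶ T}
    (h : ∀ k q hk, (θ.θ.map (Δ.ι k q i hk)).f n ≫ f = (θ.θ.map (Δ.ι k q i hk)).f n ≫ g) :
    f = g := by
  have e : ∑ k ∈ Finset.Icc a b, (θ.θ.map (Δ.pr k (i - k) i (by lia))).f n ≫
      (θ.θ.map (Δ.ι k (i - k) i (by lia))).f n = 𝟙 _ := by
    have := congrArg (θ.θ ⋙ HomologicalComplex.eval B (ComplexShape.up ℤ) n).map (Δ.sum_eq i)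
    rw [Functor.map_sum, CategoryTheory.Functor.map_id] at this
    refine Eq.trans (Finset.sum_congr rfl fun k _ => ?_) this
    rw [Functor.map_comp]
    rfl
  rw [← id_comp f, ← id_comp g, ← e, Preadditive.sum_comp, Preadditive.sum_comp]
  exact Finset.sum_congr rfl fun k _ => by rw [assoc, assoc, h]

variable {G : Unf V.Φ.functor V.w} {c d : ℤ} (Γ : Dec (θ.mapUnf Q) G c d)

/-- The inclusion of the total complex. -/
noncomputable def decι (j q i : ℤ) (h : j + q = i) : ((θ.totUnf M).X q).X j ⟶ G.X i :=
  totFun.desc θ.θ fun k n hk => (θ.θ.map (Δ.ι k q (k + q) rfl)).f n ≫ Γ.ι n (k + q) i (by lia)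

lemma ι_decι (k n j q i l : ℤ) (hk : k + n = j) (h : j + q = i) (hl : k + q = l) :
    totFun.ι θ.θ (M.X q) k n j hk ≫ θ.decι Δ Γ j q i h =
      (θ.θ.map (Δ.ι k q l hl)).f n ≫ Γ.ι n l i (by lia) := by
  subst hl
  exact totFun.ι_desc θ.θ (X := M.X q) _ _ _ _

/-- The projection to the total complex. -/
noncomputable def decpr (j q i : ℤ) (h : j + q = i) : G.X i ⟶ ((θ.totUnf M).X q).X j :=
  ∑ k ∈ Finset.Icc a b, Γ.pr (j - k) (k + q) i (by lia) ≫
    (θ.θ.map (Δ.pr k q (k + q) rfl)).f (j - k) ≫ totFun.ι θ.θ (M.X q) k (j - k) j (by lia)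

variable {θ} {Γ} in
lemma isZero_map_X (Δ : Dec M Q a b) (k q : ℤ) (hk : k ∉ Finset.Icc a b) (n : ℤ) :
    IsZero ((θ.θ.obj ((M.X q).X k)).X n) :=
  (θ.θ ⋙ HomologicalComplex.eval B (ComplexShape.up ℤ) n).map_isZero (Dec.isZero Δ k q hk)

/-- A summand of the image is indexed by the degree `k` in the source complex and the degree `n` in
`θ`; the projection to total degree `j` selects the pairs with `k + n = j`. -/
lemma ι_comp_decpr (k n j q i l : ℤ) (hk : k + n = j) (hl : k + q = l) (h : n + l = i)
    (h' : j + q = i) : (θ.θ.map (Δ.ι k q l hl)).f n ≫ Γ.ι n l i h ≫ θ.decpr Δ Γ j q i h' =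
      totFun.ι θ.θ (M.X q) k n j hk := by
  subst hl
  obtain rfl : n = j - k := by lia
  by_cases hk' : k ∈ Finset.Icc a b
  · rw [decpr, Preadditive.comp_sum, Finset.sum_eq_single k, Γ.ι_pr_assoc,
      θ.map_f_comp (Δ.ι_pr _ _ _ _), CategoryTheory.Functor.map_id, HomologicalComplex.id_f,
        id_comp]
    · intro k' _ hk'
      rw [Γ.ι_pr_ne_assoc _ _ _ _ _ _ _ (by lia)]
    · exact fun h => (h hk').elim
  · exact (isZero_map_X Δ k q hk' _).eq_of_src _ _

lemma ι_comp_decpr_ne (k n j q i l j' q' : ℤ) (hk : k + n = j) (hl : k + q = l) (h : n + l = i)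
    (h' : j' + q' = i) (hj : j ≠ j') :
    (θ.θ.map (Δ.ι k q l hl)).f n ≫ Γ.ι n l i h ≫ θ.decpr Δ Γ j' q' i h' = 0 := by
  rw [decpr, Preadditive.comp_sum, Preadditive.comp_sum]
  refine Finset.sum_eq_zero fun k' _ => ?_
  by_cases hn : n = j' - k'
  · subst hn
    obtain rfl : l = k' + q' := by lia
    rw [Γ.ι_pr_assoc, θ.map_f_comp (Δ.ι_pr_ne _ _ _ _ _ _ _ (by lia)), Functor.map_zero,
      HomologicalComplex.zero_f, zero_comp]
  · rw [Γ.ι_pr_ne_assoc _ _ _ _ _ _ _ hn, comp_zero]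

/-- The decomposition of the image of an unfolded factorization under a factored functor. -/
noncomputable def dec : Dec (θ.totUnf M) G (a + c) (b + d) where
  ι := θ.decι Δ Γ
  pr := θ.decpr Δ Γ
  ι_pr j q i h := totFun.hom_ext θ.θ fun k n hk => by
    rw [← assoc, θ.ι_decι Δ Γ k n j q i (k + q) hk h rfl, assoc, ι_comp_decpr, comp_id]
  ι_pr_ne j q j' q' i h h' hj := totFun.hom_ext θ.θ fun k n hk => by
    rw [← assoc, θ.ι_decι Δ Γ k n j q i (k + q) hk h rfl, assoc,
      θ.ι_comp_decpr_ne Δ Γ k n j q i (k + q) j' q' hk rfl _ _ hj, comp_zero]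
  sum_eq i := Γ.hom_ext fun n l h => θ.mapDec_hom_ext Δ fun k q hk => by
    by_cases hkn : k ∈ Finset.Icc a b ∧ n ∈ Finset.Icc c d
    · obtain ⟨h₁, h₂⟩ := hkn
      rw [Finset.mem_Icc] at h₁ h₂
      rw [Preadditive.comp_sum, Preadditive.comp_sum, Finset.sum_eq_single (k + n)]
      · obtain rfl : q = i - (k + n) := by lia
        rw [← assoc (Γ.ι _ _ _ _), ← assoc, θ.ι_comp_decpr Δ Γ k n (k + n) (i - (k + n)) i l rfl hk
          h (by lia),
          θ.ι_decι Δ Γ k n _ _ i l rfl (by lia) hk, comp_id]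
      · intro j _ hj
        rw [← assoc (Γ.ι _ _ _ _), ← assoc, θ.ι_comp_decpr_ne Δ Γ k n (k + n) q i l j (i - j) rfl hk
          h
          (by lia) hj.symm, zero_comp]
      · intro h
        refine (h ?_).elim
        rw [Finset.mem_Icc]
        lia
    · rw [not_and_or] at hkn
      obtain hk' | hn := hkn
      · exact (isZero_map_X Δ k q hk' _).eq_of_src _ _
      · rw [← cancel_epi (𝟙 _)]
        have := Γ.isZero n l hn
        rw [this.eq_of_src (Γ.ι n l i h ≫ _) 0]
        rw [this.eq_of_src (Γ.ι n l i h ≫ 𝟙 _) 0]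
  ι_d j q i i' h h' := totFun.hom_ext θ.θ fun k n hk => by
    have e₁ := θ.ι_decι Δ Γ k n j q i (k + q) hk h rfl
    have e₂ := Γ.ι_d n (k + q) i i' (by lia) h'
    have e₃ := θ.ι_decι Δ Γ k n j (q + 1) i' (k + q + 1) hk (by lia) (by lia)
    have e₄ := θ.ι_decι Δ Γ (k + 1) n (j + 1) q i' (k + q + 1) (by lia) (by lia) (by lia)
    have e₅ := θ.ι_decι Δ Γ k (n + 1) (j + 1) q i' (k + q) (by lia) (by lia) rfl
    have e₆ := totFun.ι_map θ.θ (M.d q (q + 1) rfl) k n j hk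
    have e₇ := totFun.ι_d θ.θ (X := M.X q) k n (k + 1) (n + 1) j (j + 1) hk rfl rfl rfl
    have e₈ := congrArg (fun f => (θ.θ.map f).f n) (Δ.ι_d k q (k + q) (k + q + 1) rfl rfl)
    have e₉ := (θ.θ.map (Δ.ι k q (k + q) rfl)).comm n (n + 1)
    simp only [Functor.map_comp, Functor.map_add, Functor.map_units_smul,
      HomologicalComplex.comp_f, HomologicalComplex.add_f_apply,
      HomologicalComplex.units_smul_f_apply] at e₈
    have abs {x₁ x₂ x₃ x₄ x₅ x₆ x₇ x₈ x₉ x₁₀ x₁₁ : B} {s t : ℤˣ} {a₁ : x₁ ⟶ x₂} {a₂ : x₂ ⟶ x₃}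
        {a₃ : x₃ ⟶ x₄} {b₁ : x₁ ⟶ x₅} {b₂ : x₅ ⟶ x₃} {c₁ : x₅ ⟶ x₆} {c₂ : x₆ ⟶ x₄}
        {c₃ : x₅ ⟶ x₇} {c₄ : x₇ ⟶ x₄} {f₁ : x₂ ⟶ x₈} {f₂ : x₈ ⟶ x₄} {g₁ : x₂ ⟶ x₉}
        {g₂ : x₉ ⟶ x₄} {p₁ : x₁ ⟶ x₁₀} {p₂ : x₁₀ ⟶ x₈} {p₃ : x₁₀ ⟶ x₆} {q₁ : x₁ ⟶ x₁₁}
        {q₂ : x₁₁ ⟶ x₉} {q₃ : x₁₁ ⟶ x₆} {r : B} {r₁ : x₁ ⟶ r} {r₂ : r ⟶ x₉} {r₃ : r ⟶ x₇}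
        (h₁ : a₁ ≫ a₂ = b₁ ≫ b₂) (h₂ : b₂ ≫ a₃ = c₁ ≫ c₂ + (t * s) • c₃ ≫ c₄)
        (h₃ : p₂ ≫ f₂ = p₃ ≫ c₂) (h₄ : q₂ ≫ g₂ = q₃ ≫ c₂) (h₅ : r₂ ≫ g₂ = r₃ ≫ c₄)
        (h₆ : a₁ ≫ f₁ = p₁ ≫ p₂) (h₇ : a₁ ≫ g₁ = q₁ ≫ q₂ + t • r₁ ≫ r₂)
        (h₈ : b₁ ≫ c₁ = p₁ ≫ p₃ + s • q₁ ≫ q₃) (h₉ : b₁ ≫ c₃ = r₁ ≫ r₃) :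
        a₁ ≫ a₂ ≫ a₃ = a₁ ≫ (f₁ ≫ f₂ + s • g₁ ≫ g₂) := by
      rw [← assoc, h₁, assoc, h₂, Preadditive.comp_add, Preadditive.comp_add,
        Linear.comp_units_smul,
        Linear.comp_units_smul, ← assoc, ← assoc, h₈, h₉, ← assoc a₁, ← assoc a₁, h₆, h₇,
        Preadditive.add_comp, Preadditive.add_comp, assoc, assoc, assoc, assoc,
        Linear.units_smul_comp, Linear.units_smul_comp, assoc, assoc, h₃, h₄, h₅, smul_add,
          smul_smul,
        mul_comm s t, add_assoc]
    -- The sign `(-1)^{k+q}` of the `θ`-direction is the product of the sign `(-1)^k` in the total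
    -- complex and the sign `(-1)^q` in the decomposition.
    rw [Int.negOnePow_add] at e₂
    exact abs e₁ e₂ e₃ e₄ e₅ e₆ e₇ e₈ e₉
  ι_π j q q' i i' h h' hq hi := θ.hom_ext_map fun k n hk => by
    have e₁ := θ.ι_decι Δ Γ k n j q i (k + q) hk h rfl
    have e₂ := Γ.ι_π n (k + q) (k + q') i i' (by lia) (by lia) (by lia) hi
    have e₃ := θ.εi_naturality (Δ.ι k q (k + q) rfl) n
    have e₄ := congrArg (fun f => (θ.θ.map f).f n)
      (Δ.ι_π k q q' (k + q) (k + q') rfl rfl hq (by lia))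
    have e₅ := θ.map_ι_totUnf_πf M q q' hq k n j hk
    have e₆ := θ.ι_decι Δ Γ k n j q' i' (k + q') hk h' rfl
    simp only [Functor.map_comp, HomologicalComplex.comp_f] at e₄
    have abs {x₁ x₂ x₃ x₄ x₅ x₆ x₇ x₈ x₉ x₁₀ : B} {a₁ : x₁ ⟶ x₂} {a₂ : x₂ ⟶ x₃} {a₃ : x₃ ⟶ x₄}
        {b₁ : x₁ ⟶ x₅} {b₂ : x₅ ⟶ x₃} {c₁ : x₅ ⟶ x₆} {c₂ : x₆ ⟶ x₇} {c₃ : x₇ ⟶ x₄}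
        {p₁ : x₁ ⟶ x₈} {p₂ : x₈ ⟶ x₆} {q₁ : x₈ ⟶ x₉} {q₂ : x₉ ⟶ x₇} {r₁ : x₂ ⟶ x₁₀}
        {r₂ : x₁₀ ⟶ x₄} {r₃ : x₉ ⟶ x₁₀}
        (h₁ : a₁ ≫ a₂ = b₁ ≫ b₂) (h₂ : b₂ ≫ a₃ = (c₁ ≫ c₂) ≫ c₃) (h₃ : b₁ ≫ c₁ = p₁ ≫ p₂)
        (h₄ : p₂ ≫ c₂ = q₁ ≫ q₂) (h₅ : a₁ ≫ r₁ = p₁ ≫ q₁ ≫ r₃) (h₆ : r₃ ≫ r₂ = q₂ ≫ c₃) :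
        a₁ ≫ a₂ ≫ a₃ = a₁ ≫ r₁ ≫ r₂ := by
      rw [← assoc, h₁, assoc, h₂, assoc, ← assoc b₁, h₃, assoc, ← assoc p₂, h₄, ← assoc a₁, h₅,
        assoc, assoc, assoc, h₆]
    exact abs ((V.Φ.functor.map_comp _ _).symm.trans ((congrArg V.Φ.functor.map e₁).trans
      (V.Φ.functor.map_comp _ _))) e₂ e₃ e₄ e₅ e₆

end

end FactoredFunctor

end

end FactCat

namespace FactCat

open CochainComplex HomComplex Factorization

/-! ### Rows of the image of a morphism -/

section

variable {A : Type u₁} [Category.{v₁} A] [Abelian A] {B : Type u₂} [Category.{v₂} B] [Abelian B]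
  [HasCoproducts.{v₂} B] {W : Potential A} {V : Potential B}

namespace FactoredFunctor

variable (θ : FactoredFunctor W V)

/-- By definition `θ^f(I)` is the totalization of a complex of factorizations, and its decomposition
is transported along the identification of this complex with the termwise image of the unfolding of
`I`. The decompositions are chosen simultaneously, naturally in `I`. -/
lemma exists_dec_onFact (c d : ℤ) :
    ∃ Γ : ∀ (I : Factorization W) [(θ.complex I).IsStrictlyGE c] [(θ.complex I).IsStrictlyLE d],
      Dec (θ.mapUnf ((unf W).obj I)) ((unf V).obj (θ.onFact.obj I)) c d,
    ∀ (I J : Factorization W) [(θ.complex I).IsStrictlyGE c] [(θ.complex I).IsStrictlyLE d]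
      [(θ.complex J).IsStrictlyGE c] [(θ.complex J).IsStrictlyLE d] (u : I ⟶ J) (n q i : ℤ)
      (h : n + q = i), (Γ I).ι n q i h ≫ Unf.Hom.f ((unf V).map (θ.onFact.map u)) i =
        (θ.θ.map (Unf.Hom.f ((unf W).map u) q)).f n ≫ (Γ J).ι n q i h := by
  obtain ⟨β, hβ⟩ := θ.exists_mapUnfIso
  refine ⟨fun I _ _ => Dec.ofIso (β I) (decTot (θ.complex I) c d),
    fun I J _ _ _ _ u n q i h => ?_⟩
  have e₁ := decTot_naturality (L := θ.complex J) (θ.complex I) c d (θ.complexFunctor.map u) c d n q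
    i h
  have e₂ := congrArg (fun f => HomologicalComplex.Hom.f (Unf.Hom.f f q) n) (hβ u)
  have abs {x₁ x₂ x₃ x₄ x₅ x₆ : B} {a₁ : x₁ ⟶ x₂} {a₂ : x₂ ⟶ x₃} {a₃ : x₃ ⟶ x₄} {b₁ : x₁ ⟶ x₅}
      {b₂ : x₅ ⟶ x₆} {b₃ : x₆ ⟶ x₄} {c₁ : x₂ ⟶ x₆} (h₁ : a₂ ≫ a₃ = c₁ ≫ b₃)
      (h₂ : b₁ ≫ b₂ = a₁ ≫ c₁) : (a₁ ≫ a₂) ≫ a₃ = b₁ ≫ b₂ ≫ b₃ := by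
    rw [assoc, h₁, ← assoc b₁, h₂, assoc]
  exact abs e₁ e₂

section

variable {I J : Factorization W} {M N : UnfC W.w} {a b a' b' : ℤ}
  (Δ : Dec M ((unf W).obj I) a b) (Δ' : Dec N ((unf W).obj J) a' b')
  {I' J' J'' : Factorization V} {N' : UnfC V.w} {c d c' d' c'' d'' : ℤ}
  (Γ : Dec (θ.mapUnf ((unf W).obj I)) ((unf V).obj I') c d)
  (Γ' : Dec (θ.mapUnf ((unf W).obj J)) ((unf V).obj J') c' d')
  (Γ'' : Dec N' ((unf V).obj J'') c'' d'')
  (u : I ⟶ J) (u' : I' ⟶ J')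
  (r : θ.totUnf N ⟶ N') (ρ : J' ⟶ J'')

lemma map_ι_comp (hρ : ∀ j q i h, (θ.dec Δ' Γ').ι j q i h ≫ Unf.Hom.f ((unf V).map ρ) i =
      (r.f q).f j ≫ Γ''.ι j q i h)
    (k q l m i j : ℤ) (hl : k + q = l) (hi : m + l = i) (hj : k + m = j) {T : B}
    (z : ((unf V).obj J'').X i ⟶ T) :
    (θ.θ.map (Δ'.ι k q l hl)).f m ≫ Γ'.ι m l i hi ≫ Unf.Hom.f ((unf V).map ρ) i ≫ z =
      totFun.ι θ.θ (N.X q) k m j hj ≫ (r.f q).f j ≫ Γ''.ι j q i (by lia) ≫ z := by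
  have e₁ := θ.ι_decι Δ' Γ' k m j q i l hj (by lia) hl
  have e₂ := hρ j q i (by lia)
  have abs {x₁ x₂ x₃ x₄ x₅ x₆ : B} {a₁ : x₁ ⟶ x₂} {a₂ : x₂ ⟶ x₃} {a₃ : x₃ ⟶ x₄} {a₄ : x₄ ⟶ x₅}
      {b₁ : x₁ ⟶ x₆} {b₂ : x₆ ⟶ x₃} {y : B} {c₁ : x₆ ⟶ y} {c₂ : y ⟶ x₄}
      (h₁ : b₁ ≫ b₂ = a₁ ≫ a₂) (h₂ : b₂ ≫ a₃ = c₁ ≫ c₂) :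
      a₁ ≫ a₂ ≫ a₃ ≫ a₄ = b₁ ≫ c₁ ≫ c₂ ≫ a₄ := by
    rw [← assoc a₁, ← h₁, assoc, ← assoc b₂, h₂, assoc]
  exact abs e₁ e₂

/-- This identifies the abstract map on double complexes with the action of `θ^f` on morphisms
followed by `ρ`. It lets the comparison of double complexes speak about `θ^f`. -/
lemma homRow_dec (hu : ∀ n q i h, Γ.ι n q i h ≫ Unf.Hom.f ((unf V).map u') i =
      (θ.θ.map (Unf.Hom.f ((unf W).map u) q)).f n ≫ Γ'.ι n q i h)
    (hρ : ∀ j q i h, (θ.dec Δ' Γ').ι j q i h ≫ Unf.Hom.f ((unf V).map ρ) i =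
      (r.f q).f j ≫ Γ''.ι j q i h)
    (p : ℤ) : homRow (θ.dec Δ Γ) Γ'' (u' ≫ ρ) p =
    (θ.rowMap (M := M) r).f 0 p (homRow Δ Δ' u p) := by
  refine UnfC.row_ext fun q q' e => ?_
  ext j j' hj
  refine totFun.hom_ext θ.θ fun k m hk => ?_
  obtain ⟨k', hk'⟩ : ∃ k', k + p = k' := ⟨_, rfl⟩
  obtain ⟨l, hl⟩ : ∃ l, k + q = l := ⟨_, rfl⟩
  obtain ⟨i, hi⟩ : ∃ i, m + l = i := ⟨_, rfl⟩
  have hl' : k' + q' = l := by lia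
  have hj' : k' + m = j' := by lia
  have e₁ := homRow_v (θ.dec Δ Γ) Γ'' (u' ≫ ρ) p q q' e j j' hj i (by lia) (by lia)
  have e₂ := θ.rowMap_f_v r 0 p (homRow Δ Δ' u p) q q' e k m j k' j' hk hk' hj
  have e₃ := homRow_v Δ Δ' u p q q' e k k' hk' l hl hl'
  have e₄ := θ.ι_decι Δ Γ k m j q i l hk (by lia) hl
  have e₅ : Unf.Hom.f ((unf V).map (u' ≫ ρ)) i = Unf.Hom.f ((unf V).map u') i ≫
      Unf.Hom.f ((unf V).map ρ) i := by
    rw [Functor.map_comp]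
    rfl
  have e₆ := hu m l i hi
  -- It suffices to compare after the images of the inclusions of `Δ'`. The summand of index `k'`
  -- contributes the asserted morphism, and the other ones are killed by both projections.
  have e₇ : (θ.θ.map (Δ'.pr k' q' l hl')).f m ≫ totFun.ι θ.θ (N.X q') k' m j' hj' ≫
      (r.f q').f j' = Γ'.ι m l i hi ≫ Unf.Hom.f ((unf V).map ρ) i ≫ Γ''.pr j' q' i (by lia) := by
    refine θ.mapDec_hom_ext Δ' fun k₁ q₁ h₁ => ?_
    refine Eq.trans ?_ (θ.map_ι_comp Δ' Γ' Γ'' r ρ hρ k₁ q₁ l m i (k₁ + m) h₁ hi rfl _).symm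
    by_cases hk₁ : k₁ = k'
    · subst hk₁
      obtain rfl : q₁ = q' := by lia
      obtain rfl : j' = k₁ + m := by lia
      rw [Γ''.ι_pr, comp_id, θ.map_f_comp (Δ'.ι_pr _ _ _ _), CategoryTheory.Functor.map_id,
        HomologicalComplex.id_f, id_comp]
    · rw [Γ''.ι_pr_ne _ _ _ _ _ _ _ (by lia), comp_zero, comp_zero,
        θ.map_f_comp (Δ'.ι_pr_ne _ _ _ _ _ _ _ hk₁), Functor.map_zero, HomologicalComplex.zero_f,
        zero_comp]
  refine (congrArg (_ ≫ ·) e₁).trans (Eq.trans ?_ e₂.symm)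
  have e₈ := congrArg (fun f => (θ.θ.map f).f m) e₃
  simp only [Functor.map_comp, HomologicalComplex.comp_f] at e₈
  have abs {x₁ x₂ x₃ x₄ x₅ x₆ x₇ x₈ y y' : B} {a₁ : x₁ ⟶ x₂} {a₂ : x₂ ⟶ x₃} {a₃ : x₃ ⟶ x₄}
      {a₄ : x₄ ⟶ x₅} {b₁ : x₁ ⟶ x₆} {b₂ : x₆ ⟶ x₃} {v₁ : x₃ ⟶ x₇} {v₂ : x₇ ⟶ x₄} {d₁ : x₆ ⟶ x₈}
      {d₂ : x₈ ⟶ x₇} {f₁ : x₁ ⟶ y} {f₂ : x₈ ⟶ y} {f₃ : y ⟶ y'} {f₄ : y' ⟶ x₅}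
      (h₁ : a₁ ≫ a₂ = b₁ ≫ b₂) (h₂ : a₃ = v₁ ≫ v₂) (h₃ : b₂ ≫ v₁ = d₁ ≫ d₂)
      (h₄ : f₁ = b₁ ≫ d₁ ≫ f₂) (h₅ : f₂ ≫ f₃ ≫ f₄ = d₂ ≫ v₂ ≫ a₄) :
      a₁ ≫ a₂ ≫ a₃ ≫ a₄ = f₁ ≫ f₃ ≫ f₄ := by
    rw [← assoc a₁, h₁, assoc, h₂, assoc, ← assoc b₂, h₃, h₄, assoc, assoc, assoc, h₅]
  exact abs e₄ e₅ e₆ e₈ e₇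

end

end FactoredFunctor

end

end FactCat

namespace FactCat

open CochainComplex HomComplex

/-! ### The components of shifts -/

section

variable {C : Type u} [Category.{v} C]

lemma nonempty_zPow_succ (e : C ≌ C) (n m : ℤ) (h : m + 1 = n) (X : C) :
    Nonempty ((zPow e n).obj X ≅ e.functor.obj ((zPow e m).obj X)) :=
  ⟨(zPowIso e n m h).app X⟩

lemma nonempty_zPow_add (e : C ≌ C) (m n : ℤ) (X : C) :
    Nonempty ((zPow e m).obj ((zPow e n).obj X) ≅ (zPow e (m + n)).obj X) := by
  induction m using Int.induction_on with
  | zero =>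
    rw [zero_add]
    exact ⟨Iso.refl _⟩
  | succ m hm =>
    obtain ⟨f⟩ := hm
    obtain ⟨g⟩ := nonempty_zPow_succ e (m + 1) m rfl ((zPow e n).obj X)
    obtain ⟨h⟩ := nonempty_zPow_succ e (m + 1 + n) (m + n) (by lia) X
    exact ⟨g ≪≫ e.functor.mapIso f ≪≫ h.symm⟩
  | pred m hm =>
    obtain ⟨f⟩ := hm
    obtain ⟨g⟩ := nonempty_zPow_succ e (-m) (-m - 1) (by lia) ((zPow e n).obj X)
    obtain ⟨h⟩ := nonempty_zPow_succ e (-m + n) (-m - 1 + n) (by lia) X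
    exact ⟨e.functor.preimageIso (g.symm ≪≫ f ≪≫ h)⟩

end

namespace Factorization

section

variable {A : Type u} [Category.{v} A] [Abelian A] {W : Potential A}

lemma nonempty_X_add_two (E : Factorization W) (i j : ℤ) (h : i + 2 = j) :
    Nonempty (E.X j ≅ W.Φ.functor.obj (E.X i)) := by
  have hp : Even j ↔ Even i := by
    subst h
    rw [Int.even_add]
    simp
  unfold X
  by_cases hi : Even i
  · rw [if_pos hi, if_pos (hp.2 hi)]
    exact nonempty_zPow_succ _ _ _ (by lia) _
  · rw [if_neg hi, if_neg (hp.not.2 hi)]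
    exact nonempty_zPow_succ _ _ _ (by lia) _

/-- The unfolding and the sequence `E.X` agree at `-1` and `0`, and both satisfy the same
periodicity; `Φ` reflects isomorphisms of objects, so the comparison goes in both directions. -/
lemma nonempty_comp_iso (E : Factorization W) (q : ℤ) : Nonempty ((comp W q).obj E ≅ E.X q) := by
  refine periodic_induction (P := fun q => Nonempty ((comp W q).obj E ≅ E.X q))
    ⟨E.unfX₁.symm⟩ ⟨E.unfX₀.symm⟩ (fun i j h => ?_) q
  obtain ⟨e⟩ := E.nonempty_X_add_two i j h
  have e' : W.Φ.functor.obj ((comp W i).obj E) ≅ (comp W j).obj E := (compπ W i j h).app E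
  exact ⟨fun ⟨f⟩ => ⟨e'.symm ≪≫ W.Φ.functor.mapIso f ≪≫ e.symm⟩,
    fun ⟨f⟩ => ⟨W.Φ.functor.preimageIso (e' ≪≫ f ≪≫ e)⟩⟩

lemma nonempty_comp_shiftBy_iso (E : Factorization W) (q t : ℤ) :
    Nonempty ((comp W q).obj ((shiftBy W t).obj E) ≅ E.X (q + t)) := by
  obtain ⟨e⟩ := nonempty_zPow_add (shiftEquiv W) q t E
  obtain ⟨f⟩ := E.nonempty_comp_iso (q + t)
  exact ⟨(ev₀ W).mapIso e ≪≫ f⟩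

end

/-! ### Folding a complex of unfoldings -/

section

variable {A : Type u} [Category.{v} A] [Abelian A] {W : Potential A} (P : UnfC W.w)

/-- The second structure map of the factorizations that correspond to a complex of unfoldings. -/
noncomputable def foldb : P.X 0 ⟶
    (W.Φ.functor.mapHomologicalComplex (ComplexShape.up ℤ)).obj (P.X (-1)) :=
  P.d 0 1 (by lia) ≫ (P.π (-1) 1 (by lia)).inv

lemma d_foldb : P.d (-1) 0 (by lia) ≫ foldb P = (complexW W.w).app (P.X (-1)) := by
  rw [foldb, ← assoc, P.d_d (-1) 0 1 _ _ (by lia), assoc, Iso.hom_inv_id, comp_id]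

lemma foldb_d : foldb P ≫ (W.Φ.functor.mapHomologicalComplex (ComplexShape.up ℤ)).map
    (P.d (-1) 0 (by lia)) = (complexW W.w).app (P.X 0) := by
  have e := P.π_d (-1) 0 1 2 (by lia) (by lia) (by lia) (by lia)
  rw [← cancel_mono (P.π 0 2 (by lia)).hom, assoc, e, foldb, assoc, Iso.inv_hom_id_assoc,
    P.d_d 0 1 2]

/-- The complex of factorizations that corresponds to a complex of unfoldings. -/
noncomputable def fold : CochainComplex (Factorization W) ℤ where
  X k :=
    { X₁ := (P.X (-1)).X k
      X₀ := (P.X 0).X k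
      a := (P.d (-1) 0 (by lia)).f k
      b := (foldb P).f k
      a_b := congrArg (fun f => HomologicalComplex.Hom.f f k) (d_foldb P)
      b_a := congrArg (fun f => HomologicalComplex.Hom.f f k) (foldb_d P) }
  d k l :=
    { f₁ := (P.X (-1)).d k l
      f₀ := (P.X 0).d k l
      comm_a := ((P.d (-1) 0 (by lia)).comm k l).symm
      comm_b := ((foldb P).comm k l).symm }
  shape k l h := by
    ext
    · exact (P.X (-1)).shape k l h
    · exact (P.X 0).shape k l h
  d_comp_d' k l m _ _ := by
    ext
    · exact (P.X (-1)).d_comp_d k l m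
    · exact (P.X 0).d_comp_d k l m

/-- Folding keeps the indices `-1` and `0`, so the isomorphism is produced there. It makes complexes
of unfoldings, such as `totUnf`, accessible to resolutions by factorizations. -/
lemma nonempty_unfC_fold : Nonempty (P ≅ (unfC W).obj (fold P)) := by
  let e₁ : P.X (-1) ≅ ((unfC W).obj (fold P)).X (-1) :=
    HomologicalComplex.Hom.isoOfComponents (fun k => ((fold P).X k).unfX₁)
      fun k l _ => unf_map_f₁ ((fold P).d k l)
  let e₀ : P.X 0 ≅ ((unfC W).obj (fold P)).X 0 :=
    HomologicalComplex.Hom.isoOfComponents (fun k => ((fold P).X k).unfX₀)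
      fun k l _ => unf_map_f₀ ((fold P).d k l)
  obtain ⟨f, -⟩ := Unf.exists_iso P ((unfC W).obj (fold P)) e₁ e₀
    (by ext k; exact ((fold P).X k).unfX₁_d) (by
      rw [Unf.homEquiv_apply]
      ext k
      exact ((fold P).X k).unfX₀_d.trans (assoc _ _ _))
  exact ⟨f⟩

lemma fold_isStrictlyGE (a : ℤ) [CochainComplex.IsStrictlyGE (P.X (-1)) a]
    [CochainComplex.IsStrictlyGE (P.X 0) a] :
    (fold P).IsStrictlyGE a := by
  rw [isStrictlyGE_iff]
  intro i hi
  exact (isZero_iff _).2 ⟨CochainComplex.isZero_of_isStrictlyGE (P.X (-1)) a i hi,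
    CochainComplex.isZero_of_isStrictlyGE (P.X 0) a i hi⟩

lemma fold_isStrictlyLE (b : ℤ) [CochainComplex.IsStrictlyLE (P.X (-1)) b]
    [CochainComplex.IsStrictlyLE (P.X 0) b] :
    (fold P).IsStrictlyLE b := by
  rw [isStrictlyLE_iff]
  intro i hi
  exact (isZero_iff _).2 ⟨CochainComplex.isZero_of_isStrictlyLE (P.X (-1)) b i hi,
    CochainComplex.isZero_of_isStrictlyLE (P.X 0) b i hi⟩

end

end Factorization

/-! ### Dimension shifting and bounded resolutions -/

section

variable {A : Type u} [Category.{v} A] [Abelian A]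

lemma shortExact_cycles (K : CochainComplex A ℤ) (i j : ℤ) (h : i + 1 = j) (hK : K.ExactAt j) :
    (ShortComplex.mk (K.iCycles i) (K.toCycles i j) (by
      rw [← cancel_mono (K.iCycles j), assoc, K.toCycles_i, zero_comp, K.iCycles_d])).ShortExact
        where
  exact := ShortComplex.exact_of_f_is_kernel _
    (isKernelOfComp (K.iCycles j) (K.d i j) (K.cyclesIsKernel i j (by simpa using h)) _
      (K.toCycles_i i j))
  mono_f := inferInstanceAs (Mono (K.iCycles i))
  epi_g := by
    obtain rfl : (ComplexShape.up ℤ).prev j = i := by simp [← h]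
    have := ShortComplex.Exact.epi_toCycles hK
    exact this

/-- Dimension shifting: in the exact range, each step along the short exact sequences of cycles,
whose middle term is injective, lowers the bound on the injective dimension by one. -/
lemma injective_cycles (K : CochainComplex A ℤ) [hI : ∀ n, Injective (K.X n)] (s : ℤ)
    (hK : ∀ n, s < n → K.ExactAt n) (n : ℕ) :
    ∀ m : ℕ, HasInjectiveDimensionLT (K.cycles (s + m)) (n + 1) →
      Injective (K.cycles (s + m + n)) := by
  induction n with
  | zero =>
    intro m hm
    rw [injective_iff_hasInjectiveDimensionLT_one]
    simpa using hm
  | succ n ih =>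
    intro m hm
    have := (shortExact_cycles K (s + m) (s + m + 1) rfl
      (hK _ (by lia))).hasInjectiveDimensionLT_X₃_iff n (hI _)
    have h := ih (m + 1) (by
      rw [Nat.cast_add, Nat.cast_one, ← add_assoc]
      exact this.2 hm)
    rwa [show s + m + (n + 1 : ℕ) = s + (m + 1 : ℕ) + n by push_cast; ring]

end

namespace Factorization

variable {A : Type u} [Category.{v} A] [Abelian A] {W : Potential A}

lemma InjComp.of_iso {I J : Factorization W} (e : I ≅ J) (hI : InjComp I) : InjComp J :=
  ⟨Injective.of_iso ((ev₁ W).mapIso e) hI.1, Injective.of_iso ((ev₀ W).mapIso e) hI.2⟩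

/-- Dimension shifting is applied to both components with the maximum of the two bounds, so that one
degree works for both. -/
lemma exists_injComp_cycles (K : CochainComplex (Factorization W) ℤ) (hK : ∀ n, InjComp (K.X n))
    (s : ℤ) (hs : ∀ n, s < n → K.ExactAt n)
    (h₁ : HasFiniteInjectiveDimension (K.cycles s).X₁)
    (h₀ : HasFiniteInjectiveDimension (K.cycles s).X₀) :
    ∃ m, s ≤ m ∧ InjComp (K.cycles m) := by
  obtain ⟨n₁, h₁⟩ := h₁
  obtain ⟨n₀, h₀⟩ := h₀
  have key (F : Factorization W ⥤ A) [F.Additive] [F.PreservesHomology]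
      (hF : ∀ n, Injective (F.obj (K.X n)))
      (hn : HasInjectiveDimensionLT (F.obj (K.cycles s)) (max n₁ n₀ + 1)) :
      Injective (F.obj (K.cycles (s + (max n₁ n₀ : ℕ)))) := by
    let K' := (F.mapHomologicalComplex (ComplexShape.up ℤ)).obj K
    have (n : ℤ) : Injective (K'.X n) := hF n
    have e (n : ℤ) : K'.cycles n ≅ F.obj (K.cycles n) := (K.sc n).mapCyclesIso F
    have h := injective_cycles K' s (fun n hn => (hs n hn).map F) (max n₁ n₀) 0 (by
      rw [Nat.cast_zero, add_zero]
      exact hasInjectiveDimensionLT_of_iso (e s).symm _)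
    rw [Nat.cast_zero, add_zero] at h
    exact Injective.of_iso (e _) h
  refine ⟨s + (max n₁ n₀ : ℕ), by lia, key (ev₁ W) (fun n => (hK n).1) ?_,
    key (ev₀ W) (fun n => (hK n).2) ?_⟩
  · have : HasInjectiveDimensionLT ((ev₁ W).obj (K.cycles s)) (n₁ + 1) := h₁
    exact hasInjectiveDimensionLT_of_ge _ (n₁ + 1) _ (by lia)
  · have : HasInjectiveDimensionLT ((ev₀ W).obj (K.cycles s)) (n₀ + 1) := h₀
    exact hasInjectiveDimensionLT_of_ge _ (n₀ + 1) _ (by lia)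

/-- The truncation changes only the top term, which becomes the object of cycles. -/
lemma InjComp.truncLE_X {K : CochainComplex (Factorization W) ℤ} (hK : ∀ n, InjComp (K.X n)) {m : ℤ}
    (hm : InjComp (K.cycles m)) (i : ℤ) : InjComp ((K.truncLE m).X i) := by
  obtain hi | rfl | hi := lt_trichotomy i m
  · exact (hK i).of_iso (K.truncLEXIso m i hi).symm
  · exact hm.of_iso (K.truncLEXIsoCycles i).symm
  · exact .of_isZero (isZero_of_isStrictlyLE (K.truncLE m) m i hi)

/-- A bounded complex has a bounded resolution with injective components, if the components of its
resolutions have finite injective dimension. -/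
lemma exists_bounded_resolution [EnoughInjectives A] (L : CochainComplex (Factorization W) ℤ)
    (a b : ℤ) [L.IsStrictlyGE a] [L.IsStrictlyLE b]
    (h : ∀ (K : CochainComplex (Factorization W) ℤ) (φ : L ⟶ K) [QuasiIso φ] [K.IsStrictlyGE a],
      HasFiniteInjectiveDimension (K.cycles b).X₁ ∧ HasFiniteInjectiveDimension (K.cycles b).X₀) :
    ∃ (K : CochainComplex (Factorization W) ℤ) (φ : L ⟶ K) (m : ℤ), QuasiIso φ ∧
      K.IsStrictlyGE a ∧ K.IsStrictlyLE m ∧ ∀ n, InjComp (K.X n) := by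
  obtain ⟨K, φ, _, hK, _⟩ :=
    CochainComplex.Plus.modelCategoryQuillen.exists_quasiIso_injective L a
  have hK (n : ℤ) : InjComp (K.X n) := .of_injective (hK n)
  obtain ⟨h₁, h₀⟩ := h K φ
  -- The resolution has the same cohomology as `L`, so it is exact above `b`. The truncation at `m ≥
  -- b` therefore remains quasi-isomorphic to `L`.
  obtain ⟨m, hm, hm'⟩ := exists_injComp_cycles K hK b (fun n hn => by
    rw [← exactAt_iff_of_quasiIsoAt φ]
    exact L.exactAt_of_isLE b n hn) h₁ h₀
  have : L.IsStrictlyLE m := isStrictlyLE_of_le L b m hm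
  refine ⟨K.truncLE m, inv (ιTruncLE L m) ≫ truncLEMap φ m, m, ?_, ?_, inferInstance,
    InjComp.truncLE_X hK hm'⟩
  · have : QuasiIso (truncLEMap φ m) := by
      rw [quasiIso_truncLEMap_iff]
      intros
      infer_instance
    infer_instance
  · infer_instance

end Factorization

/-! ### Finite injective dimension under equivalences and resolutions -/

section

variable {A : Type u} [Category.{v} A] [Abelian A]

lemma HasFiniteInjectiveDimension.of_iso {X Y : A} (h : HasFiniteInjectiveDimension X) (e : X ≅ Y) :
    HasFiniteInjectiveDimension Y := by
  obtain ⟨n, hn⟩ := h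
  exact ⟨n, hasInjectiveDimensionLT_of_iso e (n + 1)⟩

/-- An equivalence preserves injectives and the short exact sequence of an embedding into an
injective, which gives an induction on the dimension. -/
lemma hasInjectiveDimensionLE_map [EnoughInjectives A] (e : A ≌ A) (n : ℕ) : ∀ X : A,
    HasInjectiveDimensionLT X (n + 1) → HasInjectiveDimensionLT (e.functor.obj X) (n + 1) := by
  induction n with
  | zero =>
    intro X hX
    have : Injective X := injective_iff_hasInjectiveDimensionLT_one.2 hX
    exact injective_iff_hasInjectiveDimensionLT_one.1 (e.map_injective_iff X |>.2 this)
  | succ n ih =>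
    intro X hX
    let S := ShortComplex.mk (Injective.ι X) (cokernel.π (Injective.ι X)) (cokernel.condition _)
    have hS : S.ShortExact :=
      { exact := S.exact_of_g_is_cokernel (cokernelIsCokernel _) }
    have hS' := hS.map_of_exact e.functor
    have hI : Injective (S.map e.functor).X₂ :=
      (e.map_injective_iff (Injective.under X)).2 inferInstance
    exact (hS'.hasInjectiveDimensionLT_X₃_iff n hI).1
      (ih _ ((hS.hasInjectiveDimensionLT_X₃_iff n inferInstance).2 hX))

lemma HasFiniteInjectiveDimension.map [EnoughInjectives A] {X : A}
    (h : HasFiniteInjectiveDimension X) (e : A ≌ A) :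
    HasFiniteInjectiveDimension (e.functor.obj X) := by
  obtain ⟨n, hn⟩ := h
  exact ⟨n, hasInjectiveDimensionLE_map e n X hn⟩

/-- Neither complex has terms below degree `0`, so the cycles in degree `0` are the homology. -/
lemma nonempty_cycles_iso_of_quasiIso_single {E : A} {K : CochainComplex A ℤ}
    (φ : (singleFunctor A 0).obj E ⟶ K) [QuasiIso φ] [K.IsStrictlyGE 0] :
    Nonempty (E ≅ K.cycles 0) := by
  have h (L : CochainComplex A ℤ) [L.IsStrictlyGE 0] : L.cycles 0 ≅ L.homology 0 :=
    L.isoHomologyπ (-1) 0 (by simp) ((L.isZero_of_isStrictlyGE 0 (-1)).eq_of_src _ _)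
  exact ⟨(HomologicalComplex.singleObjCyclesSelfIso (ComplexShape.up ℤ) 0 E).symm ≪≫
    h ((singleFunctor A 0).obj E) ≪≫ asIso (HomologicalComplex.homologyMap φ 0) ≪≫ (h K).symm⟩

end

namespace Factorization

variable {A : Type u} [Category.{v} A] [Abelian A] [EnoughInjectives A] {W : Potential A}

lemma hasFiniteInjectiveDimension_shiftBy (E : Factorization W)
    (h₁ : HasFiniteInjectiveDimension E.X₁) (h₀ : HasFiniteInjectiveDimension E.X₀) (q : ℤ) :
    HasFiniteInjectiveDimension ((shiftBy W q).obj E).X₁ ∧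
      HasFiniteInjectiveDimension ((shiftBy W q).obj E).X₀ := by
  have h₁ (n : ℕ) : HasFiniteInjectiveDimension ((natPow (Factorization.T W) n).obj E).X₁ ∧
      HasFiniteInjectiveDimension ((natPow (Factorization.T W) n).obj E).X₀ := by
    induction n with
    | zero => exact ⟨h₁, h₀⟩
    | succ n ih => exact ⟨ih.2, ih.1.map W.Φ⟩
  have h₂ (n : ℕ) : HasFiniteInjectiveDimension ((natPow (Factorization.S W) n).obj E).X₁ ∧
      HasFiniteInjectiveDimension ((natPow (Factorization.S W) n).obj E).X₀ := by
    induction n with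
    | zero => exact h₁ 0
    | succ n ih => exact ⟨ih.2.map W.Φ.symm, ih.1⟩
  match q with
  | Int.ofNat n => exact h₁ n
  | Int.negSucc n => exact h₂ (n + 1)

/-- A factorization whose components have finite injective dimension has a bounded resolution by
factorizations with injective components. -/
lemma exists_bounded_resolution_single (E : Factorization W)
    (h₁ : HasFiniteInjectiveDimension E.X₁) (h₀ : HasFiniteInjectiveDimension E.X₀) :
    ∃ (K : CochainComplex (Factorization W) ℤ) (φ : (singleFunctor _ 0).obj E ⟶ K) (m : ℤ),
      QuasiIso φ ∧ K.IsStrictlyGE 0 ∧ K.IsStrictlyLE m ∧ ∀ n, InjComp (K.X n) := by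
  refine exists_bounded_resolution _ 0 0 fun K φ _ _ => ?_
  obtain ⟨e⟩ := nonempty_cycles_iso_of_quasiIso_single φ
  exact ⟨h₁.of_iso ((ev₁ W).mapIso e), h₀.of_iso ((ev₀ W).mapIso e)⟩

end Factorization

lemma bijective_map_of_iso {C : Type u₁} [Category.{v₁} C] {D : Type u₂} [Category.{v₂} D]
    (G : C ⥤ D) {X X' Y Y' : C} (e : X ≅ X') (e' : Y ≅ Y')
    (h : Function.Bijective (G.map : (X' ⟶ Y') → _)) :
    Function.Bijective (G.map : (X ⟶ Y) → _) := by
  refine bijective_of_comp_iso_eq (G.mapIso e) (G.mapIso e')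
    (g := fun f : X ⟶ Y => G.map (e.homCongr e' f)) (fun f => ?_) (h.comp (e.homCongr e').bijective)
  change G.map f ≫ G.map e'.hom = G.map e.hom ≫ G.map (e.inv ≫ f ≫ e'.hom)
  rw [← Functor.map_comp, ← Functor.map_comp, Iso.hom_inv_id_assoc]

/-! ### Resolutions in the derived category -/

section

variable {A : Type u₁} [Category.{v₁} A] [Abelian A] [HasDerivedCategory.{w₁} A]

lemma nonempty_plusQ_iso_single (X : CochainComplex.Plus A) {x : A}
    (ψ : (singleFunctor A 0).obj x ⟶ X.obj) [QuasiIso ψ] :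
    Nonempty (DerivedCategory.Plus.Q.obj X ≅ (DerivedCategory.Plus.singleFunctor A 0).obj x) := by
  have e : DerivedCategory.Plus.ι.obj (DerivedCategory.Plus.Q.obj X) ≅
      DerivedCategory.Q.obj X.obj := (DerivedCategory.quotientCompQhIso A).app X.obj
  have e' : DerivedCategory.Q.obj ((singleFunctor A 0).obj x) ≅
      DerivedCategory.Plus.ι.obj ((DerivedCategory.Plus.singleFunctor A 0).obj x) :=
    ((DerivedCategory.singleFunctorIsoCompQ A 0).app x).symm
  exact ⟨DerivedCategory.Plus.ι.preimageIso
    (e ≪≫ (asIso (DerivedCategory.Q.map ψ)).symm ≪≫ e')⟩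

lemma nonempty_plusQ_plusShift_iso (Y : CochainComplex.Plus A) (p : ℤ) :
    Nonempty (DerivedCategory.Plus.Q.obj (plusShift Y p) ≅
      (CategoryTheory.shiftFunctor (DerivedCategory.Plus A) p).obj (DerivedCategory.Plus.Q.obj Y))
        := by
  have e (X : CochainComplex.Plus A) : DerivedCategory.Plus.ι.obj (DerivedCategory.Plus.Q.obj X) ≅
      DerivedCategory.Q.obj X.obj := (DerivedCategory.quotientCompQhIso A).app X.obj
  have e' : DerivedCategory.Q.obj (Y.obj⟦p⟧) ≅
      (CategoryTheory.shiftFunctor (DerivedCategory A) p).obj (DerivedCategory.Q.obj Y.obj) :=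
    (DerivedCategory.Q.commShiftIso p).app Y.obj
  exact ⟨DerivedCategory.Plus.ι.preimageIso (e (plusShift Y p) ≪≫ e' ≪≫
    (CategoryTheory.shiftFunctor (DerivedCategory A) p).mapIso (e Y).symm ≪≫
      ((DerivedCategory.Plus.ι.commShiftIso p).app _).symm)⟩

/-- Resolutions become isomorphic to the resolved objects, compatibly with shifts up to isomorphism,
so bijectivity for objects in degree `0` can be used for their resolutions. -/
lemma bijective_map_plusShift {D : Type u₂} [Category.{v₂} D] (G : DerivedCategory.Plus A ⥤ D)
    {X Y : CochainComplex.Plus A} {x y : A} (ψ : (singleFunctor A 0).obj x ⟶ X.obj) [QuasiIso ψ]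
    (χ : (singleFunctor A 0).obj y ⟶ Y.obj) [QuasiIso χ] (p : ℤ)
    (h : Function.Bijective (G.map : ((DerivedCategory.Plus.singleFunctor A 0).obj x ⟶
      (CategoryTheory.shiftFunctor (DerivedCategory.Plus A) p).obj
        ((DerivedCategory.Plus.singleFunctor A 0).obj y)) → _)) :
    Function.Bijective (G.map :
      (DerivedCategory.Plus.Q.obj X ⟶ DerivedCategory.Plus.Q.obj (plusShift Y p)) → _) := by
  obtain ⟨e⟩ := nonempty_plusQ_iso_single X ψ
  obtain ⟨e'⟩ := nonempty_plusQ_iso_single Y χ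
  obtain ⟨e''⟩ := nonempty_plusQ_plusShift_iso Y p
  exact bijective_map_of_iso G e (e'' ≪≫ (CategoryTheory.shiftFunctor (DerivedCategory.Plus A)
    p).mapIso e') h

end

namespace Factorization

variable {A : Type u} [Category.{v} A] [Abelian A] {W : Potential A}

/-- The unfolding of a resolution is a resolution. -/
lemma exists_quasiIso_comp {E : Factorization W} {K : CochainComplex (Factorization W) ℤ}
    (φ : (singleFunctor _ 0).obj E ⟶ K) [QuasiIso φ] (q : ℤ) {x : A} (e : x ≅ (comp W q).obj E) :
    ∃ ψ : (singleFunctor A 0).obj x ⟶ ((unfC W).obj K).X q, QuasiIso ψ := by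
  let f : (singleFunctor A 0).obj x ≅
      ((comp W q).mapHomologicalComplex (ComplexShape.up ℤ)).obj ((singleFunctor _ 0).obj E) :=
    (singleFunctor A 0).mapIso e ≪≫ ((HomologicalComplex.singleMapHomologicalComplex (comp W q)
      (ComplexShape.up ℤ) 0).app E).symm
  have h : QuasiIso (f.hom ≫ ((comp W q).mapHomologicalComplex (ComplexShape.up ℤ)).map φ) :=
    inferInstance
  exact ⟨_, h⟩

end Factorization

end FactCat

namespace FactCat

open CochainComplex HomComplex Factorization

/-! ### Bounded replacements and the comparison of homotopy classes -/

section

variable {A : Type u} [Category.{v} A] [Abelian A] {F : A ⥤ A} {w : 𝟭 A ⟶ F} [F.Additive]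
  {M : UnfC w} {G : Unf F w} {a b : ℤ}

lemma Dec.injective (Δ : Dec M G a b) (i : ℤ) (h : ∀ k q, Injective ((M.X q).X k)) :
    Injective (G.X i) where
  factors {X Y} g f _ := by
    refine ⟨∑ k ∈ Finset.Icc a b, Injective.factorThru (g ≫ Δ.pr k (i - k) i (by lia)) f ≫
      Δ.ι k (i - k) i (by lia), ?_⟩
    rw [Preadditive.comp_sum]
    refine (Finset.sum_congr rfl fun k _ => ?_).trans ((Preadditive.comp_sum _ _ _).symm.trans
      ((congrArg (g ≫ ·) (Δ.sum_eq i)).trans (comp_id g)))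
    rw [← assoc, Injective.comp_factorThru, assoc]

lemma Dec.isStrictlyGE (Δ : Dec M G a b) (q : ℤ) : CochainComplex.IsStrictlyGE (M.X q) a := by
  rw [isStrictlyGE_iff]
  exact fun i hi => Δ.isZero i q fun h => by
    rw [Finset.mem_Icc] at h
    lia

lemma Dec.isStrictlyLE (Δ : Dec M G a b) (q : ℤ) : CochainComplex.IsStrictlyLE (M.X q) b := by
  rw [isStrictlyLE_iff]
  exact fun i hi => Δ.isZero i q fun h => by
    rw [Finset.mem_Icc] at h
    lia

end

namespace Factorization

variable {A : Type u} [Category.{v} A] [Abelian A] {W : Potential A}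

/-- A bounded totalization is a finite direct sum, so no closure of injectives under infinite
coproducts is needed. This is the form used for the category containing the values of `θ`. -/
lemma injComp_totalization_of_bounded [HasCoproducts.{v} A] (K : CochainComplex (Factorization W) ℤ)
    (hK : ∀ n, InjComp (K.X n)) (a b : ℤ) [K.IsStrictlyGE a] [K.IsStrictlyLE b] :
    InjComp ((totalization W).obj K) := by
  have h (i : ℤ) : Injective (((unf W).obj ((totalization W).obj K)).X i) :=
    (decTot K a b).injective i fun k q => ((hK k).shiftBy q).2
  exact ⟨Injective.of_iso ((totalization W).obj K).unfX₁.symm (h _),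
    Injective.of_iso ((totalization W).obj K).unfX₀.symm (h _)⟩

/-- The components of the unfolding of a bounded below complex. -/
abbrev plusUnf (K : CochainComplex (Factorization W) ℤ) (a : ℤ) [K.IsStrictlyGE a] (q : ℤ) :
    CochainComplex.Plus A :=
  ⟨((unfC W).obj K).X q, a, inferInstanceAs (CochainComplex.IsStrictlyGE
    (((comp W q).mapHomologicalComplex (ComplexShape.up ℤ)).obj K) a)⟩

end Factorization

namespace FactoredFunctor

variable {A : Type u₁} [Category.{v₁} A] [Abelian A] {B : Type u₂} [Category.{v₂} B] [Abelian B]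
  {W : Potential A} {V : Potential B} (θ : FactoredFunctor W V)

lemma exists_isStrictly_complex (I : Factorization W) :
    ∃ c d : ℤ, (θ.complex I).IsStrictlyGE c ∧ (θ.complex I).IsStrictlyLE d := by
  obtain ⟨c₁, d₁, _, _⟩ := θ.bounded I.X₁
  obtain ⟨c₀, d₀, _, _⟩ := θ.bounded I.X₀
  refine ⟨min c₁ c₀, max d₁ d₀, (isStrictlyGE_iff _ _).2 fun i hi => (isZero_iff _).2 ⟨?_, ?_⟩,
    (isStrictlyLE_iff _ _).2 fun i hi => (isZero_iff _).2 ⟨?_, ?_⟩⟩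
  · exact isZero_of_isStrictlyGE (θ.θ.obj I.X₁) c₁ i (by lia)
  · exact isZero_of_isStrictlyGE (θ.θ.obj I.X₀) c₀ i (by lia)
  · exact isZero_of_isStrictlyLE (θ.θ.obj I.X₁) d₁ i (by lia)
  · exact isZero_of_isStrictlyLE (θ.θ.obj I.X₀) d₀ i (by lia)

lemma exists_isStrictly_complex₂ (I J : Factorization W) :
    ∃ c d : ℤ, ((θ.complex I).IsStrictlyGE c ∧ (θ.complex I).IsStrictlyLE d) ∧
      (θ.complex J).IsStrictlyGE c ∧ (θ.complex J).IsStrictlyLE d := by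
  obtain ⟨c₁, d₁, _, _⟩ := θ.exists_isStrictly_complex I
  obtain ⟨c₀, d₀, _, _⟩ := θ.exists_isStrictly_complex J
  exact ⟨min c₁ c₀, max d₁ d₀,
    ⟨isStrictlyGE_of_ge _ _ c₁ (by lia), isStrictlyLE_of_le _ d₁ _ (by lia)⟩,
    isStrictlyGE_of_ge _ _ c₀ (by lia), isStrictlyLE_of_le _ d₀ _ (by lia)⟩

variable [HasCoproducts.{v₂} B]

/-- The totalization of a bounded complex becomes, after applying a factored functor, a
factorization
with a resolution that comes from the total complexes. -/
lemma exists_resolution_onFact (hB : FiniteInjectiveDimension B) {J : Factorization W}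
    {N : UnfC W.w}
    {a b c d : ℤ} (Δ : Dec N ((unf W).obj J) a b)
    (Γ : Dec (θ.mapUnf ((unf W).obj J)) ((unf V).obj (θ.onFact.obj J)) c d) :
    ∃ (J' : Factorization V) (ρ : θ.onFact.obj J ⟶ J') (N' : UnfC V.w) (r : θ.totUnf N ⟶ N')
      (c' d' : ℤ) (Γ' : Dec N' ((unf V).obj J') c' d'), InjComp J' ∧ IsIso ((toDco V).map ρ) ∧
      (∀ q, QuasiIso (r.f q)) ∧ (∀ q, CochainComplex.IsKInjective (N'.X q)) ∧
      ∀ j q i h, (θ.dec Δ Γ).ι j q i h ≫ Unf.Hom.f ((unf V).map ρ) i =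
        (r.f q).f j ≫ Γ'.ι j q i h := by
  have := hB.1
  have := fun q => (θ.dec Δ Γ).isStrictlyGE q
  have := fun q => (θ.dec Δ Γ).isStrictlyLE q
  obtain ⟨e⟩ := nonempty_unfC_fold (θ.totUnf N)
  -- The image of `J` is again the totalization of a bounded complex of factorizations, now formed
  -- from the total complexes of `θ(N^q)`.
  let L := fold (θ.totUnf N)
  have : L.IsStrictlyGE (a + c) := fold_isStrictlyGE _ _
  have : L.IsStrictlyLE (b + d) := fold_isStrictlyLE _ _
  obtain ⟨n, hn⟩ := hB.2
  -- All objects of the target category have injective dimension at most `n`, so the condition on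
  -- cycles holds for every resolution.
  obtain ⟨K, φ, m, _, _, _, hK⟩ := exists_bounded_resolution L (a + c) (b + d)
    fun _ _ _ _ => ⟨⟨n, hn _⟩, ⟨n, hn _⟩⟩
  obtain ⟨f, hf⟩ := (θ.dec Δ Γ).exists_iso (decTot L (a + c) (b + d)) e
  let g := (unf V).preimageIso f
  have hg : (unf V).map g.hom = f.hom := (unf V).map_preimage f.hom
  have := isIso_toDco_map _ (isCoacyclic_cone_totalization φ (a + c))
  refine ⟨(totalization V).obj K, g.hom ≫ (totalization V).map φ, (unfC V).obj K,
    e.hom ≫ (unfC V).map φ, a + c, m, decTot K (a + c) m,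
    injComp_totalization_of_bounded K hK (a + c) m, ?_, fun q => ?_,
    isKInjective_comp K (a + c) hK, fun j q i h => ?_⟩
  · rw [Functor.map_comp]
    infer_instance
  · have h₁ : IsIso (e.hom.f q) :=
      ⟨e.inv.f q, congrArg (fun f => Unf.Hom.f f q) e.hom_inv_id,
        congrArg (fun f => Unf.Hom.f f q) e.inv_hom_id⟩
    have h₂ : QuasiIso (((comp V q).mapHomologicalComplex (ComplexShape.up ℤ)).map φ) :=
      inferInstance
    have abs {K₁ K₂ K₃ : CochainComplex B ℤ} (x : K₁ ⟶ K₂) (y : K₂ ⟶ K₃) (_ : IsIso x)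
        (_ : QuasiIso y) : QuasiIso (x ≫ y) := inferInstance
    exact abs _ _ h₁ h₂
  · have e₁ := hf j q i h
    have e₂ := decTot_naturality L (a + c) (b + d) φ (a + c) m j q i h
    have e₃ : Unf.Hom.f ((unf V).map (g.hom ≫ (totalization V).map φ)) i =
        f.hom.f i ≫ Unf.Hom.f ((unf V).map ((totalization V).map φ)) i := by
      rw [Functor.map_comp, hg]
      rfl
    have abs {x₁ x₂ x₃ x₄ x₅ x₆ : B} {a₁ : x₁ ⟶ x₂} {a₂ : x₂ ⟶ x₄} {b₁ : x₂ ⟶ x₃} {b₂ : x₃ ⟶ x₄}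
        {c₁ : x₁ ⟶ x₅} {c₂ : x₅ ⟶ x₃} {d₁ : x₅ ⟶ x₆} {d₂ : x₆ ⟶ x₄} (h₁ : a₁ ≫ b₁ = c₁ ≫ c₂)
        (h₂ : c₂ ≫ b₂ = d₁ ≫ d₂) (h₃ : a₂ = b₁ ≫ b₂) : a₁ ≫ a₂ = (c₁ ≫ d₁) ≫ d₂ := by
      rw [h₃, ← assoc, h₁, assoc, h₂, assoc]
    exact abs e₁ e₂ e₃

variable [EnoughInjectives A] [HasCoproducts.{v₁} A] [HasDerivedCategory.{w₁} A]
  [HasDerivedCategory.{w₂} B]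

/-- The rows of the double complex for the images are Hom complexes from the total complexes of
`θ(K^q)` to injective resolutions of those of `θ(L^{q'})`. By the assumption on `Rθ`, `rowMap` is a
quasi-isomorphism on rows, and the comparison of double complexes yields both assertions. -/
lemma exists_bijective_onFact_map (hB : FiniteInjectiveDimension B)
    (K L : CochainComplex (Factorization W) ℤ) (a b a' b' : ℤ) [K.IsStrictlyGE a]
    [K.IsStrictlyLE b] [L.IsStrictlyGE a'] [L.IsStrictlyLE b'] (hK : ∀ n, InjComp (K.X n))
    (hL : ∀ n, InjComp (L.X n))
    (hR : ∀ q q' p : ℤ, Function.Bijective ((totalRightDerived θ.θ).map :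
      (DerivedCategory.Plus.Q.obj (plusUnf K a q) ⟶
        DerivedCategory.Plus.Q.obj (plusShift (plusUnf L a' q') p)) → _)) :
    ∃ (J' : Factorization V) (ρ : θ.onFact.obj ((totalization W).obj L) ⟶ J'), InjComp J' ∧
      IsIso ((toDco V).map ρ) ∧
      (∀ u : (totalization W).obj K ⟶ (totalization W).obj L,
        IsNull (θ.onFact.map u ≫ ρ) → IsNull u) ∧
      ∀ u' : θ.onFact.obj ((totalization W).obj K) ⟶ J', ∃ u : (totalization W).obj K ⟶
        (totalization W).obj L,
        IsNull (u' - θ.onFact.map u ≫ ρ) := by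
  let Δ := decTot K a b
  let Δ' := decTot L a' b'
  obtain ⟨c, d, ⟨_, _⟩, _, _⟩ :=
    θ.exists_isStrictly_complex₂ ((totalization W).obj K) ((totalization W).obj L)
  obtain ⟨Γ, hΓ⟩ := θ.exists_dec_onFact c d
  obtain ⟨J', ρ, N', r, c', d', Γ', hJ', hρ, hr, hN', h⟩ :=
    θ.exists_resolution_onFact hB Δ' (Γ ((totalization W).obj L))
  refine ⟨J', ρ, hJ', hρ, bijective_of_rowQuasiIso Δ Δ' (θ.dec Δ (Γ _)) Γ' (θ.rowMap r)
    (θ.rowQuasiIso_rowMap r ?_ ?_ ?_) (fun u => θ.onFact.map u ≫ ρ)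
    (fun u p => θ.homRow_dec Δ Δ' (Γ _) (Γ _) Γ' u (θ.onFact.map u) r ρ (hΓ _ _ u) h p)⟩
  · refine ⟨min (a' - b) (c' - (b + d)), max (b' - a) (d' - (a + c)), fun n p hp => ⟨?_, ?_⟩⟩
    · exact Dec.subsingleton_rowGroup Δ Δ' n p (by lia)
    · exact Dec.subsingleton_rowGroup (θ.dec Δ (Γ _)) Γ' n p (by lia)
  · intro q q' p z hz
    have (n : ℤ) : Injective ((plusUnf K a q).obj.X n) := ((hK n).shiftBy q).2
    have (n : ℤ) : Injective ((plusUnf L a' q').obj.X n) := ((hL n).shiftBy q').2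
    have := hr q'
    have := hN' q'
    exact mem_coboundaries_of_cocycle θ.θ (plusUnf K a q) (plusUnf L a' q') (r.f q') (hR q q') z hz
  · intro q q' p y
    have (n : ℤ) : Injective ((plusUnf K a q).obj.X n) := ((hK n).shiftBy q).2
    have (n : ℤ) : Injective ((plusUnf L a' q').obj.X n) := ((hL n).shiftBy q').2
    have := hr q'
    have := hN' q'
    exact exists_cocycle_sub_mem_coboundaries θ.θ (plusUnf K a q) (plusUnf L a' q') (r.f q')
      (hR q q') y

end FactoredFunctor

/-! ### Passage to the co-derived categories -/

section

variable {A : Type u₁} [Category.{v₁} A] [Abelian A] [HasCoproducts.{v₁} A] [EnoughInjectives A]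
  {W : Potential A}

instance : (totalization W).Additive where
  map_add {K L f g} := by
    have h (l : ℤ) : (shiftBy W (-l)).map ((f + g).f l) =
        (shiftBy W (-l)).map (f.f l) + (shiftBy W (-l)).map (g.f l) := Functor.map_add _
    have h₁ (f : K ⟶ L) (l : ℤ) : (twistedObj K).i₁ l ≫ ((totalization W).map f).f₁ =
        ((shiftBy W (-l)).map (f.f l)).f₁ ≫ (twistedObj L).i₁ l := Twisted.i₁_totMap _ _
    have h₀ (f : K ⟶ L) (l : ℤ) : (twistedObj K).i₀ l ≫ ((totalization W).map f).f₀ =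
        ((shiftBy W (-l)).map (f.f l)).f₀ ≫ (twistedObj L).i₀ l := Twisted.i₀_totMap _ _
    ext
    · refine (twistedObj K).ext₁ fun l => (h₁ _ l).trans (Eq.trans ?_
        (Preadditive.comp_add _ _ _ _ _ _).symm)
      rw [h, add_f₁]
      exact (Preadditive.add_comp _ _ _ _ _ _).trans (congrArg₂ (· + ·) (h₁ f l).symm (h₁ g l).symm)
    · refine (twistedObj K).ext₀ fun l => (h₀ _ l).trans (Eq.trans ?_
        (Preadditive.comp_add _ _ _ _ _ _).symm)
      rw [h, add_f₀]
      exact (Preadditive.add_comp _ _ _ _ _ _).trans (congrArg₂ (· + ·) (h₀ f l).symm (h₀ g l).symm)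

/-- A factorization whose components have finite injective dimension is isomorphic in the co-derived
category to the totalization of a bounded complex of factorizations with injective components. -/
lemma Factorization.exists_iso_totalization (E : Factorization W)
    (h₁ : HasFiniteInjectiveDimension E.X₁) (h₀ : HasFiniteInjectiveDimension E.X₀) :
    ∃ (K : CochainComplex (Factorization W) ℤ) (φ : (singleFunctor _ 0).obj E ⟶ K) (m : ℤ),
      QuasiIso φ ∧ K.IsStrictlyGE 0 ∧ K.IsStrictlyLE m ∧ (∀ n, InjComp (K.X n)) ∧
      Nonempty ((toDco W).obj E ≅ (toDco W).obj ((totalization W).obj K)) := by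
  obtain ⟨K, φ, m, _, _, _, hK⟩ := exists_bounded_resolution_single E h₁ h₀
  obtain ⟨e⟩ := nonempty_totSingle E
  have := isIso_toDco_map _ (isCoacyclic_cone_totalization φ 0)
  exact ⟨K, φ, m, inferInstance, inferInstance, inferInstance, hK,
    ⟨(toDco W).mapIso e ≪≫ asIso ((toDco W).map ((totalization W).map φ))⟩⟩

variable {B : Type u₂} [Category.{v₂} B] [Abelian B] [HasCoproducts.{v₂} B] {V : Potential B}

namespace FactoredFunctor

variable (θ : FactoredFunctor W V)

instance : θ.complexFunctor.Additive where
  map_add {E F f g} := by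
    ext n
    · exact congrArg (fun z => HomologicalComplex.Hom.f z n) (θ.θ.map_add (f := f.f₁) (g := g.f₁))
    · exact congrArg (fun z => HomologicalComplex.Hom.f z n) (θ.θ.map_add (f := f.f₀) (g := g.f₀))

instance : θ.onFact.Additive :=
  inferInstanceAs (θ.complexFunctor ⋙ totalization V).Additive

/-- The morphism `ρ` is invertible in the co-derived category and its target has injective
components, so morphisms from `θ^f(I)` to `θ^f(J)` there are homotopy classes of morphisms to `J'`,
to which `h₁` and `h₂` apply. -/
lemma bijective_onHoCat_map_Q {I J : Factorization W} {J' : Factorization V}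
    (ρ : θ.onFact.obj J ⟶ J') (hJ' : InjComp J') (hρ : IsIso ((toDco V).map ρ))
    (h₁ : ∀ u : I ⟶ J, IsNull (θ.onFact.map u ≫ ρ) → IsNull u)
    (h₂ : ∀ u' : θ.onFact.obj I ⟶ J', ∃ u : I ⟶ J, IsNull (u' - θ.onFact.map u ≫ ρ)) :
    Function.Bijective fun f : (toHoCat W).obj I ⟶ (toHoCat W).obj J =>
      (coQis V).Q.map (θ.onHoCat.map f) := by
  have hmap (u : I ⟶ J) : θ.onHoCat.map ((toHoCat W).map u) = (toHoCat V).map (θ.onFact.map u) :=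
    rfl
  have h : Function.Bijective fun f : (toHoCat W).obj I ⟶ (toHoCat W).obj J =>
      (show (toHoCat V).obj (θ.onFact.obj I) ⟶ (toHoCat V).obj J' from
        θ.onHoCat.map f ≫ (toHoCat V).map ρ) := by
    constructor
    · intro f g hfg
      obtain ⟨f, rfl⟩ := (toHoCat W).map_surjective f
      obtain ⟨g, rfl⟩ := (toHoCat W).map_surjective g
      have e : (toHoCat V).map (θ.onFact.map f ≫ ρ) = (toHoCat V).map (θ.onFact.map g ≫ ρ) := by
        rw [Functor.map_comp, Functor.map_comp]
        exact hfg
      rw [toHoCat_map_eq_iff, ← Preadditive.sub_comp] at e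
      rw [toHoCat_map_eq_iff]
      refine h₁ _ ?_
      rwa [Functor.map_sub]
    · intro g
      obtain ⟨g, rfl⟩ := (toHoCat V).map_surjective g
      obtain ⟨u, hu⟩ := h₂ g
      refine ⟨(toHoCat W).map u, ?_⟩
      rw [← toHoCat_map_eq_iff, Functor.map_comp] at hu
      exact hu.symm
  let e := asIso ((toDco V).map ρ)
  refine bijective_of_comp_iso_eq (Iso.refl _) e (fun f => ?_)
    ((bijective_Q_map (θ.onFact.obj I) hJ').comp h)
  refine ((coQis V).Q.map_comp _ _).symm.trans (id_comp _).symm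

/-- On objects in the image of `Qinj` the derived functor is computed by `θ^f` itself: the inverse
of the equivalence is fully faithful and returns the given representatives up to isomorphism. -/
lemma bijective_derived_map [(Qinj W).IsEquivalence] {I J : Factorization W} (hI : InjComp I)
    (hJ : InjComp J) (h : Function.Bijective fun f : (toHoCat W).obj I ⟶ (toHoCat W).obj J =>
      (coQis V).Q.map (θ.onHoCat.map f)) :
    Function.Bijective (θ.derived.map : ((toDco W).obj I ⟶ (toDco W).obj J) → _) := by
  let G : KInj W ⥤ Dco V := (hasInjectiveComponents W).ι ⋙ θ.onHoCat ⋙ (coQis V).Q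
  let X : KInj W := ⟨(toHoCat W).obj I, hI⟩
  let Y : KInj W := ⟨(toHoCat W).obj J, hJ⟩
  have hG : Function.Bijective (G.map : (X ⟶ Y) → _) :=
    h.comp ((hasInjectiveComponents W).fullyFaithfulι.map_bijective X Y)
  have hG' := bijective_map_of_iso G ((Qinj W).asEquivalence.unitIso.symm.app X)
    ((Qinj W).asEquivalence.unitIso.symm.app Y) hG
  exact hG'.comp ((Functor.FullyFaithful.ofFullyFaithful (Qinj W).inv).map_bijective
    ((Qinj W).obj X) ((Qinj W).obj Y))

end FactoredFunctor

end

end FactCat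

theorem mainTheorem2
    {A : Type u₁} [Category.{v₁} A] [Abelian A] [HasCoproducts.{v₁} A] [EnoughInjectives A]
    (hA : ∀ (J : Type v₁) (I : J → A), (∀ j, Injective (I j)) → Injective (∐ I))
    {B : Type u₂} [Category.{v₂} B] [Abelian B] [HasCoproducts.{v₂} B]
    (hB : FactCat.FiniteInjectiveDimension B)
    [HasDerivedCategory.{w₁} A] [HasDerivedCategory.{w₂} B]
    (W : FactCat.Potential A) (V : FactCat.Potential B)
    (θ : FactCat.FactoredFunctor W V) (hθ : θ.LeftExact)
    (E F : FactCat.Factorization W)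
    (hE₁ : FactCat.HasFiniteInjectiveDimension E.X₁) (hE₀ : FactCat.HasFiniteInjectiveDimension E.X₀)
    (hF₁ : FactCat.HasFiniteInjectiveDimension F.X₁) (hF₀ : FactCat.HasFiniteInjectiveDimension F.X₀)
    (hEF : ∀ i j t : ℤ, Function.Bijective
      ((FactCat.totalRightDerived θ.θ).map :
        ((DerivedCategory.Plus.singleFunctor A 0).obj (E.X i) ⟶
          (shiftFunctor (DerivedCategory.Plus A) t).obj
            ((DerivedCategory.Plus.singleFunctor A 0).obj (F.X j))) → _)) :
    ∃ _ : (FactCat.Factorization.Qinj W).IsEquivalence, ∀ t : ℤ, Function.Bijective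
      (θ.derived.map :
        ((FactCat.Factorization.toDco W).obj E ⟶
          (FactCat.Factorization.toDco W).obj ((FactCat.Factorization.shiftBy W t).obj F)) → _) := by
  have hQ := FactCat.Factorization.isEquivalence_Qinj (W := W) hA
  refine ⟨hQ, fun t => ?_⟩
  -- Shifting only permutes the components and applies powers of `Φ`, so `F[t]` also has components
  -- of finite injective dimension and a bounded replacement.
  obtain ⟨hF₁', hF₀'⟩ := FactCat.Factorization.hasFiniteInjectiveDimension_shiftBy F hF₁ hF₀ t
  obtain ⟨K, φ, m, _, _, _, hK, ⟨e⟩⟩ := E.exists_iso_totalization hE₁ hE₀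
  obtain ⟨L, χ, n, _, _, _, hL, ⟨e'⟩⟩ :=
    FactCat.Factorization.exists_iso_totalization _ hF₁' hF₀'
  obtain ⟨J', ρ, hJ', hρ, h₁, h₂⟩ := θ.exists_bijective_onFact_map hB K L 0 m 0 n hK hL
    fun q q' p => by
      obtain ⟨f⟩ := E.nonempty_comp_iso q
      -- The `q'`-th complex in the unfolding of `L` resolves the component `F^{q'+t}`, and the
      -- `q`-th one for `K` resolves `E^q`. The hypothesis is thus needed for the indices `q`, `q' +
      -- t` and every cohomological degree `p`.
      obtain ⟨f'⟩ := F.nonempty_comp_shiftBy_iso q' t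
      obtain ⟨ψ, _⟩ := FactCat.Factorization.exists_quasiIso_comp φ q f.symm
      obtain ⟨ψ', _⟩ := FactCat.Factorization.exists_quasiIso_comp χ q' f'.symm
      exact FactCat.bijective_map_plusShift _ (X := FactCat.Factorization.plusUnf K 0 q)
        (Y := FactCat.Factorization.plusUnf L 0 q') ψ ψ' p (hEF q (q' + t) p)
  exact FactCat.bijective_map_of_iso θ.derived e e' (θ.bijective_derived_map
    (FactCat.Factorization.injComp_totalization hA K hK)
    (FactCat.Factorization.injComp_totalization hA L hL)
    (θ.bijective_onHoCat_map_Q ρ hJ' hρ h₁ h₂))
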